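/- **Setting.** Fix half-widths $a_l>0$, thicknesses $T_l>0$ ($l=1,2,3$), a strength $S>0$ and an integer $P\ge 2$. Let $\sigma_l$ be the even function with $\sigma_l(t)=0$ for $0\le t<a_l$, $\sigma_l(t)=\frac{2S f_1^P}{f_1^P+f_2^P}$ for $a_l\le t\le a_l+T_l$ and $\sigma_l(t)=S$ for $t>a_l+T_l$, where $f_1=(\frac12-\frac1P)\bar t^3+\frac{\bar t}{P}+\frac12$, $f_2=1-f_1$, $\bar t=\frac{t-(a_l+T_l)}{T_l}$. Put $\tilde x_l=x_l+i\int_0^{x_l}\sigma_l(t)\,dt$, $\alpha_l=1+i\sigma_l(x_l)$, $\mathbb B=\mathrm{diag}(\alpha_1,\alpha_2,\alpha_3)$, $J=\alpha_1\alpha_2\alpha_3$, $\mathbb A=J^{-1}\mathbb B^2$, and $\widetilde\nabla\times u=J^{-1}\mathbb B\,\mathrm{curl}(\mathbb B u)$. For $k\in\mathbb C$ let $$\widetilde\Phi(k,x,y)=\frac{e^{ik\rho}}{4\pi\rho},\qquad \rho=\Big(\sum_{l=1}^3(\tilde x_l-\tilde y_l)^2\Big)^{1/2}\ \text{(principal branch)}.$$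 Let $\mathbb R^3=\Omega_1\cup\Gamma\cup\Omega_2$ be a disjoint union, with $\Omega_1,\Omega_2$ open and $\Gamma$ a smooth ($C^\infty$) embedded surface that locally separates $\Omega_1$ from $\Omega_2$; let $\nu$ be its unit normal pointing from $\Omega_1$ into $\Omega_2$. Assume that there are $c_l<a_l$ and $d$ with $|d|\le c_3$ such that outside the box $\{|x_l|\le c_l,\ l=1,2,3\}$ one has $\Omega_1=\{x_3>d\}$ and $\Omega_2=\{x_3<d\}$. Let $B_{a,T}=\prod_l(-a_l-T_l,a_l+T_l)$, $\Omega_j^b=\Omega_j\cap B_{a,T}$, $\Gamma^b=\Gamma\cap B_{a,T}$. Let $k_1,k_2\in\mathbb C$ (for instance the wavenumbers $k_j=\omega\sqrt{\mu_j\epsilon_j}>0$ of the layers). For a field $\varphi$ on $\Gamma^b$ put, with $ds$ the surface measure, $$u_j(x)=\int_{\Gamma^b}\widetilde\Phi(k_j,x,y)\mathbb B(y)\varphi(y)\,ds_y,\qquad \widetilde S_j(\varphi)=\mathbb B\,\widetilde\nabla\times\widetilde\nabla\times u_j,\qquad \widetilde D_j(\varphi)=\mathbb B\,\widetilde\nabla\times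 u_j\quad\text{in }\Omega_j^b,$$ and, for $x\in\Gamma^b$, $$\widetilde K_j(\varphi)(x)=\int_{\Gamma^b}\nu_x\times\mathbb B(x)\widetilde\nabla_x\times\big(\widetilde\Phi(k_j,x,y)\mathbb B(y)\varphi(y)\big)ds_y,$$ $$\widetilde N_j(\varphi)(x)=\mathrm{f.p.}\!\int_{\Gamma^b}\nu_x\times\mathbb B(x)\widetilde\nabla_x\times\widetilde\nabla_x\times\big(\widetilde\Phi(k_j,x,y)\mathbb B(y)\varphi(y)\big)ds_y .$$ The last, hypersingular integral is a Hadamard finite part: it exists and equals $v$ if for some constant vector $c$ the integral over $\{y\in\Gamma^b:|y-x|\ge\varepsilon\}$ is $c/\varepsilon+v+o(1)$ as $\varepsilon\to0^+$. **Theorem.** Let $\varphi$ be a complex tangential vector field that is $C^1$ on $\Gamma^b$, continuous on $\partial\Omega_1^b$ and zero on $\partial\Omega_1^b\setminus\Gamma^b$. Then for $j=1,2$ the fields $u_j$, $\widetilde S_j(\varphi)$, $\widetilde D_j(\varphi)$ are $C^1$ in $\Omega_j^b$ and $$\mathrm{curl}\,\widetilde S_j(\varphi)=k_j^2\mathbb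 A^{-1}\widetilde D_j(\varphi),\qquad \mathrm{curl}\,\widetilde D_j(\varphi)=\mathbb A^{-1}\widetilde S_j(\varphi)\qquad\text{in }\Omega_j^b.$$ Moreover, for every $x\in\Gamma^b$: 1. The limit $\lim_{h\to0^+}\nu_x\times\widetilde S_1(\varphi)(x-h\nu_x)$ exists if and only if $\widetilde N_1(\varphi)(x)$ exists, and then they are equal; likewise $\lim_{h\to0^+}\nu_x\times\widetilde S_2(\varphi)(x+h\nu_x)$ and $\widetilde N_2(\varphi)(x)$. Both $\widetilde N_j(\varphi)(x)$ exist whenever $\varphi$ is of class $C^{1,\beta}$ near $x$ for some $\beta>0$. 2. The integrals $\widetilde K_j(\varphi)(x)$ converge absolutely, and $$\lim_{h\to0^+}\nu_x\times\widetilde D_1(\varphi)(x-h\nu_x)=\widetilde K_1(\varphi)(x)-\tfrac12\varphi(x),\qquad \lim_{h\to0^+}\nu_x\times\widetilde D_2(\varphi)(x+h\nu_x)=\widetilde K_2(\varphi)(x)+\tfrac12\varphi(x).$$ -/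

import Mathlib

open scoped Matrix MeasureTheory Topology ContDiff

namespace PMLJump

/-- Points of `ℝ³`, with the Euclidean norm. Coordinates are numbered `0, 1, 2`. -/
abbrev E3 := EuclideanSpace ℝ (Fin 3)

/-- Values of complex vector fields. -/
abbrev C3 := Fin 3 → ℂ

/-! ### Complex coordinate stretching -/

/-- Parameters of the uniaxial PML: the half-widths `a` of the physical box, the thicknesses `T`
of the layer, the strength `S` and the integer order `P ≥ 2`. -/
structure PML where
  a : Fin 3 → ℝ
  T : Fin 3 → ℝ
  S : ℝ
  P : ℕ
  a_pos : ∀ l, 0 < a l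
  T_pos : ∀ l, 0 < T l
  S_pos : 0 < S
  two_le_P : 2 ≤ P

namespace PML

variable (p : PML)

/-- `x̄ = (t - (a + T)) / T`. -/
noncomputable def xbar (l : Fin 3) (t : ℝ) : ℝ := (t - (p.a l + p.T l)) / p.T l

/-- `f₁ = (1/2 - 1/P) x̄³ + x̄/P + 1/2`. -/
noncomputable def f₁ (l : Fin 3) (t : ℝ) : ℝ :=
  (1 / 2 - 1 / (p.P : ℝ)) * p.xbar l t ^ 3 + p.xbar l t / (p.P : ℝ) + 1 / 2

/-- `f₂ = 1 - f₁`. -/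
noncomputable def f₂ (l : Fin 3) (t : ℝ) : ℝ := 1 - p.f₁ l t

/-- The medium property `σ_l`, an even function: `0` for `|t| < a`, the smooth ramp for
`a ≤ |t| ≤ a + T`, and the constant `S` beyond. -/
noncomputable def σ (l : Fin 3) (t : ℝ) : ℝ :=
  if |t| < p.a l then 0
  else if |t| ≤ p.a l + p.T l then
    2 * p.S * p.f₁ l |t| ^ p.P / (p.f₁ l |t| ^ p.P + p.f₂ l |t| ^ p.P)
  else p.S

/-- The stretched coordinate `x̃_l(t) = t + i ∫₀ᵗ σ_l`. -/
noncomputable def stretch (l : Fin 3) (t : ℝ) : ℂ :=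
  (t : ℂ) + Complex.I * ((∫ s in (0 : ℝ)..t, p.σ l s : ℝ) : ℂ)

/-- `α_l(t) = 1 + i σ_l(t)`. -/
noncomputable def α (l : Fin 3) (t : ℝ) : ℂ := 1 + Complex.I * (p.σ l t : ℂ)

/-- `𝔹 = diag(α₁, α₂, α₃)`. -/
noncomputable def B (x : E3) : Matrix (Fin 3) (Fin 3) ℂ :=
  Matrix.diagonal fun l => p.α l (x l)

/-- `J = α₁ α₂ α₃`. -/
noncomputable def J (x : E3) : ℂ := ∏ l, p.α l (x l)

/-- `𝔸 = J⁻¹ 𝔹²`. -/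
noncomputable def A (x : E3) : Matrix (Fin 3) (Fin 3) ℂ := (p.J x)⁻¹ • (p.B x) ^ 2

/-- The open truncation box `B_{a,T}`. -/
def box : Set E3 := {x | ∀ l, |x l| < p.a l + p.T l}

end PML

/-! ### Differential operators -/

/-- The partial derivative `∂_i g (x)`. -/
noncomputable def pd (i : Fin 3) (g : E3 → ℂ) (x : E3) : ℂ :=
  lineDeriv ℝ g x (EuclideanSpace.single i (1 : ℝ))

/-- The curl of a complex vector field. -/
noncomputable def curl (F : E3 → C3) (x : E3) : C3 :=
  ![pd 1 (fun y => F y 2) x - pd 2 (fun y => F y 1) x,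
    pd 2 (fun y => F y 0) x - pd 0 (fun y => F y 2) x,
    pd 0 (fun y => F y 1) x - pd 1 (fun y => F y 0) x]

/-- The stretched curl `∇̃ × u = J⁻¹ 𝔹 curl (𝔹 u)`. -/
noncomputable def scurl (p : PML) (u : E3 → C3) (x : E3) : C3 :=
  (p.J x)⁻¹ • (p.B x *ᵥ curl (fun y => p.B y *ᵥ u y) x)

/-- The cross product of a real vector with a complex one. -/
noncomputable def rcross (n : E3) (w : C3) : C3 := (fun i => ((n i : ℝ) : ℂ)) ⨯₃ w

/-! ### The stretched fundamental solution -/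

/-- The complex distance. `Complex.cpow` with exponent `1/2` is the principal branch. -/
noncomputable def rho (p : PML) (x y : E3) : ℂ :=
  (∑ l, (p.stretch l (x l) - p.stretch l (y l)) ^ 2) ^ (1 / 2 : ℂ)

/-- `Φ̃(k,x,y) = exp(i k ρ) / (4 π ρ)`. -/
noncomputable def Phi (p : PML) (k : ℂ) (x y : E3) : ℂ :=
  Complex.exp (Complex.I * k * rho p x y) / (4 * (Real.pi : ℂ) * rho p x y)

/-! ### The two-layered medium -/

/-- A two-layered medium whose interface `Γ` (the complement of the two open layers) is a smooth
surface which coincides with a horizontal plane outside a closed box contained in the open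
physical box `∏ (-a_l, a_l)`. Near each point of `Γ`, the layers are the regions `f < 0` and
`f > 0` of a smooth function `f` with nonvanishing gradient on `Γ = {f = 0}`; the field `ν` is
on `Γ` the normalized gradient of `f`, i.e. the unit normal that points from `Ω₁` into `Ω₂`. -/
structure LayeredMedium (a : Fin 3 → ℝ) where
  Ω₁ : Set E3
  Ω₂ : Set E3
  ν : E3 → E3
  isOpen₁ : IsOpen Ω₁
  isOpen₂ : IsOpen Ω₂
  disj : Disjoint Ω₁ Ω₂
  smooth : ∀ x, x ∉ Ω₁ ∪ Ω₂ → ∃ (U : Set E3) (f : E3 → ℝ), IsOpen U ∧ x ∈ U ∧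
    ContDiffOn ℝ ∞ f U ∧ ∀ y ∈ U, (y ∈ Ω₁ ↔ f y < 0) ∧ (y ∈ Ω₂ ↔ 0 < f y) ∧
      (f y = 0 → gradient f y ≠ 0 ∧ ν y = ‖gradient f y‖⁻¹ • gradient f y)
  flat : ∃ (d : ℝ) (c : Fin 3 → ℝ), |d| ≤ c 2 ∧ (∀ l, c l < a l) ∧
    ∀ x : E3, (∃ l, c l < |x l|) → (x ∈ Ω₁ ↔ d < x 2) ∧ (x ∈ Ω₂ ↔ x 2 < d)

namespace LayeredMedium

variable {a : Fin 3 → ℝ} (M : LayeredMedium a)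

/-- The interface. -/
def Γ : Set E3 := (M.Ω₁ ∪ M.Ω₂)ᶜ

end LayeredMedium

section Potentials

variable (p : PML) (M : LayeredMedium p.a)

/-- The truncated interface `Γ^b = Γ ∩ B_{a,T}`. -/
def Γb : Set E3 := M.Γ ∩ p.box

/-- `Ω₁^b = Ω₁ ∩ B_{a,T}`. -/
def Ω₁b : Set E3 := M.Ω₁ ∩ p.box

/-- `Ω₂^b = Ω₂ ∩ B_{a,T}`. -/
def Ω₂b : Set E3 := M.Ω₂ ∩ p.box

/-- The vector potential `∫_{Γ^b} Φ̃(k,x,y) 𝔹(y) φ(y) ds_y`. The surface measure is the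
two-dimensional Hausdorff measure, normalized to agree with the area in planes. -/
noncomputable def vpot (k : ℂ) (φ : E3 → C3) (x : E3) : C3 :=
  ∫ y in Γb p M, Phi p k x y • (p.B y *ᵥ φ y) ∂(μHE[2] : MeasureTheory.Measure E3)

/-- The potential `S̃ φ = 𝔹 ∇̃ × ∇̃ × ∫ Φ̃ 𝔹 φ`. -/
noncomputable def Spot (k : ℂ) (φ : E3 → C3) (x : E3) : C3 :=
  p.B x *ᵥ scurl p (scurl p (vpot p M k φ)) x

/-- The potential `D̃ φ = 𝔹 ∇̃ × ∫ Φ̃ 𝔹 φ`. -/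
noncomputable def Dpot (k : ℂ) (φ : E3 → C3) (x : E3) : C3 :=
  p.B x *ᵥ scurl p (vpot p M k φ) x

/-- The integrand of `K̃ φ (x)`: `ν_x × 𝔹(x) ∇̃_x × (Φ̃(k,x,y) 𝔹(y) φ(y))`. -/
noncomputable def Kker (k : ℂ) (φ : E3 → C3) (x y : E3) : C3 :=
  rcross (M.ν x) (p.B x *ᵥ scurl p (fun z => Phi p k z y • (p.B y *ᵥ φ y)) x)

/-- The integrand of `Ñ φ (x)`: `ν_x × 𝔹(x) ∇̃_x × ∇̃_x × (Φ̃(k,x,y) 𝔹(y) φ(y))`. -/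
noncomputable def Nker (k : ℂ) (φ : E3 → C3) (x y : E3) : C3 :=
  rcross (M.ν x) (p.B x *ᵥ scurl p (scurl p (fun z => Phi p k z y • (p.B y *ᵥ φ y))) x)

/-- The boundary operator `K̃`, a weakly singular integral. -/
noncomputable def Kop (k : ℂ) (φ : E3 → C3) (x : E3) : C3 :=
  ∫ y in Γb p M, Kker p M k φ x y ∂(μHE[2] : MeasureTheory.Measure E3)

/-- The hypersingular integral `Ñ φ (x)` exists, as a Hadamard finite part, and has the value `v`:
for some constant vector `c` the integral over `Γ^b` without the ball of radius `ε` around `x`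
is `c / ε + v + o(1)` as `ε → 0⁺`. -/
def HasNop (k : ℂ) (φ : E3 → C3) (x : E3) (v : C3) : Prop :=
  ∃ c : C3, Filter.Tendsto
    (fun ε : ℝ => (∫ y in Γb p M \ Metric.ball x ε, Nker p M k φ x y
      ∂(μHE[2] : MeasureTheory.Measure E3)) - (ε⁻¹ : ℝ) • c)
    (𝓝[>] (0 : ℝ)) (𝓝 v)

/-- `φ` is of class `C^{1,β}` on the surface near `x` for some `β > 0`: it extends to a `C¹` field
on a neighbourhood of `x` in `ℝ³` whose derivative is Hölder continuous. -/
def IsC1HolderNear (φ : E3 → C3) (x : E3) : Prop :=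
  ∃ (β C : ℝ) (U : Set E3) (ψ : E3 → C3), 0 < β ∧ IsOpen U ∧ x ∈ U ∧ ContDiffOn ℝ 1 ψ U ∧
    (∀ y ∈ U ∩ Γb p M, ψ y = φ y) ∧
    ∀ y ∈ U, ∀ z ∈ U, ‖fderiv ℝ ψ y - fderiv ℝ ψ z‖ ≤ C * ‖y - z‖ ^ β

/-- A `C¹` tangential field on `Γ^b` that is continuous on `∂Ω₁^b` and vanishes on
`∂Ω₁^b \ Γ^b`. -/
structure IsDensity (φ : E3 → C3) : Prop where
  contDiffOn : ContDiffOn ℝ 1 φ (Γb p M)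
  tangential : ∀ x ∈ Γb p M, ∑ i, ((M.ν x i : ℝ) : ℂ) * φ x i = 0
  continuousOn : ContinuousOn φ (frontier (Ω₁b p M))
  vanish : ∀ x ∈ frontier (Ω₁b p M) \ Γb p M, φ x = 0

end Potentials

end PMLJump

/-!
In the stretched coordinates `x̃` the operator `∇̃ ×` is the curl of holomorphic fields, and the
kernels of the potentials are the functions `Ku`, `Kd`, `Ks` of `z = x̃ - ỹ`, built from
`G n k (z · z)`, the `n`-th iterate of `ρ⁻¹ d/dρ` on `e^{ikρ} / (4πρ)`. Since
`Re ((1 - iS) z · z) ≥ |x - y|²` (`PML.re_rot_mul_dot`), `z · z` stays off the branch cut and has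
size `|x - y|²`. Off the interface one differentiates under the integral sign, and the curl
identities reduce to the Helmholtz equation for `G 0 k` (`curlC_jac_Ks`, `curl_B_potential`).

Near a point `x₀` the interface is the graph `t ↦ Y t` of a `C²` function over its tangent plane
(`GraphChart`). The Lipschitz bounds of the projection and of the parametrization alone show that
the surface measure has a density `w` with `1 ≤ w t ≤ 1 + C² |t|²` (`GraphChart.exists_density`),
which is all the accuracy that is needed. Points of the normal line are `x₀ - h ν`, so that both
sides of the interface are treated at once, by the sign of `h`.

*The single curl.* Freezing `𝔹` and `φ` at `x₀`, and using that `φ x₀` is tangential, one finds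
`ν × 𝔹 Kd = h J G 1 0 (z · z) φ(x₀)` up to a kernel bounded by `1 / |x₀ - y|`
(`IsDensity.isBigO_curlRem`). Dominated convergence takes the latter to `K̃ φ`. In the scalar
integral that remains, the substitution `t = |h| s` leads to the integral of `q ^ (-3/2)` over the
affine plane at height one, with `q v = ∑ α_l² v_l²`. It equals `2π / J`, because the Gaussian
integral of `exp (-ω q)` over space factors both over the axes and over these planes
(`integral_inv_csqrt_qform`). This is the jump `∓ φ / 2`.

*The double curl.* The wave number may be replaced by zero, at the cost of a weakly singular
kernel. A tangential component of the trace is then a sum over the two coordinate vectors `e` of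
the chart of integrals of `α(t) k2 (b_h, z, ∂_e z)`, where `k2` is a second derivative of
`k0 = G 0 0 (z · z)` and `α` is a coefficient of `φ`. Let `T ε` be the integral at height zero over
`|t| ≥ ε`. The claim is that for some `c` the integral at height `h` is `T |h| - c / |h| + o(1)`,
and that `ε T ε → c` (`FollowsTruncation`, `Patch.Direction.exists_jump`). It gives the equivalence
of the one-sided limit and the finite part, for `c` is the only possible divergence.

Here `α` is split into its affine part at the origin and a remainder. The affine part is integrated
by parts, at height `h` and outside discs alike; the two agree in the limit, since by parity the
circle `|t| = ε` contributes `c / ε` and nothing else of order one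
(`Patch.Direction.exists_tendsto_affine`). For a remainder `o(|t|)` the substitution `t = |h| s`
shows that the kernel at height `h` acts like the kernel truncated at `|h|`, as their difference
is `O (|h|⁻³ (1 + |s|)⁻⁴)` (`Patch.Direction.exists_bound_jump`). If the derivative
of `φ` is Hölder continuous, the remainder is `O (|t| ^ (1 + β))`, hence integrable against the
kernel of order `|t|⁻³`, and both limits exist. Finally, truncation by balls of the ambient space
and by discs of the parameter plane differ by `o(1)` (`GraphChart.tendsto_truncation_sub`).
-/


namespace PMLJump

/-! ### The medium property and the stretched coordinates -/

/-- Freezing a `C¹` function at a critical point `a`, to the left of `a`, keeps it `C¹`. -/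
theorem hasDerivAt_comp_max {g g' : ℝ → ℝ} {a t : ℝ} (hg : HasDerivAt g (g' (max a t)) (max a t))
    (ha : g' a = 0) : HasDerivAt (fun s => g (max a s)) (g' (max a t)) t := by
  rcases lt_trichotomy t a with h | h | h
  · rw [max_eq_left h.le, ha]
    refine (hasDerivAt_const t (g a)).congr_of_eventuallyEq ?_
    filter_upwards [Iio_mem_nhds h] with s hs
    rw [max_eq_left (le_of_lt hs)]
  · subst h
    rw [max_self] at hg ⊢
    have h1 : HasDerivWithinAt (fun s => g (max t s)) (g' t) (Set.Iic t) t := by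
      rw [ha]
      refine (hasDerivWithinAt_const t (Set.Iic t) (g t)).congr (fun s hs => ?_) (by simp)
      rw [max_eq_left hs]
    have h2 : HasDerivWithinAt (fun s => g (max t s)) (g' t) (Set.Ici t) t :=
      hg.hasDerivWithinAt.congr (fun s hs => by rw [max_eq_right hs]) (by simp)
    have := h1.union h2
    rwa [Set.Iic_union_Ici, hasDerivWithinAt_univ] at this
  · rw [max_eq_right h.le] at hg ⊢
    refine hg.congr_of_eventuallyEq ?_
    filter_upwards [Ioi_mem_nhds h] with s hs
    rw [max_eq_right (le_of_lt hs)]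

/-- The complex number `1 - iS`, a rotation of the numerical range of the stretched metric into
the right half-plane. -/
noncomputable def rot (S : ℝ) : ℂ := 1 - Complex.I * S

theorem rot_ne_zero (S : ℝ) : rot S ≠ 0 := by
  intro h
  have := congrArg Complex.re h
  simp [rot] at this

/-- The rotated half-plane avoids the branch cut. -/
theorem mem_slitPlane_of_rot {S : ℝ} {q : ℂ} (h : 0 < (rot S * q).re) : q ∈ Complex.slitPlane := by
  by_contra hn
  rw [Complex.mem_slitPlane_iff, not_or] at hn
  obtain ⟨h1, h2⟩ := hn
  push Not at h1 h2
  simp [rot, Complex.mul_re, h2] at h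
  linarith

namespace PML

variable (p : PML) (l : Fin 3)

/-- The ramp `2 S f₁^P / (f₁^P + f₂^P)`. -/
noncomputable def ramp (t : ℝ) : ℝ :=
  2 * p.S * p.f₁ l t ^ p.P / (p.f₁ l t ^ p.P + p.f₂ l t ^ p.P)

theorem f₁_left : p.f₁ l (p.a l) = 0 := by
  have hP : (p.P : ℝ) ≠ 0 := by have := p.two_le_P; positivity
  have hT := (p.T_pos l).ne'
  have : p.xbar l (p.a l) = -1 := by unfold PML.xbar; field_simp; ring
  unfold PML.f₁
  rw [this]; field_simp; ring

theorem f₁_right : p.f₁ l (p.a l + p.T l) = 1 / 2 := by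
  unfold PML.f₁ PML.xbar; simp

theorem f₁_mem {t : ℝ} (h1 : p.a l ≤ t) (h2 : t ≤ p.a l + p.T l) :
    0 ≤ p.f₁ l t ∧ p.f₁ l t ≤ 1 / 2 := by
  have hP : (2 : ℝ) ≤ p.P := by exact_mod_cast p.two_le_P
  have hT := p.T_pos l
  have hx0 : p.xbar l t ≤ 0 := by
    unfold PML.xbar; exact div_nonpos_of_nonpos_of_nonneg (by linarith) hT.le
  have hx1 : -1 ≤ p.xbar l t := by
    unfold PML.xbar; rw [le_div_iff₀ hT]; linarith
  have hc : (0 : ℝ) ≤ 1 / 2 - 1 / p.P := by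
    have : 1 / (p.P : ℝ) ≤ 1 / 2 := one_div_le_one_div_of_le (by norm_num) hP
    linarith
  have hi : (0 : ℝ) ≤ 1 / p.P := by positivity
  have h3 : p.xbar l t ^ 3 ≤ 0 := Odd.pow_nonpos (by decide) hx0
  have h4 : -1 ≤ p.xbar l t ^ 3 := by
    have : 0 ≤ (p.xbar l t + 1) * ((p.xbar l t - 1 / 2) ^ 2 + 3 / 4) :=
      mul_nonneg (by linarith) (by positivity)
    nlinarith
  unfold PML.f₁
  rw [div_eq_mul_one_div (p.xbar l t)]
  constructor
  · nlinarith [mul_le_mul_of_nonneg_left h4 hc, mul_le_mul_of_nonneg_right hx1 hi]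
  · nlinarith [mul_nonneg hc (neg_nonneg.2 h3), mul_nonneg hi (neg_nonneg.2 hx0)]

theorem ramp_denom_pos {t : ℝ} (h1 : p.a l ≤ t) (h2 : t ≤ p.a l + p.T l) :
    0 < p.f₁ l t ^ p.P + p.f₂ l t ^ p.P := by
  obtain ⟨h3, h4⟩ := p.f₁_mem l h1 h2
  have : 0 < p.f₂ l t := by unfold PML.f₂; linarith
  positivity

theorem contDiff_f₁ : ContDiff ℝ ∞ (p.f₁ l) := by
  unfold PML.f₁ PML.xbar; fun_prop

theorem contDiffAt_ramp {t : ℝ} (h1 : p.a l ≤ t) (h2 : t ≤ p.a l + p.T l) :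
    ContDiffAt ℝ ∞ (p.ramp l) t := by
  have := (p.contDiff_f₁ l).contDiffAt (x := t)
  unfold PML.ramp
  refine ContDiffAt.div (contDiffAt_const.mul (this.pow _)) ((this.pow _).add ?_)
    (p.ramp_denom_pos l h1 h2).ne'
  unfold PML.f₂
  exact (contDiffAt_const.sub this).pow _

theorem ramp_left : p.ramp l (p.a l) = 0 := by
  have := p.two_le_P
  unfold PML.ramp; rw [f₁_left, zero_pow (by omega)]; simp

theorem ramp_right : p.ramp l (p.a l + p.T l) = p.S := by
  unfold PML.ramp PML.f₂; rw [f₁_right]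
  have : (0 : ℝ) < (1 / 2) ^ p.P := by positivity
  norm_num
  field_simp
  norm_num
  ring

theorem ramp_mem {t : ℝ} (h1 : p.a l ≤ t) (h2 : t ≤ p.a l + p.T l) :
    0 ≤ p.ramp l t ∧ p.ramp l t ≤ p.S := by
  obtain ⟨h3, h4⟩ := p.f₁_mem l h1 h2
  have h5 := p.ramp_denom_pos l h1 h2
  have hS := p.S_pos
  have h6 : p.f₁ l t ≤ p.f₂ l t := by unfold PML.f₂; linarith
  have h7 : p.f₁ l t ^ p.P ≤ p.f₂ l t ^ p.P := pow_le_pow_left₀ h3 h6 _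
  unfold PML.ramp
  refine ⟨by positivity, ?_⟩
  rw [div_le_iff₀ h5]
  nlinarith

theorem deriv_ramp_left : deriv (p.ramp l) (p.a l) = 0 := by
  have hP := p.two_le_P
  have hle : p.a l ≤ p.a l + p.T l := by linarith [p.T_pos l]
  have hd : DifferentiableAt ℝ (p.f₁ l) (p.a l) :=
    ((p.contDiff_f₁ l).differentiable (by simp)).differentiableAt
  have hn := (hd.hasDerivAt.pow p.P).const_mul (2 * p.S)
  have hd2 : HasDerivAt (p.f₂ l) (-deriv (p.f₁ l) (p.a l)) (p.a l) := by
    have h := hd.hasDerivAt.const_sub 1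
    exact h
  have hden := (hd.hasDerivAt.pow p.P).add (hd2.pow p.P)
  have := (hn.div hden (p.ramp_denom_pos l le_rfl hle).ne').deriv
  have h0 : (p.P - 1) ≠ 0 := by omega
  have h0' : p.P ≠ 0 := by omega
  unfold PML.ramp
  simpa [Pi.pow_apply, Pi.div_def, Pi.add_apply, f₁_left, h0, h0'] using this

theorem σ_eq (t : ℝ) : p.σ l t = p.ramp l (max (p.a l) (min |t| (p.a l + p.T l))) := by
  have := p.T_pos l
  unfold PML.σ
  split_ifs with h1 h2
  · rw [min_eq_left (by linarith), max_eq_left h1.le, ramp_left]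
  · rw [min_eq_left h2, max_eq_right (not_lt.1 h1)]; rfl
  · rw [min_eq_right (not_le.1 h2).le, max_eq_right (by linarith), ramp_right]

theorem continuous_σ : Continuous (p.σ l) := by
  have hT := p.T_pos l
  have : p.σ l = fun t => p.ramp l (max (p.a l) (min |t| (p.a l + p.T l))) :=
    funext (p.σ_eq l)
  rw [this]
  have hc : ContinuousOn (p.ramp l) (Set.Icc (p.a l) (p.a l + p.T l)) := fun t ht =>
    (p.contDiffAt_ramp l ht.1 ht.2).continuousAt.continuousWithinAt
  exact hc.comp_continuous (by fun_prop) fun t =>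
    ⟨le_max_left _ _, max_le (by linarith) (min_le_right _ _)⟩

theorem σ_mem (t : ℝ) : 0 ≤ p.σ l t ∧ p.σ l t ≤ p.S := by
  have hT := p.T_pos l
  rw [σ_eq]
  exact p.ramp_mem l (le_max_left _ _) (max_le (by linarith) (min_le_right _ _))

theorem contDiffOn_σ : ContDiffOn ℝ 1 (p.σ l) (Set.Ioo (-(p.a l + p.T l)) (p.a l + p.T l)) := by
  have ha := p.a_pos l
  have key : ContDiffOn ℝ 1 (fun t => p.ramp l (max (p.a l) t)) (Set.Iio (p.a l + p.T l)) := by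
    have hd : ∀ t < p.a l + p.T l, HasDerivAt (fun t => p.ramp l (max (p.a l) t))
        (deriv (p.ramp l) (max (p.a l) t)) t := fun t ht =>
      hasDerivAt_comp_max ((p.contDiffAt_ramp l (le_max_left _ _) (max_le (by linarith [p.T_pos l])
        ht.le)).differentiableAt (by simp)).hasDerivAt (p.deriv_ramp_left l)
    have h1 : (1 : WithTop ℕ∞) = 0 + 1 := by simp
    rw [h1, contDiffOn_succ_iff_deriv_of_isOpen isOpen_Iio]
    refine ⟨fun t ht => (hd t ht).differentiableAt.differentiableWithinAt, by simp, ?_⟩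
    rw [contDiffOn_zero]
    refine ContinuousOn.congr (f := fun t => deriv (p.ramp l) (max (p.a l) t)) ?_
      fun t ht => (hd t ht).deriv
    intro t ht
    have h2 : ContinuousAt (deriv (p.ramp l)) (max (p.a l) t) :=
      (((p.contDiffAt_ramp l (le_max_left _ _) (max_le (by linarith [p.T_pos l])
        (le_of_lt ht))).derivWithin (m := 0) (by simp)).continuousAt)
    exact (ContinuousAt.comp (f := fun t => max (p.a l) t) h2
      (by fun_prop)).continuousWithinAt
  have key2 : ContDiffOn ℝ 1 (fun t => p.ramp l (max (p.a l) t) + p.ramp l (max (p.a l) (-t)))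
      (Set.Ioo (-(p.a l + p.T l)) (p.a l + p.T l)) :=
    (key.mono fun t ht => ht.2).add
      (key.comp (contDiff_neg.contDiffOn) fun t ht => by simpa using neg_lt.1 ht.1)
  refine key2.congr fun t ht => ?_
  have hab : |t| < p.a l + p.T l := abs_lt.2 ht
  rw [σ_eq, min_eq_left hab.le]
  rcases le_total 0 t with h | h
  · rw [abs_of_nonneg h, max_eq_left (show -t ≤ p.a l by linarith), ramp_left, add_zero]
  · rw [abs_of_nonpos h, max_eq_left (show t ≤ p.a l by linarith), ramp_left, zero_add]

theorem α_ne_zero (t : ℝ) : p.α l t ≠ 0 := by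
  intro h
  have := congrArg Complex.re h
  simp [PML.α] at this

theorem J_ne_zero (x : E3) : p.J x ≠ 0 := Finset.prod_ne_zero_iff.2 fun l _ => p.α_ne_zero l _

theorem continuous_α : Continuous (p.α l) := by
  have := p.continuous_σ l
  unfold PML.α; fun_prop

theorem hasDerivAt_stretch (t : ℝ) : HasDerivAt (p.stretch l) (p.α l t) t := by
  have h1 : HasDerivAt (fun u => ∫ s in (0 : ℝ)..u, p.σ l s) (p.σ l t) t :=
    intervalIntegral.integral_hasDerivAt_right ((p.continuous_σ l).intervalIntegrable _ _)
      ((p.continuous_σ l).stronglyMeasurableAtFilter _ _) (p.continuous_σ l).continuousAt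
  exact ((hasDerivAt_id t).ofReal_comp).add (h1.ofReal_comp.const_mul Complex.I)

theorem contDiffOn_α : ContDiffOn ℝ 1 (p.α l) (Set.Ioo (-(p.a l + p.T l)) (p.a l + p.T l)) := by
  unfold PML.α
  exact contDiffOn_const.add (contDiffOn_const.mul
    (Complex.ofRealCLM.contDiff.comp_contDiffOn (p.contDiffOn_σ l)))

theorem contDiffOn_stretch :
    ContDiffOn ℝ 2 (p.stretch l) (Set.Ioo (-(p.a l + p.T l)) (p.a l + p.T l)) := by
  have h2 : (2 : WithTop ℕ∞) = 1 + 1 := by norm_num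
  rw [h2, contDiffOn_succ_iff_deriv_of_isOpen isOpen_Ioo]
  refine ⟨fun t _ => (p.hasDerivAt_stretch l t).differentiableAt.differentiableWithinAt,
    by simp, (p.contDiffOn_α l).congr fun t _ => (p.hasDerivAt_stretch l t).deriv⟩

theorem contDiff_stretch : ContDiff ℝ 1 (p.stretch l) := by
  have h1 : (1 : WithTop ℕ∞) = 0 + 1 := by simp
  rw [h1, contDiff_succ_iff_deriv]
  refine ⟨fun t => (p.hasDerivAt_stretch l t).differentiableAt, by simp, ?_⟩
  rw [contDiff_zero, funext fun t => (p.hasDerivAt_stretch l t).deriv]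
  exact p.continuous_α l

theorem stretch_sub (t t' : ℝ) : ∃ s : ℝ, 0 ≤ s ∧ s ≤ p.S ∧
    p.stretch l t - p.stretch l t' = (1 + Complex.I * s) * ((t - t' : ℝ) : ℂ) := by
  have hc := p.continuous_σ l
  have hint : ∀ u v, IntervalIntegrable (p.σ l) MeasureTheory.volume u v :=
    fun u v => hc.intervalIntegrable u v
  have hsub : p.stretch l t - p.stretch l t' =
      ((t - t' : ℝ) : ℂ) + Complex.I * ((∫ s in t'..t, p.σ l s : ℝ) : ℂ) := by
    have := intervalIntegral.integral_add_adjacent_intervals (hint 0 t') (hint t' t)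
    unfold PML.stretch
    rw [← this]; push_cast; ring
  have hle : ∀ u v, u ≤ v → 0 ≤ ∫ s in u..v, p.σ l s ∧ (∫ s in u..v, p.σ l s) ≤ p.S * (v - u) := by
    intro u v huv
    refine ⟨intervalIntegral.integral_nonneg huv fun s _ => (p.σ_mem l s).1, ?_⟩
    have := intervalIntegral.integral_mono_on huv (hint u v)
      (intervalIntegrable_const (c := p.S)) (fun s _ => (p.σ_mem l s).2)
    simpa [mul_comm] using this
  rcases eq_or_ne t t' with rfl | hne
  · exact ⟨0, le_rfl, p.S_pos.le, by simp⟩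
  have hne' : t - t' ≠ 0 := sub_ne_zero.2 hne
  refine ⟨(∫ s in t'..t, p.σ l s) / (t - t'), ?_, ?_, ?_⟩
  · rcases hne.lt_or_gt with h | h
    · rw [intervalIntegral.integral_symm]
      exact div_nonneg_of_nonpos (by linarith [(hle t t' h.le).1]) (by linarith)
    · exact div_nonneg (hle t' t h.le).1 (by linarith)
  · rcases hne.lt_or_gt with h | h
    · rw [intervalIntegral.integral_symm, div_le_iff_of_neg (by linarith)]
      linarith [(hle t t' h.le).2]
    · rw [div_le_iff₀ (by linarith)]
      exact (hle t' t h.le).2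
  · have : ((t - t' : ℝ) : ℂ) ≠ 0 := by exact_mod_cast hne'
    rw [hsub]; push_cast at this ⊢; field_simp

/-- The stretched point `x̃ = (x̃₁, x̃₂, x̃₃)`. -/
noncomputable def X (x : E3) : C3 := fun l => p.stretch l (x l)

/-- The diagonal `(α₁, α₂, α₃)` of `𝔹`. -/
noncomputable def β (x : E3) : C3 := fun l => p.α l (x l)

theorem re_rot_mul_sq (s : ℝ) (h0 : 0 ≤ s) (hS : s ≤ p.S) :
    1 ≤ (rot p.S * (1 + Complex.I * s) ^ 2).re := by
  have : (rot p.S * (1 + Complex.I * s) ^ 2).re = 1 - s ^ 2 + 2 * s * p.S := by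
    simp [rot, pow_two, Complex.mul_re, Complex.mul_im]; ring
  rw [this]; nlinarith

theorem re_rot_mul_dot (x y : E3) :
    ‖x - y‖ ^ 2 ≤ (rot p.S * ((p.X x - p.X y) ⬝ᵥ (p.X x - p.X y))).re := by
  rw [EuclideanSpace.norm_sq_eq, dotProduct, Finset.mul_sum, Complex.re_sum]
  refine Finset.sum_le_sum fun l _ => ?_
  obtain ⟨s, h0, hS, h⟩ := p.stretch_sub l (x l) (y l)
  simp only [Pi.sub_apply, PML.X]
  have h1 := p.re_rot_mul_sq s h0 hS
  have : rot p.S * ((p.stretch l (x l) - p.stretch l (y l)) *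
      (p.stretch l (x l) - p.stretch l (y l))) = (((x l - y l) ^ 2 : ℝ) : ℂ) * (rot p.S * (1 + Complex.I * s) ^ 2) := by
    rw [h]; push_cast; ring
  rw [this, Complex.re_ofReal_mul]
  simp only [PiLp.sub_apply, Real.norm_eq_abs, sq_abs]
  nlinarith [sq_nonneg (x l - y l)]

theorem norm_X_sub_le (x y : E3) : ‖p.X x - p.X y‖ ≤ (1 + p.S) * ‖x - y‖ := by
  have hS := p.S_pos
  refine (pi_norm_le_iff_of_nonneg (by positivity)).2 fun l => ?_
  obtain ⟨s, h0, hS', h⟩ := p.stretch_sub l (x l) (y l)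
  simp only [Pi.sub_apply, PML.X]
  rw [h, norm_mul, Complex.norm_real]
  have h1 : ‖x l - y l‖ ≤ ‖x - y‖ := by simpa using PiLp.norm_apply_le (x - y) l
  have h2 : ‖1 + Complex.I * (s : ℂ)‖ ≤ 1 + p.S := by
    refine (norm_add_le _ _).trans ?_
    simp [abs_of_nonneg h0, hS']
  gcongr

theorem norm_β_le (x : E3) : ‖p.β x‖ ≤ 1 + p.S := by
  have hS := p.S_pos
  refine (pi_norm_le_iff_of_nonneg (by positivity)).2 fun l => ?_
  unfold PML.β PML.α
  refine (norm_add_le _ _).trans ?_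
  simp [abs_of_nonneg (p.σ_mem l (x l)).1, (p.σ_mem l (x l)).2]

theorem B_mulVec (x : E3) (v : C3) : p.B x *ᵥ v = p.β x * v := by
  ext l; simp [PML.B, Matrix.mulVec_diagonal, PML.β]

theorem J_eq (x : E3) : p.J x = p.β x 0 * p.β x 1 * p.β x 2 := by
  simp [PML.J, PML.β, Fin.prod_univ_three]

end PML
end PMLJump

namespace PMLJump

/-! ### Radial kernels -/

/-- The principal square root. -/
noncomputable def csqrt (q : ℂ) : ℂ := q ^ (1 / 2 : ℂ)

theorem csqrt_sq (q : ℂ) : csqrt q ^ 2 = q := by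
  have := Complex.cpow_nat_inv_pow q (n := 2) (by norm_num)
  rwa [Nat.cast_ofNat, ← one_div] at this

theorem csqrt_unique {w q : ℂ} (hw : 0 < w.re) (h : w ^ 2 = q) : csqrt q = w := by
  rw [← h, csqrt, one_div, Complex.sq_cpow_two_inv hw]

theorem csqrt_ne_zero {q : ℂ} (hq : q ≠ 0) : csqrt q ≠ 0 := by
  intro h
  have := csqrt_sq q
  rw [h] at this
  exact hq (by simpa using this.symm)

theorem norm_csqrt_sq (q : ℂ) : ‖csqrt q‖ ^ 2 = ‖q‖ := by
  rw [← norm_pow, csqrt_sq]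

theorem re_csqrt_pos {q : ℂ} (hq : q ∈ Complex.slitPlane) : 0 < (csqrt q).re := by
  rw [csqrt, one_div, Complex.cpow_inv_two_re, Real.sqrt_pos]
  rcases (Complex.mem_slitPlane_iff).1 hq with h | h
  · have := norm_nonneg q; linarith
  · have : |q.re| < ‖q‖ := (Complex.abs_re_lt_norm).2 h
    have := neg_abs_le q.re
    linarith

theorem csqrt_real_mul {r : ℝ} (hr : 0 < r) {q : ℂ} (hq : q ∈ Complex.slitPlane) :
    csqrt ((r : ℂ) ^ 2 * q) = r * csqrt q := by
  apply csqrt_unique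
  · rw [Complex.re_ofReal_mul]; exact mul_pos hr (re_csqrt_pos hq)
  · rw [mul_pow, csqrt_sq]

theorem hasDerivAt_csqrt {q : ℂ} (hq : q ∈ Complex.slitPlane) :
    HasDerivAt csqrt (1 / (2 * csqrt q)) q := by
  have h0 : q ≠ 0 := Complex.slitPlane_ne_zero hq
  have := (hasDerivAt_id q).cpow_const (c := (1 / 2 : ℂ)) hq
  refine this.congr_deriv ?_
  have h1 := csqrt_ne_zero h0
  have : (q : ℂ) ^ (1 / 2 - 1 : ℂ) = csqrt q / q := by
    rw [Complex.cpow_sub _ _ h0, Complex.cpow_one]; rfl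
  simp only [id]
  rw [this]
  have h2 : q = csqrt q ^ 2 := (csqrt_sq q).symm
  generalize csqrt q = r at *
  subst h2
  field_simp

/-- The numerators of the successive derivatives of `e^{ikr} / r` by `r⁻¹ d/dr`, as functions of
`x = k r`. -/
noncomputable def num : ℕ → ℂ → ℂ
  | 0 => fun x => Complex.exp (Complex.I * x)
  | n + 1 => fun x => x * deriv (num n) x - (2 * n + 1) * num n x

theorem contDiff_num (n : ℕ) : ContDiff ℂ ∞ (num n) := by
  induction n with
  | zero => unfold num; fun_prop
  | succ n ih =>
    unfold num
    have : ContDiff ℂ ∞ (deriv (num n)) := (contDiff_infty_iff_deriv.1 ih).2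
    fun_prop

theorem hasDerivAt_num (n : ℕ) (x : ℂ) : HasDerivAt (num n) (deriv (num n) x) x :=
  ((contDiff_num n).differentiable (by simp)).differentiableAt.hasDerivAt

theorem deriv_num_zero (x : ℂ) : deriv (num 0) x = Complex.I * num 0 x := by
  have : HasDerivAt (num 0) (Complex.exp (Complex.I * x) * (Complex.I * 1)) x :=
    ((hasDerivAt_id x).const_mul Complex.I).cexp
  rw [this.deriv]; simp [num, mul_comm]

theorem deriv_num_succ (n : ℕ) (x : ℂ) :
    deriv (num (n + 1)) x = x * deriv (deriv (num n)) x - 2 * n * deriv (num n) x := by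
  have h2 : ContDiff ℂ ∞ (deriv (num n)) := (contDiff_infty_iff_deriv.1 (contDiff_num n)).2
  have h3 := (h2.differentiable (by simp)).differentiableAt (x := x) |>.hasDerivAt
  have := ((hasDerivAt_id x).mul h3).sub ((hasDerivAt_num n x).const_mul (2 * n + 1 : ℂ))
  rw [show num (n + 1) = fun x => x * deriv (num n) x - (2 * n + 1) * num n x from rfl]
  refine this.deriv.trans ?_
  simp only [id]; ring

theorem num_two (x : ℂ) : num 2 x + 3 * num 1 x + x ^ 2 * num 0 x = 0 := by
  have h1 : num 1 x = x * deriv (num 0) x - num 0 x := by simp [num]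
  have h2 : num 2 x = x * deriv (num 1) x - 3 * num 1 x := by
    rw [show num 2 x = x * deriv (num 1) x - (2 * ((1 : ℕ) : ℂ) + 1) * num 1 x from rfl]
    norm_num
  have h3 : deriv (deriv (num 0)) x = -num 0 x := by
    rw [funext deriv_num_zero, ((hasDerivAt_num 0 x).const_mul Complex.I).deriv, deriv_num_zero,
      ← mul_assoc, Complex.I_mul_I]; ring
  rw [h2, deriv_num_succ, h3]; push_cast; ring

theorem deriv_num_at_zero (n : ℕ) : deriv (num (n + 1)) 0 = 0 := by
  rw [deriv_num_succ]
  induction n with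
  | zero => simp
  | succ n ih => rw [deriv_num_succ, ih]; simp

theorem num_one_zero : num 1 0 = -1 := by simp [num]

theorem num_bound (n : ℕ) (R : ℝ) : ∃ C, 0 ≤ C ∧ ∀ x : ℂ, ‖x‖ ≤ R → ‖num n x‖ ≤ C := by
  obtain ⟨C, hC⟩ := (isCompact_closedBall (0 : ℂ) R).exists_bound_of_continuousOn
    (contDiff_num n).continuous.continuousOn
  exact ⟨max C 0, le_max_right _ _, fun x hx => (hC x (by simpa using hx)).trans (le_max_left _ _)⟩

theorem num_sub_bound (n : ℕ) (R : ℝ) : ∃ C, 0 ≤ C ∧ ∀ x : ℂ, ‖x‖ ≤ R →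
    ‖num (n + 1) x - num (n + 1) 0‖ ≤ C * ‖x‖ ^ 2 := by
  set f := num (n + 1) with hf
  have h1 : ContDiff ℂ ∞ (deriv f) := (contDiff_infty_iff_deriv.1 (contDiff_num _)).2
  have h2 : ContDiff ℂ ∞ (deriv (deriv f)) := (contDiff_infty_iff_deriv.1 h1).2
  obtain ⟨C, hC⟩ := (isCompact_closedBall (0 : ℂ) R).exists_bound_of_continuousOn
    h2.continuous.continuousOn
  have key : ∀ x : ℂ, ‖x‖ ≤ R → ‖deriv f x‖ ≤ max C 0 * ‖x‖ := fun x hx => by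
    have h0 : (0 : ℂ) ∈ Metric.closedBall (0 : ℂ) R := by
      simpa using (norm_nonneg x).trans hx
    have := (convex_closedBall (0 : ℂ) R).norm_image_sub_le_of_norm_deriv_le
      (fun y _ => (h1.differentiable (by simp)).differentiableAt) (fun y hy =>
        (hC y hy).trans (le_max_left _ 0)) h0 (by simpa using hx : x ∈ Metric.closedBall (0 : ℂ) R)
    simpa [hf, deriv_num_at_zero] using this
  refine ⟨max C 0, le_max_right _ _, fun x hx => ?_⟩
  have := (convex_closedBall (0 : ℂ) ‖x‖).norm_image_sub_le_of_norm_deriv_le (𝕜 := ℂ) (f := f)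
      (C := max C 0 * ‖x‖)
      (fun y _ => ((contDiff_num (n + 1)).differentiable (by simp)).differentiableAt)
      (fun y hy => by
        have hy' : ‖y‖ ≤ ‖x‖ := by simpa using hy
        exact (key y (hy'.trans hx)).trans (by gcongr))
      (by simp : (0 : ℂ) ∈ _) (by simp : x ∈ _)
  calc _ ≤ _ := this
    _ = _ := by rw [sub_zero]; ring

/-- `G n k (ρ²) = (ρ⁻¹ d/dρ)ⁿ (e^{ikρ} / (4πρ))`, as a function of `q = ρ²`. -/
noncomputable def G (n : ℕ) (k q : ℂ) : ℂ :=
  num n (k * csqrt q) / (4 * (Real.pi : ℂ) * csqrt q ^ (2 * n + 1))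

theorem hasDerivAt_G (n : ℕ) (k : ℂ) {q : ℂ} (hq : q ∈ Complex.slitPlane) :
    HasDerivAt (G n k) (G (n + 1) k q / 2) q := by
  have h0 := csqrt_ne_zero (Complex.slitPlane_ne_zero hq)
  have hs := hasDerivAt_csqrt hq
  have hpi : (Real.pi : ℂ) ≠ 0 := by exact_mod_cast Real.pi_ne_zero
  have h1 := (hasDerivAt_num n (k * csqrt q)).comp q (hs.const_mul k)
  have h2 := (hs.pow (2 * n + 1)).const_mul (4 * (Real.pi : ℂ))
  have hne : 4 * (Real.pi : ℂ) * csqrt q ^ (2 * n + 1) ≠ 0 :=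
    mul_ne_zero (mul_ne_zero (by norm_num) hpi) (pow_ne_zero _ h0)
  refine (h1.div h2 hne).congr_deriv ?_
  simp only [G, num, Function.comp, Pi.pow_apply]
  generalize csqrt q = r at *
  generalize deriv (num n) (k * r) = d
  generalize num n (k * r) = m
  simp only [Nat.add_sub_cancel]
  have e1 : r ^ (2 * n + 1) = r ^ (2 * n) * r := by ring
  have e2 : r ^ (2 * (n + 1) + 1) = r ^ (2 * n) * r ^ 3 := by ring
  rw [e1, e2]
  have h3 : r ^ (2 * n) ≠ 0 := pow_ne_zero _ h0
  generalize r ^ (2 * n) = s at *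
  field_simp
  push_cast
  ring

theorem contDiffOn_G (n : ℕ) (k : ℂ) : ContDiffOn ℂ ∞ (G n k) Complex.slitPlane := by
  have : DifferentiableOn ℂ (G n k) Complex.slitPlane := fun q hq =>
    (hasDerivAt_G n k hq).differentiableAt.differentiableWithinAt
  exact this.contDiffOn Complex.isOpen_slitPlane

theorem helmholtz_one (k : ℂ) {q : ℂ} (hq : q ≠ 0) :
    3 * G 1 k q + q * G 2 k q + k ^ 2 * G 0 k q = 0 := by
  have h0 := csqrt_ne_zero hq
  have h1 := num_two (k * csqrt q)
  have hpi : (Real.pi : ℂ) ≠ 0 := by exact_mod_cast Real.pi_ne_zero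
  have h2 : q = csqrt q ^ 2 := (csqrt_sq q).symm
  simp only [G]
  generalize csqrt q = r at *
  subst h2
  field_simp
  linear_combination r ^ 6 * h1

theorem G_bound (n : ℕ) (k : ℂ) (R : ℝ) : ∃ C, 0 ≤ C ∧ ∀ q : ℂ, ‖q‖ ≤ R →
    ‖G n k q‖ ≤ C / ‖csqrt q‖ ^ (2 * n + 1) := by
  obtain ⟨C, hC0, hC⟩ := num_bound n (‖k‖ * √R)
  have hpi := Real.pi_pos
  refine ⟨C / (4 * Real.pi), by positivity, fun q hq => ?_⟩
  have h1 : ‖csqrt q‖ ≤ √R := Real.le_sqrt_of_sq_le (by rwa [norm_csqrt_sq])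
  have h2 := hC (k * csqrt q) (by rw [norm_mul]; gcongr)
  rw [G, norm_div, norm_mul, norm_mul, norm_pow, Complex.norm_real, div_div]
  simp only [Complex.norm_ofNat, Real.norm_eq_abs, abs_of_pos hpi]
  gcongr

theorem G_sub_bound (n : ℕ) (k : ℂ) (R : ℝ) : ∃ C, 0 ≤ C ∧ ∀ q : ℂ, q ≠ 0 → ‖q‖ ≤ R →
    ‖G (n + 1) k q - G (n + 1) 0 q‖ ≤ C / ‖csqrt q‖ ^ (2 * n + 1) := by
  obtain ⟨C, hC0, hC⟩ := num_sub_bound n (‖k‖ * √R)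
  have hpi := Real.pi_pos
  refine ⟨C * ‖k‖ ^ 2 / (4 * Real.pi), by positivity, fun q hq0 hq => ?_⟩
  have h1 : ‖csqrt q‖ ≤ √R := Real.le_sqrt_of_sq_le (by rwa [norm_csqrt_sq])
  have h2 := hC (k * csqrt q) (by rw [norm_mul]; gcongr)
  have h3 : 0 < ‖csqrt q‖ := norm_pos_iff.2 (csqrt_ne_zero hq0)
  rw [G, G, ← sub_div, zero_mul, norm_div, norm_mul, norm_mul, norm_pow, Complex.norm_real]
  simp only [Complex.norm_ofNat, Real.norm_eq_abs, abs_of_pos hpi]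
  rw [div_div]
  calc _ ≤ C * ‖k * csqrt q‖ ^ 2 / (4 * Real.pi * ‖csqrt q‖ ^ (2 * (n + 1) + 1)) := by gcongr
    _ = _ := by
      rw [norm_mul]; field_simp; ring

theorem G_homogeneous (n : ℕ) {r : ℝ} (hr : 0 < r) {q : ℂ} (hq : q ∈ Complex.slitPlane) :
    G n 0 ((r : ℂ) ^ 2 * q) = ((r : ℂ) ^ (2 * n + 1))⁻¹ * G n 0 q := by
  have : (r : ℂ) ≠ 0 := by exact_mod_cast hr.ne'
  simp only [G, csqrt_real_mul hr hq, zero_mul, mul_pow]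
  field_simp

theorem G_one_zero (q : ℂ) : G 1 0 q = -(4 * (Real.pi : ℂ) * csqrt q ^ 3)⁻¹ := by
  simp [G, num_one_zero, neg_div]

/-! ### Vector kernels -/

/-- The open set of those `z ∈ ℂ³` for which `z · z` lies in the rotated half-plane. -/
def dom (S : ℝ) : Set C3 := {z | 0 < (rot S * (z ⬝ᵥ z)).re}

theorem continuous_dot_self : Continuous fun z : C3 => z ⬝ᵥ z := by
  unfold dotProduct; fun_prop

theorem isOpen_dom (S : ℝ) : IsOpen (dom S) :=
  isOpen_lt continuous_const
    (Complex.continuous_re.comp (continuous_const.mul continuous_dot_self))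

theorem dot_mem_slitPlane {S : ℝ} {z : C3} (hz : z ∈ dom S) : z ⬝ᵥ z ∈ Complex.slitPlane :=
  mem_slitPlane_of_rot hz

theorem contDiff_dot_self : ContDiff ℂ ∞ fun z : C3 => z ⬝ᵥ z := by
  unfold dotProduct; fun_prop

theorem contDiffOn_G_dot (S : ℝ) (n : ℕ) (k : ℂ) :
    ContDiffOn ℂ ∞ (fun z : C3 => G n k (z ⬝ᵥ z)) (dom S) :=
  (contDiffOn_G n k).comp contDiff_dot_self.contDiffOn fun _ hz => dot_mem_slitPlane hz

theorem contDiffOn_G_dot_fst (S : ℝ) (n : ℕ) (k : ℂ) :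
    ContDiffOn ℂ ∞ (fun v : C3 × C3 => G n k (v.1 ⬝ᵥ v.1)) (dom S ×ˢ Set.univ) :=
  (contDiffOn_G_dot S n k).comp contDiff_fst.contDiffOn fun _ hv => hv.1

/-- The fundamental solution applied to a constant vector. -/
noncomputable def Ku (k : ℂ) (v : C3 × C3) : C3 := G 0 k (v.1 ⬝ᵥ v.1) • v.2

/-- The curl of `Ku`. -/
noncomputable def Kd (k : ℂ) (v : C3 × C3) : C3 := G 1 k (v.1 ⬝ᵥ v.1) • (v.1 ⨯₃ v.2)

/-- The double curl of `Ku`. -/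
noncomputable def Ks (k : ℂ) (v : C3 × C3) : C3 :=
  (G 2 k (v.1 ⬝ᵥ v.1) * (v.1 ⬝ᵥ v.2)) • v.1 +
    (G 1 k (v.1 ⬝ᵥ v.1) + k ^ 2 * G 0 k (v.1 ⬝ᵥ v.1)) • v.2

theorem contDiffOn_Ku (S : ℝ) (k : ℂ) : ContDiffOn ℂ ∞ (Ku k) (dom S ×ˢ Set.univ) :=
  (contDiffOn_G_dot_fst S 0 k).smul contDiff_snd.contDiffOn

theorem contDiff_cross : ContDiff ℂ ∞ fun v : C3 × C3 => v.1 ⨯₃ v.2 := by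
  refine contDiff_pi.2 fun i => ?_
  simp only [cross_apply]
  fin_cases i <;> simp <;> fun_prop

theorem contDiffOn_Kd (S : ℝ) (k : ℂ) : ContDiffOn ℂ ∞ (Kd k) (dom S ×ˢ Set.univ) :=
  (contDiffOn_G_dot_fst S 1 k).smul contDiff_cross.contDiffOn

theorem contDiff_dot : ContDiff ℂ ∞ fun v : C3 × C3 => v.1 ⬝ᵥ v.2 := by
  unfold dotProduct; fun_prop

theorem contDiffOn_Ks (S : ℝ) (k : ℂ) : ContDiffOn ℂ ∞ (Ks k) (dom S ×ˢ Set.univ) := by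
  have h := ((contDiffOn_G_dot_fst S 1 k).add
    (contDiffOn_const (c := k ^ 2).mul (contDiffOn_G_dot_fst S 0 k))).smul
      (contDiff_snd (E := C3) (F := C3)).contDiffOn
  exact (((contDiffOn_G_dot_fst S 2 k).mul contDiff_dot.contDiffOn).smul
    contDiff_fst.contDiffOn).add h

/-- The curl of a holomorphic vector field with Jacobian `A`. -/
noncomputable def curlC (A : C3 →L[ℂ] C3) : C3 :=
  ![A (Pi.single 1 1) 2 - A (Pi.single 2 1) 1,
    A (Pi.single 2 1) 0 - A (Pi.single 0 1) 2,
    A (Pi.single 0 1) 1 - A (Pi.single 1 1) 0]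

/-- The Jacobian of a kernel with respect to its position argument. -/
noncomputable def jac (K : C3 × C3 → C3) (v : C3 × C3) : C3 →L[ℂ] C3 :=
  (fderiv ℂ K v).comp (ContinuousLinearMap.inl ℂ C3 C3)

theorem jac_apply (K : C3 × C3 → C3) (v : C3 × C3) (e : C3) :
    jac K v e = fderiv ℂ K v (e, 0) := rfl

theorem dom_prod_mem_nhds {S : ℝ} {z : C3} (hz : z ∈ dom S) (w : C3) :
    dom S ×ˢ (Set.univ : Set C3) ∈ 𝓝 (z, w) :=
  ((isOpen_dom S).prod isOpen_univ).mem_nhds (Set.mk_mem_prod hz (Set.mem_univ w))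

theorem hasDerivAt_line {S : ℝ} {K : C3 × C3 → C3} (hK : ContDiffOn ℂ ∞ K (dom S ×ˢ Set.univ))
    {z : C3} (hz : z ∈ dom S) (w e : C3) (i : Fin 3) :
    HasDerivAt (fun t : ℂ => K (z + t • e, w) i) (jac K (z, w) e i) 0 := by
  have h1 : HasFDerivAt K (fderiv ℂ K (z, w)) (z, w) :=
    ((hK.contDiffAt (dom_prod_mem_nhds hz w)).differentiableAt (by simp)).hasFDerivAt
  have h2 : HasDerivAt (fun t : ℂ => (z, w) + t • (e, (0 : C3))) ((1 : ℂ) • (e, (0 : C3))) 0 :=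
    ((hasDerivAt_id (0 : ℂ)).smul_const (e, (0 : C3))).const_add (z, w)
  have h3 := h1.comp_hasDerivAt_of_eq (0 : ℂ) h2 (by rw [zero_smul, add_zero])
  rw [one_smul, ← jac_apply] at h3
  have h4 : HasDerivAt (fun t : ℂ => K (z + t • e, w)) (jac K (z, w) e) 0 := by
    refine h3.congr_of_eventuallyEq (Filter.Eventually.of_forall fun t => ?_)
    simp only [Function.comp, Prod.smul_mk, Prod.mk_add_mk, smul_zero, add_zero]
  exact hasDerivAt_pi.1 h4 i

theorem hasDerivAt_dot_line (z e w : C3) :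
    HasDerivAt (fun t : ℂ => (z + t • e) ⬝ᵥ w) (e ⬝ᵥ w) 0 := by
  have : (fun t : ℂ => (z + t • e) ⬝ᵥ w) = fun t => z ⬝ᵥ w + t * (e ⬝ᵥ w) := by
    ext t; rw [add_dotProduct, smul_dotProduct, smul_eq_mul]
  rw [this]
  simpa using ((hasDerivAt_id (0 : ℂ)).mul_const (e ⬝ᵥ w)).const_add (z ⬝ᵥ w)

theorem hasDerivAt_coord_line (z e : C3) (i : Fin 3) :
    HasDerivAt (fun t : ℂ => z i + t * e i) (e i) 0 := by
  simpa using ((hasDerivAt_id (0 : ℂ)).mul_const (e i)).const_add (z i)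

theorem hasDerivAt_G_line {S : ℝ} (n : ℕ) (k : ℂ) {z : C3} (hz : z ∈ dom S) (e : C3) :
    HasDerivAt (fun t : ℂ => G n k ((z + t • e) ⬝ᵥ (z + t • e)))
      (G (n + 1) k (z ⬝ᵥ z) * (z ⬝ᵥ e)) 0 := by
  have h1 : HasDerivAt (fun t : ℂ => (z + t • e) ⬝ᵥ (z + t • e)) (2 * (z ⬝ᵥ e)) 0 := by
    have : (fun t : ℂ => (z + t • e) ⬝ᵥ (z + t • e)) =
        fun t => z ⬝ᵥ z + t * (2 * (z ⬝ᵥ e)) + t ^ 2 * (e ⬝ᵥ e) := by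
      ext t
      simp only [add_dotProduct, dotProduct_add, smul_dotProduct, dotProduct_smul, smul_eq_mul,
        dotProduct_comm e z]
      ring
    rw [this]
    exact ((((hasDerivAt_id (0 : ℂ)).mul_const (2 * (z ⬝ᵥ e))).const_add (z ⬝ᵥ z)).add
      ((hasDerivAt_pow 2 (0 : ℂ)).mul_const (e ⬝ᵥ e))).congr_deriv (by simp)
  have h2 : HasDerivAt (G n k) (G (n + 1) k (z ⬝ᵥ z) / 2)
      ((z + (0 : ℂ) • e) ⬝ᵥ (z + (0 : ℂ) • e)) := by
    rw [zero_smul, add_zero]; exact hasDerivAt_G n k (dot_mem_slitPlane hz)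
  refine (h2.comp (0 : ℂ) h1).congr_deriv ?_
  ring

theorem jac_Ku {S : ℝ} (k : ℂ) {z : C3} (hz : z ∈ dom S) (w e : C3) (i : Fin 3) :
    jac (Ku k) (z, w) e i = G 1 k (z ⬝ᵥ z) * (z ⬝ᵥ e) * w i := by
  refine (hasDerivAt_line (contDiffOn_Ku S k) hz w e i).unique ?_
  exact (hasDerivAt_G_line 0 k hz e).mul_const (w i)

theorem jac_Kd {S : ℝ} (k : ℂ) {z : C3} (hz : z ∈ dom S) (w e : C3) (i : Fin 3) :
    jac (Kd k) (z, w) e i = G 2 k (z ⬝ᵥ z) * (z ⬝ᵥ e) * (z ⨯₃ w) i +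
      G 1 k (z ⬝ᵥ z) * (e ⨯₃ w) i := by
  refine (hasDerivAt_line (contDiffOn_Kd S k) hz w e i).unique ?_
  have h1 : HasDerivAt (fun t : ℂ => ((z + t • e) ⨯₃ w) i) ((e ⨯₃ w) i) 0 := by
    have : (fun t : ℂ => ((z + t • e) ⨯₃ w) i) = fun t => (z ⨯₃ w) i + t * (e ⨯₃ w) i := by
      ext t; simp
    rw [this]
    exact hasDerivAt_coord_line (z ⨯₃ w) (e ⨯₃ w) i
  refine ((hasDerivAt_G_line 1 k hz e).mul h1).congr_deriv ?_
  simp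

theorem jac_Ks {S : ℝ} (k : ℂ) {z : C3} (hz : z ∈ dom S) (w e : C3) (i : Fin 3) :
    jac (Ks k) (z, w) e i = (G 3 k (z ⬝ᵥ z) * (z ⬝ᵥ e) * (z ⬝ᵥ w) +
      G 2 k (z ⬝ᵥ z) * (e ⬝ᵥ w)) * z i + G 2 k (z ⬝ᵥ z) * (z ⬝ᵥ w) * e i +
      (G 2 k (z ⬝ᵥ z) + k ^ 2 * G 1 k (z ⬝ᵥ z)) * (z ⬝ᵥ e) * w i := by
  refine (hasDerivAt_line (contDiffOn_Ks S k) hz w e i).unique ?_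
  have h := ((((hasDerivAt_G_line 2 k hz e).mul (hasDerivAt_dot_line z e w)).mul
    (hasDerivAt_coord_line z e i))).add (((hasDerivAt_G_line 1 k hz e).add
      ((hasDerivAt_G_line 0 k hz e).const_mul (k ^ 2))).mul_const (w i))
  refine (h.congr_deriv ?_).congr_of_eventuallyEq ?_
  · simp only [zero_smul, add_zero, zero_mul, Pi.mul_apply]
    ring
  · refine Filter.Eventually.of_forall fun t => ?_
    simp only [Ks, Pi.add_apply, Pi.smul_apply, Pi.mul_apply, smul_eq_mul]

theorem curlC_jac_Ku {S : ℝ} (k : ℂ) {z : C3} (hz : z ∈ dom S) (w : C3) :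
    curlC (jac (Ku k) (z, w)) = Kd k (z, w) := by
  ext i
  simp only [curlC, jac_Ku k hz, dotProduct_single, mul_one, Kd, cross_apply]
  fin_cases i <;> simp <;> ring

theorem curlC_jac_Kd {S : ℝ} (k : ℂ) {z : C3} (hz : z ∈ dom S) (w : C3) :
    curlC (jac (Kd k) (z, w)) = Ks k (z, w) := by
  have h := helmholtz_one k (Complex.slitPlane_ne_zero (dot_mem_slitPlane hz))
  ext i
  simp only [curlC, jac_Kd k hz, dotProduct_single, mul_one, Ks, cross_apply]
  generalize G 0 k (z ⬝ᵥ z) = g0 at *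
  generalize G 1 k (z ⬝ᵥ z) = g1 at *
  generalize G 2 k (z ⬝ᵥ z) = g2 at *
  simp only [dotProduct, Fin.sum_univ_three] at *
  fin_cases i <;> simp
  · linear_combination (-w 0) * h
  · linear_combination (-w 1) * h
  · linear_combination (-w 2) * h

theorem curlC_jac_Ks {S : ℝ} (k : ℂ) {z : C3} (hz : z ∈ dom S) (w : C3) :
    curlC (jac (Ks k) (z, w)) = k ^ 2 • Kd k (z, w) := by
  ext i
  simp only [curlC, jac_Ks k hz, dotProduct_single, single_dotProduct, mul_one, one_mul, Kd,
    cross_apply]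
  fin_cases i <;> simp <;> ring

end PMLJump

namespace PMLJump

/-! ### The stretched curl as a holomorphic curl -/

namespace PML
variable (p : PML)

theorem contDiff_X : ContDiff ℝ 1 p.X := by
  refine contDiff_pi.2 fun l => ?_
  exact (p.contDiff_stretch l).comp (by fun_prop : ContDiff ℝ 1 fun x : E3 => x l)

theorem hasFDerivAt_X (x : E3) : HasFDerivAt p.X (fderiv ℝ p.X x) x :=
  (p.contDiff_X.differentiable (by simp)).differentiableAt.hasFDerivAt

theorem fderiv_X_apply (x v : E3) (l : Fin 3) : fderiv ℝ p.X x v l = p.β x l * v l := by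
  have h1 := hasFDerivAt_pi'.1 (p.hasFDerivAt_X x) l
  have h2 : HasFDerivAt (fun y : E3 => y l) (EuclideanSpace.proj l : E3 →L[ℝ] ℝ) x :=
    (EuclideanSpace.proj l : E3 →L[ℝ] ℝ).hasFDerivAt
  have h3 := (p.hasDerivAt_stretch l (x l)).hasFDerivAt.comp x h2
  have h4 := h1.unique h3
  have h5 := congrArg (fun A : E3 →L[ℝ] ℂ => A v) h4
  simpa [PML.β, mul_comm] using h5

theorem fderiv_X_single (x : E3) (i : Fin 3) :
    fderiv ℝ p.X x (EuclideanSpace.single i 1) = p.β x i • Pi.single i 1 := by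
  ext l
  rw [fderiv_X_apply]
  rcases eq_or_ne l i with rfl | h <;> simp [*]

theorem fderiv_X (x v : E3) : fderiv ℝ p.X x v = p.β x * fun l => (v l : ℂ) := by
  ext l; rw [fderiv_X_apply]; rfl

theorem β_ne_zero (x : E3) (l : Fin 3) : p.β x l ≠ 0 := p.α_ne_zero l _

theorem X_sub_mem_dom {x y : E3} (h : x ≠ y) : p.X x - p.X y ∈ dom p.S := by
  have h1 := p.re_rot_mul_dot x y
  have : 0 < ‖x - y‖ := norm_pos_iff.2 (sub_ne_zero.2 h)
  exact lt_of_lt_of_le (by positivity) h1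

theorem pd_B_mulVec {u : E3 → C3} {A : E3 →L[ℝ] C3} {D : C3 →L[ℂ] C3} {x : E3}
    (hu : HasFDerivAt u A x)
    (hA : ∀ i, A (EuclideanSpace.single i 1) = p.β x i • D (Pi.single i 1)) {i l : Fin 3}
    (h : i ≠ l) :
    pd i (fun y => (p.B y *ᵥ u y) l) x = p.β x l * (p.β x i * D (Pi.single i 1) l) := by
  have h1 := (hasFDerivAt_pi'.1 hu l).hasLineDerivAt (EuclideanSpace.single i (1 : ℝ))
  have h2 : HasLineDerivAt ℝ (fun y => (p.B y *ᵥ u y) l)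
      (p.β x l * (A (EuclideanSpace.single i 1)) l) x (EuclideanSpace.single i (1 : ℝ)) := by
    unfold HasLineDerivAt at h1 ⊢
    refine (h1.const_mul (p.β x l)).congr_of_eventuallyEq (Filter.Eventually.of_forall fun t => ?_)
    simp [B_mulVec, PML.β, h.symm]
  unfold pd
  rw [h2.lineDeriv, hA]; simp

theorem curl_B_mulVec {u : E3 → C3} {A : E3 →L[ℝ] C3} {D : C3 →L[ℂ] C3} {x : E3}
    (hu : HasFDerivAt u A x)
    (hA : ∀ i, A (EuclideanSpace.single i 1) = p.β x i • D (Pi.single i 1)) :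
    curl (fun y => p.B y *ᵥ u y) x = p.J x • ((p.β x)⁻¹ * curlC D) := by
  have h0 := p.β_ne_zero x 0
  have h1 := p.β_ne_zero x 1
  have h2 := p.β_ne_zero x 2
  have key := fun i l (h : i ≠ l) => p.pd_B_mulVec hu hA h
  unfold curl curlC
  rw [key 1 2 (by decide), key 2 1 (by decide), key 2 0 (by decide), key 0 2 (by decide),
    key 0 1 (by decide), key 1 0 (by decide), J_eq]
  ext i
  fin_cases i <;> simp <;> field_simp

theorem scurl_eq_curlC {u : E3 → C3} {A : E3 →L[ℝ] C3} {D : C3 →L[ℂ] C3} {x : E3}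
    (hu : HasFDerivAt u A x)
    (hA : ∀ i, A (EuclideanSpace.single i 1) = p.β x i • D (Pi.single i 1)) :
    scurl p u x = curlC D := by
  unfold scurl
  rw [p.curl_B_mulVec hu hA, B_mulVec]
  have hJ := p.J_ne_zero x
  ext i
  have := p.β_ne_zero x i
  simp; field_simp

theorem hasFDerivAt_kernel {K : C3 × C3 → C3} (hK : ContDiffOn ℂ ∞ K (dom p.S ×ˢ Set.univ))
    {x y : E3} (h : x ≠ y) (w : C3) :
    HasFDerivAt (fun x' => K (p.X x' - p.X y, w))
      (((jac K (p.X x - p.X y, w)).restrictScalars ℝ).comp (fderiv ℝ p.X x)) x := by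
  have hz := p.X_sub_mem_dom h
  have h1 : HasFDerivAt K (fderiv ℂ K (p.X x - p.X y, w)) (p.X x - p.X y, w) :=
    ((hK.contDiffAt (dom_prod_mem_nhds hz w)).differentiableAt (by simp)).hasFDerivAt
  have h2 : HasFDerivAt (fun x' => (p.X x' - p.X y, w))
      ((fderiv ℝ p.X x).prod (0 : E3 →L[ℝ] C3)) x :=
    ((p.hasFDerivAt_X x).sub_const _).prodMk (hasFDerivAt_const w x)
  exact (h1.restrictScalars ℝ).comp x h2

theorem kernel_fderiv_single (K : C3 × C3 → C3) (x : E3) (v : C3 × C3) (i : Fin 3) :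
    (((jac K v).restrictScalars ℝ).comp (fderiv ℝ p.X x)) (EuclideanSpace.single i 1) =
      p.β x i • jac K v (Pi.single i 1) := by
  rw [ContinuousLinearMap.comp_apply, fderiv_X_single]
  exact map_smul (jac K v) _ _

theorem scurl_kernel {K : C3 × C3 → C3} (hK : ContDiffOn ℂ ∞ K (dom p.S ×ˢ Set.univ))
    {x y : E3} (h : x ≠ y) (w : C3) :
    scurl p (fun x' => K (p.X x' - p.X y, w)) x = curlC (jac K (p.X x - p.X y, w)) :=
  p.scurl_eq_curlC (p.hasFDerivAt_kernel hK h w) (p.kernel_fderiv_single K x _)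

theorem scurl_congr {u v : E3 → C3} {x : E3} (h : u =ᶠ[𝓝 x] v) : scurl p u x = scurl p v x := by
  have : ∀ i l, pd i (fun y => (p.B y *ᵥ u y) l) x = pd i (fun y => (p.B y *ᵥ v y) l) x :=
    fun i l => Filter.EventuallyEq.lineDeriv_eq (by
      filter_upwards [h] with y hy; rw [hy])
  unfold scurl curl
  simp only [this]

theorem Phi_smul (k : ℂ) (x y : E3) (w : C3) :
    Phi p k x y • w = Ku k (p.X x - p.X y, w) := by
  have h : rho p x y = csqrt ((p.X x - p.X y) ⬝ᵥ (p.X x - p.X y)) := by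
    unfold rho csqrt dotProduct PML.X
    simp only [Pi.sub_apply, pow_two]
  simp [Ku, Phi, G, h, num, mul_assoc]

theorem scurl_Phi (k : ℂ) {x y : E3} (h : x ≠ y) (w : C3) :
    scurl p (fun z => Phi p k z y • w) x = Kd k (p.X x - p.X y, w) := by
  simp only [Phi_smul]
  rw [p.scurl_kernel (contDiffOn_Ku p.S k) h, curlC_jac_Ku k (p.X_sub_mem_dom h)]

theorem scurl_scurl_Phi (k : ℂ) {x y : E3} (h : x ≠ y) (w : C3) :
    scurl p (scurl p (fun z => Phi p k z y • w)) x = Ks k (p.X x - p.X y, w) := by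
  rw [p.scurl_congr (v := fun x' => Kd k (p.X x' - p.X y, w)) (by
    filter_upwards [isOpen_ne.mem_nhds h] with x' hx'
    exact p.scurl_Phi k hx' w)]
  rw [p.scurl_kernel (contDiffOn_Kd p.S k) h, curlC_jac_Kd k (p.X_sub_mem_dom h)]

end PML

/-! ### Differentiation of potentials off the surface -/

section Potential
open MeasureTheory

theorem aestronglyMeasurable_comp_continuousOn {α β γ : Type*} [MeasurableSpace α]
    [TopologicalSpace β] [MeasurableSpace β] [BorelSpace β] [SecondCountableTopology β]
    [TopologicalSpace γ] [TopologicalSpace.PseudoMetrizableSpace γ] {μ : Measure α} {g : α → β}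
    {f : β → γ} {s : Set β} (hs : MeasurableSet s) (hf : ContinuousOn f s)
    (hg : AEMeasurable g μ) (hgs : ∀ᵐ a ∂μ, g a ∈ s) :
    AEStronglyMeasurable (fun a => f (g a)) μ := by
  have h1 : (μ.map g).restrict s = μ.map g :=
    Measure.restrict_eq_self_of_ae_mem ((ae_map_iff hg hs).2 hgs)
  have h2 : AEStronglyMeasurable f (μ.map g) := by
    rw [← h1]; exact hf.aestronglyMeasurable hs
  exact h2.comp_aemeasurable hg

theorem continuousOn_jac {S : ℝ} {K : C3 × C3 → C3}
    (hK : ContDiffOn ℂ ∞ K (dom S ×ˢ Set.univ)) : ContinuousOn (jac K) (dom S ×ˢ Set.univ) := by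
  have h : ContinuousOn (fderiv ℂ K) (dom S ×ˢ Set.univ) :=
    hK.continuousOn_fderiv_of_isOpen ((isOpen_dom S).prod isOpen_univ) (by simp)
  exact h.clm_comp continuousOn_const

/-- `curlC` as a linear map. -/
noncomputable def curlCL : (C3 →L[ℂ] C3) →L[ℂ] C3 :=
  LinearMap.toContinuousLinearMap
    { toFun := curlC
      map_add' := fun A B => by
        ext i; fin_cases i <;> simp [curlC] <;> ring
      map_smul' := fun c A => by
        ext i; fin_cases i <;> simp [curlC] <;> ring }

variable (p : PML) {μ : Measure E3} {m : E3 → C3} {Cs : Set E3} {R : ℝ}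
  {K : C3 × C3 → C3}

theorem kernel_compact_bound {F : Type*} [SeminormedAddCommGroup F] {f : E3 → C3 × C3 → F}
    (hf : ContinuousOn (fun v : E3 × (C3 × C3) => f v.1 v.2) (Set.univ ×ˢ (dom p.S ×ˢ Set.univ)))
    (hCs : IsCompact Cs) (R : ℝ) {U : Set E3} (hU : IsOpen U) (hd : Disjoint U Cs)
    {x₀ : E3} (hx : x₀ ∈ U) :
    ∃ C, ∀ᶠ x in 𝓝 x₀, ∀ y ∈ Cs, ∀ w : C3, ‖w‖ ≤ R → ‖f x (p.X x - p.X y, w)‖ ≤ C := by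
  obtain ⟨δ, hδ, hsub⟩ := Metric.nhds_basis_closedBall.mem_iff.1 (hU.mem_nhds hx)
  have hcomp : IsCompact (Metric.closedBall x₀ δ ×ˢ (Cs ×ˢ Metric.closedBall (0 : C3) R)) :=
    (isCompact_closedBall _ _).prod (hCs.prod (isCompact_closedBall _ _))
  have hX := p.contDiff_X.continuous
  have hc : ContinuousOn (fun v : E3 × (E3 × C3) => f v.1 (p.X v.1 - p.X v.2.1, v.2.2))
      (Metric.closedBall x₀ δ ×ˢ (Cs ×ˢ Metric.closedBall (0 : C3) R)) := by
    have hg : Continuous fun v : E3 × (E3 × C3) => (v.1, (p.X v.1 - p.X v.2.1, v.2.2)) := by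
      fun_prop
    refine hf.comp hg.continuousOn ?_
    rintro ⟨x, y, w⟩ ⟨h1, h2, -⟩
    refine Set.mk_mem_prod (Set.mem_univ _) (Set.mk_mem_prod (p.X_sub_mem_dom ?_) (Set.mem_univ _))
    intro (h : x = y)
    subst h
    exact Set.disjoint_left.1 hd (hsub h1) h2
  obtain ⟨C, hC⟩ := hcomp.exists_bound_of_continuousOn hc
  refine ⟨C, ?_⟩
  filter_upwards [Metric.closedBall_mem_nhds x₀ hδ] with x hx y hy w hw
  exact hC (x, y, w) ⟨hx, hy, by simpa using hw⟩

theorem aestronglyMeasurable_kernel {F : Type*} [TopologicalSpace F]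
    [TopologicalSpace.PseudoMetrizableSpace F] {f : C3 × C3 → F}
    (hf : ContinuousOn f (dom p.S ×ˢ Set.univ)) (hm : AEStronglyMeasurable m μ)
    {x : E3} (hx : ∀ᵐ y ∂μ, x ≠ y) :
    AEStronglyMeasurable (fun y => f (p.X x - p.X y, m y)) μ := by
  have hX := p.contDiff_X.continuous
  refine aestronglyMeasurable_comp_continuousOn (s := dom p.S ×ˢ Set.univ)
    (g := fun y => (p.X x - p.X y, m y))
    ((isOpen_dom p.S).prod isOpen_univ).measurableSet hf ?_ ?_
  · exact ((continuous_const.sub hX).measurable.aemeasurable).prodMk hm.aemeasurable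
  · filter_upwards [hx] with y hy
    exact Set.mk_mem_prod (p.X_sub_mem_dom hy) (Set.mem_univ _)

variable [IsFiniteMeasure μ]

theorem integrable_kernel {F : Type*} [NormedAddCommGroup F] {f : C3 × C3 → F}
    (hf : ContinuousOn f (dom p.S ×ˢ Set.univ)) (hm : AEStronglyMeasurable m μ)
    (hCs : IsCompact Cs) (hμ : ∀ᵐ y ∂μ, y ∈ Cs ∧ ‖m y‖ ≤ R) {x : E3} (hx : x ∉ Cs) :
    Integrable (fun y => f (p.X x - p.X y, m y)) μ := by
  obtain ⟨C, hC⟩ := kernel_compact_bound p (f := fun _ => f)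
    (hf.comp continuousOn_snd fun v hv => hv.2) hCs R hCs.isClosed.isOpen_compl
    disjoint_compl_left (Set.mem_compl hx)
  refine (integrable_const C).mono' (aestronglyMeasurable_kernel p hf hm ?_) ?_
  · filter_upwards [hμ] with y hy
    rintro rfl; exact hx hy.1
  · filter_upwards [hμ] with y hy
    exact hC.self_of_nhds y hy.1 _ hy.2

/-- Differentiation under the integral sign, off the support of the measure. -/
theorem hasFDerivAt_potential (hK : ContDiffOn ℂ ∞ K (dom p.S ×ˢ Set.univ))
    (hm : AEStronglyMeasurable m μ) (hCs : IsCompact Cs) (hμ : ∀ᵐ y ∂μ, y ∈ Cs ∧ ‖m y‖ ≤ R)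
    {x : E3} (hx : x ∉ Cs) :
    HasFDerivAt (fun x => ∫ y, K (p.X x - p.X y, m y) ∂μ)
      (∫ y, ((jac K (p.X x - p.X y, m y)).restrictScalars ℝ).comp (fderiv ℝ p.X x) ∂μ) x := by
  have hopen : IsOpen Csᶜ := hCs.isClosed.isOpen_compl
  have hcont := hK.continuousOn
  have hX1 : Continuous (fderiv ℝ p.X) := p.contDiff_X.continuous_fderiv (by simp)
  have hjr : ContinuousOn (fun v : C3 × C3 => (jac K v).restrictScalars ℝ)
      (dom p.S ×ˢ Set.univ) :=
    (ContinuousLinearMap.restrictScalarsL ℂ C3 C3 ℝ ℝ).continuous.comp_continuousOn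
      (continuousOn_jac hK)
  have hj : ContinuousOn (fun v : E3 × (C3 × C3) =>
      ((jac K v.2).restrictScalars ℝ).comp (fderiv ℝ p.X v.1))
      (Set.univ ×ˢ (dom p.S ×ˢ Set.univ)) :=
    (hjr.comp continuousOn_snd fun v hv => hv.2).clm_comp
      (hX1.comp continuous_fst).continuousOn
  obtain ⟨C, hC⟩ := kernel_compact_bound p
    (f := fun x v => ((jac K v).restrictScalars ℝ).comp (fderiv ℝ p.X x)) hj hCs R hopen
    disjoint_compl_left (Set.mem_compl hx)
  have hne : ∀ x ∉ Cs, ∀ᵐ y ∂μ, x ≠ y := fun x hx => by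
    filter_upwards [hμ] with y hy
    rintro rfl; exact hx hy.1
  have hset : {x | x ∉ Cs ∧ ∀ y ∈ Cs, ∀ w : C3, ‖w‖ ≤ R →
      ‖((jac K (p.X x - p.X y, w)).restrictScalars ℝ).comp (fderiv ℝ p.X x)‖ ≤ C} ∈ 𝓝 x := by
    filter_upwards [hC, hopen.mem_nhds hx] with x' h1 h2
    exact ⟨h2, h1⟩
  refine hasFDerivAt_integral_of_dominated_of_fderiv_le (𝕜 := ℝ) (bound := fun _ => C)
    (F' := fun x y => ((jac K (p.X x - p.X y, m y)).restrictScalars ℝ).comp (fderiv ℝ p.X x))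
    (F := fun x y => K (p.X x - p.X y, m y)) hset ?_
    (integrable_kernel p hcont hm hCs hμ hx) ?_ ?_ (integrable_const C) ?_
  · filter_upwards [hopen.mem_nhds hx] with x' hx'
    exact aestronglyMeasurable_kernel p hcont hm (hne x' hx')
  · exact aestronglyMeasurable_kernel p
      (f := fun v => ((jac K v).restrictScalars ℝ).comp (fderiv ℝ p.X x))
      (hjr.clm_comp continuousOn_const) hm (hne x hx)
  · filter_upwards [hμ] with y hy x' hx'
    exact hx'.2 y hy.1 _ hy.2
  · filter_upwards [hμ] with y hy x' hx'
    refine p.hasFDerivAt_kernel hK ?_ _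
    rintro rfl; exact hx'.1 hy.1

theorem contDiffOn_potential (hK : ContDiffOn ℂ ∞ K (dom p.S ×ˢ Set.univ))
    (hm : AEStronglyMeasurable m μ) (hCs : IsCompact Cs) (hμ : ∀ᵐ y ∂μ, y ∈ Cs ∧ ‖m y‖ ≤ R) :
    ContDiffOn ℝ 1 (fun x => ∫ y, K (p.X x - p.X y, m y) ∂μ) Csᶜ := by
  have hopen : IsOpen Csᶜ := hCs.isClosed.isOpen_compl
  have hX := p.contDiff_X.continuous
  have hX1 : Continuous (fderiv ℝ p.X) := p.contDiff_X.continuous_fderiv (by simp)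
  have hjr : ContinuousOn (fun v : C3 × C3 => (jac K v).restrictScalars ℝ)
      (dom p.S ×ˢ Set.univ) :=
    (ContinuousLinearMap.restrictScalarsL ℂ C3 C3 ℝ ℝ).continuous.comp_continuousOn
      (continuousOn_jac hK)
  have hj : ContinuousOn (fun v : E3 × (C3 × C3) =>
      ((jac K v.2).restrictScalars ℝ).comp (fderiv ℝ p.X v.1))
      (Set.univ ×ˢ (dom p.S ×ˢ Set.univ)) :=
    (hjr.comp continuousOn_snd fun v hv => hv.2).clm_comp
      (hX1.comp continuous_fst).continuousOn
  have h1 : (1 : WithTop ℕ∞) = 0 + 1 := by simp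
  rw [h1, contDiffOn_succ_iff_hasFDerivWithinAt_of_uniqueDiffOn hopen.uniqueDiffOn]
  refine ⟨by simp, fun x =>
    ∫ y, ((jac K (p.X x - p.X y, m y)).restrictScalars ℝ).comp (fderiv ℝ p.X x) ∂μ, ?_,
    fun x hx => (hasFDerivAt_potential p hK hm hCs hμ hx).hasFDerivWithinAt⟩
  rw [contDiffOn_zero]
  intro x hx
  refine ContinuousAt.continuousWithinAt ?_
  obtain ⟨C, hC⟩ := kernel_compact_bound p
    (f := fun x v => ((jac K v).restrictScalars ℝ).comp (fderiv ℝ p.X x)) hj hCs R hopen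
    disjoint_compl_left hx
  refine continuousAt_of_dominated (bound := fun _ => C) ?_ ?_ (integrable_const C) ?_
  · filter_upwards [hopen.mem_nhds hx] with x' hx'
    refine aestronglyMeasurable_kernel p
      (f := fun v => ((jac K v).restrictScalars ℝ).comp (fderiv ℝ p.X x'))
      (hjr.clm_comp continuousOn_const) hm ?_
    filter_upwards [hμ] with y hy
    rintro rfl; exact hx' hy.1
  · filter_upwards [hC] with x' hx'
    filter_upwards [hμ] with y hy
    exact hx' y hy.1 _ hy.2
  · filter_upwards [hμ] with y hy
    have hxy : x ≠ y := by rintro rfl; exact hx hy.1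
    have hg : Continuous fun x' : E3 => (x', (p.X x' - p.X y, m y)) := by fun_prop
    refine ContinuousAt.comp (f := fun x' : E3 => (x', (p.X x' - p.X y, m y)))
      (hj.continuousAt ?_) hg.continuousAt
    exact prod_mem_nhds Filter.univ_mem (dom_prod_mem_nhds (p.X_sub_mem_dom hxy) _)

theorem potential_fderiv_single (hK : ContDiffOn ℂ ∞ K (dom p.S ×ˢ Set.univ))
    (hm : AEStronglyMeasurable m μ) (hCs : IsCompact Cs) (hμ : ∀ᵐ y ∂μ, y ∈ Cs ∧ ‖m y‖ ≤ R)
    {x : E3} (hx : x ∉ Cs) (i : Fin 3) :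
    (∫ y, ((jac K (p.X x - p.X y, m y)).restrictScalars ℝ).comp (fderiv ℝ p.X x) ∂μ)
      (EuclideanSpace.single i 1) =
      p.β x i • (∫ y, jac K (p.X x - p.X y, m y) ∂μ) (Pi.single i 1) := by
  have hjr : ContinuousOn (fun v : C3 × C3 => ((jac K v).restrictScalars ℝ).comp (fderiv ℝ p.X x))
      (dom p.S ×ˢ Set.univ) :=
    ((ContinuousLinearMap.restrictScalarsL ℂ C3 C3 ℝ ℝ).continuous.comp_continuousOn
      (continuousOn_jac hK)).clm_comp continuousOn_const
  rw [ContinuousLinearMap.integral_apply (integrable_kernel p hjr hm hCs hμ hx),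
    ContinuousLinearMap.integral_apply (integrable_kernel p (continuousOn_jac hK) hm hCs hμ hx),
    ← integral_smul]
  exact integral_congr_ae (Filter.Eventually.of_forall fun y => p.kernel_fderiv_single K x _ i)

theorem integral_curlC (hK : ContDiffOn ℂ ∞ K (dom p.S ×ˢ Set.univ))
    (hm : AEStronglyMeasurable m μ) (hCs : IsCompact Cs) (hμ : ∀ᵐ y ∂μ, y ∈ Cs ∧ ‖m y‖ ≤ R)
    {x : E3} (hx : x ∉ Cs) :
    curlC (∫ y, jac K (p.X x - p.X y, m y) ∂μ) =
      ∫ y, curlC (jac K (p.X x - p.X y, m y)) ∂μ :=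
  (curlCL.integral_comp_comm
    (integrable_kernel p (continuousOn_jac hK) hm hCs hμ hx)).symm

theorem scurl_potential (hK : ContDiffOn ℂ ∞ K (dom p.S ×ˢ Set.univ))
    (hm : AEStronglyMeasurable m μ) (hCs : IsCompact Cs) (hμ : ∀ᵐ y ∂μ, y ∈ Cs ∧ ‖m y‖ ≤ R)
    {x : E3} (hx : x ∉ Cs) :
    scurl p (fun x => ∫ y, K (p.X x - p.X y, m y) ∂μ) x =
      ∫ y, curlC (jac K (p.X x - p.X y, m y)) ∂μ := by
  rw [p.scurl_eq_curlC (hasFDerivAt_potential p hK hm hCs hμ hx)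
    (potential_fderiv_single p hK hm hCs hμ hx), integral_curlC p hK hm hCs hμ hx]

theorem curl_B_potential (hK : ContDiffOn ℂ ∞ K (dom p.S ×ˢ Set.univ))
    (hm : AEStronglyMeasurable m μ) (hCs : IsCompact Cs) (hμ : ∀ᵐ y ∂μ, y ∈ Cs ∧ ‖m y‖ ≤ R)
    {x : E3} (hx : x ∉ Cs) :
    curl (fun x => p.B x *ᵥ ∫ y, K (p.X x - p.X y, m y) ∂μ) x =
      p.J x • ((p.β x)⁻¹ * ∫ y, curlC (jac K (p.X x - p.X y, m y)) ∂μ) := by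
  rw [p.curl_B_mulVec (hasFDerivAt_potential p hK hm hCs hμ hx)
    (potential_fderiv_single p hK hm hCs hμ hx), integral_curlC p hK hm hCs hμ hx]

end Potential
end PMLJump

namespace PMLJump

/-! ### Graph charts of the interface -/

/-- The parameter plane. -/
abbrev E2 := EuclideanSpace ℝ (Fin 2)

section Frame

variable (b : OrthonormalBasis (Fin 3) ℝ E3)

/-- The isometric embedding of the plane onto the span of the first two vectors of a frame. -/
noncomputable def emb : E2 →L[ℝ] E3 :=
  (EuclideanSpace.proj 0 : E2 →L[ℝ] ℝ).smulRight (b 0) +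
    (EuclideanSpace.proj 1 : E2 →L[ℝ] ℝ).smulRight (b 1)

/-- The orthogonal projection onto the span of the first two vectors of a frame, in coordinates. -/
noncomputable def prj : E3 →L[ℝ] E2 :=
  (innerSL ℝ (b 0)).smulRight (EuclideanSpace.single 0 1) +
    (innerSL ℝ (b 1)).smulRight (EuclideanSpace.single 1 1)

theorem emb_apply (t : E2) : emb b t = t 0 • b 0 + t 1 • b 1 := by
  simp [emb]

theorem prj_apply_zero (v : E3) : prj b v 0 = inner ℝ (b 0) v := by
  simp [prj]

theorem prj_apply_one (v : E3) : prj b v 1 = inner ℝ (b 1) v := by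
  simp [prj]

theorem inner_emb_zero (t : E2) : inner ℝ (b 0) (emb b t) = t 0 := by
  simp [emb_apply, inner_add_right, inner_smul_right]

theorem inner_emb_one (t : E2) : inner ℝ (b 1) (emb b t) = t 1 := by
  simp [emb_apply, inner_add_right, inner_smul_right]

theorem inner_emb_two (t : E2) : inner ℝ (b 2) (emb b t) = (0 : ℝ) := by
  simp [emb_apply, inner_add_right, inner_smul_right]

theorem prj_emb_add (t : E2) (s : ℝ) : prj b (emb b t + s • b 2) = t := by
  ext i; fin_cases i
  · simp [prj_apply_zero, inner_emb_zero]
  · simp [prj_apply_one, inner_emb_one]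

theorem inner_two_emb_add (t : E2) (s : ℝ) : inner ℝ (b 2) (emb b t + s • b 2) = s := by
  simp [inner_add_right, inner_smul_right, inner_emb_two]

theorem emb_prj_add (v : E3) : emb b (prj b v) + (inner ℝ (b 2) v : ℝ) • b 2 = v := by
  have := b.sum_repr' v
  rw [Fin.sum_univ_three] at this
  rw [emb_apply, prj_apply_zero, prj_apply_one]
  exact this

theorem norm_emb_add_sq (t : E2) (s : ℝ) : ‖emb b t + s • b 2‖ ^ 2 = ‖t‖ ^ 2 + s ^ 2 := by
  rw [← b.sum_sq_norm_inner_right, Fin.sum_univ_three, EuclideanSpace.norm_sq_eq,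
    Fin.sum_univ_two, inner_two_emb_add]
  simp [inner_add_right, inner_smul_right, inner_emb_zero, inner_emb_one]

theorem norm_emb (t : E2) : ‖emb b t‖ = ‖t‖ := by
  have := norm_emb_add_sq b t 0
  simp only [zero_smul, add_zero, ne_eq, OfNat.ofNat_ne_zero, not_false_eq_true, zero_pow] at this
  exact (sq_eq_sq₀ (norm_nonneg _) (norm_nonneg _)).1 this

theorem norm_prj_le (v : E3) : ‖prj b v‖ ≤ ‖v‖ := by
  have := norm_emb_add_sq b (prj b v) (inner ℝ (b 2) v)
  rw [emb_prj_add] at this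
  exact (sq_le_sq₀ (norm_nonneg _) (norm_nonneg _)).1 (by nlinarith [sq_nonneg (inner ℝ (b 2) v)])

theorem exists_frame {ν : E3} (hν : ‖ν‖ = 1) : ∃ b : OrthonormalBasis (Fin 3) ℝ E3, b 2 = ν := by
  obtain ⟨b, hb⟩ := Orthonormal.exists_orthonormalBasis_extension_of_card_eq (𝕜 := ℝ) (E := E3)
    (ι := Fin 3) (by simp) (v := fun _ => ν) (s := {2}) (by
      rw [orthonormal_iff_ite]
      rintro ⟨i, rfl⟩ ⟨j, rfl⟩
      simp [Set.domRestrict, hν])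
  exact ⟨b, hb 2 rfl⟩

/-- The graph of `f` over the plane through `x₀` spanned by the first two vectors of a frame. -/
noncomputable def graphPt (x₀ : E3) (f : E2 → ℝ) (t : E2) : E3 := x₀ + (emb b t + f t • b 2)

/-- A graph chart of the interface around one of its points: near `x₀`, the interface is the graph
of a `C²` function over its tangent plane. -/
structure GraphChart {a : Fin 3 → ℝ} (M : LayeredMedium a) (x₀ : E3) where
  b : OrthonormalBasis (Fin 3) ℝ E3
  f : E2 → ℝ
  R : ℝ
  C : ℝ
  V : Set E3
  frame_two : b 2 = M.ν x₀
  R_pos : 0 < R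
  C_nonneg : 0 ≤ C
  small : C * R ≤ 1 / 2
  contDiffOn : ContDiffOn ℝ 2 f (Metric.ball 0 R)
  f_zero : f 0 = 0
  fderiv_zero : fderiv ℝ f 0 = 0
  norm_f_le : ∀ t ∈ Metric.ball (0 : E2) R, |f t| ≤ C * ‖t‖ ^ 2
  norm_fderiv_le : ∀ t ∈ Metric.ball (0 : E2) R, ‖fderiv ℝ f t‖ ≤ C * ‖t‖
  isOpen_V : IsOpen V
  mem_V : x₀ ∈ V
  image : M.Γ ∩ V = graphPt b x₀ f '' Metric.ball 0 R
  normal : ∀ t ∈ Metric.ball (0 : E2) R, M.ν (graphPt b x₀ f t) ≠ 0 ∧ ∀ e : E2,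
    inner ℝ (M.ν (graphPt b x₀ f t)) (emb b e + fderiv ℝ f t e • b 2) = 0

end Frame

variable {a : Fin 3 → ℝ} (M : LayeredMedium a)

theorem LayeredMedium.isClosed_Γ : IsClosed M.Γ := (M.isOpen₁.union M.isOpen₂).isClosed_compl

/-- The data of a local defining function of the interface at one of its points. -/
theorem LayeredMedium.exists_local {x₀ : E3} (hx : x₀ ∈ M.Γ) : ∃ (U : Set E3) (F : E3 → ℝ),
    IsOpen U ∧ x₀ ∈ U ∧ ContDiffOn ℝ ∞ F U ∧ (∀ y ∈ U, (y ∈ M.Ω₁ ↔ F y < 0)) ∧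
    (∀ y ∈ U, (y ∈ M.Ω₂ ↔ 0 < F y)) ∧ (∀ y ∈ U, y ∈ M.Γ ↔ F y = 0) ∧
    ∀ y ∈ U, F y = 0 → gradient F y ≠ 0 ∧ M.ν y = ‖gradient F y‖⁻¹ • gradient F y := by
  obtain ⟨U, F, hU, hxU, hF, h⟩ := M.smooth x₀ hx
  refine ⟨U, F, hU, hxU, hF, fun y hy => (h y hy).1, fun y hy => (h y hy).2.1, fun y hy => ?_,
    fun y hy => (h y hy).2.2⟩
  obtain ⟨h1, h2, -⟩ := h y hy
  unfold LayeredMedium.Γ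
  rw [Set.mem_compl_iff, Set.mem_union, h1, h2]
  constructor
  · intro h3; push Not at h3; exact le_antisymm h3.2 h3.1
  · intro h3; simp [h3]

theorem LayeredMedium.norm_ν {x₀ : E3} (hx : x₀ ∈ M.Γ) : ‖M.ν x₀‖ = 1 := by
  obtain ⟨U, F, hU, hxU, hF, -, -, h0, h⟩ := M.exists_local hx
  obtain ⟨h1, h2⟩ := h x₀ hxU ((h0 x₀ hxU).1 hx)
  rw [h2, norm_smul, norm_inv, norm_norm, inv_mul_cancel₀ (norm_ne_zero_iff.2 h1)]

theorem gradient_inner {F : E3 → ℝ} (y v : E3) : inner ℝ (gradient F y) v = fderiv ℝ F y v := by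
  simp [gradient]

theorem LayeredMedium.exists_graphChart {x₀ : E3} (hx : x₀ ∈ M.Γ) {W : Set E3} (hW : IsOpen W)
    (hxW : x₀ ∈ W) : ∃ c : GraphChart M x₀, c.V ⊆ W := by
  obtain ⟨U, F, hU, hxU, hF, -, -, hΓ, hgrad⟩ := M.exists_local hx
  have hF0 : F x₀ = 0 := (hΓ x₀ hxU).1 hx
  obtain ⟨b, hb⟩ := exists_frame (M.norm_ν hx)
  -- the defining function in the coordinates of the frame
  set P : E2 × ℝ → E3 := fun v => x₀ + (emb b v.1 + v.2 • b 2) with hP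
  have hPs : ContDiff ℝ ∞ P := by fun_prop
  have hP0 : P (0, 0) = x₀ := by simp [hP]
  set g : E2 × ℝ → ℝ := fun v => F (P v) with hg
  have hFx : ContDiffAt ℝ ∞ F x₀ := hF.contDiffAt (hU.mem_nhds hxU)
  have hgs : ContDiffAt ℝ ∞ g (0, 0) := by
    refine ContDiffAt.comp (0, 0) ?_ hPs.contDiffAt
    rw [hP0]; exact hFx
  have hder : (fderiv ℝ g (0, 0) ∘L .inr ℝ E2 ℝ).IsInvertible := by
    have h1 : HasFDerivAt P ((emb b).comp (.fst ℝ E2 ℝ) +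
        (ContinuousLinearMap.snd ℝ E2 ℝ).smulRight (b 2)) (0, 0) := by
      have e1 := ((emb b).comp (.fst ℝ E2 ℝ) +
        (ContinuousLinearMap.snd ℝ E2 ℝ).smulRight (b 2)).hasFDerivAt (x := ((0 : E2), (0 : ℝ)))
      exact e1.const_add x₀
    have h2 : HasFDerivAt F (fderiv ℝ F x₀) (P (0, 0)) := by
      rw [hP0]; exact (hFx.differentiableAt (by simp)).hasFDerivAt
    have h3 := (h2.comp _ h1).fderiv
    obtain ⟨h4, h5⟩ := hgrad x₀ hxU hF0
    have hc : fderiv ℝ F x₀ (b 2) ≠ 0 := by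
      rw [hb, h5, map_smul, ← gradient_inner, real_inner_self_eq_norm_sq]
      have := norm_pos_iff.2 h4
      simp only [smul_eq_mul]; positivity
    refine ⟨ContinuousLinearEquiv.unitsEquivAut ℝ (Units.mk0 _ hc), ?_⟩
    ext
    change _ = fderiv ℝ (F ∘ P) (0, 0) (0, 1)
    rw [h3]
    simp
  have hinf : (∞ : WithTop ℕ∞) ≠ 0 := by simp
  set f : E2 → ℝ := hgs.implicitFunction hinf hder with hf
  have hf0 : f 0 = 0 := hgs.implicitFunction_apply_self hinf hder
  have hfs : ContDiffAt ℝ ∞ f 0 := hgs.contDiffAt_implicitFunction hinf hder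
  have hiff := hgs.eventually_apply_eq_iff_implicitFunction hinf hder
  rw [← hf] at hiff
  have hgoal : ∀ᶠ v in 𝓝 ((0 : E2), (0 : ℝ)), (g v = 0 ↔ f v.1 = v.2) ∧ P v ∈ U ∩ W := by
    have h1 : g (0, 0) = 0 := by simp [hg, hP0, hF0]
    rw [h1] at hiff
    exact hiff.and (hPs.continuous.continuousAt.preimage_mem_nhds
      (by rw [hP0]; exact (hU.inter hW).mem_nhds ⟨hxU, hxW⟩))
  obtain ⟨N, hN, hNo, hN0⟩ := eventually_nhds_iff.1 hgoal
  -- Lipschitz bound for the derivative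
  have hf2 : ContDiffAt ℝ 2 f 0 := hfs.of_le (WithTop.coe_le_coe.2 le_top)
  obtain ⟨K, s, hs, hK⟩ := (hf2.fderiv_right (m := 1) (by norm_num)).exists_lipschitzOnWith
  have hev : ∀ᶠ t in 𝓝 (0 : E2), (t, f t) ∈ N ∧ t ∈ s ∧ ContDiffAt ℝ 2 f t := by
    have h1 : Filter.Tendsto (fun t => (t, f t)) (𝓝 0) (𝓝 ((0 : E2), (0 : ℝ))) := by
      have := (continuousAt_id.prodMk hf2.continuousAt :
        ContinuousAt (fun t : E2 => (t, f t)) 0).tendsto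
      rwa [hf0] at this
    exact Filter.Eventually.and (h1 (hNo.mem_nhds hN0))
      (Filter.Eventually.and hs (hf2.eventually (by simp)))
  obtain ⟨r, hr, hball⟩ := Metric.eventually_nhds_iff_ball.1 hev
  set R : ℝ := min r (1 / (2 * (K + 1))) with hR
  have hK0 : (0 : ℝ) ≤ K := K.2
  have hRpos : 0 < R := lt_min hr (by positivity)
  have hsub : ∀ t ∈ Metric.ball (0 : E2) R, t ∈ Metric.ball (0 : E2) r :=
    Metric.ball_subset_ball (min_le_left _ _)
  have hYN : ∀ t ∈ Metric.ball (0 : E2) R, graphPt b x₀ f t ∈ U ∩ W ∧ F (graphPt b x₀ f t) = 0 := by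
    intro t ht
    have := hN _ (hball t (hsub t ht)).1
    exact ⟨this.2, this.1.2 rfl⟩
  have hdf : ∀ t ∈ Metric.ball (0 : E2) R, HasFDerivAt f (fderiv ℝ f t) t := fun t ht =>
    ((hball t (hsub t ht)).2.2.differentiableAt (by simp)).hasFDerivAt
  have hnormal : ∀ t ∈ Metric.ball (0 : E2) R, M.ν (graphPt b x₀ f t) ≠ 0 ∧ ∀ e : E2,
      inner ℝ (M.ν (graphPt b x₀ f t)) (emb b e + fderiv ℝ f t e • b 2) = 0 := by
    intro t ht
    obtain ⟨⟨h1, -⟩, h2⟩ := hYN t ht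
    obtain ⟨h3, h4⟩ := hgrad _ h1 h2
    have hne : M.ν (graphPt b x₀ f t) ≠ 0 := by
      rw [h4]; exact smul_ne_zero (inv_ne_zero (norm_ne_zero_iff.2 h3)) h3
    refine ⟨hne, fun e => ?_⟩
    have hY : HasFDerivAt (graphPt b x₀ f) (emb b + (fderiv ℝ f t).smulRight (b 2)) t :=
      ((emb b).hasFDerivAt.add ((hdf t ht).smul_const (b 2))).const_add x₀
    have hFy : HasFDerivAt F (fderiv ℝ F (graphPt b x₀ f t)) (graphPt b x₀ f t) :=
      ((hF.contDiffAt (hU.mem_nhds h1)).differentiableAt (by simp)).hasFDerivAt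
    have h5 := hFy.comp t hY
    have h6 : HasFDerivAt (F ∘ graphPt b x₀ f) (0 : E2 →L[ℝ] ℝ) t := by
      refine (hasFDerivAt_const (0 : ℝ) t).congr_of_eventuallyEq ?_
      filter_upwards [Metric.isOpen_ball.mem_nhds ht] with t' ht'
      exact (hYN t' ht').2
    have h7 := congrArg (fun A : E2 →L[ℝ] ℝ => A e) (h5.unique h6)
    rw [h4, inner_smul_left, gradient_inner]
    simp only [ContinuousLinearMap.comp_apply, add_apply,
      ContinuousLinearMap.smulRight_apply, zero_apply] at h7
    rw [h7, mul_zero]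
  have hzero : (0 : E2) ∈ Metric.ball (0 : E2) R := by simpa using hRpos
  have hY0 : graphPt b x₀ f 0 = x₀ := by simp [graphPt, hf0]
  have hfd0 : fderiv ℝ f 0 = 0 := by
    ext e
    have := (hnormal 0 hzero).2 e
    rw [hY0, ← hb, inner_two_emb_add] at this
    simpa using this
  have hfd : ∀ t ∈ Metric.ball (0 : E2) R, ‖fderiv ℝ f t‖ ≤ K * ‖t‖ := by
    intro t ht
    have := hK.dist_le_mul t (hball t (hsub t ht)).2.1 0 (mem_of_mem_nhds hs)
    simpa [hfd0, dist_eq_norm] using this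
  set V : Set E3 := {y | (prj b (y - x₀), (inner ℝ (b 2) (y - x₀) : ℝ)) ∈ N ∧
    prj b (y - x₀) ∈ Metric.ball 0 R} with hV
  refine ⟨⟨b, f, R, K, V, hb, hRpos, hK0, ?_, ?_, hf0, hfd0, ?_, hfd, ?_, ?_, ?_, hnormal⟩, ?_⟩
  · calc (K : ℝ) * R ≤ K * (1 / (2 * (K + 1))) := by gcongr; exact min_le_right _ _
      _ ≤ 1 / 2 := by
        rw [mul_one_div, div_le_div_iff₀ (by positivity) (by positivity)]; nlinarith
  · exact fun t ht => (hball t (hsub t ht)).2.2.contDiffWithinAt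
  · intro t ht
    have ht' : ‖t‖ < R := by simpa using ht
    have := (convex_closedBall (0 : E2) ‖t‖).norm_image_sub_le_of_norm_hasFDerivWithin_le
      (f := f) (f' := fderiv ℝ f) (C := K * ‖t‖)
      (fun y hy => (hdf y (by
        have : ‖y‖ ≤ ‖t‖ := by simpa using hy
        simpa using this.trans_lt ht')).hasFDerivWithinAt)
      (fun y hy => by
        have h1 : ‖y‖ ≤ ‖t‖ := by simpa using hy
        exact (hfd y (by simpa using h1.trans_lt ht')).trans (by gcongr))
      (by simp : (0 : E2) ∈ _) (by simp : t ∈ _)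
    rw [hf0, sub_zero, sub_zero, Real.norm_eq_abs] at this
    calc _ ≤ _ := this
      _ = _ := by ring
  · refine IsOpen.inter (hNo.preimage ?_) (Metric.isOpen_ball.preimage ?_) <;> fun_prop
  · simp [hV, hN0, hRpos]
  · ext y
    constructor
    · rintro ⟨h1, h2, h3⟩
      have hPy : P (prj b (y - x₀), (inner ℝ (b 2) (y - x₀) : ℝ)) = y := by
        simp only [hP]; rw [emb_prj_add]; abel
      obtain ⟨h4, h5⟩ := hN _ h2
      rw [hg] at h4
      simp only [hPy] at h4 h5
      have h6 := h4.1 ((hΓ y h5.1).1 h1)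
      refine ⟨prj b (y - x₀), h3, ?_⟩
      unfold graphPt
      rw [h6, emb_prj_add]; abel
    · rintro ⟨t, ht, rfl⟩
      obtain ⟨⟨h1, -⟩, h2⟩ := hYN t ht
      refine ⟨(hΓ _ h1).2 h2, ?_⟩
      have h3 : graphPt b x₀ f t - x₀ = emb b t + f t • b 2 := by simp [graphPt]
      simp only [hV, Set.mem_ofPred_eq, h3, prj_emb_add, inner_two_emb_add]
      exact ⟨(hball t (hsub t ht)).1, ht⟩
  · rintro y ⟨h2, h3⟩
    have hPy : P (prj b (y - x₀), (inner ℝ (b 2) (y - x₀) : ℝ)) = y := by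
      simp only [hP]; rw [emb_prj_add]; abel
    have := (hN _ h2).2.2
    rwa [hPy] at this

/-- Just below a point of the interface lies the first layer, just above it the second. -/
theorem LayeredMedium.eventually_side {x₀ : E3} (hx : x₀ ∈ M.Γ) :
    ∀ᶠ h in 𝓝[>] (0 : ℝ), x₀ - h • M.ν x₀ ∈ M.Ω₁ ∧ x₀ + h • M.ν x₀ ∈ M.Ω₂ := by
  obtain ⟨U, F, hU, hxU, hF, h1, h2, hΓ, hgrad⟩ := M.exists_local hx
  have hF0 : F x₀ = 0 := (hΓ x₀ hxU).1 hx
  obtain ⟨h4, h5⟩ := hgrad x₀ hxU hF0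
  have hd : HasFDerivAt F (fderiv ℝ F x₀) x₀ :=
    ((hF.contDiffAt (hU.mem_nhds hxU)).differentiableAt (by simp)).hasFDerivAt
  have hpos : 0 < fderiv ℝ F x₀ (M.ν x₀) := by
    rw [h5, map_smul, ← gradient_inner, real_inner_self_eq_norm_sq]
    have := norm_pos_iff.2 h4
    simp only [smul_eq_mul]; positivity
  have key : ∀ v : E3, 0 < fderiv ℝ F x₀ v → ∀ᶠ h in 𝓝[>] (0 : ℝ), 0 < F (x₀ + h • v) := by
    intro v hv
    have h6 : HasDerivAt (fun h : ℝ => F (x₀ + h • v)) (fderiv ℝ F x₀ v) 0 := by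
      have e : HasDerivAt (fun h : ℝ => x₀ + h • v) ((1 : ℝ) • v) 0 :=
        ((hasDerivAt_id (0 : ℝ)).smul_const v).const_add x₀
      rw [one_smul] at e
      exact hd.comp_hasDerivAt_of_eq (0 : ℝ) e (by simp)
    have h7 := (hasDerivAt_iff_tendsto_slope.1 h6).eventually (lt_mem_nhds hv)
    have h8 : 𝓝[>] (0 : ℝ) ≤ 𝓝[≠] 0 := nhdsWithin_mono _ fun h hh => ne_of_gt hh
    filter_upwards [h8 h7, self_mem_nhdsWithin] with h hh hpos
    have hpos' : 0 < h := hpos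
    simp only [slope_def_field, zero_smul, add_zero, hF0, sub_zero] at hh
    exact (div_pos_iff_of_pos_right hpos').1 hh
  have keyneg : ∀ᶠ h in 𝓝[>] (0 : ℝ), F (x₀ - h • M.ν x₀) < 0 := by
    have h6 : HasDerivAt (fun h : ℝ => F (x₀ - h • M.ν x₀)) (-fderiv ℝ F x₀ (M.ν x₀)) 0 := by
      have e : HasDerivAt (fun h : ℝ => x₀ - h • M.ν x₀) (-((1 : ℝ) • M.ν x₀)) 0 :=
        ((hasDerivAt_id (0 : ℝ)).smul_const _).const_sub x₀
      rw [one_smul] at e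
      have := hd.comp_hasDerivAt_of_eq (0 : ℝ) e (by simp)
      rwa [map_neg] at this
    have h7 := (hasDerivAt_iff_tendsto_slope.1 h6).eventually (gt_mem_nhds (neg_neg_of_pos hpos))
    have h8 : 𝓝[>] (0 : ℝ) ≤ 𝓝[≠] 0 := nhdsWithin_mono _ fun h hh => ne_of_gt hh
    filter_upwards [h8 h7, self_mem_nhdsWithin] with h hh hpos
    have hpos' : 0 < h := hpos
    simp only [slope_def_field, zero_smul, sub_zero, hF0] at hh
    exact (div_neg_iff.1 hh).resolve_left (fun h9 => absurd h9.2 (not_lt.2 hpos'.le)) |>.1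
  have hc : ∀ v : E3, ∀ᶠ h in 𝓝[>] (0 : ℝ), x₀ + h • v ∈ U := fun v => by
    have : Filter.Tendsto (fun h : ℝ => x₀ + h • v) (𝓝[>] 0) (𝓝 x₀) := by
      have e : Continuous fun h : ℝ => x₀ + h • v := by fun_prop
      have := e.tendsto 0
      simp only [zero_smul, add_zero] at this
      exact this.mono_left nhdsWithin_le_nhds
    exact this (hU.mem_nhds hxU)
  filter_upwards [key _ hpos, keyneg, hc (M.ν x₀), hc (-M.ν x₀)] with h e1 e2 e3 e4
  rw [smul_neg, ← sub_eq_add_neg] at e4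
  exact ⟨(h1 _ e4).2 e2, (h2 _ e3).2 e1⟩

end PMLJump

namespace PMLJump
open MeasureTheory

/-! ### Surface measure in a graph chart -/

theorem euclideanHausdorffMeasure_image_le {X Y : Type*} [EMetricSpace X] [MeasurableSpace X]
    [BorelSpace X] [EMetricSpace Y] [MeasurableSpace Y] [BorelSpace Y] {K : NNReal} {f : X → Y}
    {s : Set X} (h : LipschitzOnWith K f s) (d : ℕ) :
    (μHE[d] : Measure Y) (f '' s) ≤ (K : ENNReal) ^ d * (μHE[d] : Measure X) s := by
  have := h.hausdorffMeasure_image_le (d := d) (by positivity)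
  rw [Measure.euclideanHausdorffMeasure_def, Measure.euclideanHausdorffMeasure_def,
    Measure.smul_apply, Measure.smul_apply, ENNReal.smul_def, smul_eq_mul, ENNReal.smul_def,
    smul_eq_mul, mul_left_comm]
  rw [ENNReal.rpow_natCast] at this
  gcongr

namespace GraphChart

variable {a : Fin 3 → ℝ} {M : LayeredMedium a} {x₀ : E3} (c : GraphChart M x₀)

/-- The parametrization of the chart. -/
noncomputable def Y : E2 → E3 := graphPt c.b x₀ c.f

theorem Y_sub (t : E2) : c.Y t - x₀ = emb c.b t + c.f t • c.b 2 := by simp [Y, graphPt]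

theorem prj_Y (t : E2) : prj c.b (c.Y t - x₀) = t := by rw [Y_sub, prj_emb_add]

theorem Y_zero : c.Y 0 = x₀ := by simp [Y, graphPt, c.f_zero]

theorem hasFDerivAt_f {t : E2} (ht : t ∈ Metric.ball (0 : E2) c.R) :
    HasFDerivAt c.f (fderiv ℝ c.f t) t :=
  ((c.contDiffOn.contDiffAt (Metric.isOpen_ball.mem_nhds ht)).differentiableAt
    (by simp)).hasFDerivAt

theorem contDiffOn_Y : ContDiffOn ℝ 2 c.Y (Metric.ball 0 c.R) := by
  have := c.contDiffOn
  have h : ContDiff ℝ 2 (emb c.b) := (emb c.b).contDiff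
  exact contDiffOn_const.add (h.contDiffOn.add (this.smul contDiffOn_const))

theorem hasFDerivAt_Y {t : E2} (ht : t ∈ Metric.ball (0 : E2) c.R) :
    HasFDerivAt c.Y (emb c.b + (fderiv ℝ c.f t).smulRight (c.b 2)) t :=
  ((emb c.b).hasFDerivAt.add ((c.hasFDerivAt_f ht).smul_const (c.b 2))).const_add x₀

theorem mem_iff {y : E3} : y ∈ M.Γ ∩ c.V ↔ ∃ t ∈ Metric.ball (0 : E2) c.R, c.Y t = y := by
  rw [c.image]; rfl

theorem norm_Y_sub_sq (t t' : E2) :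
    ‖c.Y t - c.Y t'‖ ^ 2 = ‖t - t'‖ ^ 2 + (c.f t - c.f t') ^ 2 := by
  rw [← norm_emb_add_sq c.b]
  congr 2
  simp only [Y, graphPt, map_sub, sub_smul]; abel

theorem abs_f_sub_le {r : ℝ} {t t' : E2} (ht : t ∈ Metric.ball (0 : E2) c.R)
    (htr : ‖t‖ ≤ r) (ht' : t' ∈ Metric.ball (0 : E2) c.R) (htr' : ‖t'‖ ≤ r) :
    |c.f t - c.f t'| ≤ c.C * r * ‖t - t'‖ := by
  have hconv : Convex ℝ (Metric.ball (0 : E2) c.R ∩ Metric.closedBall 0 r) :=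
    (convex_ball _ _).inter (convex_closedBall _ _)
  have hC := c.C_nonneg
  have := hconv.norm_image_sub_le_of_norm_hasFDerivWithin_le
    (f := c.f) (f' := fderiv ℝ c.f) (C := c.C * r)
    (fun y hy => (c.hasFDerivAt_f hy.1).hasFDerivWithinAt)
    (fun y hy => (c.norm_fderiv_le y hy.1).trans (by
      have : ‖y‖ ≤ r := by simpa using hy.2
      gcongr)) (x := t') (y := t) ⟨ht', by simpa using htr'⟩ ⟨ht, by simpa using htr⟩
  simpa using this

theorem lipschitzOnWith_Y (r : ℝ) :
    LipschitzOnWith (Real.sqrt (1 + c.C ^ 2 * r ^ 2)).toNNReal c.Y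
      (Metric.ball 0 c.R ∩ Metric.closedBall 0 r) := by
  refine LipschitzOnWith.of_dist_le_mul fun t ht t' ht' => ?_
  rw [Real.coe_toNNReal _ (Real.sqrt_nonneg _), dist_eq_norm, dist_eq_norm]
  have h1 := c.abs_f_sub_le ht.1 (by simpa using ht.2) ht'.1 (by simpa using ht'.2)
  refine le_of_sq_le_sq ?_ (by positivity)
  rw [norm_Y_sub_sq, mul_pow, Real.sq_sqrt (by positivity)]
  have h2 : (c.f t - c.f t') ^ 2 ≤ (c.C * r * ‖t - t'‖) ^ 2 := sq_le_sq' (neg_le_of_abs_le h1)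
    (le_of_abs_le h1)
  linarith

theorem volume_le_image (A : Set E2) : volume A ≤ (μHE[2] : Measure E3) (c.Y '' A) := by
  have h1 : LipschitzOnWith 1 (fun y => prj c.b (y - x₀)) (c.Y '' A) := by
    refine LipschitzOnWith.of_dist_le_mul fun y _ y' _ => ?_
    rw [dist_eq_norm, dist_eq_norm, ← map_sub, sub_sub_sub_cancel_right, NNReal.coe_one, one_mul]
    exact norm_prj_le _ _
  have := euclideanHausdorffMeasure_image_le h1 2
  rw [Set.image_image] at this
  simpa [prj_Y, EuclideanSpace.euclideanHausdorffMeasure_eq_volume] using this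

theorem image_le_volume {A : Set E2} {r : ℝ}
    (hA : A ⊆ Metric.ball 0 c.R ∩ Metric.closedBall 0 r) :
    (μHE[2] : Measure E3) (c.Y '' A) ≤ ENNReal.ofReal (1 + c.C ^ 2 * r ^ 2) * volume A := by
  have := euclideanHausdorffMeasure_image_le ((c.lipschitzOnWith_Y r).mono hA) 2
  rw [EuclideanSpace.euclideanHausdorffMeasure_eq_volume] at this
  refine this.trans (le_of_eq ?_)
  congr 1
  change ENNReal.ofReal (Real.sqrt (1 + c.C ^ 2 * r ^ 2)) ^ 2 = _
  rw [← ENNReal.ofReal_pow (Real.sqrt_nonneg _), Real.sq_sqrt (by positivity)]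

theorem measurableSet : MeasurableSet (M.Γ ∩ c.V) :=
  M.isClosed_Γ.measurableSet.inter c.isOpen_V.measurableSet

/-- The surface measure in a graph chart has a density which differs from `1` by a quadratic
term only. The density is sandwiched between the Lipschitz constants of the orthogonal projection
and of the parametrization, so that no area formula is needed. -/
theorem exists_density : ∃ w : E2 → ℝ, Measurable w ∧
    (∀ t, 1 ≤ w t ∧ w t ≤ 1 + c.C ^ 2 * ‖t‖ ^ 2) ∧
    (μHE[2] : Measure E3).restrict (M.Γ ∩ c.V) =
      ((volume.restrict (Metric.ball (0 : E2) c.R)).withDensity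
        fun t => ENNReal.ofReal (w t)).map c.Y ∧
    AEMeasurable c.Y ((volume.restrict (Metric.ball (0 : E2) c.R)).withDensity
        fun t => ENNReal.ofReal (w t)) := by
  set B := Metric.ball (0 : E2) c.R with hB
  have hBm : MeasurableSet B := Metric.isOpen_ball.measurableSet
  -- below, `m` is the projection of the surface measure to the plane, and `ν` is the area
  set pi : E3 → E2 := fun y => prj c.b (y - x₀) with hpi
  have hpic : Continuous pi := by fun_prop
  have hpiY : ∀ t, pi (c.Y t) = t := c.prj_Y
  set μ := (μHE[2] : Measure E3).restrict (M.Γ ∩ c.V) with hμ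
  set m := μ.map pi with hm
  have hmA : ∀ A, MeasurableSet A → m A = (μHE[2] : Measure E3) (c.Y '' (A ∩ B)) := by
    intro A hA
    rw [hm, Measure.map_apply hpic.measurable hA, hμ,
      Measure.restrict_apply (hpic.measurable hA)]
    congr 1
    ext y
    constructor
    · rintro ⟨h1, h2⟩
      obtain ⟨t, ht, rfl⟩ := c.mem_iff.1 h2
      rw [Set.mem_preimage, hpiY] at h1
      exact ⟨t, ⟨h1, ht⟩, rfl⟩
    · rintro ⟨t, ⟨h1, h2⟩, rfl⟩
      exact ⟨by rwa [Set.mem_preimage, hpiY], c.mem_iff.2 ⟨t, h2, rfl⟩⟩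
  set ν := (volume : Measure E2).restrict B with hν
  have hlow : ∀ A, MeasurableSet A → ν A ≤ m A := fun A hA => by
    rw [hmA A hA, hν, Measure.restrict_apply hA]; exact c.volume_le_image _
  have hup : ∀ A, MeasurableSet A → ∀ r : ℝ, m (A ∩ Metric.closedBall 0 r) ≤
      ENNReal.ofReal (1 + c.C ^ 2 * r ^ 2) * ν (A ∩ Metric.closedBall 0 r) := fun A hA r => by
    have hA' : MeasurableSet (A ∩ Metric.closedBall (0 : E2) r) :=
      hA.inter Metric.isClosed_closedBall.measurableSet
    rw [hmA _ hA', hν, Measure.restrict_apply hA']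
    exact c.image_le_volume fun t ht => ⟨ht.2, ht.1.2⟩
  have hBν : ∀ A, MeasurableSet A → ν (A ∩ Metric.closedBall 0 c.R) = ν A := fun A hA => by
    have hA' : MeasurableSet (A ∩ Metric.closedBall (0 : E2) c.R) :=
      hA.inter Metric.isClosed_closedBall.measurableSet
    rw [hν, Measure.restrict_apply hA', Measure.restrict_apply hA]
    congr 1
    ext t
    simp only [Set.mem_inter_iff]
    exact ⟨fun h => ⟨h.1.1, h.2⟩, fun h => ⟨⟨h.1, Metric.ball_subset_closedBall h.2⟩, h.2⟩⟩
  have hBm' : ∀ A, MeasurableSet A → m (A ∩ Metric.closedBall 0 c.R) = m A := fun A hA => by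
    have hA' : MeasurableSet (A ∩ Metric.closedBall (0 : E2) c.R) :=
      hA.inter Metric.isClosed_closedBall.measurableSet
    rw [hmA _ hA', hmA _ hA]
    congr 2
    ext t
    simp only [Set.mem_inter_iff]
    exact ⟨fun h => ⟨h.1.1, h.2⟩, fun h => ⟨⟨h.1, Metric.ball_subset_closedBall h.2⟩, h.2⟩⟩
  have hupR : ∀ A, MeasurableSet A → m A ≤ ENNReal.ofReal (1 + c.C ^ 2 * c.R ^ 2) * ν A :=
    fun A hA => by
      have := hup A hA c.R
      rwa [hBν A hA, hBm' A hA] at this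
  have : IsFiniteMeasure ν := ⟨by
    rw [hν, Measure.restrict_apply_univ]; exact measure_ball_lt_top⟩
  have : IsFiniteMeasure m := ⟨(hupR _ MeasurableSet.univ).trans_lt
    (ENNReal.mul_lt_top ENNReal.ofReal_lt_top (measure_lt_top _ _))⟩
  have hac : m ≪ ν := by
    refine Measure.AbsolutelyContinuous.mk fun A hA h0 => ?_
    have := hupR A hA
    rw [h0, mul_zero] at this
    exact le_antisymm this bot_le
  have hdens : ν.withDensity (m.rnDeriv ν) = m := Measure.withDensity_rnDeriv_eq _ _ hac
  have hrn := Measure.measurable_rnDeriv m ν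
  have hint : ∀ A, MeasurableSet A → ∫⁻ t in A, m.rnDeriv ν t ∂ν = m A := fun A hA => by
    rw [← withDensity_apply _ hA, hdens]
  have h1 : ∀ᵐ t ∂ν, 1 ≤ m.rnDeriv ν t := by
    refine ae_le_of_forall_setLIntegral_le_of_sigmaFinite measurable_const fun A hA _ => ?_
    rw [hint A hA]; simpa using hlow A hA
  -- rational radii give the pointwise bound off one null set
  have h2 : ∀ᵐ t ∂ν, ∀ r : ℚ, t ∈ Metric.closedBall (0 : E2) (r : ℝ) →
      m.rnDeriv ν t ≤ ENNReal.ofReal (1 + c.C ^ 2 * (r : ℝ) ^ 2) := by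
    rw [ae_all_iff]
    intro r
    rw [← ae_restrict_iff' Metric.isClosed_closedBall.measurableSet]
    refine ae_le_of_forall_setLIntegral_le_of_sigmaFinite hrn fun A hA _ => ?_
    rw [Measure.restrict_restrict hA, hint _ (hA.inter Metric.isClosed_closedBall.measurableSet),
      setLIntegral_const]
    exact hup A hA r
  -- a modification on a null set makes the bounds hold at every point
  set w : E2 → ℝ := fun t => max 1 (min (m.rnDeriv ν t).toReal (1 + c.C ^ 2 * ‖t‖ ^ 2)) with hw
  have hwm : Measurable w := by
    have : Measurable fun t : E2 => 1 + c.C ^ 2 * ‖t‖ ^ 2 := by fun_prop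
    exact measurable_const.max (hrn.ennreal_toReal.min this)
  have hwe : (fun t => ENNReal.ofReal (w t)) =ᵐ[ν] m.rnDeriv ν := by
    filter_upwards [h1, h2, Measure.rnDeriv_lt_top m ν] with t e1 e2 e3
    have e4 : 1 ≤ (m.rnDeriv ν t).toReal := by
      rw [← ENNReal.toReal_one]
      exact (ENNReal.toReal_le_toReal (by simp) e3.ne).2 e1
    have e5 : (m.rnDeriv ν t).toReal ≤ 1 + c.C ^ 2 * ‖t‖ ^ 2 := by
      by_contra hcon
      push Not at hcon
      have hev : ∀ᶠ r in 𝓝 ‖t‖, 1 + c.C ^ 2 * r ^ 2 < (m.rnDeriv ν t).toReal :=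
        (by fun_prop : Continuous fun r : ℝ => 1 + c.C ^ 2 * r ^ 2).continuousAt.eventually
          (gt_mem_nhds hcon)
      obtain ⟨δ, hδ, hδ'⟩ := Metric.eventually_nhds_iff.1 hev
      obtain ⟨r, hr1, hr2⟩ := exists_rat_btwn (show ‖t‖ < ‖t‖ + δ by linarith)
      have e6 := hδ' (show dist (r : ℝ) ‖t‖ < δ by
        rw [Real.dist_eq, abs_lt]; constructor <;> linarith)
      have e7 := ENNReal.toReal_mono (by simp) (e2 r (by simpa using hr1.le))
      rw [ENNReal.toReal_ofReal (by positivity)] at e7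
      linarith
    rw [hw]
    simp only
    rw [min_eq_left e5, max_eq_right e4, ENNReal.ofReal_toReal e3.ne]
  have hmeq : ν.withDensity (fun t => ENNReal.ofReal (w t)) = m := by
    rw [withDensity_congr_ae hwe, hdens]
  have hYae : AEMeasurable c.Y m := by
    have : AEMeasurable c.Y ν := c.contDiffOn_Y.continuousOn.aemeasurable hBm
    exact this.mono_ac hac
  refine ⟨w, hwm, fun t => ⟨le_max_left _ _, max_le ?_ (min_le_right _ _)⟩, ?_, ?_⟩
  · have : 0 ≤ c.C ^ 2 * ‖t‖ ^ 2 := by positivity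
    linarith
  · rw [hmeq, hm, AEMeasurable.map_map_of_aemeasurable hYae hpic.measurable.aemeasurable]
    have : c.Y ∘ pi =ᵐ[μ] id := by
      filter_upwards [ae_restrict_mem c.measurableSet] with y hy
      obtain ⟨t, ht, rfl⟩ := c.mem_iff.1 hy
      simp only [Function.comp, hpiY, id]
    rw [Measure.map_congr this, Measure.map_id]
  · rwa [hmeq]

/-- The density of the surface measure in the chart. -/
noncomputable def w : E2 → ℝ := c.exists_density.choose

theorem measurable_w : Measurable c.w := c.exists_density.choose_spec.1

theorem one_le_w (t : E2) : 1 ≤ c.w t := (c.exists_density.choose_spec.2.1 t).1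

theorem w_le (t : E2) : c.w t ≤ 1 + c.C ^ 2 * ‖t‖ ^ 2 := (c.exists_density.choose_spec.2.1 t).2

theorem w_nonneg (t : E2) : 0 ≤ c.w t := zero_le_one.trans (c.one_le_w t)

theorem w_le_two {t : E2} (ht : t ∈ Metric.ball (0 : E2) c.R) : c.w t ≤ 2 := by
  have ht' : ‖t‖ < c.R := by simpa using ht
  have h1 : c.C * ‖t‖ ≤ 1 / 2 :=
    (mul_le_mul_of_nonneg_left ht'.le c.C_nonneg).trans c.small
  have h2 : (c.C * ‖t‖) ^ 2 ≤ 1 := by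
    have := mul_nonneg c.C_nonneg (norm_nonneg t)
    nlinarith
  have := c.w_le t
  rw [mul_pow] at h2; linarith

variable {F : Type*} [NormedAddCommGroup F]

theorem integrableOn_iff {g : E3 → F}
    (hg : AEStronglyMeasurable g ((μHE[2] : Measure E3).restrict (M.Γ ∩ c.V))) [NormedSpace ℝ F] :
    IntegrableOn g (M.Γ ∩ c.V) (μHE[2] : Measure E3) ↔
      IntegrableOn (fun t => c.w t • g (c.Y t)) (Metric.ball 0 c.R) := by
  obtain ⟨h1, h2, h3, h4⟩ := c.exists_density.choose_spec
  rw [IntegrableOn, h3] at *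
  rw [integrable_map_measure hg h4, integrable_withDensity_iff_integrable_smul' (by fun_prop)
    (Filter.Eventually.of_forall fun _ => ENNReal.ofReal_lt_top)]
  refine integrable_congr (Filter.Eventually.of_forall fun t => ?_)
  simp only [Function.comp]
  change (ENNReal.ofReal (c.w t)).toReal • g (c.Y t) = _
  rw [ENNReal.toReal_ofReal (c.w_nonneg t)]

theorem integral_eq [NormedSpace ℝ F] {g : E3 → F}
    (hg : AEStronglyMeasurable g ((μHE[2] : Measure E3).restrict (M.Γ ∩ c.V))) :
    ∫ y in M.Γ ∩ c.V, g y ∂(μHE[2] : Measure E3) =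
      ∫ t in Metric.ball 0 c.R, c.w t • g (c.Y t) := by
  obtain ⟨h1, h2, h3, h4⟩ := c.exists_density.choose_spec
  rw [h3] at *
  rw [integral_map h4 hg, integral_withDensity_eq_integral_toReal_smul (by fun_prop)
    (Filter.Eventually.of_forall fun _ => ENNReal.ofReal_lt_top)]
  refine integral_congr_ae (Filter.Eventually.of_forall fun t => ?_)
  simp only
  change (ENNReal.ofReal (c.w t)).toReal • g (c.Y t) = _
  rw [ENNReal.toReal_ofReal (c.w_nonneg t)]

theorem aestronglyMeasurable_comp_Y {g : E3 → F}
    (hg : AEStronglyMeasurable g ((μHE[2] : Measure E3).restrict (M.Γ ∩ c.V))) :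
    AEStronglyMeasurable (fun t => g (c.Y t)) (volume.restrict (Metric.ball 0 c.R)) := by
  obtain ⟨h1, h2, h3, h4⟩ := c.exists_density.choose_spec
  rw [h3] at hg
  refine (hg.comp_aemeasurable h4).mono_ac ?_
  refine withDensity_absolutelyContinuous' (by fun_prop) ?_
  refine Filter.Eventually.of_forall fun t => ?_
  have := c.one_le_w t
  rw [ne_eq, ENNReal.ofReal_eq_zero, not_le]
  exact zero_lt_one.trans_le this

theorem measure_lt_top : (μHE[2] : Measure E3) (M.Γ ∩ c.V) < ⊤ := by
  have h1 := c.image_le_volume (A := Metric.ball 0 c.R) (r := c.R)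
    (fun t ht => ⟨ht, Metric.ball_subset_closedBall ht⟩)
  have h2 : c.Y '' Metric.ball 0 c.R = M.Γ ∩ c.V := c.image.symm
  rw [h2] at h1
  exact h1.trans_lt (ENNReal.mul_lt_top ENNReal.ofReal_lt_top measure_ball_lt_top)

end GraphChart

theorem LayeredMedium.measure_inter_lt_top {a : Fin 3 → ℝ} (M : LayeredMedium a) {K : Set E3}
    (hK : IsCompact K) : (μHE[2] : Measure E3) (M.Γ ∩ K) < ⊤ := by
  have hc : IsCompact (M.Γ ∩ K) := hK.inter_left M.isClosed_Γ
  refine hc.measure_lt_top_of_nhdsWithin fun x hx => ?_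
  obtain ⟨c, -⟩ := M.exists_graphChart hx.1 isOpen_univ (Set.mem_univ x)
  refine ⟨M.Γ ∩ c.V, ?_, c.measure_lt_top⟩
  refine Filter.mem_of_superset (inter_mem_nhdsWithin (M.Γ ∩ K) (c.isOpen_V.mem_nhds c.mem_V)) ?_
  rintro y ⟨h1, h2⟩
  exact ⟨h1.1, h2⟩

/-! ### Integrability of powers of the distance -/

theorem integrableOn_ball_norm_rpow {s : ℝ} (hs : -2 < s) (R : ℝ) :
    IntegrableOn (fun t : E2 => ‖t‖ ^ s) (Metric.ball 0 R) := by
  have h1 : Integrable (fun t : E2 => (Set.Iio R).indicator (fun r : ℝ => r ^ s) ‖t‖) := by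
    rw [integrable_fun_norm_addHaar (volume : Measure E2)
      (f := (Set.Iio R).indicator fun r : ℝ => r ^ s)]
    simp only [finrank_euclideanSpace, Fintype.card_fin, Nat.add_one_sub_one, pow_one, smul_eq_mul]
    have h2 : IntegrableOn (fun r : ℝ => r ^ (s + 1)) (Set.Ioo 0 R) := by
      rcases le_or_gt R 0 with hR | hR
      · rw [Set.Ioo_eq_empty (not_lt.2 hR)]; simp
      · have := intervalIntegral.intervalIntegrable_rpow' (a := 0) (b := R)
          (show -1 < s + 1 by linarith)
        rw [intervalIntegrable_iff_integrableOn_Ioo_of_le hR.le] at this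
        exact this
    have h3 : IntegrableOn (fun y : ℝ => y * (Set.Iio R).indicator (fun r : ℝ => r ^ s) y)
        (Set.Ioi 0) := by
      have h4 := (integrable_indicator_iff measurableSet_Ioo).2 h2
      refine h4.integrableOn.congr ?_
      filter_upwards [ae_restrict_mem measurableSet_Ioi] with r hr
      have hr' : 0 < r := hr
      by_cases hrR : r < R
      · rw [Set.indicator_of_mem (show r ∈ Set.Ioo 0 R from ⟨hr', hrR⟩),
          Set.indicator_of_mem (show r ∈ Set.Iio R from hrR), Real.rpow_add_one hr'.ne', mul_comm]
      · rw [Set.indicator_of_notMem (fun h : r ∈ Set.Ioo 0 R => hrR h.2),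
          Set.indicator_of_notMem (show r ∉ Set.Iio R from hrR), mul_zero]
    exact h3
  have h4 : (Metric.ball (0 : E2) R).indicator (fun t : E2 => ‖t‖ ^ s) =
      fun t : E2 => (Set.Iio R).indicator (fun r : ℝ => r ^ s) ‖t‖ := by
    ext t
    by_cases ht : ‖t‖ < R
    · rw [Set.indicator_of_mem (by simpa using ht), Set.indicator_of_mem (by simpa using ht)]
    · rw [Set.indicator_of_notMem (by simpa using ht), Set.indicator_of_notMem (by simpa using ht)]
  rw [← integrable_indicator_iff Metric.isOpen_ball.measurableSet, h4]
  exact h1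

theorem integrableOn_ball_norm_inv (R : ℝ) :
    IntegrableOn (fun t : E2 => ‖t‖⁻¹) (Metric.ball 0 R) := by
  have := integrableOn_ball_norm_rpow (s := -1) (by norm_num) R
  simpa [Real.rpow_neg_one] using this

end PMLJump

namespace PMLJump
open MeasureTheory

/-! ### The potentials in the layers -/

theorem PML.isOpen_box (p : PML) : IsOpen p.box := by
  have : p.box = ⋂ l, {x : E3 | |x l| < p.a l + p.T l} := by ext; simp [PML.box]
  rw [this]
  exact isOpen_iInter_of_finite fun l => isOpen_lt (by fun_prop) continuous_const

/-- The closed truncation box. -/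
def PML.cbox (p : PML) : Set E3 := {x | ∀ l, |x l| ≤ p.a l + p.T l}

theorem PML.box_subset_cbox (p : PML) : p.box ⊆ p.cbox := fun _ hx l => (hx l).le

theorem PML.isCompact_cbox (p : PML) : IsCompact p.cbox := by
  refine Metric.isCompact_of_isClosed_isBounded ?_ ?_
  · have : p.cbox = ⋂ l, {x : E3 | |x l| ≤ p.a l + p.T l} := by ext; simp [PML.cbox]
    rw [this]
    exact isClosed_iInter fun l => isClosed_le (by fun_prop) continuous_const
  · refine isBounded_iff_forall_norm_le.2 ⟨√(∑ l, (p.a l + p.T l) ^ 2), fun x hx => ?_⟩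
    rw [EuclideanSpace.norm_eq]
    refine Real.sqrt_le_sqrt (Finset.sum_le_sum fun l _ => ?_)
    have := hx l
    rw [Real.norm_eq_abs]
    gcongr

variable (p : PML) (M : LayeredMedium p.a)

theorem measurableSet_Γb : MeasurableSet (Γb p M) :=
  M.isClosed_Γ.measurableSet.inter p.isOpen_box.measurableSet

/-- The surface measure on the truncated interface. -/
noncomputable def sμ : Measure E3 := (μHE[2] : Measure E3).restrict (Γb p M)

instance : IsFiniteMeasure (sμ p M) := ⟨by
  rw [sμ, Measure.restrict_apply_univ]
  exact (measure_mono (Set.inter_subset_inter_right _ p.box_subset_cbox)).trans_lt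
    (M.measure_inter_lt_top p.isCompact_cbox)⟩

theorem Γb_subset_frontier : Γb p M ⊆ frontier (Ω₁b p M) := by
  rintro x ⟨hx, hb⟩
  rw [frontier, Set.mem_sdiff]
  constructor
  · refine mem_closure_of_tendsto (b := 𝓝[>] (0 : ℝ)) (f := fun h => x - h • M.ν x) ?_ ?_
    · have e : Continuous fun h : ℝ => x - h • M.ν x := by fun_prop
      have := e.tendsto 0
      simp only [zero_smul, sub_zero] at this
      exact this.mono_left nhdsWithin_le_nhds
    · have e : Continuous fun h : ℝ => x - h • M.ν x := by fun_prop
      have h0 := e.tendsto 0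
      simp only [zero_smul, sub_zero] at h0
      filter_upwards [M.eventually_side hx,
        (h0.mono_left nhdsWithin_le_nhds) (p.isOpen_box.mem_nhds hb)] with h h1 h2
      exact ⟨h1.1, h2⟩
  · intro h
    exact hx (Or.inl (interior_subset h).1)

/-- A compact part of the interface that contains the truncated one. -/
def Γc : Set E3 := M.Γ ∩ p.cbox

theorem isCompact_Γc : IsCompact (Γc p M) := p.isCompact_cbox.inter_left M.isClosed_Γ

theorem Γb_subset_Γc : Γb p M ⊆ Γc p M := Set.inter_subset_inter_right _ p.box_subset_cbox

theorem Ω₁b_subset : Ω₁b p M ⊆ (Γc p M)ᶜ := fun _ hx h => h.1 (Or.inl hx.1)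

theorem Ω₂b_subset : Ω₂b p M ⊆ (Γc p M)ᶜ := fun _ hx h => h.1 (Or.inr hx.1)

/-- The stretched density `𝔹 φ`. -/
noncomputable def dens (φ : E3 → C3) (y : E3) : C3 := p.β y * φ y

theorem continuous_β : Continuous p.β := by
  refine continuous_pi fun l => ?_
  exact (p.continuous_α l).comp (by fun_prop)

variable {p M} {φ : E3 → C3}

theorem IsDensity.exists_bound (hφ : IsDensity p M φ) :
    ∃ R, 0 ≤ R ∧ ∀ y ∈ Γb p M, ‖φ y‖ ≤ R := by
  have hb : Bornology.IsBounded (Ω₁b p M) := p.isCompact_cbox.isBounded.subset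
    fun x hx => p.box_subset_cbox hx.2
  have hc : IsCompact (frontier (Ω₁b p M)) :=
    hb.isCompact_closure.of_isClosed_subset isClosed_frontier frontier_subset_closure
  obtain ⟨R, hR⟩ := hc.exists_bound_of_continuousOn hφ.continuousOn
  exact ⟨max R 0, le_max_right _ _,
    fun y hy => (hR y (Γb_subset_frontier p M hy)).trans (le_max_left _ _)⟩

theorem IsDensity.aestronglyMeasurable (hφ : IsDensity p M φ) :
    AEStronglyMeasurable φ (sμ p M) :=
  hφ.contDiffOn.continuousOn.aestronglyMeasurable (measurableSet_Γb p M)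

theorem IsDensity.aestronglyMeasurable_dens (hφ : IsDensity p M φ) :
    AEStronglyMeasurable (dens p φ) (sμ p M) :=
  ((continuous_β p).continuousOn.mul hφ.contDiffOn.continuousOn).aestronglyMeasurable
    (measurableSet_Γb p M)

theorem IsDensity.exists_bound_dens (hφ : IsDensity p M φ) :
    ∃ R, 0 ≤ R ∧ ∀ y ∈ Γb p M, ‖dens p φ y‖ ≤ R := by
  obtain ⟨R, hR0, hR⟩ := hφ.exists_bound
  have hS := p.S_pos
  refine ⟨(1 + p.S) * R, by positivity, fun y hy => (norm_mul_le _ _).trans ?_⟩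
  exact mul_le_mul (p.norm_β_le y) (hR y hy) (norm_nonneg _) (by positivity)

theorem ae_sμ : ∀ᵐ y ∂(sμ p M), y ∈ Γb p M := ae_restrict_mem (measurableSet_Γb p M)

theorem vpot_eq (k : ℂ) :
    vpot p M k φ = fun x => ∫ y, Ku k (p.X x - p.X y, dens p φ y) ∂(sμ p M) := by
  ext1 x
  simp only [vpot, p.Phi_smul, p.B_mulVec, dens, sμ]

section

variable (k : ℂ) {x : E3}

theorem IsDensity.exists_ae_bound (hφ : IsDensity p M φ) :
    ∃ R, ∀ᵐ y ∂(sμ p M), y ∈ Γc p M ∧ ‖dens p φ y‖ ≤ R := by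
  obtain ⟨R, -, hR⟩ := hφ.exists_bound_dens
  exact ⟨R, ae_sμ.mono fun y hy => ⟨Γb_subset_Γc p M hy, hR y hy⟩⟩

theorem IsDensity.scurl_vpot (hφ : IsDensity p M φ) (hx : x ∉ Γc p M) :
    scurl p (vpot p M k φ) x = ∫ y, Kd k (p.X x - p.X y, dens p φ y) ∂(sμ p M) := by
  obtain ⟨R, hR⟩ := hφ.exists_ae_bound
  rw [vpot_eq, scurl_potential p (contDiffOn_Ku p.S k) hφ.aestronglyMeasurable_dens
    (isCompact_Γc p M) hR hx]
  refine integral_congr_ae (hR.mono fun y hy => ?_)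
  exact curlC_jac_Ku k (p.X_sub_mem_dom (ne_of_mem_of_not_mem hy.1 hx).symm) _

theorem IsDensity.Dpot_eq (hφ : IsDensity p M φ) (hx : x ∉ Γc p M) :
    Dpot p M k φ x = p.B x *ᵥ ∫ y, Kd k (p.X x - p.X y, dens p φ y) ∂(sμ p M) := by
  rw [Dpot, hφ.scurl_vpot k hx]

theorem IsDensity.Spot_eq (hφ : IsDensity p M φ) (hx : x ∉ Γc p M) :
    Spot p M k φ x = p.B x *ᵥ ∫ y, Ks k (p.X x - p.X y, dens p φ y) ∂(sμ p M) := by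
  obtain ⟨R, hR⟩ := hφ.exists_ae_bound
  rw [Spot, p.scurl_congr (v := fun x => ∫ y, Kd k (p.X x - p.X y, dens p φ y) ∂(sμ p M)) (by
    filter_upwards [(isCompact_Γc p M).isClosed.isOpen_compl.mem_nhds hx] with z hz
    exact hφ.scurl_vpot k hz), scurl_potential p (contDiffOn_Kd p.S k)
    hφ.aestronglyMeasurable_dens (isCompact_Γc p M) hR hx]
  congr 1
  refine integral_congr_ae (hR.mono fun y hy => ?_)
  exact curlC_jac_Kd k (p.X_sub_mem_dom (ne_of_mem_of_not_mem hy.1 hx).symm) _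

theorem IsDensity.contDiffOn_vpot (hφ : IsDensity p M φ) :
    ContDiffOn ℝ 1 (vpot p M k φ) (Γc p M)ᶜ := by
  obtain ⟨R, hR⟩ := hφ.exists_ae_bound
  rw [vpot_eq]
  exact contDiffOn_potential p (contDiffOn_Ku p.S k) hφ.aestronglyMeasurable_dens
    (isCompact_Γc p M) hR

theorem contDiffOn_β : ContDiffOn ℝ 1 p.β p.box := by
  refine contDiffOn_pi.2 fun l => ?_
  refine (p.contDiffOn_α l).comp (f := fun x : E3 => x l)
    (by fun_prop : ContDiff ℝ 1 fun x : E3 => x l).contDiffOn fun x hx => ?_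
  exact abs_lt.1 (hx l)

theorem contDiffOn_B_mulVec {V : E3 → C3} {Ω : Set E3} (hΩ : Ω ⊆ p.box)
    (hV : ContDiffOn ℝ 1 V Ω) : ContDiffOn ℝ 1 (fun x => p.B x *ᵥ V x) Ω := by
  simp only [p.B_mulVec]
  have h1 := contDiffOn_pi.1 (contDiffOn_β.mono hΩ)
  have h2 := contDiffOn_pi.1 hV
  exact contDiffOn_pi.2 fun l => (h1 l).mul (h2 l)

theorem IsDensity.contDiffOn_Dpot (hφ : IsDensity p M φ) {Ω : Set E3} (hΩ : Ω ⊆ p.box)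
    (hΩ' : Ω ⊆ (Γc p M)ᶜ) :
    ContDiffOn ℝ 1 (Dpot p M k φ) Ω := by
  obtain ⟨R, hR⟩ := hφ.exists_ae_bound
  refine (contDiffOn_B_mulVec hΩ ((contDiffOn_potential p (contDiffOn_Kd p.S k)
    hφ.aestronglyMeasurable_dens (isCompact_Γc p M) hR).mono hΩ')).congr fun x hx => ?_
  exact hφ.Dpot_eq k (hΩ' hx)

theorem IsDensity.contDiffOn_Spot (hφ : IsDensity p M φ) {Ω : Set E3} (hΩ : Ω ⊆ p.box)
    (hΩ' : Ω ⊆ (Γc p M)ᶜ) :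
    ContDiffOn ℝ 1 (Spot p M k φ) Ω := by
  obtain ⟨R, hR⟩ := hφ.exists_ae_bound
  refine (contDiffOn_B_mulVec hΩ ((contDiffOn_potential p (contDiffOn_Ks p.S k)
    hφ.aestronglyMeasurable_dens (isCompact_Γc p M) hR).mono hΩ')).congr fun x hx => ?_
  exact hφ.Spot_eq k (hΩ' hx)

theorem curl_congr {u v : E3 → C3} (h : u =ᶠ[𝓝 x] v) : curl u x = curl v x := by
  have : ∀ i l, pd i (fun y => u y l) x = pd i (fun y => v y l) x :=
    fun i l => Filter.EventuallyEq.lineDeriv_eq (by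
      filter_upwards [h] with y hy; rw [hy])
  unfold curl
  simp only [this]

theorem A_inv_mulVec (x : E3) (v : C3) :
    (p.A x)⁻¹ *ᵥ v = p.J x • ((p.β x)⁻¹ * ((p.β x)⁻¹ * v)) := by
  have hβ := p.β_ne_zero x
  have hJ := p.J_ne_zero x
  have hAB : (p.A x)⁻¹ = p.J x • Matrix.diagonal fun l => (p.β x l)⁻¹ * (p.β x l)⁻¹ := by
    refine Matrix.inv_eq_right_inv ?_
    ext i j
    rcases eq_or_ne i j with rfl | h
    · have : p.α i (x i) ≠ 0 := hβ i
      simp [PML.A, PML.B, Matrix.diagonal_pow, PML.β]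
      field_simp
    · simp [PML.A, PML.B, Matrix.diagonal_pow, h]
  rw [hAB, Matrix.smul_mulVec]
  ext i
  simp [Matrix.mulVec_diagonal, mul_assoc]

theorem inv_β_mul_B_mulVec (x : E3) (v : C3) : (p.β x)⁻¹ * (p.B x *ᵥ v) = v := by
  ext i
  have := p.β_ne_zero x i
  simp [p.B_mulVec, this]

theorem IsDensity.curl_Dpot (hφ : IsDensity p M φ) (hx : x ∉ Γc p M) :
    curl (Dpot p M k φ) x = (p.A x)⁻¹ *ᵥ Spot p M k φ x := by
  obtain ⟨R, hR⟩ := hφ.exists_ae_bound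
  rw [curl_congr (v := fun x => p.B x *ᵥ ∫ y, Kd k (p.X x - p.X y, dens p φ y) ∂(sμ p M)) (by
    filter_upwards [(isCompact_Γc p M).isClosed.isOpen_compl.mem_nhds hx] with z hz
    exact hφ.Dpot_eq k hz), curl_B_potential p (contDiffOn_Kd p.S k)
    hφ.aestronglyMeasurable_dens (isCompact_Γc p M) hR hx, A_inv_mulVec, hφ.Spot_eq k hx,
    inv_β_mul_B_mulVec]
  congr 2
  refine integral_congr_ae (hR.mono fun y hy => ?_)
  exact curlC_jac_Kd k (p.X_sub_mem_dom (ne_of_mem_of_not_mem hy.1 hx).symm) _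

theorem IsDensity.curl_Spot (hφ : IsDensity p M φ) (hx : x ∉ Γc p M) :
    curl (Spot p M k φ) x = k ^ 2 • ((p.A x)⁻¹ *ᵥ Dpot p M k φ x) := by
  obtain ⟨R, hR⟩ := hφ.exists_ae_bound
  rw [curl_congr (v := fun x => p.B x *ᵥ ∫ y, Ks k (p.X x - p.X y, dens p φ y) ∂(sμ p M)) (by
    filter_upwards [(isCompact_Γc p M).isClosed.isOpen_compl.mem_nhds hx] with z hz
    exact hφ.Spot_eq k hz), curl_B_potential p (contDiffOn_Ks p.S k)
    hφ.aestronglyMeasurable_dens (isCompact_Γc p M) hR hx, A_inv_mulVec, hφ.Dpot_eq k hx,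
    inv_β_mul_B_mulVec, smul_comm]
  congr 1
  rw [← mul_smul_comm, ← integral_smul]
  congr 1
  refine integral_congr_ae (hR.mono fun y hy => ?_)
  exact curlC_jac_Ks k (p.X_sub_mem_dom (ne_of_mem_of_not_mem hy.1 hx).symm) _

end

end PMLJump

namespace PMLJump
open MeasureTheory

/-! ### Truncated integration by parts in the plane -/

section

variable {F : Type*} [NormedAddCommGroup F] [NormedSpace ℝ F]

theorem integrable_smul_of_tsupport {O : Set E2} {u : E2 → ℝ} {W : E2 → F}
    (hu : Continuous u) (hc : HasCompactSupport u) (hO : tsupport u ⊆ O)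
    (hW : ContinuousOn W O) : Integrable fun t => u t • W t := by
  have h1 : IntegrableOn (fun t => u t • W t) (tsupport u) :=
    (hu.continuousOn.smul (hW.mono hO)).integrableOn_compact hc.isCompact
  refine (integrableOn_iff_integrable_of_support_subset fun t ht => ?_).1 h1
  refine subset_tsupport u fun h => ht ?_
  simp only
  rw [h, zero_smul]

theorem tsupport_fderiv_apply_subset' (u : E2 → ℝ) (e : E2) :
    tsupport (fun t => fderiv ℝ u t e) ⊆ tsupport u := by
  refine (closure_mono fun t ht => ?_).trans (tsupport_fderiv_subset ℝ (f := u))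
  intro h
  simp [h] at ht

theorem continuous_fderiv_apply' {u : E2 → ℝ} (hu : ContDiff ℝ 1 u) (e : E2) :
    Continuous fun t => fderiv ℝ u t e :=
  (hu.continuous_fderiv (by simp)).clm_apply continuous_const

theorem integrable_fderiv_smul {O : Set E2} {u : E2 → ℝ} {W : E2 → F}
    (hu : ContDiff ℝ 1 u) (hc : HasCompactSupport u) (hO : tsupport u ⊆ O)
    (hW : ContinuousOn W O) (e : E2) : Integrable fun t => fderiv ℝ u t e • W t :=
  integrable_smul_of_tsupport (continuous_fderiv_apply' hu e)
    (hc.mono' ((subset_tsupport _).trans (tsupport_fderiv_apply_subset' u e)))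
    ((tsupport_fderiv_apply_subset' u e).trans hO) hW

theorem integral_smul_lineDeriv {O : Set E2} {u : E2 → ℝ} {W W' : E2 → F} {e : E2}
    (hu : ContDiff ℝ 1 u) (hc : HasCompactSupport u) (hO : tsupport u ⊆ O)
    (hW : ContinuousOn W O) (hW' : ContinuousOn W' O)
    (hd : ∀ t ∈ O, HasLineDerivAt ℝ W (W' t) t e) :
    ∫ t, u t • W' t = -∫ t, fderiv ℝ u t e • W t := by
  refine integral_bilinear_hasLineDerivAt_right_eq_neg_left_of_integrable
    (B := ContinuousLinearMap.lsmul ℝ ℝ) (v := e) (f := u) (f' := fun t => fderiv ℝ u t e)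
    (integrable_fderiv_smul hu hc hO hW e)
    (integrable_smul_of_tsupport hu.continuous hc hO hW')
    (integrable_smul_of_tsupport hu.continuous hc hO hW) (fun t _ => ?_) fun t ht => hd t (hO ht)
  exact ((hu.differentiable (by simp)).differentiableAt.hasFDerivAt).hasLineDerivAt e

end

/-- The closed annulus on which the truncation at scale one takes place. -/
def ann : Set E2 := {s | 1 / 2 ≤ ‖s‖ ∧ ‖s‖ ≤ 1}

theorem isCompact_ann : IsCompact ann := by
  refine Metric.isCompact_of_isClosed_isBounded ?_ ?_
  · exact (isClosed_le continuous_const continuous_norm).inter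
      (isClosed_le continuous_norm continuous_const)
  · exact isBounded_iff_forall_norm_le.2 ⟨1, fun x hx => hx.2⟩

theorem ne_zero_of_mem_ann {s : E2} (hs : s ∈ ann) : s ≠ 0 := by
  rintro rfl
  have := hs.1
  norm_num at this

theorem neg_mem_ann {s : E2} (hs : s ∈ ann) : -s ∈ ann := by
  simpa [ann] using hs

/-- The profile of the truncation near the singularity. -/
noncomputable def θ : ContDiffBump (0 : E2) := ⟨1 / 2, 1, by norm_num, by norm_num⟩

theorem fderiv_θ_eq_zero {s : E2} (hs : s ∉ ann) : fderiv ℝ θ s = 0 := by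
  have h : ‖s‖ < 1 / 2 ∨ 1 < ‖s‖ := by
    by_contra hcon
    push Not at hcon
    exact hs hcon
  rcases h with h | h
  · rw [(θ.eventuallyEq_one_of_mem_ball (by simpa [θ] using h)).fderiv_eq]
    simp
  · have : θ =ᶠ[𝓝 s] fun _ => 0 := by
      filter_upwards [(isOpen_lt continuous_const continuous_norm).mem_nhds h] with t ht
      exact θ.zero_of_le_dist (by simpa [θ] using (le_of_lt ht))
    rw [this.fderiv_eq]
    simp

theorem fderiv_bump_neg (χ : ContDiffBump (0 : E2)) (s : E2) :
    fderiv ℝ χ (-s) = -fderiv ℝ χ s := by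
  have h1 := ((χ.contDiff (n := 1)).differentiable (by simp)).differentiableAt
    (x := s) |>.hasFDerivAt
  have h2 : HasFDerivAt (fun t : E2 => -t) (-ContinuousLinearMap.id ℝ E2) (-s) :=
    (hasFDerivAt_id (𝕜 := ℝ) (-s)).neg
  rw [← neg_neg s] at h1
  have h3 := HasFDerivAt.comp (g := (χ : E2 → ℝ)) (-s) h1 h2
  have h4 : (χ : E2 → ℝ) ∘ (fun t : E2 => -t) = χ := funext fun t => χ.neg t
  rw [h4, neg_neg] at h3
  rw [h3.fderiv]
  ext v; simp

variable {R : ℝ} {W W' : E2 → ℂ} {e : E2}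

theorem continuousOn_comp_smul {ε : ℝ} (hε : 0 < ε) (hεR : ε < R)
    (hW : ContinuousOn W (Metric.ball 0 R \ {0})) :
    ContinuousOn (fun s => W (ε • s)) ann := by
  refine hW.comp (continuous_const_smul ε).continuousOn fun s hs => ⟨?_, ?_⟩
  · simp only [mem_ball_zero_iff, norm_smul, Real.norm_eq_abs, abs_of_pos hε]
    have := hs.2
    nlinarith
  · simp [hε.ne', ne_zero_of_mem_ann hs]

theorem continuousOn_comp_neg_smul {ε : ℝ} (hε : 0 < ε) (hεR : ε < R)
    (hW : ContinuousOn W (Metric.ball 0 R \ {0})) :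
    ContinuousOn (fun s => W (-(ε • s))) ann := by
  have := (continuousOn_comp_smul hε hεR hW).comp continuous_neg.continuousOn
    fun s hs => neg_mem_ann hs
  refine this.congr fun s _ => ?_
  simp

theorem integral_odd_smul {g : E2 → ℝ} (hg : Continuous g) (hodd : ∀ s, g (-s) = -g s)
    (h0 : ∀ s ∉ ann, g s = 0) {ε : ℝ} (hε : 0 < ε) (hεR : ε < R)
    (hW : ContinuousOn W (Metric.ball 0 R \ {0})) :
    ∫ s, g s • W (ε • s) = (1 / 2 : ℝ) • ∫ s in ann, g s • (W (ε • s) - W (-(ε • s))) := by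
  have hA := isCompact_ann.measurableSet
  have i1 : IntegrableOn (fun s => g s • W (ε • s)) ann :=
    (hg.continuousOn.smul (continuousOn_comp_smul hε hεR hW)).integrableOn_compact isCompact_ann
  have i2 : IntegrableOn (fun s => g s • W (-(ε • s))) ann :=
    (hg.continuousOn.smul (continuousOn_comp_neg_smul hε hεR hW)).integrableOn_compact
      isCompact_ann
  have e1 : ∫ s, g s • W (ε • s) = ∫ s in ann, g s • W (ε • s) :=
    (setIntegral_eq_integral_of_forall_compl_eq_zero fun s hs => by simp [h0 s hs]).symm
  have e2 : ∫ s in ann, g s • W (-(ε • s)) = ∫ s, g s • W (-(ε • s)) :=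
    setIntegral_eq_integral_of_forall_compl_eq_zero fun s hs => by simp [h0 s hs]
  have e3 : ∫ s, g s • W (-(ε • s)) = -∫ s, g s • W (ε • s) := by
    rw [← integral_neg_eq_self, ← integral_neg]
    simp [hodd]
  simp only [smul_sub]
  rw [integral_sub i1 i2, e2, e3, ← e1]
  module

theorem integral_even_smul {g : E2 → ℝ} (hg : Continuous g) (heven : ∀ s, g (-s) = g s)
    (h0 : ∀ s ∈ Metric.ball (0 : E2) 1, s ∉ ann → g s = 0) {ε : ℝ} (hε : 0 < ε) (hεR : ε < R)
    (hW : ContinuousOn W (Metric.ball 0 R \ {0})) :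
    ∫ s in Metric.ball 0 1, g s • W (ε • s) =
      (1 / 2 : ℝ) • ∫ s in ann ∩ Metric.ball 0 1, g s • (W (ε • s) + W (-(ε • s))) := by
  have hB : MeasurableSet (Metric.ball (0 : E2) 1) := Metric.isOpen_ball.measurableSet
  have i1 : IntegrableOn (fun s => g s • W (ε • s)) (ann ∩ Metric.ball 0 1) :=
    ((hg.continuousOn.smul (continuousOn_comp_smul hε hεR hW)).integrableOn_compact
      isCompact_ann).mono_set Set.inter_subset_left
  have i2 : IntegrableOn (fun s => g s • W (-(ε • s))) (ann ∩ Metric.ball 0 1) :=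
    ((hg.continuousOn.smul (continuousOn_comp_neg_smul hε hεR hW)).integrableOn_compact
      isCompact_ann).mono_set Set.inter_subset_left
  have e0 : ∀ V : E2 → ℂ, ∫ s in ann ∩ Metric.ball 0 1, g s • V s =
      ∫ s in Metric.ball 0 1, g s • V s := fun V =>
    (setIntegral_eq_of_subset_of_forall_sdiff_eq_zero hB Set.inter_subset_right fun s hs => by
      rw [h0 s hs.1 fun h => hs.2 ⟨h, hs.1⟩, zero_smul]).symm
  have e3 : ∫ s in Metric.ball 0 1, g s • W (-(ε • s)) =
      ∫ s in Metric.ball 0 1, g s • W (ε • s) := by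
    rw [← integral_indicator hB, ← integral_indicator hB, ← integral_neg_eq_self]
    congr 1
    ext s
    by_cases hs : s ∈ Metric.ball (0 : E2) 1
    · rw [Set.indicator_of_mem hs, Set.indicator_of_mem (by simpa using hs)]
      simp [heven]
    · rw [Set.indicator_of_notMem hs, Set.indicator_of_notMem (by simpa using hs)]
  simp only [smul_add]
  rw [integral_add i1 i2, e0 fun s => W (ε • s), e0 fun s => W (-(ε • s)), e3]
  module

/-- Integration by parts outside a small disc, the boundary term being expressed through integrals
over a fixed annulus. -/
theorem integral_truncated {χ : ContDiffBump (0 : E2)} (hχ : χ.rOut < R)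
    (hW : ContinuousOn W (Metric.ball 0 R \ {0})) (hW' : ContinuousOn W' (Metric.ball 0 R \ {0}))
    (hd : ∀ t ∈ Metric.ball 0 R \ {0}, HasLineDerivAt ℝ W (W' t) t e) {ε : ℝ} (hε : 0 < ε)
    (hεχ : ε ≤ χ.rIn) :
    ∫ t in Metric.ball 0 R \ Metric.ball 0 ε, χ t • W' t =
      -(∫ t, fderiv ℝ χ t e • W t) + ε • (∫ s, fderiv ℝ θ s e • W (ε • s)) -
        ε ^ 2 • ∫ s in Metric.ball 0 1, (1 - θ s) • W' (ε • s) := by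
  have hrr := χ.rIn_lt_rOut
  set θε : E2 → ℝ := fun t => θ (ε⁻¹ • t) with hθε
  have hθs : ContDiff ℝ 1 θε := θ.contDiff.comp (contDiff_const_smul _)
  have hθ0 : ∀ t : E2, ε ≤ ‖t‖ → θε t = 0 := fun t ht => θ.zero_of_le_dist (by
    rw [dist_zero_right, norm_smul, norm_inv, Real.norm_eq_abs, abs_of_pos hε]
    change 1 ≤ _
    rwa [← div_eq_inv_mul, one_le_div hε])
  have hθ1 : ∀ t : E2, ‖t‖ < ε / 2 → θε t = 1 := fun t ht => θ.one_of_mem_closedBall (by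
    rw [mem_closedBall_zero_iff, norm_smul, norm_inv, Real.norm_eq_abs, abs_of_pos hε]
    change _ ≤ 1 / 2
    rw [← div_eq_inv_mul, div_le_iff₀ hε]; linarith)
  have hχ1 : ∀ t : E2, ‖t‖ ≤ χ.rIn → χ t = 1 := fun t ht => χ.one_of_mem_closedBall (by simpa)
  have hχ0 : ∀ t : E2, χ.rOut ≤ ‖t‖ → χ t = 0 := fun t ht => χ.zero_of_le_dist (by simpa)
  -- integration by parts takes place with the smooth cut-off `u`, whose difference from the sharp
  -- one lives on the disc of radius `ε`
  set u : E2 → ℝ := fun t => χ t - θε t with hu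
  have hus : ContDiff ℝ 1 u := χ.contDiff.sub hθs
  have hsupp : Function.support u ⊆ {t | ε / 2 ≤ ‖t‖ ∧ ‖t‖ ≤ χ.rOut} := by
    intro t ht
    refine ⟨?_, ?_⟩
    · by_contra hcon
      push Not at hcon
      exact ht (by simp only [hu]; rw [hχ1 t (by linarith), hθ1 t hcon, sub_self])
    · by_contra hcon
      push Not at hcon
      exact ht (by simp only [hu]; rw [hχ0 t hcon.le, hθ0 t (by linarith), sub_self])
  have hcl : IsClosed {t : E2 | ε / 2 ≤ ‖t‖ ∧ ‖t‖ ≤ χ.rOut} :=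
    (isClosed_le continuous_const continuous_norm).inter
      (isClosed_le continuous_norm continuous_const)
  have hts : tsupport u ⊆ {t | ε / 2 ≤ ‖t‖ ∧ ‖t‖ ≤ χ.rOut} := closure_minimal hsupp hcl
  have hsub : {t : E2 | ε / 2 ≤ ‖t‖ ∧ ‖t‖ ≤ χ.rOut} ⊆ Metric.ball 0 R \ {0} := by
    rintro t ⟨h1, h2⟩
    refine ⟨by simpa using h2.trans_lt hχ, ?_⟩
    rintro rfl
    rw [norm_zero] at h1; linarith
  have huc : HasCompactSupport u :=
    HasCompactSupport.intro (isCompact_closedBall (0 : E2) χ.rOut) fun t ht => by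
      by_contra h
      exact ht (by simpa using (hsupp h).2)
  have hutO := hts.trans hsub
  have hibp := integral_smul_lineDeriv hus huc hutO hW hW' hd
  have hint := integrable_smul_of_tsupport hus.continuous huc hutO hW'
  -- the derivative of the cut-off
  have hfd : ∀ t, fderiv ℝ u t e = fderiv ℝ χ t e - ε⁻¹ • fderiv ℝ θ (ε⁻¹ • t) e := by
    intro t
    have h1 : HasFDerivAt θε (ε⁻¹ • fderiv ℝ θ (ε⁻¹ • t)) t := by
      have h2 := ((θ.contDiff (n := 1)).differentiable (by simp)).differentiableAt
        (x := ε⁻¹ • t) |>.hasFDerivAt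
      have h3 := h2.comp t ((hasFDerivAt_id (𝕜 := ℝ) t).const_smul ε⁻¹)
      refine h3.congr_fderiv ?_
      ext v; simp
    have h4 := ((χ.contDiff (n := 1)).differentiable (by simp)).differentiableAt
        (x := t) |>.hasFDerivAt
    have h5 : HasFDerivAt u _ t := h4.sub h1
    rw [h5.fderiv]
    rfl
  have iχ : Integrable fun t => fderiv ℝ χ t e • W t := by
    have hz : ∀ t : E2, ‖t‖ < χ.rIn → fderiv ℝ χ t = 0 := fun t ht => by
      rw [(χ.eventuallyEq_one_of_mem_ball (by simpa using ht)).fderiv_eq]; simp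
    refine integrable_smul_of_tsupport (O := Metric.ball 0 R \ {0})
      (continuous_fderiv_apply' χ.contDiff e)
      (χ.hasCompactSupport.mono' ((subset_tsupport _).trans (tsupport_fderiv_apply_subset' χ e)))
      (fun t ht => ⟨?_, ?_⟩) hW
    · have := tsupport_fderiv_apply_subset' χ e ht
      rw [χ.tsupport_eq, mem_closedBall_zero_iff] at this
      simpa using this.trans_lt hχ
    · rintro rfl
      refine absurd ht (notMem_tsupport_iff_eventuallyEq.2 ?_)
      filter_upwards [Metric.ball_mem_nhds (0 : E2) χ.rIn_pos] with t ht
      rw [hz t (by simpa using ht)]; simp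
  have iθ : Integrable fun t => fderiv ℝ u t e • W t := integrable_fderiv_smul hus huc hutO hW e
  have hsplit : ∫ t, fderiv ℝ u t e • W t = (∫ t, fderiv ℝ χ t e • W t) -
      ∫ t, (ε⁻¹ • fderiv ℝ θ (ε⁻¹ • t) e) • W t := by
    rw [← integral_sub iχ]
    · congr 1; ext1 t; rw [hfd, sub_smul]
    · refine (iχ.sub iθ).congr (Filter.Eventually.of_forall fun t => ?_)
      simp only [Pi.sub_apply]
      rw [hfd, sub_smul, sub_sub_cancel]
  have hfin : Module.finrank ℝ E2 = 2 := by simp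
  have hscale1 : ∫ t, (ε⁻¹ • fderiv ℝ θ (ε⁻¹ • t) e) • W t =
      ε • ∫ s, fderiv ℝ θ s e • W (ε • s) := by
    have := Measure.integral_comp_smul (volume : Measure E2)
      (fun t => (ε⁻¹ • fderiv ℝ θ (ε⁻¹ • t) e) • W t) ε
    rw [hfin] at this
    rw [abs_of_pos (by positivity)] at this
    have h2 : ∫ t, (ε⁻¹ • fderiv ℝ θ (ε⁻¹ • t) e) • W t =
        ε ^ 2 • ∫ s, (ε⁻¹ • fderiv ℝ θ (ε⁻¹ • (ε • s)) e) • W (ε • s) := by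
      rw [this, smul_smul, mul_inv_cancel₀ (by positivity), one_smul]
    rw [h2]
    simp only [inv_smul_smul₀ hε.ne', smul_assoc]
    rw [integral_smul, smul_smul]
    congr 1; field_simp
  have hscale2 : ∫ t in Metric.ball 0 ε, (1 - θε t) • W' t =
      ε ^ 2 • ∫ s in Metric.ball 0 1, (1 - θ s) • W' (ε • s) := by
    have := Measure.setIntegral_comp_smul_of_pos (volume : Measure E2)
      (fun t => (1 - θε t) • W' t) (Metric.ball 0 1) hε
    rw [hfin, smul_unitBall_of_pos hε] at this
    have h2 : ∫ t in Metric.ball 0 ε, (1 - θε t) • W' t =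
        ε ^ 2 • ∫ s in Metric.ball 0 1, (1 - θε (ε • s)) • W' (ε • s) := by
      rw [this, smul_smul, mul_inv_cancel₀ (by positivity), one_smul]
    rw [h2]
    simp only [hθε, inv_smul_smul₀ hε.ne']
  have hB : MeasurableSet (Metric.ball (0 : E2) R) := Metric.isOpen_ball.measurableSet
  have hBε : MeasurableSet (Metric.ball (0 : E2) ε) := Metric.isOpen_ball.measurableSet
  have hballs : Metric.ball (0 : E2) ε ⊆ Metric.ball 0 R := Metric.ball_subset_ball (by linarith)
  have e1 : ∫ t, u t • W' t = ∫ t in Metric.ball 0 R, u t • W' t :=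
    (setIntegral_eq_integral_of_forall_compl_eq_zero fun t ht => by
      have : u t = 0 := by
        by_contra h
        exact ht (hsub (hsupp h)).1
      rw [this, zero_smul]).symm
  have e2 := setIntegral_sdiff hBε hint.integrableOn hballs
  have e3 : ∫ t in Metric.ball 0 ε, u t • W' t = ∫ t in Metric.ball 0 ε, (1 - θε t) • W' t :=
    setIntegral_congr_fun hBε fun t ht => by
      simp only [hu]
      rw [hχ1 t ((by simpa using ht : ‖t‖ < ε).le.trans hεχ)]
  have e4 : ∫ t in Metric.ball 0 R \ Metric.ball 0 ε, u t • W' t =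
      ∫ t in Metric.ball 0 R \ Metric.ball 0 ε, χ t • W' t :=
    setIntegral_congr_fun (MeasurableSet.diff hB hBε) fun t ht => by
      simp only [hu]
      rw [hθ0 t (by simpa using ht.2), sub_zero]
  rw [← e4, e2, ← e1, e3, hibp, hsplit, hscale1, hscale2]
  abel

/-- If the odd part of `W` and the even part of its derivative are asymptotically homogeneous of
degrees `-2` and `-3`, up to errors of relative order `o(r)`, the truncated integrals diverge like
`c / ε`, and their finite part is given by formal integration by parts. -/
theorem exists_tendsto_truncated {χ : ContDiffBump (0 : E2)} (hχ : χ.rOut < R)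
    (hW : ContinuousOn W (Metric.ball 0 R \ {0})) (hW' : ContinuousOn W' (Metric.ball 0 R \ {0}))
    (hd : ∀ t ∈ Metric.ball 0 R \ {0}, HasLineDerivAt ℝ W (W' t) t e) {g g' : E2 → ℂ}
    (hg : ContinuousOn g ann) (hg' : ContinuousOn g' ann)
    (h : ∀ δ > 0, ∀ᶠ ε in 𝓝[>] (0 : ℝ), ∀ s ∈ ann,
      ‖ε ^ 2 • (W (ε • s) - W (-(ε • s))) - g s‖ ≤ δ * ε)
    (h' : ∀ δ > 0, ∀ᶠ ε in 𝓝[>] (0 : ℝ), ∀ s ∈ ann,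
      ‖ε ^ 3 • (W' (ε • s) + W' (-(ε • s))) - g' s‖ ≤ δ * ε) :
    Filter.Tendsto (fun ε : ℝ => (∫ t in Metric.ball 0 R \ Metric.ball 0 ε, χ t • W' t) -
      ε⁻¹ • ((1 / 2 : ℝ) • (∫ s in ann, fderiv ℝ θ s e • g s) -
        (1 / 2 : ℝ) • ∫ s in ann ∩ Metric.ball 0 1, (1 - θ s) • g' s))
      (𝓝[>] 0) (𝓝 (-∫ t, fderiv ℝ χ t e • W t)) := by
  have hA := isCompact_ann.measurableSet
  have hθc : Continuous fun s => fderiv ℝ θ s e := continuous_fderiv_apply' θ.contDiff e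
  obtain ⟨C, hC⟩ := isCompact_ann.exists_bound_of_continuousOn hθc.continuousOn
  have hfinA : volume ann < ⊤ := isCompact_ann.measure_lt_top
  set m := (volume : Measure E2).real ann with hm
  have hm0 : 0 ≤ m := measureReal_nonneg
  rw [Metric.tendsto_nhds]
  intro ρ hρ
  set δ := ρ / ((|C| + 1) * (m + 1)) with hδ
  have hδpos : 0 < δ := by positivity
  have hδle : δ * ((|C| + 1) * (m + 1)) = ρ := by rw [hδ]; field_simp
  have hrpos := χ.rIn_pos
  have hsmall : ∀ᶠ ε in 𝓝[>] (0 : ℝ), ε < χ.rIn :=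
    nhdsWithin_le_nhds (Iio_mem_nhds hrpos)
  filter_upwards [h δ hδpos, h' δ hδpos, hsmall, self_mem_nhdsWithin] with ε h1 h2 h3 hε
  have hε : 0 < ε := hε
  have hεR : ε < R := h3.trans (χ.rIn_lt_rOut.trans hχ)
  have hodd : ∀ s, fderiv ℝ θ (-s) e = -fderiv ℝ θ s e := fun s => by
    rw [fderiv_bump_neg]; rfl
  have hη0 : ∀ s ∈ Metric.ball (0 : E2) 1, s ∉ ann → 1 - θ s = 0 := fun s hs hs' => by
    have h5 : ‖s‖ < 1 := by simpa using hs
    have : ‖s‖ ≤ 1 / 2 := by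
      by_contra hcon
      push Not at hcon
      exact hs' ⟨hcon.le, h5.le⟩
    rw [θ.one_of_mem_closedBall (by simpa [θ] using this), sub_self]
  have hηc : Continuous fun s => 1 - θ s := continuous_const.sub θ.continuous
  rw [integral_truncated hχ hW hW' hd hε h3.le,
    integral_odd_smul hθc hodd (fun s hs => by simp [fderiv_θ_eq_zero hs]) hε hεR hW,
    integral_even_smul hηc (fun s => by rw [θ.neg]) hη0 hε hεR hW', dist_eq_norm]
  have iW := ((continuousOn_comp_smul hε hεR hW).sub (continuousOn_comp_neg_smul hε hεR hW))
  have iW' := ((continuousOn_comp_smul hε hεR hW').add (continuousOn_comp_neg_smul hε hεR hW'))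
  have j1 : IntegrableOn (fun s => fderiv ℝ θ s e • (ε ^ 2 • (W (ε • s) - W (-(ε • s))) - g s))
      ann := (hθc.continuousOn.smul ((iW.const_smul (ε ^ 2)).sub hg)).integrableOn_compact
        isCompact_ann
  have j0 : IntegrableOn (fun s => fderiv ℝ θ s e • g s)
      ann := (hθc.continuousOn.smul hg).integrableOn_compact isCompact_ann
  have j2 : IntegrableOn (fun s => (1 - θ s) • (ε ^ 3 • (W' (ε • s) + W' (-(ε • s))) - g' s))
      (ann ∩ Metric.ball 0 1) :=
    ((hηc.continuousOn.smul ((iW'.const_smul (ε ^ 3)).sub hg')).integrableOn_compact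
        isCompact_ann).mono_set Set.inter_subset_left
  have j3 : IntegrableOn (fun s => (1 - θ s) • g' s) (ann ∩ Metric.ball 0 1) :=
    ((hηc.continuousOn.smul hg').integrableOn_compact isCompact_ann).mono_set
      Set.inter_subset_left
  have k1 : ε ^ 2 • (∫ s in ann, fderiv ℝ θ s e • (W (ε • s) - W (-(ε • s)))) =
      (∫ s in ann, fderiv ℝ θ s e • (ε ^ 2 • (W (ε • s) - W (-(ε • s))) - g s)) +
        ∫ s in ann, fderiv ℝ θ s e • g s := by
    rw [← integral_add j1 j0, ← integral_smul]
    refine integral_congr_ae (Filter.Eventually.of_forall fun s => ?_)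
    simp only
    rw [← smul_add, sub_add_cancel, smul_comm]
  have k2 : ε ^ 3 • (∫ s in ann ∩ Metric.ball 0 1, (1 - θ s) • (W' (ε • s) + W' (-(ε • s)))) =
      (∫ s in ann ∩ Metric.ball 0 1, (1 - θ s) • (ε ^ 3 • (W' (ε • s) + W' (-(ε • s))) - g' s)) +
        ∫ s in ann ∩ Metric.ball 0 1, (1 - θ s) • g' s := by
    rw [← integral_add j2 j3, ← integral_smul]
    refine integral_congr_ae (Filter.Eventually.of_forall fun s => ?_)
    simp only
    rw [← smul_add, sub_add_cancel, smul_comm]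
  have b1 : ‖∫ s in ann, fderiv ℝ θ s e • (ε ^ 2 • (W (ε • s) - W (-(ε • s))) - g s)‖ ≤
      |C| * (δ * ε) * m := by
    refine norm_setIntegral_le_of_norm_le_const hfinA fun s hs => ?_
    rw [norm_smul]
    exact mul_le_mul ((hC s hs).trans (le_abs_self C)) (h1 s hs) (norm_nonneg _) (abs_nonneg _)
  have b2 : ‖∫ s in ann ∩ Metric.ball 0 1,
      (1 - θ s) • (ε ^ 3 • (W' (ε • s) + W' (-(ε • s))) - g' s)‖ ≤ δ * ε * m := by
    refine (norm_setIntegral_le_of_norm_le_const (C := δ * ε)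
      ((measure_mono Set.inter_subset_left).trans_lt hfinA) fun s hs => ?_).trans ?_
    · rw [norm_smul]
      have n1 : ‖1 - θ s‖ ≤ 1 := by
        rw [Real.norm_eq_abs, abs_le]
        constructor <;> linarith [θ.nonneg' s, θ.le_one (x := s)]
      nlinarith [h2 s hs.1, norm_nonneg (1 - θ s),
        norm_nonneg (ε ^ 3 • (W' (ε • s) + W' (-(ε • s))) - g' s)]
    · have : (volume : Measure E2).real (ann ∩ Metric.ball 0 1) ≤ m :=
        measureReal_mono Set.inter_subset_left hfinA.ne
      gcongr
  set I1 := ∫ s in ann, fderiv ℝ θ s e • (W (ε • s) - W (-(ε • s)))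
  set I2 := ∫ s in ann ∩ Metric.ball 0 1, (1 - θ s) • (W' (ε • s) + W' (-(ε • s)))
  set A1 := ∫ s in ann, fderiv ℝ θ s e • (ε ^ 2 • (W (ε • s) - W (-(ε • s))) - g s)
  set A2 := ∫ s in ann ∩ Metric.ball 0 1,
      (1 - θ s) • (ε ^ 3 • (W' (ε • s) + W' (-(ε • s))) - g' s)
  set B1 := ∫ s in ann, fderiv ℝ θ s e • g s
  set B2 := ∫ s in ann ∩ Metric.ball 0 1, (1 - θ s) • g' s
  set Q := ∫ t, fderiv ℝ χ t e • W t
  have k1' : ε • I1 = ε⁻¹ • (A1 + B1) := by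
    rw [← k1, smul_smul]; congr 1; field_simp
  have k2' : ε ^ 2 • I2 = ε⁻¹ • (A2 + B2) := by
    rw [← k2, smul_smul]; congr 1; field_simp
  have key : -Q + ε • (1 / 2 : ℝ) • I1 - ε ^ 2 • (1 / 2 : ℝ) • I2 -
      ε⁻¹ • ((1 / 2 : ℝ) • B1 - (1 / 2 : ℝ) • B2) - -Q = (ε⁻¹ * (1 / 2)) • (A1 - A2) := by
    rw [smul_comm ε, smul_comm (ε ^ 2), k1', k2']
    module
  rw [key, norm_smul, norm_mul, norm_inv, Real.norm_eq_abs, abs_of_pos hε]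
  have b3 : ‖A1 - A2‖ ≤ ε * ρ := by
    refine (norm_sub_le _ _).trans ((add_le_add b1 b2).trans ?_)
    rw [← hδle]
    have := abs_nonneg C
    have h9 : 0 ≤ δ * ε := by positivity
    have : |C| * (δ * ε) * m + δ * ε * m ≤ (δ * ε) * ((|C| + 1) * (m + 1)) := by nlinarith
    linarith
  have : ε⁻¹ * ‖(1 / 2 : ℝ)‖ * ‖A1 - A2‖ ≤ ε⁻¹ * (1 / 2) * (ε * ρ) := by
    rw [Real.norm_eq_abs, abs_of_pos (by norm_num : (0 : ℝ) < 1 / 2)]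
    gcongr
  refine this.trans_lt ?_
  have : ε⁻¹ * (1 / 2) * (ε * ρ) = ρ / 2 := by field_simp
  rw [this]; linarith

end PMLJump

namespace PMLJump
open MeasureTheory Asymptotics

/-! ### Size of the kernels -/

theorem norm_dotProduct_le (v w : C3) : ‖v ⬝ᵥ w‖ ≤ 3 * (‖v‖ * ‖w‖) := by
  unfold dotProduct
  refine (norm_sum_le _ _).trans ((Finset.sum_le_card_nsmul _ _ (‖v‖ * ‖w‖) fun i _ => ?_).trans ?_)
  · rw [norm_mul]
    exact mul_le_mul (norm_le_pi_norm v i) (norm_le_pi_norm w i) (norm_nonneg _) (norm_nonneg _)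
  · simp

theorem norm_crossProduct_le (v w : C3) : ‖v ⨯₃ w‖ ≤ 2 * (‖v‖ * ‖w‖) := by
  have h : ∀ i j k l, ‖v i * w j - v k * w l‖ ≤ 2 * (‖v‖ * ‖w‖) := fun i j k l => by
    refine (norm_sub_le _ _).trans ?_
    rw [norm_mul, norm_mul, two_mul]
    gcongr <;> exact norm_le_pi_norm _ _
  rw [cross_apply]
  refine (pi_norm_le_iff_of_nonneg (by positivity)).2 fun i => ?_
  fin_cases i <;> exact h _ _ _ _

section BigO

variable {ι : Type*} {l : Filter ι} {f g : ι → C3} {u v : ι → ℝ}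

theorem isBigO_dot (hf : f =O[l] u) (hg : g =O[l] v) :
    (fun i => f i ⬝ᵥ g i) =O[l] fun i => u i * v i := by
  have h : (fun i => f i ⬝ᵥ g i) =O[l] fun i => ‖f i‖ * ‖g i‖ :=
    IsBigO.of_bound 3 (Filter.Eventually.of_forall fun i => by
      rw [Real.norm_of_nonneg (by positivity)]; exact norm_dotProduct_le _ _)
  exact h.trans (hf.norm_left.mul hg.norm_left)

theorem isBigO_cross (hf : f =O[l] u) (hg : g =O[l] v) :
    (fun i => f i ⨯₃ g i) =O[l] fun i => u i * v i := by
  have h : (fun i => f i ⨯₃ g i) =O[l] fun i => ‖f i‖ * ‖g i‖ :=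
    IsBigO.of_bound 2 (Filter.Eventually.of_forall fun i => by
      rw [Real.norm_of_nonneg (by positivity)]; exact norm_crossProduct_le _ _)
  exact h.trans (hf.norm_left.mul hg.norm_left)

variable {S κ D : ℝ} {z : ι → C3} {d : ι → ℝ}

theorem norm_csqrt_ge (hκ : 0 < κ) {q : ℂ} {d : ℝ}
    (h : κ * d ^ 2 ≤ (rot S * q).re) : √(κ / ‖rot S‖) * d ≤ ‖csqrt q‖ := by
  have hr : 0 < ‖rot S‖ := norm_pos_iff.2 (rot_ne_zero S)
  refine le_of_sq_le_sq ?_ (norm_nonneg _)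
  rw [norm_csqrt_sq, mul_pow, Real.sq_sqrt (by positivity), div_mul_eq_mul_div, div_le_iff₀ hr]
  refine h.trans ((Complex.re_le_norm _).trans ?_)
  rw [norm_mul, mul_comm]

/-- A family of arguments `z` of the kernels whose size is comparable to `d`, uniformly away from
the singularities. -/
structure Comparable (S κ : ℝ) (l : Filter ι) (z : ι → C3) (d : ι → ℝ) : Prop where
  κ_pos : 0 < κ
  pos : ∀ᶠ i in l, 0 < d i
  lower : ∀ᶠ i in l, κ * d i ^ 2 ≤ (rot S * (z i ⬝ᵥ z i)).re
  upper : z =O[l] d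

theorem Comparable.mem_dom (h : Comparable S κ l z d) : ∀ᶠ i in l, z i ∈ dom S := by
  filter_upwards [h.pos, h.lower] with i h1 h2
  have := h.κ_pos
  exact lt_of_lt_of_le (by positivity) h2

theorem Comparable.inv_csqrt (h : Comparable S κ l z d) :
    (fun i => (csqrt (z i ⬝ᵥ z i))⁻¹) =O[l] fun i => (d i)⁻¹ := by
  have hr : 0 < ‖rot S‖ := norm_pos_iff.2 (rot_ne_zero S)
  have hκ := h.κ_pos
  refine IsBigO.of_bound (√(κ / ‖rot S‖))⁻¹ ?_
  filter_upwards [h.pos, h.lower] with i h1 h2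
  have := norm_csqrt_ge hκ h2
  rw [norm_inv, norm_inv, Real.norm_of_nonneg h1.le, ← mul_inv]
  exact inv_anti₀ (by positivity) this

theorem Comparable.isBigO_G (h : Comparable S κ l z d) (hD : ∀ᶠ i in l, d i ≤ D) (n : ℕ) (k : ℂ) :
    (fun i => G n k (z i ⬝ᵥ z i)) =O[l] fun i => (d i)⁻¹ ^ (2 * n + 1) := by
  obtain ⟨C, hC⟩ := h.upper.bound
  obtain ⟨C', -, hC'⟩ := G_bound n k (3 * ((|C| * |D|) * (|C| * |D|)))
  refine IsBigO.trans (g := fun i => (csqrt (z i ⬝ᵥ z i))⁻¹ ^ (2 * n + 1))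
    (IsBigO.of_bound C' ?_) (h.inv_csqrt.pow _)
  filter_upwards [h.pos, hD, hC] with i h1 h2 h3
  have h4 : ‖z i‖ ≤ |C| * |D| := by
    refine h3.trans ?_
    rw [Real.norm_of_nonneg h1.le]
    exact mul_le_mul (le_abs_self C) (h2.trans (le_abs_self D)) h1.le (abs_nonneg C)
  have := hC' (z i ⬝ᵥ z i) ((norm_dotProduct_le _ _).trans (by gcongr))
  rwa [norm_pow, norm_inv, inv_pow]

theorem Comparable.isBigO_G_sub (h : Comparable S κ l z d) (hD : ∀ᶠ i in l, d i ≤ D) (n : ℕ)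
    (k : ℂ) : (fun i => G (n + 1) k (z i ⬝ᵥ z i) - G (n + 1) 0 (z i ⬝ᵥ z i)) =O[l]
      fun i => (d i)⁻¹ ^ (2 * n + 1) := by
  obtain ⟨C, hC⟩ := h.upper.bound
  obtain ⟨C', -, hC'⟩ := G_sub_bound n k (3 * ((|C| * |D|) * (|C| * |D|)))
  refine IsBigO.trans (g := fun i => (csqrt (z i ⬝ᵥ z i))⁻¹ ^ (2 * n + 1))
    (IsBigO.of_bound C' ?_) (h.inv_csqrt.pow _)
  filter_upwards [h.pos, hD, hC, h.mem_dom] with i h1 h2 h3 h5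
  have h4 : ‖z i‖ ≤ |C| * |D| := by
    refine h3.trans ?_
    rw [Real.norm_of_nonneg h1.le]
    exact mul_le_mul (le_abs_self C) (h2.trans (le_abs_self D)) h1.le (abs_nonneg C)
  have := hC' (z i ⬝ᵥ z i) (Complex.slitPlane_ne_zero (dot_mem_slitPlane h5))
    ((norm_dotProduct_le _ _).trans (by gcongr))
  rwa [norm_pow, norm_inv, inv_pow]

/-- The double curl kernels with wave numbers `k` and `0` differ by a weakly singular kernel. -/
theorem Comparable.isBigO_Ks_sub (h : Comparable S κ l z d) (hD : ∀ᶠ i in l, d i ≤ D) (k : ℂ)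
    {w : ι → C3} (hw : w =O[l] fun _ => (1 : ℝ)) :
    (fun i => Ks k (z i, w i) - Ks 0 (z i, w i)) =O[l] fun i => (d i)⁻¹ := by
  have h1 := ((h.isBigO_G_sub hD 1 k).mul (isBigO_dot h.upper hw)).smul h.upper
  have h2 := ((h.isBigO_G_sub hD 0 k).add (((h.isBigO_G hD 0 k)).const_mul_left (k ^ 2))).smul hw
  have e : (fun i => Ks k (z i, w i) - Ks 0 (z i, w i)) = fun i =>
      ((G (1 + 1) k (z i ⬝ᵥ z i) - G (1 + 1) 0 (z i ⬝ᵥ z i)) * (z i ⬝ᵥ w i)) • z i +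
      ((G (0 + 1) k (z i ⬝ᵥ z i) - G (0 + 1) 0 (z i ⬝ᵥ z i)) +
        k ^ 2 * G 0 k (z i ⬝ᵥ z i)) • w i := by
    ext i j
    simp [Ks]; ring
  rw [e]
  refine IsBigO.add (h1.congr' .rfl ?_) (h2.congr' .rfl ?_)
  · filter_upwards [h.pos] with i hi
    simp; field_simp
  · filter_upwards with i
    simp

theorem Comparable.isBigO_Ks (h : Comparable S κ l z d)
    {w : ι → C3} (hw : w =O[l] fun _ => (1 : ℝ)) (hD : ∀ᶠ i in l, d i ≤ D) :
    (fun i => Ks 0 (z i, w i)) =O[l] fun i => (d i)⁻¹ ^ 3 := by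
  have h1 := ((h.isBigO_G hD 2 0).mul (isBigO_dot h.upper hw)).smul h.upper
  have h2 := (h.isBigO_G hD 1 0).smul hw
  have e : (fun i => Ks 0 (z i, w i)) = fun i =>
      (G 2 0 (z i ⬝ᵥ z i) * (z i ⬝ᵥ w i)) • z i + G 1 0 (z i ⬝ᵥ z i) • w i := by
    ext i j
    simp [Ks]
  rw [e]
  refine IsBigO.add (h1.congr' .rfl ?_) (h2.congr' .rfl ?_)
  · filter_upwards [h.pos] with i hi
    simp; field_simp
  · filter_upwards with i
    simp

theorem Comparable.isBigO_jac_Ks (h : Comparable S κ l z d)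
    {w e : ι → C3} (hw : w =O[l] fun _ => (1 : ℝ)) (he : e =O[l] fun _ => (1 : ℝ))
    (hD : ∀ᶠ i in l, d i ≤ D) :
    (fun i => jac (Ks 0) (z i, w i) (e i)) =O[l] fun i => (d i)⁻¹ ^ 4 := by
  have h1 := ((((h.isBigO_G hD 3 0).mul (isBigO_dot h.upper he)).mul (isBigO_dot h.upper hw)).smul
    h.upper)
  have h2 := ((h.isBigO_G hD 2 0).mul (isBigO_dot he hw)).smul h.upper
  have h3 := ((h.isBigO_G hD 2 0).mul (isBigO_dot h.upper hw)).smul he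
  have h4 := ((h.isBigO_G hD 2 0).mul (isBigO_dot h.upper he)).smul hw
  have hsum : (fun i => (G 3 0 (z i ⬝ᵥ z i) * (z i ⬝ᵥ e i) * (z i ⬝ᵥ w i)) • z i +
      (G 2 0 (z i ⬝ᵥ z i) * (e i ⬝ᵥ w i)) • z i + (G 2 0 (z i ⬝ᵥ z i) * (z i ⬝ᵥ w i)) • e i +
      (G 2 0 (z i ⬝ᵥ z i) * (z i ⬝ᵥ e i)) • w i) =O[l] fun i => (d i)⁻¹ ^ 4 := by
    refine IsBigO.add (IsBigO.add (IsBigO.add (h1.congr' .rfl ?_) (h2.congr' .rfl ?_))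
      (h3.congr' .rfl ?_)) (h4.congr' .rfl ?_)
    all_goals
      filter_upwards [h.pos] with i hi
      simp; field_simp
  refine hsum.congr' ?_ .rfl
  filter_upwards [h.mem_dom] with i hi
  ext j
  rw [jac_Ks 0 hi]
  simp; ring

end BigO

/-! ### Scalar kernels -/

/-- The static fundamental solution. -/
noncomputable def k0 (z : C3) : ℂ := G 0 0 (z ⬝ᵥ z)

/-- The derivative of `k0` at `z` in direction `b`. -/
noncomputable def k1 (b z : C3) : ℂ := G 1 0 (z ⬝ᵥ z) * (b ⬝ᵥ z)

/-- The second derivative of `k0` at `z` in directions `b` and `D`, which is also the component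
along `b` of the static double curl kernel applied to `D`. -/
noncomputable def k2 (b z D : C3) : ℂ := b ⬝ᵥ Ks 0 (z, D)

theorem k2_eq (b z D : C3) :
    k2 b z D = G 2 0 (z ⬝ᵥ z) * (z ⬝ᵥ D) * (b ⬝ᵥ z) + G 1 0 (z ⬝ᵥ z) * (b ⬝ᵥ D) := by
  simp only [k2, Ks, dotProduct_add, dotProduct_smul, smul_eq_mul]
  ring

theorem k1_neg (b z : C3) : k1 b (-z) = -k1 b z := by simp [k1]

theorem k0_neg (z : C3) : k0 (-z) = k0 z := by simp [k0]

theorem k2_neg (b z D : C3) : k2 b (-z) D = k2 b z D := by simp [k2_eq]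

theorem smul_dot_smul (r : ℝ) (z : C3) : (r • z) ⬝ᵥ (r • z) = (r : ℂ) ^ 2 * (z ⬝ᵥ z) := by
  rw [smul_dotProduct, dotProduct_smul, smul_smul, Complex.real_smul]
  push_cast; ring

theorem smul_mem_dom {S r : ℝ} (hr : 0 < r) {z : C3} (hz : z ∈ dom S) : r • z ∈ dom S := by
  have : 0 < (rot S * (z ⬝ᵥ z)).re := hz
  change 0 < (rot S * (r • z ⬝ᵥ r • z)).re
  rw [smul_dot_smul, mul_left_comm, ← Complex.ofReal_pow, Complex.re_ofReal_mul]
  positivity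

section Homogeneous

variable {S r : ℝ} {z : C3}

theorem k0_smul (hr : 0 < r) (hz : z ∈ dom S) : r • k0 (r • z) = k0 z := by
  have hr' : (r : ℂ) ≠ 0 := by exact_mod_cast hr.ne'
  simp only [k0]
  rw [smul_dot_smul, G_homogeneous 0 hr (dot_mem_slitPlane hz), Complex.real_smul]
  field_simp
  ring

theorem k1_smul (hr : 0 < r) (hz : z ∈ dom S) (b : C3) : r ^ 2 • k1 b (r • z) = k1 b z := by
  have hr' : (r : ℂ) ≠ 0 := by exact_mod_cast hr.ne'
  simp only [k1]
  rw [smul_dot_smul, G_homogeneous 1 hr (dot_mem_slitPlane hz), Complex.real_smul,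
    dotProduct_smul, Complex.real_smul]
  push_cast; field_simp

theorem k2_smul (hr : 0 < r) (hz : z ∈ dom S) (b D : C3) :
    r ^ 3 • k2 b (r • z) D = k2 b z D := by
  have hr' : (r : ℂ) ≠ 0 := by exact_mod_cast hr.ne'
  rw [k2_eq, k2_eq, smul_dot_smul, G_homogeneous 1 hr (dot_mem_slitPlane hz),
    G_homogeneous 2 hr (dot_mem_slitPlane hz), Complex.real_smul,
    dotProduct_smul, smul_dotProduct, Complex.real_smul, Complex.real_smul]
  push_cast; field_simp

end Homogeneous

theorem contDiffOn_k0 (S : ℝ) : ContDiffOn ℂ ∞ k0 (dom S) := contDiffOn_G_dot S 0 0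

theorem contDiffOn_k1 (S : ℝ) :
    ContDiffOn ℂ ∞ (fun v : C3 × C3 => k1 v.1 v.2) (Set.univ ×ˢ dom S) := by
  have h : ContDiff ℂ ∞ fun v : C3 × C3 => v.1 ⬝ᵥ v.2 := contDiff_dot
  exact ((contDiffOn_G_dot S 1 0).comp contDiffOn_snd fun v hv => hv.2).mul h.contDiffOn

theorem contDiffOn_k2 (S : ℝ) :
    ContDiffOn ℂ ∞ (fun v : C3 × C3 × C3 => k2 v.1 v.2.1 v.2.2)
      (Set.univ ×ˢ (dom S ×ˢ Set.univ)) := by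
  have h : ContDiff ℂ ∞ fun v : C3 × C3 => v.1 ⬝ᵥ v.2 := contDiff_dot
  exact h.comp_contDiffOn (contDiffOn_fst.prodMk
    ((contDiffOn_Ks S 0).comp contDiffOn_snd fun v hv => hv.2))

section Deriv

variable {S r : ℝ} {z w : ℝ → C3} {z' w' : C3}

theorem hasDerivAt_dot (hz : HasDerivAt z z' r) (hw : HasDerivAt w w' r) :
    HasDerivAt (fun r => z r ⬝ᵥ w r) (z' ⬝ᵥ w r + z r ⬝ᵥ w') r := by
  unfold dotProduct
  rw [← Finset.sum_add_distrib]
  exact HasDerivAt.fun_sum fun i _ => (hasDerivAt_pi.1 hz i).mul (hasDerivAt_pi.1 hw i)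

theorem hasDerivAt_G_dot (n : ℕ) (hz : HasDerivAt z z' r) (hd : z r ∈ dom S) :
    HasDerivAt (fun r => G n 0 (z r ⬝ᵥ z r)) (G (n + 1) 0 (z r ⬝ᵥ z r) * (z' ⬝ᵥ z r)) r := by
  have := (hasDerivAt_G n 0 (dot_mem_slitPlane hd)).comp r (hasDerivAt_dot hz hz)
  refine this.congr_deriv ?_
  rw [dotProduct_comm (z r) z']; ring

theorem hasDerivAt_k0 (hz : HasDerivAt z z' r) (hd : z r ∈ dom S) :
    HasDerivAt (fun r => k0 (z r)) (k1 z' (z r)) r := hasDerivAt_G_dot 0 hz hd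

theorem hasDerivAt_k1 (hz : HasDerivAt z z' r) (hd : z r ∈ dom S) (b : C3) :
    HasDerivAt (fun r => k1 b (z r)) (k2 b (z r) z') r := by
  have := (hasDerivAt_G_dot 1 hz hd).mul (hasDerivAt_dot (hasDerivAt_const r b) hz)
  refine this.congr_deriv ?_
  rw [k2_eq, zero_dotProduct, zero_add, dotProduct_comm z']

end Deriv

end PMLJump

namespace PMLJump
open MeasureTheory Asymptotics

/-! ### Local asymptotics of the kernels along the surface -/

/-- The filter of the pairs `(ε, s)` with `ε → 0⁺`, uniformly for `s` in the closed annulus. -/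
def annFilter : Filter (ℝ × E2) := 𝓝[>] (0 : ℝ) ×ˢ Filter.principal ann

theorem eventually_annFilter {P : ℝ × E2 → Prop} :
    (∀ᶠ v in annFilter, P v) ↔ ∀ᶠ ε in 𝓝[>] (0 : ℝ), ∀ s ∈ ann, P (ε, s) :=
  Filter.eventually_prod_principal_iff

theorem eventually_prod_principal_of_local {X Y : Type*} [TopologicalSpace Y] {K : Set Y}
    (hK : IsCompact K) {l : Filter X} {P : X × Y → Prop}
    (h : ∀ y ∈ K, ∀ᶠ v in (l ×ˢ Filter.principal K) ⊓ Filter.comap Prod.snd (𝓝 y), P v) :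
    ∀ᶠ v in l ×ˢ Filter.principal K, P v := by
  have h1 : ∀ᶠ v in l ×ˢ Filter.principal K, v.2 ∈ K → P v := by
    refine hK.induction_on (p := fun T : Set Y =>
      ∀ᶠ v in l ×ˢ Filter.principal K, v.2 ∈ T → P v) ?_ ?_ ?_ ?_
    · exact Filter.Eventually.of_forall fun v hv => absurd hv (Set.notMem_empty _)
    · intro T T' hT h'
      filter_upwards [h'] with v hv hv'
      exact hv (Set.mem_of_subset_of_mem hT hv')
    · intro T T' h1 h2
      filter_upwards [h1, h2] with v e1 e2 e3
      exact (Set.mem_or_mem_of_mem_union e3).elim e1 e2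
    · intro s hs
      obtain ⟨A, hA, B, hB, hAB⟩ := Filter.eventually_inf.1 (h s hs)
      obtain ⟨U, hU, hUB⟩ := Filter.mem_comap.1 hB
      refine ⟨U, mem_nhdsWithin_of_mem_nhds hU, ?_⟩
      filter_upwards [hA] with v hv hv'
      exact hAB v (Set.mem_inter hv (hUB hv'))
  have h2 : ∀ᶠ v in l ×ˢ Filter.principal K, v.2 ∈ K :=
    Filter.tendsto_snd.eventually (Filter.eventually_mem_principal K)
  filter_upwards [h1, h2] with v hv hv' using hv hv'

theorem eventually_annFilter_of_local {P : ℝ × E2 → Prop}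
    (h : ∀ s ∈ ann, ∀ᶠ v in annFilter ⊓ Filter.comap Prod.snd (𝓝 s), P v) :
    ∀ᶠ v in annFilter, P v := eventually_prod_principal_of_local isCompact_ann h

theorem tendsto_fst_annFilter : Filter.Tendsto Prod.fst annFilter (𝓝[>] (0 : ℝ)) :=
  Filter.tendsto_fst

theorem annFilter_pos : ∀ᶠ v in annFilter, 0 < v.1 ∧ v.2 ∈ ann :=
  eventually_annFilter.2 (by
    filter_upwards [self_mem_nhdsWithin] with ε hε s hs using ⟨hε, hs⟩)

theorem isBigO_snd_annFilter : (fun v : ℝ × E2 => v.2) =O[annFilter] fun _ => (1 : ℝ) :=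
  IsBigO.of_bound 1 (by
    filter_upwards [annFilter_pos] with v hv
    simpa using hv.2.2)

theorem tendsto_smul_annFilter :
    Filter.Tendsto (fun v : ℝ × E2 => v.1 • v.2) annFilter (𝓝 0) := by
  have h1 : (fun v : ℝ × E2 => v.1 • v.2) =O[annFilter] fun v => v.1 • (1 : ℝ) :=
    (isBigO_refl _ _).smul isBigO_snd_annFilter
  refine h1.trans_tendsto ?_
  simp only [smul_eq_mul, mul_one]
  exact tendsto_fst_annFilter.mono_right nhdsWithin_le_nhds

section

variable {F : Type*} [NormedAddCommGroup F] {K : F → ℂ} {V : E2 → F} {a a' : ℝ × E2 → F}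

theorem isLittleO_one_kernel (hV : Continuous V) (hK : ∀ s ∈ ann, ContinuousAt K (V s))
    (ha : Filter.Tendsto a annFilter (𝓝 0)) :
    Filter.Tendsto (fun v => K (V v.2 + a v) - K (V v.2)) annFilter (𝓝 0) := by
  rw [Metric.tendsto_nhds]
  intro δ hδ
  refine eventually_annFilter_of_local fun s hs => ?_
  set l := annFilter ⊓ Filter.comap Prod.snd (𝓝 s)
  have h1 : Filter.Tendsto (fun v : ℝ × E2 => V v.2) l (𝓝 (V s)) :=
    (hV.tendsto s).comp (Filter.tendsto_comap.mono_left inf_le_right)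
  have h2 : Filter.Tendsto (fun v : ℝ × E2 => V v.2 + a v) l (𝓝 (V s)) := by
    simpa using h1.add (ha.mono_left inf_le_left)
  have h3 := ((hK s hs).tendsto.comp h2).sub ((hK s hs).tendsto.comp h1)
  rw [sub_self] at h3
  exact Metric.tendsto_nhds.1 h3 δ hδ

/-- A second order symmetric difference of a strictly differentiable function, uniformly on the
annulus. -/
theorem isLittleO_second_difference [NormedSpace ℝ F] (hV : Continuous V) {K' : E2 → F →L[ℝ] ℂ}
    (hK : ∀ s ∈ ann, HasStrictFDerivAt K (K' s) (V s))
    (ha : a =O[annFilter] fun v => v.1) (ha' : a' =O[annFilter] fun v => v.1)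
    (haa' : (fun v => a v - a' v) =o[annFilter] fun v => v.1) :
    (fun v => K (V v.2 + a v) + K (V v.2 - a' v) - 2 • K (V v.2)) =o[annFilter]
      fun v => v.1 := by
  rw [isLittleO_iff]
  intro δ hδ
  refine eventually_annFilter_of_local fun s hs => ?_
  set l := annFilter ⊓ Filter.comap Prod.snd (𝓝 s) with hl
  have hle : l ≤ annFilter := inf_le_left
  have h0 : Filter.Tendsto (fun v : ℝ × E2 => v.1) annFilter (𝓝 0) :=
    tendsto_fst_annFilter.mono_right nhdsWithin_le_nhds
  have h1 : Filter.Tendsto (fun v : ℝ × E2 => V v.2) l (𝓝 (V s)) :=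
    (hV.tendsto s).comp (Filter.tendsto_comap.mono_left inf_le_right)
  have h2 : Filter.Tendsto (fun v : ℝ × E2 => V v.2 + a v) l (𝓝 (V s)) := by
    simpa using h1.add ((ha.trans_tendsto h0).mono_left hle)
  have h3 : Filter.Tendsto (fun v : ℝ × E2 => V v.2 - a' v) l (𝓝 (V s)) := by
    simpa using h1.sub ((ha'.trans_tendsto h0).mono_left hle)
  have s1 := (hK s hs).isLittleO.comp_tendsto (h2.prodMk_nhds h1)
  have s2 := (hK s hs).isLittleO.comp_tendsto (h3.prodMk_nhds h1)
  have t1 : (fun v => K (V v.2 + a v) - K (V v.2) - K' s (a v)) =o[l] fun v => v.1 := by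
    refine (s1.trans_isBigO ?_).congr_left fun v => ?_
    · exact (ha.mono hle).congr_left fun v => by simp
    · simp
  have t2 : (fun v => K (V v.2 - a' v) - K (V v.2) - K' s (-a' v)) =o[l] fun v => v.1 := by
    refine (s2.trans_isBigO ?_).congr_left fun v => ?_
    · exact (ha'.mono hle).neg_left.congr_left fun v => by simp
    · simp
  have t3 : (fun v => K' s (a v - a' v)) =o[l] fun v => v.1 :=
    ((K' s).isBigO_comp _ _).trans_isLittleO (haa'.mono hle)
  have t4 : (fun v => K (V v.2 + a v) + K (V v.2 - a' v) - 2 • K (V v.2)) =o[l]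
      fun v => v.1 := by
    refine ((t1.add t2).add t3).congr_left fun v => ?_
    rw [map_sub, map_neg]; simp only [two_smul]; abel
  exact t4.def hδ

end

/-- The local data of the interface in stretched coordinates: `ψ` parametrizes the interface, `ζ`
the normal line, both issuing from the origin. The constants `κ` and `C` bound the argument
`ψ t - ζ h` of the kernels from below, in the rotated half-plane, and from above. -/
structure Patch where
  S : ℝ
  R : ℝ
  h₀ : ℝ
  κ : ℝ
  C : ℝ
  ζ : ℝ → C3
  ψ : E2 → C3
  R_pos : 0 < R
  h₀_pos : 0 < h₀
  κ_pos : 0 < κ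
  C_nonneg : 0 ≤ C
  contDiffOn_ψ : ContDiffOn ℝ 2 ψ (Metric.ball 0 R)
  ψ_zero : ψ 0 = 0
  contDiff_ζ : ContDiff ℝ 1 ζ
  ζ_zero : ζ 0 = 0
  lower : ∀ h t, |h| ≤ h₀ → t ∈ Metric.ball (0 : E2) R →
    κ * (|h| + ‖t‖) ^ 2 ≤ (rot S * ((ψ t - ζ h) ⬝ᵥ (ψ t - ζ h))).re
  norm_ζ_le : ∀ h, ‖ζ h‖ ≤ C * |h|
  norm_deriv_ζ_le : ∀ h, ‖deriv ζ h‖ ≤ C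
  norm_ψ_le : ∀ t ∈ Metric.ball (0 : E2) R, ‖ψ t‖ ≤ C * ‖t‖
  norm_fderiv_le : ∀ t ∈ Metric.ball (0 : E2) R, ‖fderiv ℝ ψ t‖ ≤ C
  norm_fderiv_sub_le : ∀ t ∈ Metric.ball (0 : E2) R, ‖fderiv ℝ ψ t - fderiv ℝ ψ 0‖ ≤ C * ‖t‖

namespace Patch

variable (P : Patch)

/-- The argument of the kernels. -/
noncomputable def z (h : ℝ) (t : E2) : C3 := P.ψ t - P.ζ h

/-- The derivative of the argument in direction `e`. -/
noncomputable def D (e t : E2) : C3 := fderiv ℝ P.ψ t e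

theorem z_zero (t : E2) : P.z 0 t = P.ψ t := by simp [z, P.ζ_zero]

theorem zero_mem : (0 : E2) ∈ Metric.ball (0 : E2) P.R := Metric.mem_ball_self P.R_pos

theorem z_mem_dom {h : ℝ} {t : E2} (hh : |h| ≤ P.h₀) (ht : t ∈ Metric.ball (0 : E2) P.R)
    (h0 : h ≠ 0 ∨ t ≠ 0) : P.z h t ∈ dom P.S := by
  have h1 := P.lower h t hh ht
  have h2 := P.κ_pos
  have : 0 < |h| + ‖t‖ := by
    rcases h0 with h0 | h0
    · have := abs_pos.2 h0; positivity
    · have := norm_pos_iff.2 h0; positivity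
  exact lt_of_lt_of_le (by positivity) h1

theorem ψ_mem_dom {t : E2} (ht : t ∈ Metric.ball (0 : E2) P.R) (h0 : t ≠ 0) :
    P.ψ t ∈ dom P.S := by
  rw [← z_zero]
  exact P.z_mem_dom (by simp [P.h₀_pos.le]) ht (Or.inr h0)

theorem hasFDerivAt_ψ {t : E2} (ht : t ∈ Metric.ball (0 : E2) P.R) :
    HasFDerivAt P.ψ (fderiv ℝ P.ψ t) t :=
  ((P.contDiffOn_ψ.contDiffAt (Metric.isOpen_ball.mem_nhds ht)).differentiableAt
    (by simp)).hasFDerivAt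

theorem continuousOn_fderiv : ContinuousOn (fderiv ℝ P.ψ) (Metric.ball 0 P.R) :=
  P.contDiffOn_ψ.continuousOn_fderiv_of_isOpen Metric.isOpen_ball (by norm_num)

theorem differentiableAt_fderiv : DifferentiableAt ℝ (fderiv ℝ P.ψ) 0 :=
  ((P.contDiffOn_ψ.contDiffAt (Metric.isOpen_ball.mem_nhds P.zero_mem)).fderiv_right
    (m := 1) (by norm_num)).differentiableAt (by simp)

/-- The linearization of the parametrization. -/
noncomputable def V : E2 →L[ℝ] C3 := fderiv ℝ P.ψ 0

theorem V_lower (s : E2) : P.κ * ‖s‖ ^ 2 ≤ (rot P.S * (P.V s ⬝ᵥ P.V s)).re := by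
  have h1 : Filter.Tendsto (fun ε : ℝ => ε⁻¹ • P.ψ (ε • s)) (𝓝[≠] 0) (𝓝 (P.V s)) := by
    have := ((P.hasFDerivAt_ψ P.zero_mem).hasLineDerivAt s).tendsto_slope_zero
    simpa [P.ψ_zero, V] using this
  have h2 : Continuous fun z : C3 => (rot P.S * (z ⬝ᵥ z)).re :=
    Complex.continuous_re.comp (continuous_const.mul continuous_dot_self)
  refine ge_of_tendsto ((h2.tendsto _).comp h1) ?_
  have h3 : ∀ᶠ ε in 𝓝 (0 : ℝ), ε • s ∈ Metric.ball (0 : E2) P.R := by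
    have : Continuous fun ε : ℝ => ε • s := by fun_prop
    exact this.continuousAt (Metric.isOpen_ball.mem_nhds (by simpa using P.R_pos))
  filter_upwards [nhdsWithin_le_nhds h3, self_mem_nhdsWithin] with ε h4 h5
  have h6 := P.lower 0 _ (by simp [P.h₀_pos.le]) h4
  rw [P.ζ_zero, sub_zero, abs_zero, zero_add, norm_smul, mul_pow, Real.norm_eq_abs, sq_abs] at h6
  have h5' : ε ≠ 0 := h5
  have h7 : 0 < ε ^ 2 := by positivity
  simp only [Function.comp]
  rw [smul_dot_smul, mul_left_comm, ← Complex.ofReal_pow, Complex.re_ofReal_mul, inv_pow,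
    ← div_eq_inv_mul, le_div_iff₀ h7]
  linarith

theorem V_mem_dom {s : E2} (hs : s ≠ 0) : P.V s ∈ dom P.S := by
  have h1 := P.V_lower s
  have := P.κ_pos
  have := norm_pos_iff.2 hs
  exact lt_of_lt_of_le (by positivity) h1

/-- The remainder of `ψ` at scale `ε`. -/
noncomputable def rem (v : ℝ × E2) : C3 := v.1⁻¹ • P.ψ (v.1 • v.2) - P.V v.2

/-- The reflected remainder of `ψ` at scale `ε`. -/
noncomputable def rem' (v : ℝ × E2) : C3 := v.1⁻¹ • P.ψ (-(v.1 • v.2)) + P.V v.2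

theorem isBigO_ψ_sub : (fun t => P.ψ t - P.V t) =O[𝓝 0] fun t => ‖t‖ ^ 2 := by
  refine IsBigO.of_bound P.C ?_
  filter_upwards [Metric.isOpen_ball.mem_nhds P.zero_mem] with t ht
  have hconv : Convex ℝ (Metric.ball (0 : E2) P.R ∩ Metric.closedBall 0 ‖t‖) :=
    (convex_ball _ _).inter (convex_closedBall _ _)
  have hC := P.C_nonneg
  have := hconv.norm_image_sub_le_of_norm_hasFDerivWithin_le
    (f := fun t => P.ψ t - P.V t) (f' := fun t => fderiv ℝ P.ψ t - P.V) (C := P.C * ‖t‖)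
    (fun y hy => ((P.hasFDerivAt_ψ hy.1).sub P.V.hasFDerivAt).hasFDerivWithinAt)
    (fun y hy => (P.norm_fderiv_sub_le y hy.1).trans (by
      have : ‖y‖ ≤ ‖t‖ := by simpa using hy.2
      gcongr)) (x := 0) (y := t) ⟨P.zero_mem, by simp⟩ ⟨ht, by simp⟩
  simp only [P.ψ_zero, map_zero, sub_zero] at this
  rw [Real.norm_of_nonneg (by positivity)]
  refine this.trans (le_of_eq (by ring))

theorem isLittleO_fderiv_even :
    (fun t => fderiv ℝ P.ψ t + fderiv ℝ P.ψ (-t) - 2 • P.V) =o[𝓝 0] fun t => t := by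
  have h1 := P.differentiableAt_fderiv.hasFDerivAt.isLittleO
  have h2 : Filter.Tendsto (fun t : E2 => -t) (𝓝 0) (𝓝 0) := by
    simpa using (continuous_neg (G := E2)).tendsto 0
  have h3 := h1.comp_tendsto h2
  simp only [sub_zero] at h1
  have h3' : (fun t => fderiv ℝ P.ψ (-t) - fderiv ℝ P.ψ 0 -
      fderiv ℝ (fderiv ℝ P.ψ) 0 (-t)) =o[𝓝 0] fun t : E2 => t := by
    refine (h3.congr_left fun t => by simp).trans_isBigO ?_
    exact (isBigO_refl (fun t : E2 => t) (𝓝 0)).neg_left.congr_left fun t => by simp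
  refine (h1.add h3').congr_left fun t => ?_
  rw [map_neg, two_smul, V]; abel

/-- The quadratic part of `ψ` is even, so the odd part of `ψ` is linear up to `o (‖t‖ ^ 2)`. -/
theorem isLittleO_ψ_odd :
    (fun t => P.ψ t - P.ψ (-t) - 2 • P.V t) =o[𝓝 0] fun t => ‖t‖ ^ 2 := by
  rw [isLittleO_iff]
  intro δ hδ
  obtain ⟨r, hr, hr'⟩ := Metric.eventually_nhds_iff_ball.1 (P.isLittleO_fderiv_even.def hδ)
  filter_upwards [Metric.ball_mem_nhds (0 : E2) (lt_min hr P.R_pos)] with t ht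
  have ht' : ‖t‖ < min r P.R := by simpa using ht
  have key : ∀ y : E2, ‖y‖ ≤ ‖t‖ → y ∈ Metric.ball (0 : E2) P.R := fun y hy => by
    simpa using hy.trans_lt (ht'.trans_le (min_le_right _ _))
  have := (convex_closedBall (0 : E2) ‖t‖).norm_image_sub_le_of_norm_hasFDerivWithin_le
    (f := fun t => P.ψ t - P.ψ (-t) - 2 • P.V t)
    (f' := fun t => fderiv ℝ P.ψ t + fderiv ℝ P.ψ (-t) - 2 • P.V) (C := δ * ‖t‖)
    (fun y hy => by
      have hy' : ‖y‖ ≤ ‖t‖ := by simpa using hy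
      have g1 := P.hasFDerivAt_ψ (key y hy')
      have g2 := (P.hasFDerivAt_ψ (key (-y) (by simpa using hy'))).comp y
        (hasFDerivAt_id (𝕜 := ℝ) y).neg
      have g3 := (g1.sub g2).sub (P.V.hasFDerivAt.const_smul (2 : ℕ) (x := y))
      refine (g3.congr_fderiv ?_).hasFDerivWithinAt
      ext v; simp)
    (fun y hy => by
      have hy' : ‖y‖ ≤ ‖t‖ := by simpa using hy
      refine (hr' y (by simpa using hy'.trans_lt (ht'.trans_le (min_le_left _ _)))).trans ?_
      gcongr) (x := 0) (y := t) (by simp) (by simp)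
  simp only [P.ψ_zero, map_zero, neg_zero, smul_zero, sub_zero] at this
  rw [Real.norm_of_nonneg (by positivity)]
  refine this.trans (le_of_eq (by ring))

theorem isBigO_sq : (fun v : ℝ × E2 => ‖v.1 • v.2‖ ^ 2) =O[annFilter] fun v => v.1 ^ 2 := by
  have h : (fun v : ℝ × E2 => v.1 • v.2) =O[annFilter] fun v => v.1 • (1 : ℝ) :=
    (isBigO_refl _ _).smul isBigO_snd_annFilter
  simpa using h.norm_left.pow 2

theorem isBigO_of_sq {F : Type*} [NormedAddCommGroup F] [NormedSpace ℝ F] {f : ℝ × E2 → F}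
    (h : f =O[annFilter] fun v => v.1 ^ 2) :
    (fun v => v.1⁻¹ • f v) =O[annFilter] fun v => v.1 := by
  refine ((isBigO_refl (fun v : ℝ × E2 => v.1⁻¹) annFilter).smul h).congr' .rfl ?_
  filter_upwards [annFilter_pos] with v hv
  have := hv.1.ne'
  simp only [smul_eq_mul]; field_simp

theorem isLittleO_of_sq {F : Type*} [NormedAddCommGroup F] [NormedSpace ℝ F] {f : ℝ × E2 → F}
    (h : f =o[annFilter] fun v => v.1 ^ 2) :
    (fun v => v.1⁻¹ • f v) =o[annFilter] fun v => v.1 := by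
  refine ((isBigO_refl (fun v : ℝ × E2 => v.1⁻¹) annFilter).smul_isLittleO h).congr' .rfl ?_
  filter_upwards [annFilter_pos] with v hv
  have := hv.1.ne'
  simp only [smul_eq_mul]; field_simp

theorem isBigO_rem : P.rem =O[annFilter] fun v => v.1 := by
  have h := isBigO_of_sq ((P.isBigO_ψ_sub.comp_tendsto tendsto_smul_annFilter).trans isBigO_sq)
  refine h.congr' ?_ .rfl
  filter_upwards [annFilter_pos] with v hv
  simp [rem, smul_sub, smul_smul, hv.1.ne']

theorem isLittleO_rem_sub : (fun v => P.rem v - P.rem' v) =o[annFilter] fun v => v.1 := by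
  have h := isLittleO_of_sq
    ((P.isLittleO_ψ_odd.comp_tendsto tendsto_smul_annFilter).trans_isBigO isBigO_sq)
  refine h.congr' ?_ .rfl
  filter_upwards [annFilter_pos] with v hv
  simp only [rem, rem', Function.comp, smul_sub, map_smul]
  rw [smul_comm (2 : ℕ) v.1, inv_smul_smul₀ hv.1.ne', two_smul]
  abel

theorem isBigO_rem' : P.rem' =O[annFilter] fun v => v.1 := by
  refine (P.isBigO_rem.sub P.isLittleO_rem_sub.isBigO).congr_left fun v => ?_
  abel

/-- The remainder of the derivative at scale `ε`. -/
noncomputable def remD (e : E2) (v : ℝ × E2) : C3 := P.D e (v.1 • v.2) - P.V e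

/-- The reflected remainder of the derivative at scale `ε`. -/
noncomputable def remD' (e : E2) (v : ℝ × E2) : C3 := P.V e - P.D e (-(v.1 • v.2))

theorem isBigO_fst : (fun v : ℝ × E2 => v.1 • v.2) =O[annFilter] fun v => v.1 := by
  have h : (fun v : ℝ × E2 => v.1 • v.2) =O[annFilter] fun v => v.1 • (1 : ℝ) :=
    (isBigO_refl _ _).smul isBigO_snd_annFilter
  simpa using h

theorem isBigO_remD (e : E2) : P.remD e =O[annFilter] fun v => v.1 := by
  have h1 := (P.differentiableAt_fderiv.hasFDerivAt.isBigO_sub.comp_tendsto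
    tendsto_smul_annFilter)
  have h2 : (fun v : ℝ × E2 => fderiv ℝ P.ψ (v.1 • v.2) - fderiv ℝ P.ψ 0) =O[annFilter]
      fun v => v.1 := h1.trans (isBigO_fst.congr_left fun v => by simp)
  exact ((ContinuousLinearMap.apply ℝ C3 e).isBigO_comp _ _).trans h2

theorem isLittleO_remD_sub (e : E2) :
    (fun v => P.remD e v - P.remD' e v) =o[annFilter] fun v => v.1 := by
  have h1 := (P.isLittleO_fderiv_even.comp_tendsto tendsto_smul_annFilter).trans_isBigO
    isBigO_fst
  refine (((ContinuousLinearMap.apply ℝ C3 e).isBigO_comp _ _).trans_isLittleO h1).congr_left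
    fun v => ?_
  simp [remD, remD', D, two_smul]; abel

theorem isBigO_remD' (e : E2) : P.remD' e =O[annFilter] fun v => v.1 := by
  refine ((P.isBigO_remD e).sub (P.isLittleO_remD_sub e).isBigO).congr_left fun v => ?_
  abel

theorem tendsto_of_isBigO_fst {F : Type*} [NormedAddCommGroup F] {f : ℝ × E2 → F}
    (h : f =O[annFilter] fun v => v.1) : Filter.Tendsto f annFilter (𝓝 0) :=
  h.trans_tendsto (tendsto_fst_annFilter.mono_right nhdsWithin_le_nhds)

/-- Scaling identities at small positive scale on the annulus. -/
theorem eventually_scaling : ∀ᶠ v in annFilter, 0 < v.1 ∧ v.2 ∈ ann ∧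
    (P.V v.2 + P.rem v ∈ dom P.S) ∧ (P.V v.2 - P.rem' v ∈ dom P.S) ∧
    P.ψ (v.1 • v.2) = v.1 • (P.V v.2 + P.rem v) ∧
    P.ψ (-(v.1 • v.2)) = v.1 • -(P.V v.2 - P.rem' v) := by
  filter_upwards [annFilter_pos, tendsto_smul_annFilter
    (Metric.isOpen_ball.mem_nhds P.zero_mem)] with v hv hb
  have hb' : v.1 • v.2 ∈ Metric.ball (0 : E2) P.R := hb
  have hne : v.1 • v.2 ≠ 0 := smul_ne_zero hv.1.ne' (ne_zero_of_mem_ann hv.2)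
  have e1 : P.V v.2 + P.rem v = v.1⁻¹ • P.ψ (v.1 • v.2) := by simp [rem]
  have e2 : P.V v.2 - P.rem' v = -(v.1⁻¹ • P.ψ (-(v.1 • v.2))) := by simp [rem']
  have hi : 0 < v.1⁻¹ := inv_pos.2 hv.1
  have hnb : -(v.1 • v.2) ∈ Metric.ball (0 : E2) P.R := by simpa using hb'
  refine ⟨hv.1, hv.2, ?_, ?_, ?_, ?_⟩
  · rw [e1]; exact smul_mem_dom hi (P.ψ_mem_dom hb' hne)
  · rw [e2]
    have := smul_mem_dom hi (P.ψ_mem_dom hnb (neg_ne_zero.2 hne))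
    simpa [dom] using this
  · rw [e1, smul_inv_smul₀ hv.1.ne']
  · rw [e2, neg_neg, smul_inv_smul₀ hv.1.ne']

end Patch

end PMLJump

namespace PMLJump
open MeasureTheory Asymptotics

/-! ### Finite parts of the model integrals -/

theorem forall_of_isLittleO_fst {f : ℝ × E2 → ℂ} (h : f =o[annFilter] fun v => v.1) :
    ∀ δ > 0, ∀ᶠ ε in 𝓝[>] (0 : ℝ), ∀ s ∈ ann, ‖f (ε, s)‖ ≤ δ * ε := fun δ hδ => by
  filter_upwards [eventually_annFilter.1 (h.def hδ), self_mem_nhdsWithin] with ε hε hpos s hs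
  have hpos' : 0 < ε := hpos
  simpa [abs_of_pos hpos'] using hε s hs

theorem isLittleO_fst_mul {f : ℝ × E2 → ℂ} (h : Filter.Tendsto f annFilter (𝓝 0)) :
    (fun v => v.1 • f v) =o[annFilter] fun v => v.1 := by
  have := (isBigO_refl (fun v : ℝ × E2 => v.1) annFilter).smul_isLittleO
    ((isLittleO_one_iff ℝ).2 h)
  simpa using this

theorem hasStrictFDerivAt_of_contDiffOn {F : Type*} [NormedAddCommGroup F] [NormedSpace ℂ F]
    {K : F → ℂ} {s : Set F} (hs : IsOpen s) (hK : ContDiffOn ℂ ∞ K s) {v : F} (hv : v ∈ s) :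
    HasStrictFDerivAt K ((fderiv ℂ K v).restrictScalars ℝ) v :=
  ((hK.contDiffAt (hs.mem_nhds hv)).hasStrictFDerivAt (by simp)).restrictScalars ℝ

theorem contDiffOn_k1_right (S : ℝ) (b : C3) : ContDiffOn ℂ ∞ (k1 b) (dom S) := by
  have h : ContDiff ℂ ∞ fun z : C3 => b ⬝ᵥ z := by unfold dotProduct; fun_prop
  exact (contDiffOn_G_dot S 1 0).mul h.contDiffOn

theorem contDiffOn_k2_right (S : ℝ) (b : C3) :
    ContDiffOn ℂ ∞ (fun v : C3 × C3 => k2 b v.1 v.2) (dom S ×ˢ Set.univ) := by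
  have h : ContDiff ℂ ∞ fun z : C3 => b ⬝ᵥ z := by unfold dotProduct; fun_prop
  exact h.comp_contDiffOn (contDiffOn_Ks S 0)

namespace Patch

variable (P : Patch)

/-- The pairs of a small height `h` and a parameter `t`, the singular pair `(0, 0)` excluded. -/
def rset : Set (ℝ × E2) :=
  {v | |v.1| ≤ P.h₀ ∧ v.2 ∈ Metric.ball (0 : E2) P.R ∧ (v.1 ≠ 0 ∨ v.2 ≠ 0)}

theorem mem_rset {v : ℝ × E2} : v ∈ P.rset ↔
    |v.1| ≤ P.h₀ ∧ v.2 ∈ Metric.ball (0 : E2) P.R ∧ (v.1 ≠ 0 ∨ v.2 ≠ 0) := Iff.rfl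

theorem continuousOn_z : ContinuousOn (fun v : ℝ × E2 => P.z v.1 v.2) P.rset := by
  have h1 : ContinuousOn (fun v : ℝ × E2 => P.ψ v.2) P.rset :=
    P.contDiffOn_ψ.continuousOn.comp continuousOn_snd fun _ hv => (P.mem_rset.1 hv).2.1
  exact h1.sub ((P.contDiff_ζ.continuous.comp continuous_fst).continuousOn)

theorem continuousOn_D (e : E2) : ContinuousOn (P.D e) (Metric.ball 0 P.R) :=
  P.continuousOn_fderiv.clm_apply continuousOn_const

theorem continuousOn_D_snd (e : E2) : ContinuousOn (fun v : ℝ × E2 => P.D e v.2) P.rset :=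
  (P.continuousOn_D e).comp continuousOn_snd fun _ hv => (P.mem_rset.1 hv).2.1

theorem z_mem_dom_of_rset {v : ℝ × E2} (hv : v ∈ P.rset) : P.z v.1 v.2 ∈ dom P.S := by
  obtain ⟨h1, h2, h3⟩ := P.mem_rset.1 hv
  exact P.z_mem_dom h1 h2 h3

theorem continuousOn_k0 : ContinuousOn (fun v : ℝ × E2 => k0 (P.z v.1 v.2)) P.rset :=
  (contDiffOn_k0 P.S).continuousOn.comp P.continuousOn_z fun _ hv => P.z_mem_dom_of_rset hv

theorem continuousOn_k1 {c : ℝ × E2 → C3} (hc : ContinuousOn c P.rset) :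
    ContinuousOn (fun v : ℝ × E2 => k1 (c v) (P.z v.1 v.2)) P.rset := by
  have h1 : ContinuousOn (fun v : ℝ × E2 => G 1 0 (P.z v.1 v.2 ⬝ᵥ P.z v.1 v.2)) P.rset :=
    (contDiffOn_G_dot P.S 1 0).continuousOn.comp P.continuousOn_z
      fun _ hv => P.z_mem_dom_of_rset hv
  exact h1.mul (contDiff_dot.continuous.comp_continuousOn (hc.prodMk P.continuousOn_z))

theorem continuousOn_k2 {c : ℝ × E2 → C3} (hc : ContinuousOn c P.rset) (e : E2) :
    ContinuousOn (fun v : ℝ × E2 => k2 (c v) (P.z v.1 v.2) (P.D e v.2)) P.rset :=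
  (contDiffOn_k2 P.S).continuousOn.comp (hc.prodMk (P.continuousOn_z.prodMk
    (P.continuousOn_D_snd e))) fun _ hv => Set.mk_mem_prod (Set.mem_univ _)
      (Set.mk_mem_prod (P.z_mem_dom_of_rset hv) (Set.mem_univ _))

theorem continuousOn_slice {F : Type*} [TopologicalSpace F] {f : ℝ × E2 → F}
    (hf : ContinuousOn f P.rset) {h : ℝ} (hh : |h| ≤ P.h₀) :
    ContinuousOn (fun t => f (h, t)) (Metric.ball 0 P.R \ {0}) :=
  hf.comp (by fun_prop) fun t ht => P.mem_rset.2 ⟨hh, ht.1, Or.inr ht.2⟩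

theorem continuousOn_slice_ne {F : Type*} [TopologicalSpace F] {f : ℝ × E2 → F}
    (hf : ContinuousOn f P.rset) {h : ℝ} (hh : |h| ≤ P.h₀) (h0 : h ≠ 0) :
    ContinuousOn (fun t => f (h, t)) (Metric.ball 0 P.R) :=
  hf.comp (by fun_prop) fun t ht => P.mem_rset.2 ⟨hh, ht, Or.inl h0⟩

theorem hasDerivAt_z (h : ℝ) (e : E2) {t : E2} (ht : t ∈ Metric.ball (0 : E2) P.R) :
    HasDerivAt (fun r : ℝ => P.z h (t + r • e)) (P.D e t) 0 := by
  have := (P.hasFDerivAt_ψ ht).hasLineDerivAt e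
  exact HasDerivAt.sub_const (P.ζ h) this

theorem hasLineDerivAt_k0 {h : ℝ} (hh : |h| ≤ P.h₀) (e : E2) {t : E2}
    (ht : t ∈ Metric.ball (0 : E2) P.R) (h0 : h ≠ 0 ∨ t ≠ 0) :
    HasLineDerivAt ℝ (fun t => k0 (P.z h t)) (k1 (P.D e t) (P.z h t)) t e := by
  have := hasDerivAt_k0 (S := P.S) (P.hasDerivAt_z h e ht)
    (by simpa using P.z_mem_dom hh ht h0)
  simpa [HasLineDerivAt] using this

theorem hasLineDerivAt_k1 {h : ℝ} (hh : |h| ≤ P.h₀) (e : E2) {t : E2}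
    (ht : t ∈ Metric.ball (0 : E2) P.R) (h0 : h ≠ 0 ∨ t ≠ 0) (b : C3) :
    HasLineDerivAt ℝ (fun t => k1 b (P.z h t)) (k2 b (P.z h t) (P.D e t)) t e := by
  have := hasDerivAt_k1 (S := P.S) (P.hasDerivAt_z h e ht)
    (by simpa using P.z_mem_dom hh ht h0) b
  simpa [HasLineDerivAt] using this

theorem hasLineDerivAt_linear_mul_k1 {h : ℝ} (hh : |h| ≤ P.h₀) (e : E2) {t : E2}
    (ht : t ∈ Metric.ball (0 : E2) P.R) (h0 : h ≠ 0 ∨ t ≠ 0) (b : C3) (A : E2 →L[ℝ] ℂ) :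
    HasLineDerivAt ℝ (fun t => A t * k1 b (P.z h t))
      (A e * k1 b (P.z h t) + A t * k2 b (P.z h t) (P.D e t)) t e := by
  have h1 : HasDerivAt (fun r : ℝ => A (t + r • e)) (A e) 0 :=
    A.hasFDerivAt.hasLineDerivAt e
  exact (h1.mul (P.hasLineDerivAt_k1 hh e ht h0 b)).congr_deriv (by simp)

/-- The cut-off function of a patch. -/
noncomputable def χ : ContDiffBump (0 : E2) :=
  ⟨P.R / 4, P.R / 2, by linarith [P.R_pos], by linarith [P.R_pos]⟩

theorem χ_rOut_lt : P.χ.rOut < P.R := by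
  change P.R / 2 < P.R
  linarith [P.R_pos]

theorem abs_zero_le : |(0 : ℝ)| ≤ P.h₀ := by simp [P.h₀_pos.le]

theorem continuousOn_zero_slice {F : Type*} [TopologicalSpace F] {f : ℝ × E2 → F}
    (hf : ContinuousOn f P.rset) :
    ContinuousOn (fun t => f (0, t)) (Metric.ball 0 P.R \ {0}) :=
  P.continuousOn_slice hf P.abs_zero_le

theorem continuousOn_k1_ψ (b : C3) :
    ContinuousOn (fun t => k1 b (P.ψ t)) (Metric.ball 0 P.R \ {0}) := by
  have := P.continuousOn_zero_slice (P.continuousOn_k1 (continuousOn_const (c := b)))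
  simpa only [z_zero] using this

theorem continuousOn_k2_ψ (b : C3) (e : E2) :
    ContinuousOn (fun t => k2 b (P.ψ t) (P.D e t)) (Metric.ball 0 P.R \ {0}) := by
  have := P.continuousOn_zero_slice (P.continuousOn_k2 (continuousOn_const (c := b)) e)
  simpa only [z_zero] using this

theorem eventually_k1_scaling (b : C3) : ∀ᶠ v in annFilter,
    v.1 ^ 2 • k1 b (P.ψ (v.1 • v.2)) = k1 b (P.V v.2 + P.rem v) ∧
    v.1 ^ 2 • k1 b (P.ψ (-(v.1 • v.2))) = -k1 b (P.V v.2 - P.rem' v) := by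
  filter_upwards [P.eventually_scaling] with v hv
  obtain ⟨h1, -, h3, h4, h5, h6⟩ := hv
  rw [h5, h6, smul_neg, k1_neg, smul_neg, k1_smul h1 h3, k1_smul h1 h4]
  exact ⟨rfl, rfl⟩

theorem eventually_k2_scaling (b : C3) (e : E2) : ∀ᶠ v in annFilter,
    v.1 ^ 3 • k2 b (P.ψ (v.1 • v.2)) (P.D e (v.1 • v.2)) =
      k2 b (P.V v.2 + P.rem v) (P.V e + P.remD e v) ∧
    v.1 ^ 3 • k2 b (P.ψ (-(v.1 • v.2))) (P.D e (-(v.1 • v.2))) =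
      k2 b (P.V v.2 - P.rem' v) (P.V e - P.remD' e v) := by
  filter_upwards [P.eventually_scaling] with v hv
  obtain ⟨h1, -, h3, h4, h5, h6⟩ := hv
  rw [h5, h6, smul_neg, k2_neg, k2_smul h1 h3, k2_smul h1 h4]
  simp [remD, remD']

theorem isLittleO_k1_odd (b : C3) :
    (fun v : ℝ × E2 => v.1 ^ 2 • (k1 b (P.ψ (v.1 • v.2)) - k1 b (P.ψ (-(v.1 • v.2)))) -
      2 • k1 b (P.V v.2)) =o[annFilter] fun v => v.1 := by
  have h := isLittleO_second_difference (K := k1 b) P.V.continuous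
    (fun s hs => hasStrictFDerivAt_of_contDiffOn (isOpen_dom P.S) (contDiffOn_k1_right P.S b)
      (P.V_mem_dom (ne_zero_of_mem_ann hs))) P.isBigO_rem P.isBigO_rem' P.isLittleO_rem_sub
  refine h.congr' ?_ .rfl
  filter_upwards [P.eventually_k1_scaling b] with v hv
  rw [smul_sub, hv.1, hv.2, sub_neg_eq_add]

theorem continuous_V_prod (e : E2) : Continuous fun s => (P.V s, P.V e) :=
  P.V.continuous.prodMk continuous_const

theorem V_prod_mem {s : E2} (hs : s ∈ ann) (e : E2) :
    (P.V s, P.V e) ∈ dom P.S ×ˢ (Set.univ : Set C3) :=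
  Set.mk_mem_prod (P.V_mem_dom (ne_zero_of_mem_ann hs)) (Set.mem_univ _)

theorem isLittleO_k2_even (b : C3) (e : E2) :
    (fun v : ℝ × E2 => v.1 ^ 3 • (k2 b (P.ψ (v.1 • v.2)) (P.D e (v.1 • v.2)) +
      k2 b (P.ψ (-(v.1 • v.2))) (P.D e (-(v.1 • v.2)))) -
      2 • k2 b (P.V v.2) (P.V e)) =o[annFilter] fun v => v.1 := by
  have h := isLittleO_second_difference (K := fun v : C3 × C3 => k2 b v.1 v.2)
    (P.continuous_V_prod e)
    (fun s hs => hasStrictFDerivAt_of_contDiffOn ((isOpen_dom P.S).prod isOpen_univ)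
      (contDiffOn_k2_right P.S b) (P.V_prod_mem hs e))
    (P.isBigO_rem.prod_left (P.isBigO_remD e)) (P.isBigO_rem'.prod_left (P.isBigO_remD' e))
    ((P.isLittleO_rem_sub.prod_left (P.isLittleO_remD_sub e)).congr_left fun v => rfl)
  refine h.congr' ?_ .rfl
  filter_upwards [P.eventually_k2_scaling b e] with v hv
  rw [smul_add, hv.1, hv.2]
  rfl

theorem continuousOn_k1_V (b : C3) : ContinuousOn (fun s => k1 b (P.V s)) ann :=
  (contDiffOn_k1_right P.S b).continuousOn.comp P.V.continuous.continuousOn fun _ hs =>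
    P.V_mem_dom (ne_zero_of_mem_ann hs)

theorem continuousOn_k2_V (b : C3) (e : E2) : ContinuousOn (fun s => k2 b (P.V s) (P.V e)) ann :=
  ContinuousOn.comp (g := fun v : C3 × C3 => k2 b v.1 v.2) (f := fun s => (P.V s, P.V e))
    (contDiffOn_k2_right P.S b).continuousOn (P.continuous_V_prod e).continuousOn
    fun _ hs => P.V_prod_mem hs e

/-- The constant part of the density produces a divergence `c / ε`, and nothing else at order
one. -/
theorem exists_tendsto_truncated_k2 (b : C3) (e : E2) : ∃ c : ℂ, Filter.Tendsto
    (fun ε : ℝ => (∫ t in Metric.ball 0 P.R \ Metric.ball 0 ε,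
      P.χ t • k2 b (P.ψ t) (P.D e t)) - ε⁻¹ • c) (𝓝[>] 0)
    (𝓝 (-∫ t, fderiv ℝ P.χ t e • k1 b (P.ψ t))) :=
  ⟨_, exists_tendsto_truncated P.χ_rOut_lt (P.continuousOn_k1_ψ b) (P.continuousOn_k2_ψ b e)
    (fun t ht => by
      have := P.hasLineDerivAt_k1 P.abs_zero_le e ht.1 (Or.inr ht.2) b
      simpa only [z_zero] using this)
    ((P.continuousOn_k1_V b).const_smul 2) ((P.continuousOn_k2_V b e).const_smul 2)
    (forall_of_isLittleO_fst (P.isLittleO_k1_odd b))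
    (forall_of_isLittleO_fst (P.isLittleO_k2_even b e))⟩

theorem tendsto_truncated_of_isLittleO {W W' : E2 → ℂ} {e : E2}
    (hW : ContinuousOn W (Metric.ball 0 P.R \ {0}))
    (hW' : ContinuousOn W' (Metric.ball 0 P.R \ {0}))
    (hd : ∀ t ∈ Metric.ball 0 P.R \ {0}, HasLineDerivAt ℝ W (W' t) t e)
    (h : (fun v : ℝ × E2 => v.1 ^ 2 • (W (v.1 • v.2) - W (-(v.1 • v.2)))) =o[annFilter]
      fun v => v.1)
    (h' : (fun v : ℝ × E2 => v.1 ^ 3 • (W' (v.1 • v.2) + W' (-(v.1 • v.2)))) =o[annFilter]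
      fun v => v.1) :
    Filter.Tendsto (fun ε : ℝ => ∫ t in Metric.ball 0 P.R \ Metric.ball 0 ε, P.χ t • W' t)
      (𝓝[>] 0) (𝓝 (-∫ t, fderiv ℝ P.χ t e • W t)) := by
  have := exists_tendsto_truncated P.χ_rOut_lt hW hW' hd (g := fun _ => 0) (g' := fun _ => 0)
    continuousOn_const continuousOn_const
    (by simpa only [sub_zero] using forall_of_isLittleO_fst h)
    (by simpa only [sub_zero] using forall_of_isLittleO_fst h')
  simpa only [smul_zero, integral_zero, sub_zero] using this

/-- At small scale the kernel takes nearly the same values, up to sign, at opposite points of the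
annulus, here for `k1` and below for `k2` and `k0`. -/
theorem tendsto_k1_sub {b : ℝ × E2 → C3} {b' : ℝ × E2 → C3} {e : E2}
    (hb : Filter.Tendsto b annFilter (𝓝 0)) (hb' : Filter.Tendsto b' annFilter (𝓝 0)) :
    Filter.Tendsto (fun v : ℝ × E2 => k1 (P.V e + b v) (P.V v.2 + P.rem v) -
      k1 (P.V e - b' v) (P.V v.2 - P.rem' v)) annFilter (𝓝 0) := by
  have hc : ∀ s ∈ ann, ContinuousAt (fun v : C3 × C3 => k1 v.2 v.1) (P.V s, P.V e) := by
    intro s hs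
    have h1 : ContinuousAt (fun v : C3 × C3 => k1 v.1 v.2) (P.V e, P.V s) :=
      (contDiffOn_k1 P.S).continuousOn.continuousAt (((isOpen_univ).prod (isOpen_dom P.S)).mem_nhds
        (Set.mk_mem_prod (Set.mem_univ (P.V e)) (P.V_mem_dom (ne_zero_of_mem_ann hs))))
    exact ContinuousAt.comp (g := fun v : C3 × C3 => k1 v.1 v.2)
      (f := fun v : C3 × C3 => (v.2, v.1)) (x := (P.V s, P.V e)) h1 (by fun_prop)
  have t1 := isLittleO_one_kernel (K := fun v : C3 × C3 => k1 v.2 v.1) (P.continuous_V_prod e) hc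
    ((tendsto_of_isBigO_fst P.isBigO_rem).prodMk_nhds hb)
  have t2 := isLittleO_one_kernel (K := fun v : C3 × C3 => k1 v.2 v.1) (P.continuous_V_prod e) hc
    (a := fun v => -(P.rem' v, b' v)) (by
      have := ((tendsto_of_isBigO_fst P.isBigO_rem').prodMk_nhds hb').neg
      rwa [show -((0 : C3), (0 : C3)) = 0 by simp] at this)
  have t3 := t1.sub t2
  rw [sub_zero] at t3
  refine t3.congr fun v => ?_
  simp [sub_eq_add_neg]

theorem tendsto_k2_sub (b : C3) (e : E2) :
    Filter.Tendsto (fun v : ℝ × E2 => k2 b (P.V v.2 + P.rem v) (P.V e + P.remD e v) -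
      k2 b (P.V v.2 - P.rem' v) (P.V e - P.remD' e v)) annFilter (𝓝 0) := by
  have hc : ∀ s ∈ ann, ContinuousAt (fun v : C3 × C3 => k2 b v.1 v.2) (P.V s, P.V e) := fun s hs =>
    (contDiffOn_k2_right P.S b).continuousOn.continuousAt
      (((isOpen_dom P.S).prod isOpen_univ).mem_nhds (P.V_prod_mem hs e))
  have t1 := isLittleO_one_kernel (P.continuous_V_prod e) hc
    ((tendsto_of_isBigO_fst P.isBigO_rem).prodMk_nhds (tendsto_of_isBigO_fst (P.isBigO_remD e)))
  have t2 := isLittleO_one_kernel (P.continuous_V_prod e) hc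
    (a := fun v => -(P.rem' v, P.remD' e v)) (by
      have := ((tendsto_of_isBigO_fst P.isBigO_rem').prodMk_nhds
        (tendsto_of_isBigO_fst (P.isBigO_remD' e))).neg
      rwa [show -((0 : C3), (0 : C3)) = 0 by simp] at this)
  have t3 := t1.sub t2
  rw [sub_zero] at t3
  refine t3.congr fun v => ?_
  simp [sub_eq_add_neg]

theorem tendsto_k0_sub :
    Filter.Tendsto (fun v : ℝ × E2 => k0 (P.V v.2 + P.rem v) - k0 (P.V v.2 - P.rem' v))
      annFilter (𝓝 0) := by
  have hc : ∀ s ∈ ann, ContinuousAt k0 (P.V s) := fun s hs =>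
    (contDiffOn_k0 P.S).continuousOn.continuousAt
      ((isOpen_dom P.S).mem_nhds (P.V_mem_dom (ne_zero_of_mem_ann hs)))
  have t1 := isLittleO_one_kernel P.V.continuous hc (tendsto_of_isBigO_fst P.isBigO_rem)
  have t2 := isLittleO_one_kernel P.V.continuous hc
    (a := fun v => -P.rem' v) (by simpa using (tendsto_of_isBigO_fst P.isBigO_rem').neg)
  have t3 := t1.sub t2
  rw [sub_zero] at t3
  refine t3.congr fun v => ?_
  simp [sub_eq_add_neg]

/-- The derivative of the static single layer kernel has a convergent principal value. -/
theorem tendsto_truncated_k1 (e : E2) : Filter.Tendsto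
    (fun ε : ℝ => ∫ t in Metric.ball 0 P.R \ Metric.ball 0 ε, P.χ t • k1 (P.D e t) (P.ψ t))
    (𝓝[>] 0) (𝓝 (-∫ t, fderiv ℝ P.χ t e • k0 (P.ψ t))) := by
  refine P.tendsto_truncated_of_isLittleO ?_ ?_ (fun t ht => ?_) ?_ ?_
  · have := P.continuousOn_zero_slice P.continuousOn_k0
    simpa only [z_zero] using this
  · have := P.continuousOn_zero_slice (P.continuousOn_k1 (P.continuousOn_D_snd e))
    simpa only [z_zero] using this
  · have := P.hasLineDerivAt_k0 P.abs_zero_le e ht.1 (Or.inr ht.2)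
    simpa only [z_zero] using this
  · refine (isLittleO_fst_mul P.tendsto_k0_sub).congr' ?_ .rfl
    filter_upwards [P.eventually_scaling] with v hv
    obtain ⟨h1, -, h3, h4, h5, h6⟩ := hv
    rw [h5, h6, smul_neg, k0_neg, ← k0_smul h1 h3, ← k0_smul h1 h4, ← smul_sub, smul_smul, pow_two]
  · refine (isLittleO_fst_mul (P.tendsto_k1_sub (e := e)
      (tendsto_of_isBigO_fst (P.isBigO_remD e))
      (tendsto_of_isBigO_fst (P.isBigO_remD' e)))).congr' ?_ .rfl
    filter_upwards [P.eventually_scaling] with v hv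
    obtain ⟨h1, -, h3, h4, h5, h6⟩ := hv
    have e1 : P.V e + P.remD e v = P.D e (v.1 • v.2) := by simp [remD]
    have e2 : P.V e - P.remD' e v = P.D e (-(v.1 • v.2)) := by simp [remD']
    rw [h5, h6, smul_neg, k1_neg, e1, e2, ← k1_smul h1 h3, ← k1_smul h1 h4, ← sub_eq_add_neg,
      ← smul_sub, smul_smul, ← pow_succ']

/-- The linear part of the density contributes no divergence. -/
theorem tendsto_truncated_linear (b : C3) (e e' : E2) (hb : b = P.V e') (A : E2 →L[ℝ] ℂ) :
    Filter.Tendsto (fun ε : ℝ => ∫ t in Metric.ball 0 P.R \ Metric.ball 0 ε,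
      P.χ t • (A e * k1 b (P.ψ t) + A t * k2 b (P.ψ t) (P.D e t)))
    (𝓝[>] 0) (𝓝 (-∫ t, fderiv ℝ P.χ t e • (A t * k1 b (P.ψ t)))) := by
  have hAc : ContinuousOn (fun t => A t) (Metric.ball 0 P.R \ {0}) := A.continuous.continuousOn
  have hk1 : Filter.Tendsto (fun v : ℝ × E2 => k1 b (P.V v.2 + P.rem v) -
      k1 b (P.V v.2 - P.rem' v)) annFilter (𝓝 0) := by
    have := P.tendsto_k1_sub (e := e') (b := fun _ => 0) (b' := fun _ => 0)
      tendsto_const_nhds tendsto_const_nhds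
    simpa only [add_zero, sub_zero, ← hb] using this
  have hA : (fun v : ℝ × E2 => A v.2) =O[annFilter] fun _ => (1 : ℝ) :=
    (A.isBigO_comp _ _).trans isBigO_snd_annFilter
  have hAk : ∀ {f : ℝ × E2 → ℂ}, Filter.Tendsto f annFilter (𝓝 0) →
      Filter.Tendsto (fun v : ℝ × E2 => A v.2 * f v) annFilter (𝓝 0) := fun {f} hf => by
    have := hA.mul_isLittleO ((isLittleO_one_iff ℝ).2 hf)
    simp only [mul_one] at this
    exact (isLittleO_one_iff ℝ).1 this
  refine P.tendsto_truncated_of_isLittleO (hAc.mul (P.continuousOn_k1_ψ b))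
    ((continuousOn_const.mul (P.continuousOn_k1_ψ b)).add (hAc.mul (P.continuousOn_k2_ψ b e)))
    (fun t ht => ?_) ?_ ?_
  · have := P.hasLineDerivAt_linear_mul_k1 P.abs_zero_le e ht.1 (Or.inr ht.2) b A
    simpa only [z_zero] using this
  · refine (isLittleO_fst_mul (hAk hk1)).congr' ?_ .rfl
    filter_upwards [P.eventually_k1_scaling b] with v hv
    rw [sub_eq_add_neg, ← hv.2, ← hv.1, map_neg, map_smul]
    simp only [Complex.real_smul]
    push_cast; ring
  · refine (isLittleO_fst_mul ((hk1.const_mul (A e)).add (hAk (P.tendsto_k2_sub b e))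
      |> fun h => by simpa using h)).congr' ?_ .rfl
    filter_upwards [P.eventually_k1_scaling b, P.eventually_k2_scaling b e] with v hv hv'
    rw [sub_eq_add_neg, ← hv.2, ← hv.1, ← hv'.1, ← hv'.2, map_neg, map_smul]
    simp only [Complex.real_smul]
    push_cast; ring

end Patch

end PMLJump

namespace PMLJump
open MeasureTheory Asymptotics

/-! ### Limits of the model integrals from off the surface -/

theorem k1_add_left (b b' z : C3) : k1 (b + b') z = k1 b z + k1 b' z := by
  simp [k1, mul_add]

theorem integral_linear_combination {X : Type*} [MeasurableSpace X] {m : Measure X}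
    {f g k : X → ℂ} (hf : Integrable f m) (hg : Integrable g m) (hk : Integrable k m) (a b : ℂ) :
    a * ∫ t, f t ∂m + ∫ t, g t ∂m - b * ∫ t, k t ∂m = ∫ t, (a * f t + g t - b * k t) ∂m := by
  have h : Integrable (fun t => a * f t + g t) m := (hf.const_mul a).add hg
  rw [integral_sub h (hk.const_mul b), integral_add (hf.const_mul a) hg, integral_const_mul,
    integral_const_mul]

theorem ae_ball_ne_zero (R : ℝ) :
    ∀ᵐ t ∂(volume.restrict (Metric.ball (0 : E2) R)), t ∈ Metric.ball (0 : E2) R \ {0} := by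
  filter_upwards [ae_restrict_mem Metric.isOpen_ball.measurableSet,
    ae_restrict_of_ae (compl_mem_ae_iff.2 (measure_singleton (0 : E2)))] with t h1 h2
  exact ⟨h1, h2⟩

theorem aestronglyMeasurable_of_continuousOn {F : Type*} [NormedAddCommGroup F] {g : E2 → F}
    {R : ℝ} (hg : ContinuousOn g (Metric.ball 0 R \ {0})) :
    AEStronglyMeasurable g (volume.restrict (Metric.ball 0 R)) := by
  rw [← Measure.restrict_congr_set (sdiff_null_ae_eq_self (measure_singleton (0 : E2)))]
  exact hg.aestronglyMeasurable
    (Metric.isOpen_ball.measurableSet.diff (measurableSet_singleton 0))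

theorem tendsto_integral_sdiff_ball {F : Type*} [NormedAddCommGroup F] [NormedSpace ℝ F]
    {g : E2 → F} {R : ℝ} (hR : 0 < R) (hg : IntegrableOn g (Metric.ball 0 R)) :
    Filter.Tendsto (fun ε : ℝ => ∫ t in Metric.ball 0 R \ Metric.ball 0 ε, g t) (𝓝[>] 0)
      (𝓝 (∫ t in Metric.ball 0 R, g t)) := by
  have h1 : Filter.Tendsto (fun ε : ℝ => (volume.restrict (Metric.ball (0 : E2) R))
      (Metric.ball (0 : E2) ε)) (𝓝[>] 0) (𝓝 0) := by
    have h2 : Filter.Tendsto (fun ε : ℝ => ENNReal.ofReal (ε ^ 2) *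
        volume (Metric.ball (0 : E2) 1)) (𝓝[>] 0) (𝓝 0) := by
      have : Filter.Tendsto (fun ε : ℝ => ENNReal.ofReal (ε ^ 2)) (𝓝[>] 0) (𝓝 0) := by
        have h3 : Continuous fun ε : ℝ => ENNReal.ofReal (ε ^ 2) :=
          ENNReal.continuous_ofReal.comp (continuous_pow 2)
        have h4 := h3.tendsto 0
        simp only [ne_eq, OfNat.ofNat_ne_zero, not_false_eq_true, zero_pow,
          ENNReal.ofReal_zero] at h4
        exact h4.mono_left nhdsWithin_le_nhds
      have h5 := ENNReal.Tendsto.mul_const (b := volume (Metric.ball (0 : E2) 1)) this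
        (Or.inr measure_ball_lt_top.ne)
      simpa using h5
    refine tendsto_of_tendsto_of_tendsto_of_le_of_le' tendsto_const_nhds h2
      (Filter.Eventually.of_forall fun _ => bot_le) ?_
    filter_upwards [self_mem_nhdsWithin] with ε hε
    refine (Measure.restrict_apply_le _ _).trans (le_of_eq ?_)
    rw [Measure.addHaar_ball _ _ (le_of_lt hε)]
    simp
  have h2 := Integrable.tendsto_setIntegral_nhds_zero hg h1
  have h3 := (tendsto_const_nhds (x := ∫ t in Metric.ball 0 R, g t)).sub h2
  rw [sub_zero] at h3
  refine h3.congr' ?_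
  filter_upwards [nhdsWithin_le_nhds (Iio_mem_nhds hR), self_mem_nhdsWithin] with ε h4 h5
  have h4' : ε < R := h4
  have hsub : Metric.ball (0 : E2) ε ⊆ Metric.ball 0 R := Metric.ball_subset_ball h4'.le
  rw [setIntegral_sdiff Metric.isOpen_ball.measurableSet hg hsub,
    Measure.restrict_restrict Metric.isOpen_ball.measurableSet, Set.inter_eq_left.2 hsub]

namespace Patch

variable (P : Patch)

/-- The size of the kernel argument. -/
noncomputable def d (v : ℝ × E2) : ℝ := |v.1| + ‖v.2‖

theorem comparable :
    Comparable P.S P.κ (Filter.principal P.rset) (fun v => P.z v.1 v.2) d where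
  κ_pos := P.κ_pos
  pos := Filter.eventually_principal.2 fun v hv => by
    unfold d
    rcases (P.mem_rset.1 hv).2.2 with h | h
    · have := abs_pos.2 h; positivity
    · have := norm_pos_iff.2 h; positivity
  lower := Filter.eventually_principal.2 fun v hv =>
    P.lower v.1 v.2 (P.mem_rset.1 hv).1 (P.mem_rset.1 hv).2.1
  upper := isBigO_principal.2 ⟨P.C, fun v hv => by
    have h1 := P.norm_ψ_le v.2 (P.mem_rset.1 hv).2.1
    have h2 := P.norm_ζ_le v.1
    rw [d, Real.norm_of_nonneg (by positivity), mul_add]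
    refine (norm_sub_le _ _).trans ?_
    linarith⟩

theorem d_le : ∀ᶠ v in Filter.principal P.rset, d v ≤ P.h₀ + P.R :=
  Filter.eventually_principal.2 fun v hv => by
    have h1 := (P.mem_rset.1 hv).1
    have h2 : ‖v.2‖ < P.R := by simpa using (P.mem_rset.1 hv).2.1
    unfold d; linarith

theorem isBigO_D (e : E2) : (fun v : ℝ × E2 => P.D e v.2) =O[Filter.principal P.rset]
    fun _ => (1 : ℝ) :=
  isBigO_principal.2 ⟨P.C * ‖e‖, fun v hv => by
    rw [norm_one, mul_one]
    exact ((fderiv ℝ P.ψ v.2).le_opNorm e).trans (mul_le_mul_of_nonneg_right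
      (P.norm_fderiv_le _ (P.mem_rset.1 hv).2.1) (norm_nonneg _))⟩

theorem isBigO_k0 : (fun v : ℝ × E2 => k0 (P.z v.1 v.2)) =O[Filter.principal P.rset]
    fun v => (d v)⁻¹ := by
  simpa [k0] using P.comparable.isBigO_G P.d_le 0 0

theorem isBigO_k1 {c : ℝ × E2 → C3} {u : ℝ × E2 → ℝ} (hc : c =O[Filter.principal P.rset] u) :
    (fun v : ℝ × E2 => k1 (c v) (P.z v.1 v.2)) =O[Filter.principal P.rset]
      fun v => (d v)⁻¹ ^ 2 * u v := by
  refine ((P.comparable.isBigO_G P.d_le 1 0).mul (isBigO_dot hc P.comparable.upper)).congr'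
    .rfl ?_
  filter_upwards [P.comparable.pos] with v hv
  have := hv.ne'
  norm_num
  field_simp

theorem isBigO_k2 {c : ℝ × E2 → C3} {u : ℝ × E2 → ℝ} (hc : c =O[Filter.principal P.rset] u)
    (e : E2) : (fun v : ℝ × E2 => k2 (c v) (P.z v.1 v.2) (P.D e v.2))
      =O[Filter.principal P.rset] fun v => (d v)⁻¹ ^ 3 * u v := by
  refine (isBigO_dot hc (P.comparable.isBigO_Ks (P.isBigO_D e) P.d_le)).congr' .rfl ?_
  exact Filter.Eventually.of_forall fun v => mul_comm _ _

theorem tendsto_integral {f : ℝ × E2 → ℂ} (hf : ContinuousOn f P.rset)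
    (hb : f =O[Filter.principal P.rset] fun v => (d v)⁻¹) :
    Filter.Tendsto (fun h => ∫ t in Metric.ball 0 P.R, f (h, t)) (𝓝 0)
      (𝓝 (∫ t in Metric.ball 0 P.R, f (0, t))) := by
  obtain ⟨c, hc⟩ := isBigO_principal.1 hb
  have hh : ∀ᶠ h in 𝓝 (0 : ℝ), |h| ≤ P.h₀ := by
    have : ∀ᶠ h in 𝓝 (0 : ℝ), |h| < P.h₀ :=
      continuous_abs.continuousAt.eventually_lt continuousAt_const (by simpa using P.h₀_pos)
    exact this.mono fun _ h => h.le
  refine tendsto_integral_filter_of_dominated_convergence (fun t => |c| * ‖t‖⁻¹) ?_ ?_ ?_ ?_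
  · filter_upwards [hh] with h h1
    exact aestronglyMeasurable_of_continuousOn (P.continuousOn_slice hf h1)
  · filter_upwards [hh] with h h1
    filter_upwards [ae_ball_ne_zero P.R] with t ht
    have h2 := hc (h, t) (P.mem_rset.2 ⟨h1, ht.1, Or.inr ht.2⟩)
    have h3 : 0 < ‖t‖ := norm_pos_iff.2 ht.2
    have h4 : ‖t‖ ≤ d (h, t) := by unfold d; linarith [abs_nonneg h]
    have h5 := h3.trans_le h4
    rw [norm_inv, Real.norm_of_nonneg h5.le] at h2
    exact h2.trans (mul_le_mul (le_abs_self c) (inv_anti₀ h3 h4) (inv_nonneg.2 h5.le)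
      (abs_nonneg c))
  · exact (integrableOn_ball_norm_inv P.R).const_mul _
  · filter_upwards [ae_ball_ne_zero P.R] with t ht
    have h1 : Filter.Tendsto (fun h : ℝ => (h, t)) (𝓝 0) (𝓝[P.rset] (0, t)) := by
      refine tendsto_nhdsWithin_iff.2 ⟨?_, ?_⟩
      · exact (by fun_prop : Continuous fun h : ℝ => (h, t)).tendsto 0
      · filter_upwards [hh] with h h2
        exact P.mem_rset.2 ⟨h2, ht.1, Or.inr ht.2⟩
    exact (hf (0, t) (P.mem_rset.2 ⟨P.abs_zero_le, ht.1, Or.inr ht.2⟩)).tendsto.comp h1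

theorem integrableOn_of_isBigO {f : ℝ × E2 → ℂ} (hf : ContinuousOn f P.rset)
    (hb : f =O[Filter.principal P.rset] fun v => (d v)⁻¹) :
    IntegrableOn (fun t => f (0, t)) (Metric.ball 0 P.R) := by
  obtain ⟨c, hc⟩ := isBigO_principal.1 hb
  refine ((integrableOn_ball_norm_inv P.R).const_mul c).mono'
    (aestronglyMeasurable_of_continuousOn (P.continuousOn_zero_slice hf)) ?_
  filter_upwards [ae_ball_ne_zero P.R] with t ht
  simpa [d] using hc (0, t) (P.mem_rset.2 ⟨P.abs_zero_le, ht.1, Or.inr ht.2⟩)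

theorem tsupport_χ_subset : tsupport P.χ ⊆ Metric.ball 0 P.R := by
  rw [P.χ.tsupport_eq]
  exact Metric.closedBall_subset_ball P.χ_rOut_lt

theorem χ_eq_zero {t : E2} (ht : t ∉ Metric.ball (0 : E2) P.R) : P.χ t = 0 :=
  image_eq_zero_of_notMem_tsupport fun h => ht (P.tsupport_χ_subset h)

theorem fderiv_χ_eq_zero {t : E2} (ht : t ∉ Metric.ball (0 : E2) P.R) : fderiv ℝ P.χ t = 0 :=
  image_eq_zero_of_notMem_tsupport fun h => ht
    (P.tsupport_χ_subset (tsupport_fderiv_subset ℝ h))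

theorem setIntegral_fderiv_χ (W : E2 → ℂ) (e : E2) :
    ∫ t in Metric.ball 0 P.R, fderiv ℝ P.χ t e • W t = ∫ t, fderiv ℝ P.χ t e • W t :=
  setIntegral_eq_integral_of_forall_compl_eq_zero fun t ht => by simp [P.fderiv_χ_eq_zero ht]

theorem integral_χ_smul {W W' : E2 → ℂ} {e : E2} (hW : ContinuousOn W (Metric.ball 0 P.R))
    (hW' : ContinuousOn W' (Metric.ball 0 P.R))
    (hd : ∀ t ∈ Metric.ball 0 P.R, HasLineDerivAt ℝ W (W' t) t e) :
    ∫ t in Metric.ball 0 P.R, P.χ t • W' t =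
      -∫ t in Metric.ball 0 P.R, fderiv ℝ P.χ t e • W t := by
  rw [setIntegral_fderiv_χ, ← integral_smul_lineDeriv P.χ.contDiff P.χ.hasCompactSupport
    P.tsupport_χ_subset hW hW' hd]
  exact setIntegral_eq_integral_of_forall_compl_eq_zero fun t ht => by simp [P.χ_eq_zero ht]

theorem isBigO_fderiv_χ (e : E2) :
    (fun v : ℝ × E2 => fderiv ℝ P.χ v.2 e) =O[Filter.principal P.rset] d := by
  have hc : Continuous fun t => fderiv ℝ P.χ t e := continuous_fderiv_apply' P.χ.contDiff e
  obtain ⟨C, hC⟩ := (isCompact_closedBall (0 : E2) P.R).exists_bound_of_continuousOn hc.continuousOn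
  have hR := P.R_pos
  refine isBigO_principal.2 ⟨|C| * (4 / P.R), fun v hv => ?_⟩
  have h1 := hC v.2 (Metric.ball_subset_closedBall (P.mem_rset.1 hv).2.1)
  have h2 : 0 ≤ |v.1| := abs_nonneg _
  rw [Real.norm_of_nonneg (show 0 ≤ d v from add_nonneg h2 (norm_nonneg _)), d]
  by_cases h : ‖v.2‖ < P.R / 4
  · have : fderiv ℝ P.χ v.2 = 0 := by
      rw [(P.χ.eventuallyEq_one_of_mem_ball (x := v.2)
        (mem_ball_zero_iff.2 h)).fderiv_eq]; simp
    rw [this]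
    simp; positivity
  · push Not at h
    have h3 : 1 ≤ 4 / P.R * (|v.1| + ‖v.2‖) := by
      rw [div_mul_eq_mul_div, one_le_div hR]; linarith
    calc ‖fderiv ℝ P.χ v.2 e‖ ≤ |C| * 1 := by rw [mul_one]; exact h1.trans (le_abs_self C)
      _ ≤ |C| * (4 / P.R * (|v.1| + ‖v.2‖)) := by gcongr
      _ = _ := by ring

theorem isBigO_χ : (fun v : ℝ × E2 => P.χ v.2) =O[Filter.principal P.rset] fun _ => (1 : ℝ) :=
  isBigO_principal.2 ⟨1, fun v _ => by
    rw [Real.norm_of_nonneg P.χ.nonneg]; simpa using P.χ.le_one⟩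

theorem isBigO_linear (A : E2 →L[ℝ] ℂ) :
    (fun v : ℝ × E2 => A v.2) =O[Filter.principal P.rset] fun _ => (1 : ℝ) :=
  isBigO_principal.2 ⟨‖A‖ * P.R, fun v hv => by
    have h2 : ‖v.2‖ < P.R := by simpa using (P.mem_rset.1 hv).2.1
    rw [norm_one, mul_one]
    exact (A.le_opNorm _).trans (mul_le_mul_of_nonneg_left h2.le (norm_nonneg _))⟩

theorem eventually_small : ∀ᶠ h in 𝓝[≠] (0 : ℝ), |h| ≤ P.h₀ ∧ h ≠ 0 := by
  have : ∀ᶠ h in 𝓝 (0 : ℝ), |h| < P.h₀ :=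
    continuous_abs.continuousAt.eventually_lt continuousAt_const (by simpa using P.h₀_pos)
  filter_upwards [nhdsWithin_le_nhds this, self_mem_nhdsWithin] with h h1 h2
  exact ⟨h1.le, h2⟩

end Patch

/-- The test direction of a patch, transported off the surface along the normal line. -/
structure Patch.Direction (P : Patch) where
  e' : E2
  b : ℝ → C3
  L : ℝ
  continuous_b : Continuous b
  b_zero : b 0 = P.V e'
  norm_sub_le : ∀ h, |h| ≤ P.h₀ → ‖b h - b 0‖ ≤ L * |h|

namespace Patch.Direction

variable {P : Patch} (Q : P.Direction)

theorem continuousOn_b : ContinuousOn (fun v : ℝ × E2 => Q.b v.1) P.rset :=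
  (Q.continuous_b.comp continuous_fst).continuousOn

theorem isBigO_b : (fun v : ℝ × E2 => Q.b v.1) =O[Filter.principal P.rset] fun _ => (1 : ℝ) := by
  obtain ⟨C, hC⟩ := (isCompact_Icc (a := -P.h₀) (b := P.h₀)).exists_bound_of_continuousOn
    Q.continuous_b.continuousOn
  refine isBigO_principal.2 ⟨C, fun v hv => ?_⟩
  simpa using hC v.1 (abs_le.1 (P.mem_rset.1 hv).1)

theorem isBigO_b_sub : (fun v : ℝ × E2 => Q.b v.1 - P.D Q.e' v.2) =O[Filter.principal P.rset]
    Patch.d := by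
  refine isBigO_principal.2 ⟨|Q.L| + P.C * ‖Q.e'‖, fun v hv => ?_⟩
  have hv' := P.mem_rset.1 hv
  have h1 := Q.norm_sub_le v.1 hv'.1
  have h2 : ‖P.V Q.e' - P.D Q.e' v.2‖ ≤ P.C * ‖v.2‖ * ‖Q.e'‖ := by
    rw [norm_sub_rev]
    exact ((fderiv ℝ P.ψ v.2 - P.V).le_opNorm Q.e').trans
      (mul_le_mul_of_nonneg_right (P.norm_fderiv_sub_le _ hv'.2.1) (norm_nonneg _))
  have h3 : Q.b v.1 - P.D Q.e' v.2 = (Q.b v.1 - Q.b 0) + (P.V Q.e' - P.D Q.e' v.2) := by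
    rw [Q.b_zero]; abel
  have h4 : Q.L * |v.1| ≤ |Q.L| * |v.1| :=
    mul_le_mul_of_nonneg_right (le_abs_self _) (abs_nonneg _)
  have h5 := P.C_nonneg
  have h6 := abs_nonneg Q.L
  have h7 := abs_nonneg v.1
  rw [Patch.d, Real.norm_of_nonneg (by positivity), h3]
  have h8 : 0 ≤ |Q.L| * ‖v.2‖ := by positivity
  have h9 : 0 ≤ P.C * ‖Q.e'‖ * |v.1| := by positivity
  refine (norm_add_le _ _).trans ?_
  nlinarith

theorem continuousOn_slice_k1 {h : ℝ} (hh : |h| ≤ P.h₀) (h0 : h ≠ 0) :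
    ContinuousOn (fun t => k1 (Q.b h) (P.z h t)) (Metric.ball 0 P.R) :=
  P.continuousOn_slice_ne (P.continuousOn_k1 Q.continuousOn_b) hh h0

theorem continuousOn_slice_k2 (e : E2) {h : ℝ} (hh : |h| ≤ P.h₀) (h0 : h ≠ 0) :
    ContinuousOn (fun t => k2 (Q.b h) (P.z h t) (P.D e t)) (Metric.ball 0 P.R) :=
  P.continuousOn_slice_ne (P.continuousOn_k2 Q.continuousOn_b e) hh h0

theorem continuousOn_linear (e : E2) (A : E2 →L[ℝ] ℂ) {h : ℝ} (hh : |h| ≤ P.h₀) (h0 : h ≠ 0) :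
    ContinuousOn (fun t => A e * k1 (Q.b h) (P.z h t) + A t * k2 (Q.b h) (P.z h t) (P.D e t))
      (Metric.ball 0 P.R) :=
  (continuousOn_const.mul (Q.continuousOn_slice_k1 hh h0)).add
    (A.continuous.continuousOn.mul (Q.continuousOn_slice_k2 e hh h0))

/-- Off the surface `k2` is the derivative of `k1` along the patch. The derivative of the cut-off
vanishes near the origin, so that after integration by parts nothing is singular. -/
theorem tendsto_height_k2 (e : E2) : Filter.Tendsto
    (fun h : ℝ => ∫ t in Metric.ball 0 P.R, P.χ t • k2 (Q.b h) (P.z h t) (P.D e t)) (𝓝[≠] 0)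
    (𝓝 (-∫ t, fderiv ℝ P.χ t e • k1 (Q.b 0) (P.ψ t))) := by
  have h1 := P.continuousOn_k1 Q.continuousOn_b
  have h3 : ContinuousOn (fun v : ℝ × E2 => fderiv ℝ P.χ v.2 e • k1 (Q.b v.1) (P.z v.1 v.2))
      P.rset :=
    ((continuous_fderiv_apply' P.χ.contDiff e).comp continuous_snd).continuousOn.smul h1
  have h4 := (P.isBigO_fderiv_χ e).smul (P.isBigO_k1 Q.isBigO_b)
  have h5 := (P.tendsto_integral h3 (h4.congr' .rfl (by
    filter_upwards [P.comparable.pos] with v hv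
    simp only [smul_eq_mul]; field_simp))).neg
  simp only [Patch.z_zero] at h5
  rw [P.setIntegral_fderiv_χ] at h5
  refine (h5.mono_left nhdsWithin_le_nhds).congr' ?_
  filter_upwards [P.eventually_small] with h hh
  rw [P.integral_χ_smul (Q.continuousOn_slice_k1 hh.1 hh.2) (Q.continuousOn_slice_k2 e hh.1 hh.2)
    fun t ht => P.hasLineDerivAt_k1 hh.1 e ht (Or.inl hh.2) _]

theorem tendsto_height_linear (e : E2) (A : E2 →L[ℝ] ℂ) : Filter.Tendsto
    (fun h : ℝ => ∫ t in Metric.ball 0 P.R, P.χ t • (A e * k1 (Q.b h) (P.z h t) +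
      A t * k2 (Q.b h) (P.z h t) (P.D e t))) (𝓝[≠] 0)
    (𝓝 (-∫ t, fderiv ℝ P.χ t e • (A t * k1 (Q.b 0) (P.ψ t)))) := by
  have hA : ContinuousOn (fun v : ℝ × E2 => A v.2) P.rset := by fun_prop
  have h1 := P.continuousOn_k1 Q.continuousOn_b
  have h2 := P.continuousOn_k2 Q.continuousOn_b e
  have h1' : ContinuousOn (fun v : ℝ × E2 => A v.2 * k1 (Q.b v.1) (P.z v.1 v.2)) P.rset :=
    hA.mul h1
  have h3 : ContinuousOn (fun v : ℝ × E2 => fderiv ℝ P.χ v.2 e •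
      (A v.2 * k1 (Q.b v.1) (P.z v.1 v.2))) P.rset :=
    ((continuous_fderiv_apply' P.χ.contDiff e).comp continuous_snd).continuousOn.smul h1'
  have h4 := (P.isBigO_fderiv_χ e).smul ((P.isBigO_linear A).mul (P.isBigO_k1 Q.isBigO_b))
  have h5 := (P.tendsto_integral h3 (h4.congr' .rfl (by
    filter_upwards [P.comparable.pos] with v hv
    simp only [smul_eq_mul]; field_simp))).neg
  simp only [Patch.z_zero] at h5
  rw [P.setIntegral_fderiv_χ] at h5
  refine (h5.mono_left nhdsWithin_le_nhds).congr' ?_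
  filter_upwards [P.eventually_small] with h hh
  have c1 : ContinuousOn (fun t => A t * k1 (Q.b h) (P.z h t)) (Metric.ball 0 P.R) :=
    P.continuousOn_slice_ne h1' hh.1 hh.2
  rw [P.integral_χ_smul c1 (Q.continuousOn_linear e A hh.1 hh.2)
    fun t ht => P.hasLineDerivAt_linear_mul_k1 hh.1 e ht (Or.inl hh.2) _ A]

theorem continuousOn_k1_b_sub : ContinuousOn (fun v : ℝ × E2 =>
    P.χ v.2 • k1 (Q.b v.1 - P.D Q.e' v.2) (P.z v.1 v.2)) P.rset :=
  (P.χ.continuous.comp continuous_snd).continuousOn.smul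
    (P.continuousOn_k1 (Q.continuousOn_b.sub (P.continuousOn_D_snd Q.e')))

theorem isBigO_k1_b_sub : (fun v : ℝ × E2 =>
    P.χ v.2 • k1 (Q.b v.1 - P.D Q.e' v.2) (P.z v.1 v.2)) =O[Filter.principal P.rset]
      fun v => (Patch.d v)⁻¹ := by
  refine (P.isBigO_χ.smul (P.isBigO_k1 Q.isBigO_b_sub)).congr' .rfl ?_
  filter_upwards [P.comparable.pos] with v hv
  simp only [smul_eq_mul]; field_simp

theorem integrableOn_χ_smul {g : E2 → ℂ} (hg : ContinuousOn g (Metric.ball 0 P.R)) :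
    IntegrableOn (fun t => P.χ t • g t) (Metric.ball 0 P.R) :=
  (integrable_smul_of_tsupport P.χ.continuous P.χ.hasCompactSupport P.tsupport_χ_subset
    hg).integrableOn

theorem integrableOn_χ_smul_sdiff {ε : ℝ} (hε : 0 < ε) {g : E2 → ℂ}
    (hg : ContinuousOn g (Metric.ball 0 P.R \ {0})) :
    IntegrableOn (fun t => P.χ t • g t) (Metric.ball 0 P.R \ Metric.ball 0 ε) := by
  have hK : IsCompact (Metric.closedBall (0 : E2) P.χ.rOut \ Metric.ball 0 ε) :=
    (isCompact_closedBall _ _).diff Metric.isOpen_ball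
  have hsub : Metric.closedBall (0 : E2) P.χ.rOut \ Metric.ball 0 ε ⊆ Metric.ball 0 P.R \ {0} := by
    rintro t ⟨h1, h2⟩
    refine ⟨Metric.closedBall_subset_ball P.χ_rOut_lt h1, ?_⟩
    rintro rfl
    exact h2 (Metric.mem_ball_self hε)
  have h1 : IntegrableOn (fun t => P.χ t • g t)
      (Metric.closedBall (0 : E2) P.χ.rOut \ Metric.ball 0 ε) :=
    (P.χ.continuous.continuousOn.smul (hg.mono hsub)).integrableOn_compact hK
  refine h1.of_forall_sdiff_eq_zero (Metric.isOpen_ball.measurableSet.diff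
    Metric.isOpen_ball.measurableSet) fun t ht => ?_
  have h2 : t ∉ Metric.closedBall (0 : E2) P.χ.rOut := fun h => ht.2 ⟨h, ht.1.2⟩
  have : P.χ t = 0 := P.χ.zero_of_le_dist (by
    rw [Metric.mem_closedBall, not_le] at h2; exact h2.le)
  rw [this, zero_smul]

/-- The limit common to the integrals of `k1` off the surface and to the truncated ones. -/
noncomputable def limK1 : ℂ := -(∫ t, fderiv ℝ P.χ t Q.e' • k0 (P.ψ t)) +
  ∫ t in Metric.ball 0 P.R, P.χ t • k1 (Q.b 0 - P.D Q.e' t) (P.ψ t)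

/-- `k1` is not absolutely integrable at height zero. As the direction `b` is tangent to the patch
at the origin, `k1` is the derivative of `k0` along the patch up to a weakly singular kernel. -/
theorem tendsto_height_k1 : Filter.Tendsto
    (fun h : ℝ => ∫ t in Metric.ball 0 P.R, P.χ t • k1 (Q.b h) (P.z h t)) (𝓝[≠] 0)
    (𝓝 Q.limK1) := by
  have h1 := P.continuousOn_k0
  have h2 := P.continuousOn_k1 (P.continuousOn_D_snd Q.e')
  have h3 : ContinuousOn (fun v : ℝ × E2 => fderiv ℝ P.χ v.2 Q.e' • k0 (P.z v.1 v.2)) P.rset :=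
    ((continuous_fderiv_apply' P.χ.contDiff Q.e').comp continuous_snd).continuousOn.smul h1
  have h0 : (fun v : ℝ × E2 => fderiv ℝ P.χ v.2 Q.e') =O[Filter.principal P.rset]
      fun _ => (1 : ℝ) := (P.isBigO_fderiv_χ Q.e').trans (IsBigO.of_bound (P.h₀ + P.R) (by
        filter_upwards [P.d_le, P.comparable.pos] with v hv hv'
        rw [Real.norm_of_nonneg hv'.le, norm_one, mul_one]; exact hv))
  have h4 := h0.smul P.isBigO_k0
  have h5 := (P.tendsto_integral h3 (h4.congr_right fun v => by simp)).neg
  have h6 := P.tendsto_integral Q.continuousOn_k1_b_sub Q.isBigO_k1_b_sub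
  have h7 := h5.add h6
  simp only [Patch.z_zero] at h7
  rw [P.setIntegral_fderiv_χ] at h7
  refine (h7.mono_left nhdsWithin_le_nhds).congr' ?_
  filter_upwards [P.eventually_small] with h hh
  have c0 : ContinuousOn (fun t => k0 (P.z h t)) (Metric.ball 0 P.R) :=
    P.continuousOn_slice_ne h1 hh.1 hh.2
  have c1 : ContinuousOn (fun t => k1 (P.D Q.e' t) (P.z h t)) (Metric.ball 0 P.R) :=
    P.continuousOn_slice_ne h2 hh.1 hh.2
  have c2 : ContinuousOn (fun t => k1 (Q.b h - P.D Q.e' t) (P.z h t)) (Metric.ball 0 P.R) :=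
    P.continuousOn_slice_ne (P.continuousOn_k1
      (Q.continuousOn_b.sub (P.continuousOn_D_snd Q.e'))) hh.1 hh.2
  rw [← P.integral_χ_smul c0 c1
    fun t ht => P.hasLineDerivAt_k0 hh.1 Q.e' ht (Or.inl hh.2),
    ← integral_add (integrableOn_χ_smul c1) (integrableOn_χ_smul c2)]
  refine integral_congr_ae (Filter.Eventually.of_forall fun t => ?_)
  simp only
  rw [← smul_add, ← k1_add_left, add_sub_cancel]

theorem tendsto_truncated_k1 : Filter.Tendsto
    (fun ε : ℝ => ∫ t in Metric.ball 0 P.R \ Metric.ball 0 ε, P.χ t • k1 (Q.b 0) (P.ψ t)) (𝓝[>] 0)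
    (𝓝 Q.limK1) := by
  have hi := P.integrableOn_of_isBigO Q.continuousOn_k1_b_sub Q.isBigO_k1_b_sub
  simp only [Patch.z_zero] at hi
  refine ((P.tendsto_truncated_k1 Q.e').add
    (tendsto_integral_sdiff_ball P.R_pos hi)).congr' ?_
  filter_upwards [self_mem_nhdsWithin] with ε hε
  have c1 : ContinuousOn (fun t => k1 (P.D Q.e' t) (P.ψ t)) (Metric.ball 0 P.R \ {0}) := by
    have := P.continuousOn_zero_slice (P.continuousOn_k1 (P.continuousOn_D_snd Q.e'))
    simpa only [Patch.z_zero] using this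
  rw [← integral_add (integrableOn_χ_smul_sdiff hε c1) (hi.mono_set Set.sdiff_subset)]
  refine integral_congr_ae (Filter.Eventually.of_forall fun t => ?_)
  simp only
  rw [← smul_add, ← k1_add_left, add_sub_cancel]

/-- The affine part of the density: the integrals off the surface agree asymptotically with the
truncated ones, up to the divergence of the latter. -/
theorem exists_tendsto_affine (e : E2) (a₀ : ℂ) (A : E2 →L[ℝ] ℂ) : ∃ c v : ℂ,
    Filter.Tendsto (fun h : ℝ => ∫ t in Metric.ball 0 P.R,
      P.χ t • ((a₀ + A t) * k2 (Q.b h) (P.z h t) (P.D e t))) (𝓝[≠] 0) (𝓝 v) ∧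
    Filter.Tendsto (fun ε : ℝ => (∫ t in Metric.ball 0 P.R \ Metric.ball 0 ε,
      P.χ t • ((a₀ + A t) * k2 (Q.b 0) (P.ψ t) (P.D e t))) - ε⁻¹ • c) (𝓝[>] 0) (𝓝 v) := by
  obtain ⟨c, hc⟩ := P.exists_tendsto_truncated_k2 (Q.b 0) e
  -- `(a₀ + A) k2 = a₀ k2 + ∂_e (A k1) - (A e) k1`
  refine ⟨a₀ * c, _, (((Q.tendsto_height_k2 e).const_mul a₀).add
    (Q.tendsto_height_linear e A)).sub (Q.tendsto_height_k1.const_mul (A e)) |>.congr' ?_,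
    ((hc.const_mul a₀).add (P.tendsto_truncated_linear (Q.b 0) e Q.e' Q.b_zero A)).sub
    (Q.tendsto_truncated_k1.const_mul (A e)) |>.congr' ?_⟩
  · filter_upwards [P.eventually_small] with h hh
    have i1 := integrableOn_χ_smul (Q.continuousOn_slice_k1 hh.1 hh.2)
    have i2 := integrableOn_χ_smul (Q.continuousOn_slice_k2 e hh.1 hh.2)
    have i3 := integrableOn_χ_smul (Q.continuousOn_linear e A hh.1 hh.2)
    rw [integral_linear_combination i2 i3 i1]
    refine integral_congr_ae (Filter.Eventually.of_forall fun t => ?_)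
    simp only [Complex.real_smul]
    ring
  · have h1 := P.continuousOn_k1_ψ (Q.b 0)
    have h2 := P.continuousOn_k2_ψ (Q.b 0) e
    have h2' : ContinuousOn (fun t => A e * k1 (Q.b 0) (P.ψ t) +
        A t * k2 (Q.b 0) (P.ψ t) (P.D e t)) (Metric.ball 0 P.R \ {0}) :=
      (continuousOn_const.mul h1).add (A.continuous.continuousOn.mul h2)
    filter_upwards [self_mem_nhdsWithin] with ε hε
    have i1 := integrableOn_χ_smul_sdiff hε h1
    have i2 := integrableOn_χ_smul_sdiff hε h2
    have i3 := integrableOn_χ_smul_sdiff hε h2'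
    rw [mul_sub, mul_smul_comm, sub_add_eq_add_sub, sub_right_comm]
    congr 1
    rw [integral_linear_combination i2 i3 i1]
    refine integral_congr_ae (Filter.Eventually.of_forall fun t => ?_)
    simp only [Complex.real_smul]
    ring

end Patch.Direction

end PMLJump

namespace PMLJump
open MeasureTheory Asymptotics

/-! ### Densities that are differentiable at the base point -/

theorem hasDerivAt_k2 {S r : ℝ} {z : ℝ → C3} {z' : C3} (hz : HasDerivAt z z' r)
    (hd : z r ∈ dom S) (b D : C3) :
    HasDerivAt (fun r => k2 b (z r) D) (b ⬝ᵥ jac (Ks 0) (z r, D) z') r := by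
  have h1 : HasFDerivAt (Ks 0) ((fderiv ℂ (Ks 0) (z r, D)).restrictScalars ℝ) (z r, D) :=
    (((contDiffOn_Ks S 0).contDiffAt (((isOpen_dom S).prod isOpen_univ).mem_nhds
      (Set.mk_mem_prod hd (Set.mem_univ D)))).differentiableAt (by simp)).hasFDerivAt.restrictScalars
        ℝ
  have h2 := h1.comp_hasDerivAt r (hz.prodMk (hasDerivAt_const r D))
  have h3 := hasDerivAt_dot (hasDerivAt_const r b) h2
  refine h3.congr_deriv ?_
  rw [zero_dotProduct, zero_add]
  rfl

namespace Patch.Direction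

variable {P : Patch} (Q : P.Direction)

theorem exists_bound_k2 (e : E2) : ∃ c, 0 ≤ c ∧ ∀ v ∈ P.rset,
    ‖k2 (Q.b v.1) (P.z v.1 v.2) (P.D e v.2)‖ ≤ c * (Patch.d v)⁻¹ ^ 3 := by
  obtain ⟨c, hc⟩ := isBigO_principal.1 (P.isBigO_k2 Q.isBigO_b e)
  refine ⟨|c|, abs_nonneg c, fun v hv => (hc v hv).trans ?_⟩
  have hd : 0 ≤ Patch.d v := add_nonneg (abs_nonneg _) (norm_nonneg _)
  rw [mul_one, norm_pow, norm_inv, Real.norm_of_nonneg hd]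
  exact mul_le_mul_of_nonneg_right (le_abs_self c) (by positivity)

theorem exists_bound_zero (e : E2) : ∃ c, 0 ≤ c ∧ ∀ t ∈ Metric.ball (0 : E2) P.R, t ≠ 0 →
    ‖k2 (Q.b 0) (P.ψ t) (P.D e t)‖ ≤ c * ‖t‖⁻¹ ^ 3 := by
  obtain ⟨c, h0, hc⟩ := Q.exists_bound_k2 e
  refine ⟨c, h0, fun t ht h => ?_⟩
  simpa [Patch.d, Patch.z_zero] using hc (0, t) (P.mem_rset.2 ⟨P.abs_zero_le, ht, Or.inr h⟩)

/-- Away from the scale of the height, moving off the surface changes the kernel by one order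
less. -/
theorem exists_bound_sub (e : E2) : ∃ c, 0 ≤ c ∧ ∀ h t, |h| ≤ P.h₀ → t ∈ Metric.ball (0 : E2) P.R →
    h ≠ 0 → |h| ≤ ‖t‖ →
    ‖k2 (Q.b h) (P.z h t) (P.D e t) - k2 (Q.b 0) (P.ψ t) (P.D e t)‖ ≤ c * |h| * ‖t‖⁻¹ ^ 4 := by
  have hζ : (fun v : ℝ × E2 => deriv P.ζ v.1) =O[Filter.principal P.rset] fun _ => (1 : ℝ) :=
    isBigO_principal.2 ⟨P.C, fun v _ => by simpa using P.norm_deriv_ζ_le v.1⟩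
  obtain ⟨c₁, hc₁⟩ := isBigO_principal.1 (P.comparable.isBigO_jac_Ks (P.isBigO_D e) hζ P.d_le)
  obtain ⟨c₂, hc₂⟩ := isBigO_principal.1 (P.comparable.isBigO_Ks (P.isBigO_D e) P.d_le)
  obtain ⟨B, hB⟩ := isBigO_principal.1 Q.isBigO_b
  refine ⟨3 * |B| * |c₁| + 3 * |Q.L| * |c₂| * P.R, by have := P.R_pos; positivity,
    fun h t hh ht h0 hle => ?_⟩
  have ht0 : 0 < ‖t‖ := (abs_pos.2 h0).trans_le hle
  have ht1 : t ≠ 0 := norm_pos_iff.1 ht0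
  have htR : ‖t‖ < P.R := mem_ball_zero_iff.1 ht
  have hbh : ‖Q.b h‖ ≤ |B| := by
    have := hB (h, t) (P.mem_rset.2 ⟨hh, ht, Or.inr ht1⟩)
    simp only [norm_one, mul_one] at this
    exact this.trans (le_abs_self B)
  have i1 : ‖k2 (Q.b h) (P.z h t) (P.D e t) - k2 (Q.b h) (P.z 0 t) (P.D e t)‖ ≤
      3 * |B| * (|c₁| * ‖t‖⁻¹ ^ 4) * ‖h - 0‖ := by
    have hseg : ∀ s ∈ Set.uIcc 0 h, |s| ≤ P.h₀ := fun s hs => by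
      have := Set.abs_sub_left_of_mem_uIcc hs
      simp only [sub_zero] at this
      exact this.trans hh
    refine (convex_uIcc 0 h).norm_image_sub_le_of_norm_hasDerivWithin_le
      (f := fun s => k2 (Q.b h) (P.z s t) (P.D e t))
      (f' := fun s => Q.b h ⬝ᵥ jac (Ks 0) (P.z s t, P.D e t) (-deriv P.ζ s)) (fun s hs => ?_)
      (fun s hs => ?_) Set.left_mem_uIcc Set.right_mem_uIcc
    · have := (P.contDiff_ζ.differentiable (by simp) s).hasDerivAt.const_sub (P.ψ t)
      exact (hasDerivAt_k2 (S := P.S) (z := fun s => P.z s t) this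
        (P.z_mem_dom (hseg s hs) ht (Or.inr ht1)) _ _).hasDerivWithinAt
    · have h1 := hc₁ (s, t) (P.mem_rset.2 ⟨hseg s hs, ht, Or.inr ht1⟩)
      have h2 : ‖t‖ ≤ Patch.d (s, t) := by unfold Patch.d; linarith [abs_nonneg s]
      rw [norm_pow, norm_inv, Real.norm_of_nonneg (ht0.le.trans h2)] at h1
      rw [map_neg, dotProduct_neg, norm_neg]
      refine (norm_dotProduct_le _ _).trans ?_
      have h3 : ‖jac (Ks 0) (P.z s t, P.D e t) (deriv P.ζ s)‖ ≤ |c₁| * ‖t‖⁻¹ ^ 4 := by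
        have h4 := inv_nonneg.2 (ht0.le.trans h2)
        exact h1.trans (mul_le_mul (le_abs_self _)
          (pow_le_pow_left₀ h4 (inv_anti₀ ht0 h2) 4) (pow_nonneg h4 4) (abs_nonneg _))
      rw [mul_assoc]
      gcongr
  have i2 : ‖k2 (Q.b h) (P.z 0 t) (P.D e t) - k2 (Q.b 0) (P.z 0 t) (P.D e t)‖ ≤
      3 * (|Q.L| * |h|) * (|c₂| * ‖t‖⁻¹ ^ 3) := by
    have h1 := hc₂ (0, t) (P.mem_rset.2 ⟨P.abs_zero_le, ht, Or.inr ht1⟩)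
    simp only [Patch.d, abs_zero, zero_add, norm_pow, norm_inv, norm_norm] at h1
    rw [k2, k2, ← sub_dotProduct]
    refine (norm_dotProduct_le _ _).trans ?_
    have h2 : ‖Q.b h - Q.b 0‖ ≤ |Q.L| * |h| := (Q.norm_sub_le h hh).trans (by
      gcongr; exact le_abs_self _)
    have h3 := h1.trans (mul_le_mul_of_nonneg_right (le_abs_self c₂) (by positivity))
    rw [mul_assoc]
    gcongr
  rw [← P.z_zero t]
  have i3 : ‖t‖⁻¹ ^ 3 ≤ P.R * ‖t‖⁻¹ ^ 4 := by
    calc ‖t‖⁻¹ ^ 3 = ‖t‖ * ‖t‖⁻¹ ^ 4 := by field_simp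
      _ ≤ _ := by gcongr
  calc _ ≤ 3 * |B| * (|c₁| * ‖t‖⁻¹ ^ 4) * ‖h - 0‖ + 3 * (|Q.L| * |h|) * (|c₂| * ‖t‖⁻¹ ^ 3) := by
        rw [← sub_add_sub_cancel _ (k2 (Q.b h) (P.z 0 t) (P.D e t)) _]
        exact (norm_add_le _ _).trans (add_le_add i1 i2)
    _ ≤ 3 * |B| * (|c₁| * ‖t‖⁻¹ ^ 4) * ‖h - 0‖ +
        3 * (|Q.L| * |h|) * (|c₂| * (P.R * ‖t‖⁻¹ ^ 4)) := by gcongr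
    _ = _ := by rw [sub_zero, Real.norm_eq_abs]; ring

/-- The kernel at height `h` resembles the static kernel truncated at radius `|h|`. -/
theorem exists_bound_jump (e : E2) : ∃ c, 0 ≤ c ∧ ∀ h t, |h| ≤ P.h₀ →
    t ∈ Metric.ball (0 : E2) P.R → h ≠ 0 →
    ‖k2 (Q.b h) (P.z h t) (P.D e t) - (Metric.ball (0 : E2) |h|)ᶜ.indicator
      (fun t => k2 (Q.b 0) (P.ψ t) (P.D e t)) t‖ ≤ c * (|h| * (|h| + ‖t‖)⁻¹ ^ 4) := by
  obtain ⟨c₁, h₁, hc₁⟩ := Q.exists_bound_k2 e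
  obtain ⟨c₂, h₂, hc₂⟩ := Q.exists_bound_sub e
  refine ⟨2 * c₁ + 16 * c₂, by positivity, fun h t hh ht h0 => ?_⟩
  have hp : 0 < |h| := abs_pos.2 h0
  have hq : 0 ≤ |h| * (|h| + ‖t‖)⁻¹ ^ 4 := by positivity
  have hs : 0 < |h| + ‖t‖ := by positivity
  by_cases hlt : ‖t‖ < |h|
  · rw [Set.indicator_of_notMem (by simpa using hlt), sub_zero]
    refine (hc₁ (h, t) (P.mem_rset.2 ⟨hh, ht, Or.inl h0⟩)).trans ?_
    simp only [Patch.d]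
    have : (|h| + ‖t‖)⁻¹ ^ 3 ≤ 2 * (|h| * (|h| + ‖t‖)⁻¹ ^ 4) := by
      calc (|h| + ‖t‖)⁻¹ ^ 3 = (|h| + ‖t‖) * (|h| + ‖t‖)⁻¹ ^ 4 := by field_simp
        _ ≤ (2 * |h|) * (|h| + ‖t‖)⁻¹ ^ 4 := by gcongr; linarith
        _ = _ := by ring
    nlinarith [mul_le_mul_of_nonneg_left this h₁, mul_nonneg h₂ hq]
  · push Not at hlt
    rw [Set.indicator_of_mem (by simpa using hlt)]
    refine (hc₂ h t hh ht h0 hlt).trans ?_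
    have ht0 : 0 < ‖t‖ := hp.trans_le hlt
    have : ‖t‖⁻¹ ≤ 2 * (|h| + ‖t‖)⁻¹ := by
      rw [← div_eq_mul_inv, le_div_iff₀ hs, inv_mul_le_iff₀ ht0]; linarith
    have : ‖t‖⁻¹ ^ 4 ≤ (2 * (|h| + ‖t‖)⁻¹) ^ 4 := by gcongr
    rw [mul_pow] at this
    nlinarith [mul_le_mul_of_nonneg_left this (mul_nonneg h₂ hp.le), mul_nonneg h₁ hq]

end Patch.Direction

/-- A density on the parameter disc vanishing to first order at the origin. -/
structure Patch.Remainder (P : Patch) (r : E2 → ℂ) : Prop where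
  meas : AEStronglyMeasurable r (volume.restrict (Metric.ball 0 P.R))
  bound : ∃ C, ∀ t ∈ Metric.ball (0 : E2) P.R, ‖r t‖ ≤ C * ‖t‖
  small : r =o[𝓝 0] fun t => t

namespace Patch.Remainder

variable {P : Patch} {r : E2 → ℂ} (Q : P.Direction)

/-- Under the substitution `t = h s` the remainder is `o (|h|)`, and the kernel, including the
factor `h ^ 2` of the area, is `|h|⁻¹ (1 + ‖s‖)⁻⁴`. -/
theorem tendsto_integral (hr : P.Remainder r) : Filter.Tendsto (fun h : ℝ =>
    ∫ t in Metric.ball (0 : E2) P.R, ‖r t‖ * (|h| * (|h| + ‖t‖)⁻¹ ^ 4)) (𝓝[≠] 0) (𝓝 0) := by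
  obtain ⟨C, hC⟩ := hr.bound
  set f : E2 → ℝ := (Metric.ball (0 : E2) P.R).indicator fun t => ‖r t‖ with hf
  have hfm : AEStronglyMeasurable f :=
    (aestronglyMeasurable_indicator_iff Metric.isOpen_ball.measurableSet).2 hr.meas.norm
  have hfC : ∀ t, ‖f t‖ ≤ |C| * ‖t‖ := fun t => by
    by_cases ht : t ∈ Metric.ball (0 : E2) P.R
    · rw [hf, Set.indicator_of_mem ht, norm_norm]
      exact (hC t ht).trans (mul_le_mul_of_nonneg_right (le_abs_self C) (norm_nonneg _))
    · rw [hf, Set.indicator_of_notMem ht, norm_zero]; positivity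
  have key : ∀ h : ℝ, h ≠ 0 → ∫ t in Metric.ball (0 : E2) P.R, ‖r t‖ * (|h| * (|h| + ‖t‖)⁻¹ ^ 4) =
      ∫ s, (|h|⁻¹ * f (h • s)) * (1 + ‖s‖)⁻¹ ^ 4 := fun h h0 => by
    have hp : 0 < |h| := abs_pos.2 h0
    rw [← integral_indicator Metric.isOpen_ball.measurableSet]
    have h1 := Measure.integral_comp_smul (volume : Measure E2)
      (fun t => |h| * (f t * (|h| * (|h| + ‖t‖)⁻¹ ^ 4)) * |h|) h
    simp only [finrank_euclideanSpace, Fintype.card_fin, abs_inv, abs_pow, smul_eq_mul,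
      integral_const_mul, integral_mul_const, norm_smul, Real.norm_eq_abs] at h1
    have h2 : ∫ t, f t * (|h| * (|h| + ‖t‖)⁻¹ ^ 4) = |h| * (∫ t, f (h • t) *
        (|h| * (|h| + |h| * ‖t‖)⁻¹ ^ 4)) * |h| := by
      rw [h1]; field_simp; simp only [mul_comm]
    have h3 : ∀ t, (Metric.ball (0 : E2) P.R).indicator
        (fun t => ‖r t‖ * (|h| * (|h| + ‖t‖)⁻¹ ^ 4)) t = f t * (|h| * (|h| + ‖t‖)⁻¹ ^ 4) :=
      fun t => by rw [hf, Set.indicator_mul_left]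
    rw [integral_congr_ae (Filter.Eventually.of_forall h3), h2, ← integral_const_mul,
      ← integral_mul_const]
    refine integral_congr_ae (Filter.Eventually.of_forall fun t => ?_)
    have : (|h| + |h| * ‖t‖)⁻¹ = |h|⁻¹ * (1 + ‖t‖)⁻¹ := by rw [← mul_inv]; ring_nf
    simp only [this]
    field_simp
  have hlim : Filter.Tendsto (fun h : ℝ => ∫ s, (|h|⁻¹ * f (h • s)) * (1 + ‖s‖)⁻¹ ^ 4) (𝓝[≠] 0)
      (𝓝 (∫ _ : E2, 0)) := by
    refine tendsto_integral_filter_of_dominated_convergence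
      (fun s => |C| * (1 + ‖s‖) ^ (-3 : ℝ)) ?_ ?_ ?_ ?_
    · filter_upwards [self_mem_nhdsWithin] with h h0
      have h1 : AEStronglyMeasurable (fun s => f (h • s)) :=
        hfm.comp_quasiMeasurePreserving (Measure.quasiMeasurePreserving_smul volume h0)
      exact (h1.const_mul _).mul (by fun_prop)
    · filter_upwards [self_mem_nhdsWithin] with h h0
      refine Filter.Eventually.of_forall fun s => ?_
      have hp : 0 < |h| := abs_pos.2 h0
      have h1 := hfC (h • s)
      rw [norm_smul, Real.norm_eq_abs h] at h1
      have h2 : (1 + ‖s‖) ^ (-3 : ℝ) = (1 + ‖s‖) * (1 + ‖s‖)⁻¹ ^ 4 := by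
        rw [Real.rpow_neg (by positivity), show (3 : ℝ) = ((3 : ℕ) : ℝ) by norm_num,
          Real.rpow_natCast]
        field_simp
      rw [h2, norm_mul, norm_mul, norm_inv, Real.norm_eq_abs |h|, abs_abs, norm_pow, norm_inv,
        Real.norm_of_nonneg (show 0 ≤ 1 + ‖s‖ by positivity), ← mul_assoc]
      refine mul_le_mul_of_nonneg_right ?_ (by positivity)
      rw [inv_mul_le_iff₀ hp]
      refine h1.trans ?_
      have : 0 ≤ |C| * |h| := by positivity
      nlinarith
    · exact (integrable_one_add_norm (by simp; norm_num)).const_mul _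
    · refine Filter.Eventually.of_forall fun s => ?_
      have h1 : Filter.Tendsto (fun h : ℝ => h • s) (𝓝[≠] 0) (𝓝 0) := by
        have : Continuous fun h : ℝ => h • s := by fun_prop
        simpa using (this.tendsto 0).mono_left nhdsWithin_le_nhds
      have h2 : (fun h : ℝ => f (h • s)) =o[𝓝[≠] 0] fun h => h := by
        have h3 := hr.small.comp_tendsto h1
        have h4 : (fun h : ℝ => h • s) =O[𝓝[≠] 0] fun h : ℝ => h :=
          IsBigO.of_bound ‖s‖ (Filter.Eventually.of_forall fun h => by
            rw [norm_smul, mul_comm])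
        refine (h3.norm_left.trans_isBigO h4).congr' ?_ .rfl
        filter_upwards [h1 (Metric.isOpen_ball.mem_nhds P.zero_mem)] with h hh
        exact (Set.indicator_of_mem (s := Metric.ball (0 : E2) P.R) hh fun t => ‖r t‖).symm
      have h5 := (h2.norm_right.tendsto_div_nhds_zero).mul_const ((1 + ‖s‖)⁻¹ ^ 4)
      rw [zero_mul] at h5
      refine h5.congr fun h => ?_
      rw [Real.norm_eq_abs, div_eq_inv_mul]
  rw [integral_zero] at hlim
  refine hlim.congr' ?_
  filter_upwards [self_mem_nhdsWithin] with h h0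
  rw [key h h0]

theorem exists_bound (hr : P.Remainder r) : ∃ C, 0 ≤ C ∧
    ∀ t ∈ Metric.ball (0 : E2) P.R, ‖r t‖ ≤ C * ‖t‖ := by
  obtain ⟨C, hC⟩ := hr.bound
  exact ⟨|C|, abs_nonneg C, fun t ht => (hC t ht).trans
    (mul_le_mul_of_nonneg_right (le_abs_self C) (norm_nonneg _))⟩

theorem integrableOn_height (hr : P.Remainder r) (e : E2) {h : ℝ} (hh : |h| ≤ P.h₀) (h0 : h ≠ 0) :
    IntegrableOn (fun t => r t * k2 (Q.b h) (P.z h t) (P.D e t)) (Metric.ball 0 P.R) := by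
  obtain ⟨C, hC, hb⟩ := hr.exists_bound
  obtain ⟨c, hc, hk⟩ := Q.exists_bound_k2 e
  refine IntegrableOn.of_bound measure_ball_lt_top
    (hr.meas.mul ((Q.continuousOn_slice_k2 e hh h0).aestronglyMeasurable
      Metric.isOpen_ball.measurableSet)) (C * P.R * (c * |h|⁻¹ ^ 3)) ?_
  filter_upwards [ae_restrict_mem Metric.isOpen_ball.measurableSet] with t ht
  have h1 := hk (h, t) (P.mem_rset.2 ⟨hh, ht, Or.inl h0⟩)
  have hp := abs_pos.2 h0
  have h2 : |h| ≤ Patch.d (h, t) := by unfold Patch.d; linarith [norm_nonneg t]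
  have h3 : (Patch.d (h, t))⁻¹ ^ 3 ≤ |h|⁻¹ ^ 3 :=
    pow_le_pow_left₀ (inv_nonneg.2 (hp.le.trans h2)) (inv_anti₀ hp h2) 3
  have h4 : ‖t‖ ≤ P.R := (mem_ball_zero_iff.1 ht).le
  rw [norm_mul]
  exact mul_le_mul ((hb t ht).trans (by gcongr)) (h1.trans (by gcongr)) (norm_nonneg _)
    (mul_nonneg hC P.R_pos.le)

theorem aestronglyMeasurable_zero (hr : P.Remainder r) (e : E2) : AEStronglyMeasurable
    (fun t => r t * k2 (Q.b 0) (P.ψ t) (P.D e t)) (volume.restrict (Metric.ball 0 P.R)) :=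
  hr.meas.mul (aestronglyMeasurable_of_continuousOn (P.continuousOn_k2_ψ (Q.b 0) e))

theorem exists_bound_mul (hr : P.Remainder r) (e : E2) : ∃ c, 0 ≤ c ∧
    ∀ t ∈ Metric.ball (0 : E2) P.R, t ≠ 0 →
      ‖r t * k2 (Q.b 0) (P.ψ t) (P.D e t)‖ ≤ c * ‖t‖⁻¹ ^ 2 := by
  obtain ⟨C, hC, hb⟩ := hr.exists_bound
  obtain ⟨c, hc, hk⟩ := Q.exists_bound_zero e
  refine ⟨C * c, mul_nonneg hC hc, fun t ht h0 => ?_⟩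
  have := norm_pos_iff.2 h0
  rw [norm_mul]
  calc _ ≤ (C * ‖t‖) * (c * ‖t‖⁻¹ ^ 3) :=
        mul_le_mul (hb t ht) (hk t ht h0) (norm_nonneg _) (by positivity)
    _ = _ := by field_simp

theorem integrableOn_sdiff (hr : P.Remainder r) (e : E2) {ε : ℝ} (hε : 0 < ε) :
    IntegrableOn (fun t => r t * k2 (Q.b 0) (P.ψ t) (P.D e t))
      (Metric.ball 0 P.R \ Metric.ball 0 ε) := by
  obtain ⟨c, hc, hk⟩ := hr.exists_bound_mul Q e
  refine IntegrableOn.of_bound (measure_mono Set.sdiff_subset |>.trans_lt measure_ball_lt_top)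
    ((hr.aestronglyMeasurable_zero Q e).mono_set Set.sdiff_subset) (c * ε⁻¹ ^ 2) ?_
  filter_upwards [ae_restrict_mem (Metric.isOpen_ball.measurableSet.diff
    Metric.isOpen_ball.measurableSet)] with t ht
  have h1 : ε ≤ ‖t‖ := by simpa using ht.2
  refine (hk t ht.1 (norm_pos_iff.1 (hε.trans_le h1))).trans ?_
  gcongr

/-- Off the surface, the remainder sees the kernel truncated at the scale of the height. -/
theorem tendsto_jump (hr : P.Remainder r) (e : E2) : Filter.Tendsto (fun h : ℝ =>
    (∫ t in Metric.ball 0 P.R, r t * k2 (Q.b h) (P.z h t) (P.D e t)) -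
      ∫ t in Metric.ball 0 P.R \ Metric.ball 0 |h|, r t * k2 (Q.b 0) (P.ψ t) (P.D e t))
    (𝓝[≠] 0) (𝓝 0) := by
  obtain ⟨c, hc, hk⟩ := Q.exists_bound_jump e
  obtain ⟨C, hC, hb⟩ := hr.exists_bound
  have hlim := hr.tendsto_integral.const_mul c
  rw [mul_zero] at hlim
  refine squeeze_zero_norm' ?_ hlim
  filter_upwards [P.eventually_small] with h hh
  have hp := abs_pos.2 hh.2
  have hm : MeasurableSet ((Metric.ball (0 : E2) |h|)ᶜ) := Metric.isOpen_ball.measurableSet.compl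
  have i2 := hr.integrableOn_sdiff Q e hp
  rw [Set.sdiff_eq, Set.inter_comm, ← Measure.restrict_restrict hm, ← integral_indicator hm,
    ← integral_sub (hr.integrableOn_height Q e hh.1 hh.2), ← integral_const_mul]
  · refine norm_integral_le_of_norm_le (Integrable.const_mul ?_ c) ?_
    · have hmeas : AEStronglyMeasurable (fun t : E2 => |h| * (|h| + ‖t‖)⁻¹ ^ 4)
          (volume.restrict (Metric.ball 0 P.R)) := by fun_prop
      refine IntegrableOn.of_bound measure_ball_lt_top (hr.meas.norm.mul hmeas)
        (C * P.R * (|h| * |h|⁻¹ ^ 4)) ?_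
      filter_upwards [ae_restrict_mem Metric.isOpen_ball.measurableSet] with t ht
      have h4 : ‖t‖ ≤ P.R := (mem_ball_zero_iff.1 ht).le
      rw [norm_mul, norm_norm, Real.norm_of_nonneg (by positivity)]
      have : (|h| + ‖t‖)⁻¹ ≤ |h|⁻¹ := inv_anti₀ hp (by linarith [norm_nonneg t])
      exact mul_le_mul ((hb t ht).trans (by gcongr)) (by gcongr) (by positivity)
        (mul_nonneg hC P.R_pos.le)
    · filter_upwards [ae_restrict_mem Metric.isOpen_ball.measurableSet] with t ht
      have h1 := hk h t hh.1 ht hh.2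
      rw [Set.indicator_mul_right _ r, ← mul_sub, norm_mul, mul_left_comm]
      exact mul_le_mul_of_nonneg_left h1 (norm_nonneg _)
  · rw [integrable_indicator_iff hm, IntegrableOn, Measure.restrict_restrict hm, Set.inter_comm,
      ← Set.sdiff_eq]
    exact i2

/-- The truncated integral against a remainder is `o (1 / ε)`. -/
theorem tendsto_smul_truncated (hr : P.Remainder r) (e : E2) : Filter.Tendsto (fun ε : ℝ =>
    ε • ∫ t in Metric.ball 0 P.R \ Metric.ball 0 ε, r t * k2 (Q.b 0) (P.ψ t) (P.D e t))
    (𝓝[>] 0) (𝓝 0) := by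
  obtain ⟨c, hc, hk⟩ := hr.exists_bound_mul Q e
  have hm : ∀ ε : ℝ, MeasurableSet ((Metric.ball (0 : E2) ε)ᶜ) :=
    fun _ => Metric.isOpen_ball.measurableSet.compl
  have key : Filter.Tendsto (fun ε : ℝ => ∫ t in Metric.ball (0 : E2) P.R,
      ε • (Metric.ball (0 : E2) ε)ᶜ.indicator
        (fun t => r t * k2 (Q.b 0) (P.ψ t) (P.D e t)) t) (𝓝[>] 0)
      (𝓝 (∫ t in Metric.ball (0 : E2) P.R, 0)) := by
    refine tendsto_integral_filter_of_dominated_convergence (fun t => c * ‖t‖⁻¹) ?_ ?_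
      ((integrableOn_ball_norm_inv P.R).const_mul c) ?_
    · exact Filter.Eventually.of_forall fun ε =>
        ((hr.aestronglyMeasurable_zero Q e).indicator (hm ε)).const_smul ε
    · filter_upwards [self_mem_nhdsWithin] with ε hε
      have hε' : 0 < ε := hε
      filter_upwards [ae_ball_ne_zero P.R] with t ht
      have ht0 : 0 < ‖t‖ := norm_pos_iff.2 ht.2
      by_cases h : ‖t‖ < ε
      · rw [Set.indicator_of_notMem (by simpa using h), smul_zero, norm_zero]; positivity
      · push Not at h
        rw [Set.indicator_of_mem (by simpa using h), norm_smul, Real.norm_of_nonneg hε'.le]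
        calc _ ≤ ‖t‖ * (c * ‖t‖⁻¹ ^ 2) :=
              mul_le_mul h (hk t ht.1 ht.2) (norm_nonneg _) ht0.le
          _ = _ := by field_simp
    · refine Filter.Eventually.of_forall fun t => ?_
      refine squeeze_zero_norm' (a := fun ε : ℝ => ε * ‖r t * k2 (Q.b 0) (P.ψ t) (P.D e t)‖) ?_ ?_
      · filter_upwards [self_mem_nhdsWithin] with ε hε
        rw [norm_smul, Real.norm_of_nonneg (le_of_lt hε)]
        exact mul_le_mul_of_nonneg_left (norm_indicator_le_norm_self _ _) (le_of_lt hε)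
      · have : Continuous fun ε : ℝ => ε * ‖r t * k2 (Q.b 0) (P.ψ t) (P.D e t)‖ := by fun_prop
        simpa using (this.tendsto 0).mono_left nhdsWithin_le_nhds
  rw [integral_zero] at key
  refine key.congr fun ε => ?_
  rw [integral_smul, integral_indicator (hm ε), Measure.restrict_restrict (hm ε), Set.inter_comm,
    ← Set.sdiff_eq]

theorem tendsto_truncated (hr : P.Remainder r) (e : E2) {β H : ℝ} (hβ : 0 < β)
    (hH : ∀ᶠ t in 𝓝 (0 : E2), ‖r t‖ ≤ H * ‖t‖ ^ (1 + β)) : Filter.Tendsto (fun ε : ℝ =>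
    ∫ t in Metric.ball 0 P.R \ Metric.ball 0 ε, r t * k2 (Q.b 0) (P.ψ t) (P.D e t))
    (𝓝[>] 0) (𝓝 (∫ t in Metric.ball 0 P.R, r t * k2 (Q.b 0) (P.ψ t) (P.D e t))) := by
  obtain ⟨ρ, hρ, hρ'⟩ := Metric.eventually_nhds_iff_ball.1 hH
  obtain ⟨c, hc, hk⟩ := Q.exists_bound_zero e
  refine tendsto_integral_sdiff_ball P.R_pos ?_
  have h1 : IntegrableOn (fun t => r t * k2 (Q.b 0) (P.ψ t) (P.D e t))
      (Metric.ball 0 P.R ∩ Metric.ball 0 ρ) := by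
    refine Integrable.mono' (((integrableOn_ball_norm_rpow (s := β - 2) (by linarith) P.R).mono_set
      Set.inter_subset_left).const_mul (|H| * c))
      ((hr.aestronglyMeasurable_zero Q e).mono_set Set.inter_subset_left) ?_
    filter_upwards [ae_restrict_mem (Metric.isOpen_ball.measurableSet.inter
      Metric.isOpen_ball.measurableSet), ae_restrict_of_ae
      (compl_mem_ae_iff.2 (measure_singleton (0 : E2)))] with t ht ht0
    have ht1 : 0 < ‖t‖ := norm_pos_iff.2 ht0
    have h2 := hρ' t ht.2
    have h3 : ‖t‖ ^ (β - 2) = ‖t‖ ^ (1 + β) * ‖t‖⁻¹ ^ 3 := by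
      rw [inv_pow, ← Real.rpow_natCast, ← Real.rpow_neg ht1.le, ← Real.rpow_add ht1]
      congr 1; push_cast; ring
    rw [norm_mul, h3]
    calc _ ≤ (|H| * ‖t‖ ^ (1 + β)) * (c * ‖t‖⁻¹ ^ 3) :=
          mul_le_mul (h2.trans (by gcongr; exact le_abs_self H)) (hk t ht.1 ht0) (norm_nonneg _)
            (by positivity)
      _ = _ := by ring
  have h2 := h1.union (hr.integrableOn_sdiff Q e hρ)
  rwa [Set.inter_union_sdiff] at h2

end Patch.Remainder

/-- Away from its first order expansion, cut off at the patch, a bounded density differentiable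
at the origin is a remainder. -/
theorem Patch.remainder_sub (P : Patch) {α : E2 → ℂ} {A : E2 →L[ℝ] ℂ} {M : ℝ}
    (hm : AEStronglyMeasurable α (volume.restrict (Metric.ball 0 P.R)))
    (hb : ∀ t ∈ Metric.ball (0 : E2) P.R, ‖α t‖ ≤ M) (hA : HasFDerivAt α A 0) :
    P.Remainder fun t => α t - P.χ t • (α 0 + A t) := by
  have hχ : P.χ =ᶠ[𝓝 0] 1 := P.χ.eventuallyEq_one
  have hsm : (fun t => α t - P.χ t • (α 0 + A t)) =o[𝓝 0] fun t => t := by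
    have h1 := hA.isLittleO
    simp only [sub_zero] at h1
    refine h1.congr' ?_ .rfl
    filter_upwards [hχ] with t ht
    rw [ht, Pi.one_apply, one_smul, sub_sub]
  refine ⟨hm.sub (Continuous.aestronglyMeasurable ?_), ?_, hsm⟩
  · exact P.χ.continuous.smul (continuous_const.add A.continuous)
  · obtain ⟨ρ, hρ, hρ'⟩ := Metric.eventually_nhds_iff_ball.1 (hsm.def one_pos)
    set B := |M| + (‖α 0‖ + ‖A‖ * P.R) with hB
    have hR := P.R_pos
    refine ⟨1 + B / ρ, fun t ht => ?_⟩
    by_cases h : t ∈ Metric.ball (0 : E2) ρ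
    · refine (hρ' t h).trans ?_
      have : 0 ≤ B / ρ * ‖t‖ := by positivity
      linarith
    · have h1 : ρ ≤ ‖t‖ := by simpa using h
      have h2 : ‖α t - P.χ t • (α 0 + A t)‖ ≤ B := by
        refine (norm_sub_le _ _).trans (add_le_add ((hb t ht).trans (le_abs_self M)) ?_)
        rw [norm_smul, Real.norm_of_nonneg P.χ.nonneg]
        have h3 : ‖α 0 + A t‖ ≤ ‖α 0‖ + ‖A‖ * P.R := (norm_add_le _ _).trans (by
          gcongr
          exact (A.le_opNorm t).trans (by gcongr; exact (mem_ball_zero_iff.1 ht).le))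
        calc _ ≤ 1 * ‖α 0 + A t‖ := mul_le_mul_of_nonneg_right P.χ.le_one (norm_nonneg _)
          _ ≤ _ := by rwa [one_mul]
      refine h2.trans ?_
      have h4 : B ≤ B / ρ * ‖t‖ := by
        rw [div_mul_eq_mul_div, le_div_iff₀ hρ]
        gcongr
      linarith [norm_nonneg t]

namespace Patch.Direction

variable {P : Patch} (Q : P.Direction)

theorem integral_split_zero (e : E2) {α r : E2 → ℂ} {a₀ : ℂ} {A : E2 →L[ℝ] ℂ}
    (hr : P.Remainder r) (hα : ∀ t, α t = P.χ t • (a₀ + A t) + r t) {ε : ℝ} (hε : 0 < ε) :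
    ∫ t in Metric.ball 0 P.R \ Metric.ball 0 ε, α t * k2 (Q.b 0) (P.ψ t) (P.D e t) =
      (∫ t in Metric.ball 0 P.R \ Metric.ball 0 ε,
        P.χ t • ((a₀ + A t) * k2 (Q.b 0) (P.ψ t) (P.D e t))) +
      ∫ t in Metric.ball 0 P.R \ Metric.ball 0 ε, r t * k2 (Q.b 0) (P.ψ t) (P.D e t) := by
  have c1 : ContinuousOn (fun t => (a₀ + A t) * k2 (Q.b 0) (P.ψ t) (P.D e t))
      (Metric.ball 0 P.R \ {0}) :=
    (continuous_const.add A.continuous).continuousOn.mul (P.continuousOn_k2_ψ _ e)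
  rw [← integral_add (integrableOn_χ_smul_sdiff hε c1) (hr.integrableOn_sdiff Q e hε)]
  refine integral_congr_ae (Filter.Eventually.of_forall fun t => ?_)
  simp only [hα, add_mul, smul_mul_assoc]

theorem integral_split (e : E2) {α r : E2 → ℂ} {a₀ : ℂ} {A : E2 →L[ℝ] ℂ}
    (hr : P.Remainder r) (hα : ∀ t, α t = P.χ t • (a₀ + A t) + r t) {h : ℝ} (hh : |h| ≤ P.h₀)
    (h0 : h ≠ 0) :
    ∫ t in Metric.ball 0 P.R, α t * k2 (Q.b h) (P.z h t) (P.D e t) =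
      (∫ t in Metric.ball 0 P.R, P.χ t • ((a₀ + A t) * k2 (Q.b h) (P.z h t) (P.D e t))) +
      ∫ t in Metric.ball 0 P.R, r t * k2 (Q.b h) (P.z h t) (P.D e t) := by
  have c1 : ContinuousOn (fun t => (a₀ + A t) * k2 (Q.b h) (P.z h t) (P.D e t))
      (Metric.ball 0 P.R) :=
    (continuous_const.add A.continuous).continuousOn.mul (Q.continuousOn_slice_k2 e hh h0)
  rw [← integral_add (integrableOn_χ_smul c1) (hr.integrableOn_height Q e hh h0)]
  refine integral_congr_ae (Filter.Eventually.of_forall fun t => ?_)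
  simp only [hα, add_mul, smul_mul_assoc]

theorem exists_jump_of_remainder (e : E2) {α r : E2 → ℂ} {a₀ : ℂ} {A : E2 →L[ℝ] ℂ}
    (hr : P.Remainder r) (hα : ∀ t, α t = P.χ t • (a₀ + A t) + r t) : ∃ c : ℂ,
    Filter.Tendsto (fun h : ℝ =>
      (∫ t in Metric.ball 0 P.R, α t * k2 (Q.b h) (P.z h t) (P.D e t)) -
      ((∫ t in Metric.ball 0 P.R \ Metric.ball 0 |h|, α t * k2 (Q.b 0) (P.ψ t) (P.D e t)) -
        |h|⁻¹ • c)) (𝓝[≠] 0) (𝓝 0) ∧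
    Filter.Tendsto (fun ε : ℝ => ε •
      ∫ t in Metric.ball 0 P.R \ Metric.ball 0 ε, α t * k2 (Q.b 0) (P.ψ t) (P.D e t))
      (𝓝[>] 0) (𝓝 c) ∧
    ((∃ β > (0 : ℝ), ∃ H : ℝ, ∀ᶠ t in 𝓝 (0 : E2), ‖r t‖ ≤ H * ‖t‖ ^ ((1 : ℝ) + β)) →
      ∃ v : ℂ, Filter.Tendsto (fun ε : ℝ =>
        (∫ t in Metric.ball 0 P.R \ Metric.ball 0 ε, α t * k2 (Q.b 0) (P.ψ t) (P.D e t)) -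
          ε⁻¹ • c) (𝓝[>] 0) (𝓝 v)) := by
  obtain ⟨c, v, h1, h2⟩ := Q.exists_tendsto_affine e a₀ A
  have habs : Filter.Tendsto (fun h : ℝ => |h|) (𝓝[≠] 0) (𝓝[>] 0) := by
    refine tendsto_nhdsWithin_iff.2 ⟨?_, ?_⟩
    · simpa using ((continuous_abs (G := ℝ)).tendsto 0).mono_left nhdsWithin_le_nhds
    · filter_upwards [self_mem_nhdsWithin] with h hh using abs_pos.2 hh
  have hid : Filter.Tendsto (fun ε : ℝ => (ε : ℂ)) (𝓝[>] 0) (𝓝 0) := by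
    simpa using (Complex.continuous_ofReal.tendsto 0).mono_left nhdsWithin_le_nhds
  refine ⟨c, ?_, ?_, ?_⟩
  · have h3 := (h1.sub (h2.comp habs)).add (hr.tendsto_jump Q e)
    rw [sub_self, zero_add] at h3
    refine h3.congr' ?_
    filter_upwards [P.eventually_small] with h hh
    simp only [Function.comp]
    rw [Q.integral_split e hr hα hh.1 hh.2, Q.integral_split_zero e hr hα (abs_pos.2 hh.2)]
    abel
  · have h4 := (hid.mul h2).add (hr.tendsto_smul_truncated Q e) |>.add_const c
    rw [zero_mul, add_zero, zero_add] at h4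
    refine h4.congr' ?_
    filter_upwards [self_mem_nhdsWithin] with ε hε
    have hε' : (ε : ℂ) ≠ 0 := by exact_mod_cast (ne_of_gt hε)
    rw [Q.integral_split_zero e hr hα hε]
    simp only [Complex.real_smul, Complex.ofReal_inv]
    rw [mul_sub, mul_inv_cancel_left₀ hε', mul_add]
    abel
  · rintro ⟨β, hβ, H, hH⟩
    refine ⟨_, (h2.add (hr.tendsto_truncated Q e hβ hH)).congr' ?_⟩
    filter_upwards [self_mem_nhdsWithin] with ε hε
    rw [Q.integral_split_zero e hr hα hε]
    abel

/-- The off-surface integral of the static double curl kernel against a density differentiable at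
the base point follows the truncated integral, freed of its divergence `c / ε`; for a Hölder
continuously differentiable density both converge. -/
theorem exists_jump (e : E2) {α : E2 → ℂ} {A : E2 →L[ℝ] ℂ} {M : ℝ}
    (hm : AEStronglyMeasurable α (volume.restrict (Metric.ball 0 P.R)))
    (hb : ∀ t ∈ Metric.ball (0 : E2) P.R, ‖α t‖ ≤ M) (hA : HasFDerivAt α A 0) : ∃ c : ℂ,
    Filter.Tendsto (fun h : ℝ =>
      (∫ t in Metric.ball 0 P.R, α t * k2 (Q.b h) (P.z h t) (P.D e t)) -
      ((∫ t in Metric.ball 0 P.R \ Metric.ball 0 |h|, α t * k2 (Q.b 0) (P.ψ t) (P.D e t)) -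
        |h|⁻¹ • c)) (𝓝[≠] 0) (𝓝 0) ∧
    Filter.Tendsto (fun ε : ℝ => ε •
      ∫ t in Metric.ball 0 P.R \ Metric.ball 0 ε, α t * k2 (Q.b 0) (P.ψ t) (P.D e t))
      (𝓝[>] 0) (𝓝 c) ∧
    ((∃ β > (0 : ℝ), ∃ H : ℝ, ∀ᶠ t in 𝓝 (0 : E2), ‖α t - α 0 - A t‖ ≤ H * ‖t‖ ^ ((1 : ℝ) + β)) →
      ∃ v : ℂ, Filter.Tendsto (fun ε : ℝ =>
        (∫ t in Metric.ball 0 P.R \ Metric.ball 0 ε, α t * k2 (Q.b 0) (P.ψ t) (P.D e t)) -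
          ε⁻¹ • c) (𝓝[>] 0) (𝓝 v)) := by
  obtain ⟨c, h1, h2, h3⟩ := Q.exists_jump_of_remainder e (P.remainder_sub hm hb hA)
    fun t => (add_sub_cancel _ _).symm
  refine ⟨c, h1, h2, ?_⟩
  rintro ⟨β, hβ, H, hH⟩
  refine h3 ⟨β, hβ, H, ?_⟩
  filter_upwards [hH, P.χ.eventuallyEq_one] with t ht ht'
  rwa [ht', Pi.one_apply, one_smul, ← sub_sub]

end Patch.Direction

end PMLJump

namespace PMLJump
open MeasureTheory Asymptotics

/-! ### The interface near one of its points, in stretched coordinates -/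

/-- A bounded function that is differentiable at a point satisfies a global Lipschitz estimate
based at this point. -/
theorem exists_lipschitz_at {E F : Type*} [NormedAddCommGroup E] [NormedSpace ℝ E]
    [NormedAddCommGroup F] [NormedSpace ℝ F] {f : E → F} {s : Set E} {x₀ : E} {B : ℝ}
    (hf : DifferentiableWithinAt ℝ f s x₀) (hx : x₀ ∈ s) (hb : ∀ y ∈ s, ‖f y‖ ≤ B) :
    ∃ L, 0 ≤ L ∧ ∀ y ∈ s, ‖f y - f x₀‖ ≤ L * ‖y - x₀‖ := by
  obtain ⟨C, hC⟩ := hf.hasFDerivWithinAt.isBigO_sub.bound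
  obtain ⟨ρ, hρ, hρ'⟩ := Metric.mem_nhdsWithin_iff.1 hC
  have hB : 0 ≤ B := (norm_nonneg _).trans (hb x₀ hx)
  refine ⟨|C| + 2 * B / ρ, by positivity, fun y hy => ?_⟩
  have h0 := norm_nonneg (y - x₀)
  by_cases h : y ∈ Metric.ball x₀ ρ
  · have h1 : ‖f y - f x₀‖ ≤ C * ‖y - x₀‖ := hρ' ⟨h, hy⟩
    have h2 : 0 ≤ 2 * B / ρ * ‖y - x₀‖ := by positivity
    nlinarith [mul_le_mul_of_nonneg_right (le_abs_self C) h0]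
  · have h1 : ρ ≤ ‖y - x₀‖ := by simpa [dist_eq_norm] using h
    have h2 : ‖f y - f x₀‖ ≤ 2 * B := (norm_sub_le _ _).trans (by linarith [hb y hy, hb x₀ hx])
    have h3 : 2 * B ≤ 2 * B / ρ * ‖y - x₀‖ := by
      rw [div_mul_eq_mul_div, le_div_iff₀ hρ]; gcongr
    have h4 : 0 ≤ |C| * ‖y - x₀‖ := by positivity
    linarith

/-- The complexification of real vectors. -/
noncomputable def toC : E3 →L[ℝ] C3 :=
  ContinuousLinearMap.pi fun l => Complex.ofRealCLM.comp (EuclideanSpace.proj l)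

theorem toC_apply (v : E3) (l : Fin 3) : toC v l = (v l : ℂ) := rfl

theorem norm_toC_le (v : E3) : ‖toC v‖ ≤ ‖v‖ :=
  (pi_norm_le_iff_of_nonneg (norm_nonneg v)).2 fun l => by
    rw [toC_apply, Complex.norm_real]
    exact PiLp.norm_apply_le v l

namespace PML

variable (p : PML)

theorem fderiv_X_eq (x v : E3) : fderiv ℝ p.X x v = p.β x * toC v := p.fderiv_X x v

theorem exists_lipschitz_β {x₀ : E3} (hx : x₀ ∈ p.box) :
    ∃ L, 0 ≤ L ∧ ∀ y, ‖p.β y - p.β x₀‖ ≤ L * ‖y - x₀‖ := by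
  have h1 : DifferentiableWithinAt ℝ p.β Set.univ x₀ :=
    (((contDiffOn_β (p := p)).contDiffAt (p.isOpen_box.mem_nhds hx)).differentiableAt
      (by simp)).differentiableWithinAt
  obtain ⟨L, hL, h⟩ := exists_lipschitz_at h1 (Set.mem_univ _) fun y _ => p.norm_β_le y
  exact ⟨L, hL, fun y => h y (Set.mem_univ y)⟩

/-- The second order Taylor estimate of the coordinate stretching. -/
theorem exists_X_taylor {x₀ : E3} (hx : x₀ ∈ p.box) : ∃ L, 0 ≤ L ∧ ∀ x y,
    ‖p.X x - p.X y - p.β x₀ * toC (x - y)‖ ≤ L * (‖x - x₀‖ + ‖y - x₀‖) * ‖x - y‖ := by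
  obtain ⟨L, hL, hβ⟩ := p.exists_lipschitz_β hx
  refine ⟨L, hL, fun x y => ?_⟩
  set r := ‖x - x₀‖ + ‖y - x₀‖ with hr
  have hx' : x ∈ Metric.closedBall x₀ r := by
    rw [mem_closedBall_iff_norm]; linarith [norm_nonneg (y - x₀)]
  have hy' : y ∈ Metric.closedBall x₀ r := by
    rw [mem_closedBall_iff_norm]; linarith [norm_nonneg (x - x₀)]
  have := (convex_closedBall x₀ r).norm_image_sub_le_of_norm_hasFDerivWithin_le
    (f := fun v => p.X v - p.β x₀ * toC v)
    (f' := fun u => fderiv ℝ p.X u - (ContinuousLinearMap.mul ℝ C3 (p.β x₀)).comp toC)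
    (C := L * r) (fun u _ => ((p.hasFDerivAt_X u).sub
      ((ContinuousLinearMap.mul ℝ C3 (p.β x₀)).comp toC).hasFDerivAt).hasFDerivWithinAt)
    (fun u hu => ContinuousLinearMap.opNorm_le_bound _ (by positivity) fun v => by
      rw [sub_apply, fderiv_X_eq, ContinuousLinearMap.comp_apply,
        ContinuousLinearMap.mul_apply', ← sub_mul]
      have h1 : ‖u - x₀‖ ≤ r := mem_closedBall_iff_norm.1 hu
      exact (norm_mul_le _ _).trans (mul_le_mul ((hβ u).trans (by gcongr)) (norm_toC_le v)
        (norm_nonneg _) (by positivity))) hy' hx'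
  refine (le_of_eq ?_).trans this
  rw [map_sub, mul_sub]
  congr 1; abel

end PML

section Normal

variable {a : Fin 3 → ℝ} (M : LayeredMedium a) (x₀ : E3)

/-- The point at height `-h` over `x₀` on the normal line of the interface. -/
noncomputable def normalPt (h : ℝ) : E3 := x₀ - h • M.ν x₀

theorem normalPt_zero : normalPt M x₀ 0 = x₀ := by simp [normalPt]

theorem continuous_normalPt : Continuous (normalPt M x₀) := by unfold normalPt; fun_prop

theorem hasDerivAt_normalPt (h : ℝ) : HasDerivAt (normalPt M x₀) (-M.ν x₀) h := by
  have h1 := ((hasDerivAt_id h).smul_const (M.ν x₀)).const_sub x₀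
  rw [one_smul] at h1
  exact h1

variable {M x₀}

theorem norm_normalPt_sub (hx : x₀ ∈ M.Γ) (h : ℝ) : ‖normalPt M x₀ h - x₀‖ = |h| := by
  simp [normalPt, norm_smul, M.norm_ν hx]

namespace GraphChart

variable (c : GraphChart M x₀)

theorem abs_f_le {t : E2} (ht : t ∈ Metric.ball (0 : E2) c.R) : |c.f t| ≤ ‖t‖ / 2 := by
  have h1 := c.norm_f_le t ht
  have h2 : ‖t‖ < c.R := mem_ball_zero_iff.1 ht
  have h3 : c.C * ‖t‖ ≤ 1 / 2 :=
    (mul_le_mul_of_nonneg_left h2.le c.C_nonneg).trans c.small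
  nlinarith [norm_nonneg t]

theorem norm_fderiv_f_le {t : E2} (ht : t ∈ Metric.ball (0 : E2) c.R) :
    ‖fderiv ℝ c.f t‖ ≤ 1 / 2 :=
  (c.norm_fderiv_le t ht).trans ((mul_le_mul_of_nonneg_left (mem_ball_zero_iff.1 ht).le
    c.C_nonneg).trans c.small)

theorem norm_b_two : ‖c.b 2‖ = 1 := c.b.orthonormal.1 2

theorem norm_le_norm_Y_sub (t : E2) : ‖t‖ ≤ ‖c.Y t - x₀‖ := by
  have := c.norm_Y_sub_sq t 0
  rw [c.Y_zero, sub_zero] at this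
  exact (sq_le_sq₀ (norm_nonneg _) (norm_nonneg _)).1 (by nlinarith [sq_nonneg (c.f t - c.f 0)])

theorem norm_Y_sub_le {t : E2} (ht : t ∈ Metric.ball (0 : E2) c.R) :
    ‖c.Y t - x₀‖ ≤ 3 / 2 * ‖t‖ := by
  rw [Y_sub]
  refine (norm_add_le _ _).trans ?_
  rw [norm_emb, norm_smul, c.norm_b_two, Real.norm_eq_abs, mul_one]
  linarith [c.abs_f_le ht]

/-- Near the base point, the interface stays transversal to its normal line. -/
theorem normal_separation {t : E2} (ht : t ∈ Metric.ball (0 : E2) c.R) (h : ℝ) :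
    |h| + 3 / 2 * ‖t‖ ≤ 3 * ‖normalPt M x₀ h - c.Y t‖ := by
  have h1 : c.Y t - normalPt M x₀ h = emb c.b t + (c.f t + h) • c.b 2 := by
    rw [add_smul, ← add_assoc, ← c.Y_sub, normalPt, c.frame_two]; abel
  have h2 := norm_emb_add_sq c.b t (c.f t + h)
  rw [norm_sub_rev, h1]
  set N := ‖emb c.b t + (c.f t + h) • c.b 2‖
  have hN : 0 ≤ N := norm_nonneg _
  have h3 : ‖t‖ ≤ N := (sq_le_sq₀ (norm_nonneg _) hN).1 (by nlinarith [sq_nonneg (c.f t + h)])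
  have h4 : |c.f t + h| ≤ N := abs_le_of_sq_le_sq (by nlinarith [sq_nonneg ‖t‖]) hN
  have h5 : |h| ≤ |c.f t + h| + |c.f t| := by
    have := abs_sub (c.f t + h) (c.f t)
    rwa [add_sub_cancel_left] at this
  linarith [c.abs_f_le ht]

theorem exists_dist_le : ∃ ρ, 0 < ρ ∧ ∀ y, y ∉ c.V → ρ ≤ ‖x₀ - y‖ := by
  obtain ⟨ρ, hρ, h⟩ := Metric.isOpen_iff.1 c.isOpen_V x₀ c.mem_V
  refine ⟨ρ, hρ, fun y hy => ?_⟩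
  by_contra hlt
  push Not at hlt
  exact hy (h (by rwa [mem_ball_iff_norm, norm_sub_rev]))

end GraphChart

theorem exists_normal_separation (hx : x₀ ∈ M.Γ) : ∃ h₀ > 0, ∀ h, |h| ≤ h₀ → ∀ y ∈ M.Γ,
    |h| + ‖x₀ - y‖ ≤ 3 * ‖normalPt M x₀ h - y‖ := by
  obtain ⟨c, -⟩ := M.exists_graphChart hx isOpen_univ (Set.mem_univ x₀)
  obtain ⟨ρ, hρ, hV⟩ := c.exists_dist_le
  refine ⟨ρ / 4, by positivity, fun h hh y hy => ?_⟩
  by_cases hyV : y ∈ c.V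
  · obtain ⟨t, ht, rfl⟩ := c.mem_iff.1 ⟨hy, hyV⟩
    have h1 := c.normal_separation ht h
    have h2 := c.norm_Y_sub_le ht
    rw [norm_sub_rev] at h2
    linarith
  · have h1 := hV y hyV
    have h2 := norm_sub_norm_le (x₀ - y) (x₀ - normalPt M x₀ h)
    rw [sub_sub_sub_cancel_left, norm_sub_rev x₀ (normalPt M x₀ h), norm_normalPt_sub hx,
      norm_sub_rev] at h2
    rw [norm_sub_rev] at h2
    have h3 : ‖normalPt M x₀ h - y‖ ≥ ‖x₀ - y‖ - |h| := by
      linarith [norm_sub_rev (normalPt M x₀ h) y, h2]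
    linarith

/-- The interface is tangent to first order to its tangent plane. -/
theorem exists_tangency (hx : x₀ ∈ M.Γ) : ∃ C, 0 ≤ C ∧ ∀ y ∈ M.Γ,
    |inner ℝ (M.ν x₀) (x₀ - y)| ≤ C * ‖x₀ - y‖ ^ 2 := by
  obtain ⟨c, -⟩ := M.exists_graphChart hx isOpen_univ (Set.mem_univ x₀)
  obtain ⟨ρ, hρ, hV⟩ := c.exists_dist_le
  refine ⟨c.C + ρ⁻¹, add_nonneg c.C_nonneg (by positivity), fun y hy => ?_⟩
  have h0 := c.C_nonneg
  by_cases hyV : y ∈ c.V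
  · obtain ⟨t, ht, rfl⟩ := c.mem_iff.1 ⟨hy, hyV⟩
    have h1 : inner ℝ (M.ν x₀) (x₀ - c.Y t) = -c.f t := by
      rw [← neg_sub, inner_neg_right, c.Y_sub, ← c.frame_two, inner_two_emb_add]
    have h2 := c.norm_le_norm_Y_sub t
    rw [h1, abs_neg, norm_sub_rev]
    refine (c.norm_f_le t ht).trans ?_
    have : 0 ≤ ρ⁻¹ * ‖c.Y t - x₀‖ ^ 2 := by positivity
    have : c.C * ‖t‖ ^ 2 ≤ c.C * ‖c.Y t - x₀‖ ^ 2 := by gcongr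
    linarith
  · have h1 := hV y hyV
    have h2 := abs_real_inner_le_norm (M.ν x₀) (x₀ - y)
    rw [M.norm_ν hx, one_mul] at h2
    have h3 : ‖x₀ - y‖ ≤ ρ⁻¹ * ‖x₀ - y‖ ^ 2 := by
      rw [pow_two, ← mul_assoc, inv_mul_eq_div]
      exact le_mul_of_one_le_left (norm_nonneg _) ((one_le_div hρ).2 h1)
    have : 0 ≤ c.C * ‖x₀ - y‖ ^ 2 := by positivity
    linarith

end Normal

namespace GraphChart

variable {p : PML} {M : LayeredMedium p.a} {x₀ : E3} (c : GraphChart M x₀)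

theorem Y_mem {t : E2} (ht : t ∈ Metric.ball (0 : E2) c.R) : c.Y t ∈ M.Γ ∩ c.V :=
  c.mem_iff.2 ⟨t, ht, rfl⟩

theorem mem_Γ {a : Fin 3 → ℝ} {M : LayeredMedium a} (c : GraphChart M x₀) : x₀ ∈ M.Γ := by
  have := (c.mem_iff.2 ⟨0, Metric.mem_ball_self c.R_pos, rfl⟩).1
  rwa [c.Y_zero] at this

theorem fderiv_Y_apply {t : E2} (e : E2) :
    (emb c.b + (fderiv ℝ c.f t).smulRight (c.b 2)) e = emb c.b e + fderiv ℝ c.f t e • c.b 2 := rfl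

theorem norm_tangent_le {t : E2} (ht : t ∈ Metric.ball (0 : E2) c.R) (e : E2) :
    ‖emb c.b e + fderiv ℝ c.f t e • c.b 2‖ ≤ 3 / 2 * ‖e‖ := by
  refine (norm_add_le _ _).trans ?_
  rw [norm_emb, norm_smul, c.norm_b_two, mul_one]
  have := ((fderiv ℝ c.f t).le_opNorm e).trans
    (mul_le_mul_of_nonneg_right (c.norm_fderiv_f_le ht) (norm_nonneg e))
  linarith

theorem hasFDerivAt_X_Y {t : E2} (ht : t ∈ Metric.ball (0 : E2) c.R) :
    HasFDerivAt (fun t => p.X (c.Y t) - p.X x₀) ((fderiv ℝ p.X (c.Y t)).comp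
      (emb c.b + (fderiv ℝ c.f t).smulRight (c.b 2))) t :=
  ((p.hasFDerivAt_X (c.Y t)).comp t (c.hasFDerivAt_Y ht)).sub_const _

theorem fderiv_X_Y {t : E2} (ht : t ∈ Metric.ball (0 : E2) c.R) (e : E2) :
    fderiv ℝ (fun t => p.X (c.Y t) - p.X x₀) t e =
      p.β (c.Y t) * toC (emb c.b e + fderiv ℝ c.f t e • c.b 2) := by
  rw [(c.hasFDerivAt_X_Y ht).fderiv, ContinuousLinearMap.comp_apply, p.fderiv_X_eq, fderiv_Y_apply]

theorem zero_mem_ball : (0 : E2) ∈ Metric.ball (0 : E2) c.R := Metric.mem_ball_self c.R_pos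

theorem fderiv_X_Y_zero (e : E2) :
    fderiv ℝ (fun t => p.X (c.Y t) - p.X x₀) 0 e = p.β x₀ * toC (emb c.b e) := by
  rw [c.fderiv_X_Y c.zero_mem_ball, c.Y_zero, c.fderiv_zero]
  simp

/-- The constant of the Lipschitz estimate for the stretching factors. -/
noncomputable def lipβ (hV : c.V ⊆ p.box) : ℝ := (p.exists_lipschitz_β (hV c.mem_V)).choose

theorem lipβ_nonneg (hV : c.V ⊆ p.box) : 0 ≤ c.lipβ hV :=
  (p.exists_lipschitz_β (hV c.mem_V)).choose_spec.1

theorem norm_β_sub_le (hV : c.V ⊆ p.box) (y : E3) :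
    ‖p.β y - p.β x₀‖ ≤ c.lipβ hV * ‖y - x₀‖ :=
  (p.exists_lipschitz_β (hV c.mem_V)).choose_spec.2 y

/-- The patch that a graph chart inside the box defines. -/
noncomputable def patch (hV : c.V ⊆ p.box) : Patch where
  S := p.S
  R := c.R
  h₀ := 1
  κ := 1 / 9
  C := (1 + p.S) * 2 + 3 * c.lipβ hV + (1 + p.S) * c.C
  ζ h := p.X (normalPt M x₀ h) - p.X x₀
  ψ t := p.X (c.Y t) - p.X x₀
  R_pos := c.R_pos
  h₀_pos := one_pos
  κ_pos := by norm_num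
  C_nonneg := by
    have := p.S_pos; have := c.lipβ_nonneg hV; have := c.C_nonneg; positivity
  contDiffOn_ψ := by
    refine ContDiffOn.sub ?_ contDiffOn_const
    have h1 : ContDiffOn ℝ 2 p.X p.box := contDiffOn_pi.2 fun l =>
      (p.contDiffOn_stretch (l := l)).comp
        (EuclideanSpace.proj l : E3 →L[ℝ] ℝ).contDiff.contDiffOn
        fun x hx => abs_lt.1 (hx l)
    exact h1.comp c.contDiffOn_Y fun t ht => hV (c.Y_mem ht).2
  ψ_zero := by simp [c.Y_zero]
  contDiff_ζ := by
    refine ContDiff.sub (p.contDiff_X.comp ?_) contDiff_const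
    unfold normalPt
    fun_prop
  ζ_zero := by simp [normalPt_zero]
  lower h t _ ht := by
    have h1 := p.re_rot_mul_dot (c.Y t) (normalPt M x₀ h)
    have h2 := c.normal_separation ht h
    rw [norm_sub_rev] at h2
    rw [sub_sub_sub_cancel_right]
    refine le_trans ?_ h1
    have h3 : |h| + ‖t‖ ≤ 3 * ‖c.Y t - normalPt M x₀ h‖ := by linarith [norm_nonneg t]
    have h4 := pow_le_pow_left₀ (by positivity) h3 2
    linarith
  norm_ζ_le h := by
    have := p.S_pos; have := c.lipβ_nonneg hV; have := c.C_nonneg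
    have h1 := p.norm_X_sub_le (normalPt M x₀ h) x₀
    rw [norm_normalPt_sub c.mem_Γ] at h1
    have h4 : 0 ≤ 3 * c.lipβ hV + (1 + p.S) * c.C := by positivity
    exact h1.trans (mul_le_mul_of_nonneg_right (by linarith) (abs_nonneg h))
  norm_deriv_ζ_le h := by
    have := p.S_pos; have := c.lipβ_nonneg hV; have := c.C_nonneg
    have h1 := ((p.hasFDerivAt_X (normalPt M x₀ h)).comp_hasDerivAt h
      (hasDerivAt_normalPt M x₀ h)).sub_const (p.X x₀)
    rw [p.fderiv_X_eq] at h1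
    have h2 : ‖toC (-M.ν x₀)‖ ≤ 1 := (norm_toC_le _).trans (by rw [norm_neg, M.norm_ν c.mem_Γ])
    have h3 : ‖p.β (normalPt M x₀ h) * toC (-M.ν x₀)‖ ≤ (1 + p.S) * 1 :=
      (norm_mul_le _ _).trans (mul_le_mul (p.norm_β_le _) h2 (norm_nonneg _) (by positivity))
    have h4 : 0 ≤ 3 * c.lipβ hV + (1 + p.S) * c.C := by positivity
    refine (le_of_eq ?_).trans (h3.trans (by linarith))
    exact congrArg _ h1.deriv
  norm_ψ_le t ht := by
    have := p.S_pos; have := c.lipβ_nonneg hV; have := c.C_nonneg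
    refine (p.norm_X_sub_le _ _).trans ?_
    have h1 := mul_le_mul_of_nonneg_left (c.norm_Y_sub_le ht) (by positivity : 0 ≤ 1 + p.S)
    have h2 : 0 ≤ (3 * c.lipβ hV + (1 + p.S) * c.C) * ‖t‖ := by positivity
    have h3 : 0 ≤ (1 + p.S) * ‖t‖ := by positivity
    linarith
  norm_fderiv_le t ht := by
    have := p.S_pos; have := c.lipβ_nonneg hV; have := c.C_nonneg
    refine ContinuousLinearMap.opNorm_le_bound _ (by positivity) fun e => ?_
    rw [c.fderiv_X_Y ht]
    refine (norm_mul_le _ _).trans ((mul_le_mul (p.norm_β_le _) ((norm_toC_le _).trans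
      (c.norm_tangent_le ht e)) (norm_nonneg _) (by positivity)).trans ?_)
    have h2 : 0 ≤ (3 * c.lipβ hV + (1 + p.S) * c.C) * ‖e‖ := by positivity
    have h3 : 0 ≤ (1 + p.S) * ‖e‖ := by positivity
    linarith
  norm_fderiv_sub_le t ht := by
    have := p.S_pos; have := c.lipβ_nonneg hV; have := c.C_nonneg
    refine ContinuousLinearMap.opNorm_le_bound _ (by positivity) fun e => ?_
    rw [sub_apply, c.fderiv_X_Y ht, c.fderiv_X_Y_zero]
    have e1 : p.β (c.Y t) * toC (emb c.b e + fderiv ℝ c.f t e • c.b 2) - p.β x₀ * toC (emb c.b e) =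
        (p.β (c.Y t) - p.β x₀) * toC (emb c.b e + fderiv ℝ c.f t e • c.b 2) +
          p.β x₀ * toC (fderiv ℝ c.f t e • c.b 2) := by
      rw [map_add]; ring
    have h1 : ‖p.β (c.Y t) - p.β x₀‖ ≤ c.lipβ hV * (3 / 2 * ‖t‖) :=
      (c.norm_β_sub_le hV _).trans (by gcongr; exact c.norm_Y_sub_le ht)
    have h2 : ‖toC (fderiv ℝ c.f t e • c.b 2)‖ ≤ c.C * ‖t‖ * ‖e‖ := by
      refine (norm_toC_le _).trans ?_
      rw [norm_smul, c.norm_b_two, mul_one]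
      exact ((fderiv ℝ c.f t).le_opNorm e).trans
        (mul_le_mul_of_nonneg_right (c.norm_fderiv_le t ht) (norm_nonneg e))
    have h3 : ‖toC (emb c.b e + fderiv ℝ c.f t e • c.b 2)‖ ≤ 3 / 2 * ‖e‖ :=
      (norm_toC_le _).trans (c.norm_tangent_le ht e)
    rw [e1]
    have h4 := p.norm_β_le x₀
    calc _ ≤ c.lipβ hV * (3 / 2 * ‖t‖) * (3 / 2 * ‖e‖) + (1 + p.S) * (c.C * ‖t‖ * ‖e‖) := by
          refine (norm_add_le _ _).trans (add_le_add ((norm_mul_le _ _).trans ?_)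
            ((norm_mul_le _ _).trans ?_)) <;> gcongr
      _ ≤ _ := by
          have h5 : 0 ≤ c.lipβ hV * (‖t‖ * ‖e‖) := by positivity
          have h6 : 0 ≤ (1 + p.S) * (‖t‖ * ‖e‖) := by positivity
          linarith

/-- The direction that a tangent vector at the base point defines: it is stretched by the factors
at the point where the field is evaluated. -/
noncomputable def direction (hV : c.V ⊆ p.box) (e' : E2) : (c.patch hV).Direction where
  e' := e'
  b h := p.β (normalPt M x₀ h) * toC (emb c.b e')
  L := c.lipβ hV * ‖e'‖
  continuous_b := ((continuous_β p).comp (continuous_normalPt M x₀)).mul continuous_const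
  b_zero := by rw [normalPt_zero]; exact (c.fderiv_X_Y_zero e').symm
  norm_sub_le h _ := by
    rw [normalPt_zero, ← sub_mul]
    have h1 := c.norm_β_sub_le hV (normalPt M x₀ h)
    rw [norm_normalPt_sub c.mem_Γ] at h1
    refine (norm_mul_le _ _).trans ((mul_le_mul h1 ((norm_toC_le _).trans (norm_emb c.b e').le)
      (norm_nonneg _) (mul_nonneg (c.lipβ_nonneg hV) (abs_nonneg h))).trans (le_of_eq (by ring)))

end GraphChart

end PMLJump

namespace PMLJump
open MeasureTheory Asymptotics

/-! ### Weakly singular integrals over the truncated interface -/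

section WeaklySingular

variable {p : PML} {M : LayeredMedium p.a} {x₀ : E3}

theorem euclideanHausdorffMeasure_singleton (x : E3) : (μHE[2] : Measure E3) {x} = 0 := by
  have : (μH[2] : Measure E3) {x} = 0 :=
    (Measure.nullSingletonClass_hausdorff E3 (by norm_num : (0 : ℝ) < 2)).measure_singleton x
  rw [Measure.euclideanHausdorffMeasure_def, Measure.smul_apply]
  simp [this]

theorem ae_sμ_ne (x : E3) : ∀ᵐ y ∂(sμ p M), y ≠ x :=
  ae_restrict_of_ae (compl_mem_ae_iff.2 (euclideanHausdorffMeasure_singleton x))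

theorem exists_chart_box (hx : x₀ ∈ Γb p M) : ∃ c : GraphChart M x₀, c.V ⊆ p.box :=
  M.exists_graphChart hx.1 p.isOpen_box hx.2

theorem GraphChart.inter_V_subset {c : GraphChart M x₀} (hV : c.V ⊆ p.box) :
    M.Γ ∩ c.V ⊆ Γb p M := Set.inter_subset_inter_right _ hV

theorem GraphChart.Γb_inter_V {c : GraphChart M x₀} (hV : c.V ⊆ p.box) :
    Γb p M ∩ c.V = M.Γ ∩ c.V := by
  rw [Γb, Set.inter_assoc, Set.inter_eq_right.2 hV]

theorem integrable_norm_inv (hx : x₀ ∈ Γb p M) :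
    Integrable (fun y => ‖x₀ - y‖⁻¹) (sμ p M) := by
  obtain ⟨c, hV⟩ := exists_chart_box hx
  obtain ⟨ρ, hρ, hfar⟩ := c.exists_dist_le
  have hm : Measurable fun y : E3 => ‖x₀ - y‖⁻¹ := by fun_prop
  have h1 : IntegrableOn (fun y => ‖x₀ - y‖⁻¹) (M.Γ ∩ c.V) (μHE[2] : Measure E3) := by
    rw [c.integrableOn_iff hm.aestronglyMeasurable]
    refine Integrable.mono' ((integrableOn_ball_norm_inv c.R).const_mul 2)
      (c.measurable_w.aestronglyMeasurable.smul
        (c.aestronglyMeasurable_comp_Y hm.aestronglyMeasurable)) ?_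
    filter_upwards [ae_ball_ne_zero c.R] with t ht
    have h0 : 0 < ‖t‖ := norm_pos_iff.2 ht.2
    have h2 := c.norm_le_norm_Y_sub t
    rw [norm_sub_rev] at h2
    rw [norm_smul, norm_inv, norm_norm, Real.norm_of_nonneg (c.w_nonneg t)]
    exact mul_le_mul (c.w_le_two ht.1) (inv_anti₀ h0 h2) (by positivity) (by norm_num)
  have h2 : IntegrableOn (fun y => ‖x₀ - y‖⁻¹) (Γb p M \ c.V) (μHE[2] : Measure E3) := by
    refine IntegrableOn.of_bound ((measure_mono Set.sdiff_subset).trans_lt ?_)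
      hm.aestronglyMeasurable ρ⁻¹ ?_
    · have : sμ p M Set.univ < ⊤ := measure_lt_top _ _
      rwa [sμ, Measure.restrict_apply_univ] at this
    · filter_upwards [ae_restrict_mem ((measurableSet_Γb p M).diff c.isOpen_V.measurableSet)]
        with y hy
      rw [norm_inv, norm_norm]
      exact inv_anti₀ hρ (hfar y hy.2)
  rw [← c.Γb_inter_V hV] at h1
  have h3 := h1.union h2
  rwa [Set.inter_union_sdiff] at h3

/-- Passage to the limit in weakly singular integrals, as a parameter tends to zero and as a
shrinking ball is removed. -/
theorem tendsto_integral_sμ {F : Type*} [NormedAddCommGroup F] [NormedSpace ℝ F]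
    {g : ℝ → E3 → F} {h₀ C : ℝ} (hx : x₀ ∈ Γb p M) (h₀_pos : 0 < h₀)
    (hm : ∀ h, |h| ≤ h₀ → AEStronglyMeasurable (g h) (sμ p M))
    (hb : ∀ h, |h| ≤ h₀ → ∀ y ∈ Γb p M, y ≠ x₀ → ‖g h y‖ ≤ C * ‖x₀ - y‖⁻¹)
    (hc : ∀ y ∈ Γb p M, y ≠ x₀ → Filter.Tendsto (fun h => g h y) (𝓝 0) (𝓝 (g 0 y))) :
    Integrable (g 0) (sμ p M) ∧
    Filter.Tendsto (fun h => ∫ y, g h y ∂(sμ p M)) (𝓝 0) (𝓝 (∫ y, g 0 y ∂(sμ p M))) ∧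
    Filter.Tendsto (fun ε => ∫ y in (Metric.ball x₀ ε)ᶜ, g 0 y ∂(sμ p M)) (𝓝[>] 0)
      (𝓝 (∫ y, g 0 y ∂(sμ p M))) := by
  have hi := (integrable_norm_inv hx).const_mul C
  have h0 : |(0 : ℝ)| ≤ h₀ := by simpa using h₀_pos.le
  have hh : ∀ᶠ h in 𝓝 (0 : ℝ), |h| ≤ h₀ := by
    have : ∀ᶠ h in 𝓝 (0 : ℝ), |h| < h₀ :=
      continuous_abs.continuousAt.eventually_lt continuousAt_const (by simpa using h₀_pos)
    exact this.mono fun _ h => h.le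
  have hae : ∀ᵐ y ∂(sμ p M), y ∈ Γb p M ∧ y ≠ x₀ := ae_sμ.and (ae_sμ_ne x₀)
  refine ⟨hi.mono' (hm 0 h0) ?_, ?_, ?_⟩
  · filter_upwards [hae] with y hy using hb 0 h0 y hy.1 hy.2
  · refine tendsto_integral_filter_of_dominated_convergence _ (hh.mono fun h => hm h) ?_ hi ?_
    · filter_upwards [hh] with h hh
      filter_upwards [hae] with y hy using hb h hh y hy.1 hy.2
    · filter_upwards [hae] with y hy using hc y hy.1 hy.2
  · have hms : ∀ ε : ℝ, MeasurableSet (Metric.ball x₀ ε)ᶜ :=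
      fun ε => Metric.isOpen_ball.measurableSet.compl
    simp_rw [← integral_indicator (hms _)]
    refine tendsto_integral_filter_of_dominated_convergence _
      (Filter.Eventually.of_forall fun ε => (hm 0 h0).indicator (hms ε)) ?_ hi ?_
    · refine Filter.Eventually.of_forall fun ε => ?_
      filter_upwards [hae] with y hy
      exact (norm_indicator_le_norm_self _ _).trans (hb 0 h0 y hy.1 hy.2)
    · filter_upwards [hae] with y hy
      have hy' : 0 < dist y x₀ := dist_pos.2 hy.2
      refine tendsto_const_nhds.congr' ?_
      filter_upwards [nhdsWithin_le_nhds (Iio_mem_nhds hy')] with ε hε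
      rw [Set.indicator_of_mem]
      simpa using le_of_lt hε

variable (p M x₀)

/-- The pairs of a small height and a point of the truncated interface other than the base
point. -/
def nset (h₀ : ℝ) : Set (ℝ × E3) := {v | |v.1| ≤ h₀ ∧ v.2 ∈ Γb p M ∧ v.2 ≠ x₀}

/-- The argument of the kernels, between a point of the normal line and a point of the
interface. -/
noncomputable def nZ (v : ℝ × E3) : C3 := p.X (normalPt M x₀ v.1) - p.X v.2

/-- The size of `nZ`. -/
noncomputable def nd (v : ℝ × E3) : ℝ := |v.1| + ‖x₀ - v.2‖

variable {p M x₀}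

theorem mem_nset {h₀ : ℝ} {v : ℝ × E3} :
    v ∈ nset p M x₀ h₀ ↔ |v.1| ≤ h₀ ∧ v.2 ∈ Γb p M ∧ v.2 ≠ x₀ := Iff.rfl

theorem nd_pos {h : ℝ} {y : E3} (hy : y ≠ x₀) : 0 < nd x₀ (h, y) := by
  have := norm_pos_iff.2 (sub_ne_zero.2 hy.symm)
  unfold nd; positivity

/-- The geometric data of the normal line at a point of the truncated interface. -/
theorem exists_comparable (hx : x₀ ∈ Γb p M) : ∃ h₀ D : ℝ, 0 < h₀ ∧
    (∀ h, |h| ≤ h₀ → h ≠ 0 → normalPt M x₀ h ∉ Γc p M) ∧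
    (∀ᶠ v in Filter.principal (nset p M x₀ h₀), nd x₀ v ≤ D) ∧
    Comparable p.S (1 / 9) (Filter.principal (nset p M x₀ h₀)) (nZ p M x₀) (nd x₀) := by
  obtain ⟨h₀, hh₀, hsep⟩ := exists_normal_separation hx.1
  obtain ⟨D, hD⟩ := (isCompact_Γc p M).isBounded.exists_norm_le
  have hS := p.S_pos
  refine ⟨h₀, h₀ + (‖x₀‖ + D), hh₀, fun h hh h0 hmem => ?_, ?_, by norm_num, ?_, ?_, ?_⟩
  · have h1 := hsep h hh _ hmem.1
    rw [sub_self, norm_zero, mul_zero] at h1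
    have := abs_pos.2 h0
    linarith [norm_nonneg (x₀ - normalPt M x₀ h)]
  · refine Filter.eventually_principal.2 fun v hv => ?_
    have h1 := (mem_nset.1 hv).1
    have h2 := hD v.2 (Γb_subset_Γc p M (mem_nset.1 hv).2.1)
    unfold nd
    linarith [norm_sub_le x₀ v.2]
  · exact Filter.eventually_principal.2 fun v hv => nd_pos (h := v.1) (mem_nset.1 hv).2.2
  · refine Filter.eventually_principal.2 fun v hv => ?_
    have hv' := mem_nset.1 hv
    have h1 := hsep v.1 hv'.1 v.2 hv'.2.1.1
    refine le_trans ?_ (p.re_rot_mul_dot (normalPt M x₀ v.1) v.2)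
    have h2 := pow_le_pow_left₀ (nd_pos (h := v.1) hv'.2.2).le h1 2
    change 1 / 9 * nd x₀ (v.1, v.2) ^ 2 ≤ _
    linarith
  · refine isBigO_principal.2 ⟨1 + p.S, fun v hv => ?_⟩
    refine (p.norm_X_sub_le _ _).trans ?_
    rw [Real.norm_of_nonneg (nd_pos (h := v.1) (mem_nset.1 hv).2.2).le]
    gcongr
    have := norm_sub_le (normalPt M x₀ v.1 - x₀) (v.2 - x₀)
    rw [sub_sub_sub_cancel_right, norm_normalPt_sub hx.1, norm_sub_rev v.2] at this
    exact this

theorem continuousAt_kernel {F : Type*} [TopologicalSpace F] {K : C3 × C3 → F}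
    (hK : ContinuousOn K (dom p.S ×ˢ Set.univ)) {y : E3} (hy : y ≠ x₀) (w : C3) :
    ContinuousAt (fun h => K (nZ p M x₀ (h, y), w)) 0 := by
  have h1 : nZ p M x₀ (0, y) ∈ dom p.S := by
    rw [nZ, normalPt_zero]; exact p.X_sub_mem_dom hy.symm
  have h2 : ContinuousAt K (nZ p M x₀ (0, y), w) :=
    hK.continuousAt (((isOpen_dom p.S).prod isOpen_univ).mem_nhds
      (Set.mk_mem_prod h1 (Set.mem_univ w)))
  have h3 : Continuous fun h : ℝ => (nZ p M x₀ (h, y), w) := by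
    have h4 : Continuous fun h : ℝ => p.X (normalPt M x₀ h) :=
      p.contDiff_X.continuous.comp (continuous_normalPt M x₀)
    have h5 : Continuous fun h : ℝ => nZ p M x₀ (h, y) :=
      h4.sub (continuous_const (y := p.X y))
    exact h5.prodMk continuous_const
  exact ContinuousAt.comp (g := K) (f := fun h : ℝ => (nZ p M x₀ (h, y), w)) h2 h3.continuousAt

theorem aestronglyMeasurable_nZ {F : Type*} [TopologicalSpace F]
    [TopologicalSpace.PseudoMetrizableSpace F] {K : C3 × C3 → F}
    (hK : ContinuousOn K (dom p.S ×ˢ Set.univ)) {m : E3 → C3}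
    (hm : AEStronglyMeasurable m (sμ p M)) (h : ℝ) :
    AEStronglyMeasurable (fun y => K (nZ p M x₀ (h, y), m y)) (sμ p M) := by
  refine aestronglyMeasurable_kernel p (x := normalPt M x₀ h) hK hm ?_
  filter_upwards [ae_sμ_ne (p := p) (M := M) (normalPt M x₀ h)] with y hy using hy.symm

end WeaklySingular

end PMLJump

namespace PMLJump
open MeasureTheory Asymptotics

/-! ### The single curl: reduction to a scalar model integral -/

/-- The map `w ↦ n × (b w)`, where `b` multiplies componentwise. -/
noncomputable def traceCL (n : E3) (b : C3) : C3 →L[ℂ] C3 :=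
  LinearMap.toContinuousLinearMap ((crossProduct (toC n)).comp (LinearMap.mulLeft ℂ b))

theorem traceCL_apply (n : E3) (b w : C3) : traceCL n b w = toC n ⨯₃ (b * w) := rfl

theorem mul_cross_mul (b v w : C3) :
    b * ((b * v) ⨯₃ (b * w)) = (b 0 * b 1 * b 2) • (v ⨯₃ w) := by
  ext i
  fin_cases i <;> simp [cross_apply] <;> ring

theorem cross_cross_of_orthogonal (n v w : C3) (h : n ⬝ᵥ w = 0) :
    n ⨯₃ (v ⨯₃ w) = -(n ⬝ᵥ v) • w := by
  simp only [dotProduct, Fin.sum_univ_three] at h ⊢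
  ext i
  fin_cases i
  · simp [cross_apply]; linear_combination v 0 * h
  · simp [cross_apply]; linear_combination v 1 * h
  · simp [cross_apply]; linear_combination v 2 * h

theorem toC_dot_toC (v w : E3) : toC v ⬝ᵥ toC w = ((inner ℝ v w : ℝ) : ℂ) := by
  simp [dotProduct, toC_apply, Fin.sum_univ_three, PiLp.inner_apply, mul_comm]

section SingleCurl

variable {p : PML} {M : LayeredMedium p.a} {x₀ : E3} {φ : E3 → C3} {h₀ D : ℝ}

theorem Kker_eq (k : ℂ) (φ : E3 → C3) {y : E3} (hy : y ≠ x₀) :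
    Kker p M k φ x₀ y = traceCL (M.ν x₀) (p.β x₀) (Kd k (p.X x₀ - p.X y, dens p φ y)) := by
  rw [Kker, p.scurl_Phi k hy.symm, p.B_mulVec, p.B_mulVec]
  rfl

theorem Nker_eq (k : ℂ) (φ : E3 → C3) {y : E3} (hy : y ≠ x₀) :
    Nker p M k φ x₀ y = traceCL (M.ν x₀) (p.β x₀) (Ks k (p.X x₀ - p.X y, dens p φ y)) := by
  rw [Nker, p.scurl_scurl_Phi k hy.symm, p.B_mulVec, p.B_mulVec]
  rfl

theorem IsDensity.exists_lipschitz (hφ : IsDensity p M φ) (hx : x₀ ∈ Γb p M) :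
    ∃ L, 0 ≤ L ∧ ∀ y ∈ Γb p M, ‖φ y - φ x₀‖ ≤ L * ‖y - x₀‖ := by
  obtain ⟨R, -, hR⟩ := hφ.exists_bound
  exact exists_lipschitz_at ((hφ.contDiffOn x₀ hx).differentiableWithinAt (by simp)) hx hR

/-- The tangential trace of the curl kernel without its scalar factor, freed of its part that is
not weakly singular. -/
noncomputable def curlRem (p : PML) (M : LayeredMedium p.a) (x₀ : E3) (φ : E3 → C3)
    (v : ℝ × E3) : C3 :=
  traceCL (M.ν x₀) (p.β (normalPt M x₀ v.1)) (nZ p M x₀ v ⨯₃ dens p φ v.2) -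
    ((v.1 : ℂ) * p.J x₀) • φ x₀

theorem isBigO_snd_nd (hD : ∀ᶠ v in Filter.principal (nset p M x₀ h₀), nd x₀ v ≤ D) :
    (fun _ => (1 : ℝ)) =O[Filter.principal (nset p M x₀ h₀)] fun v => (nd x₀ v)⁻¹ := by
  refine IsBigO.of_bound |D| ?_
  filter_upwards [hD, Filter.eventually_mem_principal _] with v h1 h2
  have h3 := nd_pos (h := v.1) (mem_nset.1 h2).2.2
  change 0 < nd x₀ v at h3
  rw [norm_one, norm_inv, Real.norm_of_nonneg h3.le, ← div_eq_mul_inv, one_le_div h3]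
  exact h1.trans (le_abs_self D)

theorem IsDensity.isBigO_curlRem (hφ : IsDensity p M φ) (hx : x₀ ∈ Γb p M)
    (hcmp : Comparable p.S (1 / 9) (Filter.principal (nset p M x₀ h₀)) (nZ p M x₀) (nd x₀)) :
    curlRem p M x₀ φ =O[Filter.principal (nset p M x₀ h₀)] fun v => nd x₀ v ^ 2 := by
  set l := Filter.principal (nset p M x₀ h₀) with hl
  obtain ⟨L₁, hL₁, hβ⟩ := p.exists_lipschitz_β hx.2
  obtain ⟨L₂, hL₂, hX⟩ := p.exists_X_taylor hx.2
  obtain ⟨L₃, hL₃, hφL⟩ := hφ.exists_lipschitz hx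
  obtain ⟨R, hR0, hR⟩ := hφ.exists_bound
  obtain ⟨Rd, hRd0, hRd⟩ := hφ.exists_bound_dens
  obtain ⟨L₄, hL₄, hν⟩ := exists_tangency hx.1
  have hS := p.S_pos
  have hpos : ∀ v ∈ nset p M x₀ h₀, 0 < nd x₀ v := fun v hv =>
    nd_pos (h := v.1) (mem_nset.1 hv).2.2
  have hy_le : ∀ v ∈ nset p M x₀ h₀, ‖v.2 - x₀‖ ≤ nd x₀ v := fun v _ => by
    rw [norm_sub_rev]; unfold nd; linarith [abs_nonneg v.1]
  have hx_le : ∀ v ∈ nset p M x₀ h₀, ‖normalPt M x₀ v.1 - x₀‖ ≤ nd x₀ v := fun v _ => by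
    rw [norm_normalPt_sub hx.1]; unfold nd; linarith [norm_nonneg (x₀ - v.2)]
  have hxy_le : ∀ v ∈ nset p M x₀ h₀, ‖normalPt M x₀ v.1 - v.2‖ ≤ nd x₀ v := fun v _ => by
    have := norm_sub_le (normalPt M x₀ v.1 - x₀) (v.2 - x₀)
    rw [sub_sub_sub_cancel_right, norm_normalPt_sub hx.1, norm_sub_rev v.2] at this
    exact this
  -- the frozen data: the factors and the density at the base point, the unstretched argument
  set z' : ℝ × E3 → C3 := fun v => p.β x₀ * toC (normalPt M x₀ v.1 - v.2) with hz'
  set w₀ : C3 := p.β x₀ * φ x₀ with hw₀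
  have o1 : (fun v => nZ p M x₀ v - z' v) =O[l] fun v => nd x₀ v * nd x₀ v := by
    refine isBigO_principal.2 ⟨L₂ * 2, fun v hv => (hX _ _).trans ?_⟩
    have h0 := hpos v hv
    rw [Real.norm_of_nonneg (by positivity)]
    calc _ ≤ L₂ * (nd x₀ v + nd x₀ v) * nd x₀ v := by
          have := hx_le v hv; have := hy_le v hv; have := hxy_le v hv
          gcongr
      _ = _ := by ring
  have o2 : z' =O[l] nd x₀ := by
    refine isBigO_principal.2 ⟨1 + p.S, fun v hv => (norm_mul_le _ _).trans ?_⟩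
    rw [Real.norm_of_nonneg (hpos v hv).le]
    exact mul_le_mul (p.norm_β_le _) ((norm_toC_le _).trans (hxy_le v hv)) (norm_nonneg _)
      (by positivity)
  have o3 : (fun v : ℝ × E3 => dens p φ v.2) =O[l] fun _ => (1 : ℝ) :=
    isBigO_principal.2 ⟨Rd, fun v hv => by simpa using hRd v.2 (mem_nset.1 hv).2.1⟩
  have o4 : (fun v : ℝ × E3 => dens p φ v.2 - w₀) =O[l] nd x₀ := by
    refine isBigO_principal.2 ⟨L₁ * R + (1 + p.S) * L₃, fun v hv => ?_⟩
    have e : dens p φ v.2 - w₀ =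
        (p.β v.2 - p.β x₀) * φ v.2 + p.β x₀ * (φ v.2 - φ x₀) := by rw [dens, hw₀]; ring
    have h1 := (hβ v.2).trans (mul_le_mul_of_nonneg_left (hy_le v hv) hL₁)
    have h2 := (hφL v.2 (mem_nset.1 hv).2.1).trans (mul_le_mul_of_nonneg_left (hy_le v hv) hL₃)
    have h0 := hpos v hv
    rw [e, Real.norm_of_nonneg h0.le]
    calc _ ≤ (L₁ * nd x₀ v) * R + (1 + p.S) * (L₃ * nd x₀ v) := by
          refine (norm_add_le _ _).trans (add_le_add
            ((norm_mul_le _ _).trans (mul_le_mul h1 (hR _ (mem_nset.1 hv).2.1) (norm_nonneg _)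
              (by positivity)))
            ((norm_mul_le _ _).trans (mul_le_mul (p.norm_β_le _) h2 (norm_nonneg _)
              (by positivity))))
      _ = _ := by ring
  have o5 : (fun v : ℝ × E3 => p.β (normalPt M x₀ v.1) - p.β x₀) =O[l] nd x₀ := by
    refine isBigO_principal.2 ⟨L₁, fun v hv => (hβ _).trans ?_⟩
    rw [Real.norm_of_nonneg (hpos v hv).le]
    exact mul_le_mul_of_nonneg_left (hx_le v hv) hL₁
  have o6 : (fun v : ℝ × E3 => inner ℝ (M.ν x₀) (x₀ - v.2)) =O[l] fun v => nd x₀ v * nd x₀ v := by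
    refine isBigO_principal.2 ⟨L₄, fun v hv => (hν v.2 (mem_nset.1 hv).2.1.1).trans ?_⟩
    have h0 := hpos v hv
    rw [Real.norm_of_nonneg (by positivity), ← pow_two, norm_sub_rev]
    have := hy_le v hv
    gcongr
  have one : ∀ c : C3, (fun _ : ℝ × E3 => c) =O[l] fun _ => (1 : ℝ) := fun c =>
    isBigO_const_const c one_ne_zero _
  -- replacing the data by the frozen ones costs one order
  have e1 : (fun v => nZ p M x₀ v ⨯₃ dens p φ v.2 - z' v ⨯₃ w₀) =O[l]
      fun v => nd x₀ v * nd x₀ v := by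
    have h1 := (isBigO_cross o1 o3).add ((isBigO_cross o2 o4).congr_right fun v => by
      rw [mul_one])
    refine (h1.congr_left fun v => ?_).congr_right fun v => by rw [mul_one]
    simp only [map_sub, LinearMap.sub_apply]; abel
  have e2 : (fun v => p.β (normalPt M x₀ v.1) * (nZ p M x₀ v ⨯₃ dens p φ v.2) -
      p.β x₀ * (z' v ⨯₃ w₀)) =O[l] fun v => nd x₀ v * nd x₀ v := by
    have h1 := o5.mul (isBigO_cross hcmp.upper o3)
    have h2 := (one (p.β x₀)).mul e1
    simp only [mul_one] at h1
    simp only [one_mul] at h2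
    refine (h1.add h2).congr_left fun v => ?_
    ring
  have e3 := isBigO_cross (one (toC (M.ν x₀))) e2
  have e4 : ∀ v : ℝ × E3, toC (M.ν x₀) ⨯₃ (p.β x₀ * (z' v ⨯₃ w₀)) =
      ((v.1 : ℂ) * p.J x₀) • φ x₀ -
        (inner ℝ (M.ν x₀) (x₀ - v.2) : ℝ) • (p.J x₀ • φ x₀) := fun v => by
    have ht : toC (M.ν x₀) ⬝ᵥ φ x₀ = 0 := hφ.tangential x₀ hx
    have hn : inner ℝ (M.ν x₀) (normalPt M x₀ v.1 - v.2) =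
        (inner ℝ (M.ν x₀) (x₀ - v.2) : ℝ) - v.1 := by
      rw [normalPt, sub_right_comm, inner_sub_right, inner_smul_right, real_inner_self_eq_norm_sq,
        M.norm_ν hx.1]
      simp
    rw [hz', hw₀, mul_cross_mul, ← p.J_eq, map_smul, cross_cross_of_orthogonal _ _ _ ht,
      toC_dot_toC, hn]
    ext i
    simp
    ring
  have e5 : (fun v : ℝ × E3 => (inner ℝ (M.ν x₀) (x₀ - v.2) : ℝ) • (p.J x₀ • φ x₀)) =O[l]
      fun v => nd x₀ v * nd x₀ v := by
    have := o6.smul (one (p.J x₀ • φ x₀))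
    simpa using this
  simp only [one_mul] at e3
  refine ((e3.sub e5).congr_left fun v => ?_).congr_right fun v => (pow_two _).symm
  rw [map_sub, e4, curlRem, traceCL_apply]
  abel

/-- The tangential trace of the curl kernel, freed of its part that is not weakly singular. -/
noncomputable def regCurl (p : PML) (M : LayeredMedium p.a) (x₀ : E3) (φ : E3 → C3) (k : ℂ)
    (v : ℝ × E3) : C3 :=
  traceCL (M.ν x₀) (p.β (normalPt M x₀ v.1)) (Kd k (nZ p M x₀ v, dens p φ v.2)) -
    ((v.1 : ℂ) * p.J x₀ * G 1 0 (nZ p M x₀ v ⬝ᵥ nZ p M x₀ v)) • φ x₀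

theorem regCurl_eq (k : ℂ) (v : ℝ × E3) : regCurl p M x₀ φ k v =
    G 1 k (nZ p M x₀ v ⬝ᵥ nZ p M x₀ v) • curlRem p M x₀ φ v +
      (G (0 + 1) k (nZ p M x₀ v ⬝ᵥ nZ p M x₀ v) - G (0 + 1) 0 (nZ p M x₀ v ⬝ᵥ nZ p M x₀ v)) •
        (((v.1 : ℂ) * p.J x₀) • φ x₀) := by
  simp only [regCurl, curlRem, Kd, map_smul, zero_add]
  module

theorem IsDensity.isBigO_regCurl (hφ : IsDensity p M φ) (hx : x₀ ∈ Γb p M) (k : ℂ)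
    (hD : ∀ᶠ v in Filter.principal (nset p M x₀ h₀), nd x₀ v ≤ D)
    (hcmp : Comparable p.S (1 / 9) (Filter.principal (nset p M x₀ h₀)) (nZ p M x₀) (nd x₀)) :
    regCurl p M x₀ φ k =O[Filter.principal (nset p M x₀ h₀)] fun v => (nd x₀ v)⁻¹ := by
  set l := Filter.principal (nset p M x₀ h₀) with hl
  have h1 := (hcmp.isBigO_G hD 1 k).smul (hφ.isBigO_curlRem hx hcmp)
  have hh : (fun v : ℝ × E3 => ((v.1 : ℂ) * p.J x₀) • φ x₀) =O[l] nd x₀ := by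
    have h3 : (fun v : ℝ × E3 => (v.1 : ℂ)) =O[l] nd x₀ := IsBigO.of_bound 1 (by
      filter_upwards [hcmp.pos] with v hv
      rw [Complex.norm_real, Real.norm_of_nonneg hv.le, one_mul, nd]
      exact le_add_of_nonneg_right (norm_nonneg _))
    have h4 : (fun _ : ℝ × E3 => p.J x₀ • φ x₀) =O[l] fun _ => (1 : ℝ) :=
      isBigO_const_const _ one_ne_zero _
    exact ((h3.smul h4).congr_left fun v => smul_smul _ _ _).congr_right fun v => by simp
  have h2 := (hcmp.isBigO_G_sub hD 0 k).smul hh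
  have h1' := h1.congr' (g₂ := fun v => (nd x₀ v)⁻¹) .rfl (by
    filter_upwards [hcmp.pos] with v hv
    have := hv.ne'
    norm_num
    field_simp)
  have h2' := (h2.congr' (g₂ := fun _ => (1 : ℝ)) .rfl (by
    filter_upwards [hcmp.pos] with v hv
    have := hv.ne'
    norm_num
    field_simp)).trans (isBigO_snd_nd hD)
  exact (h1'.add h2').congr_left fun v => (regCurl_eq k v).symm

theorem continuousOn_Kd (S : ℝ) (k : ℂ) : ContinuousOn (Kd k) (dom S ×ˢ Set.univ) :=
  (contDiffOn_Kd S k).continuousOn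

theorem continuousOn_G_one (S : ℝ) :
    ContinuousOn (fun v : C3 × C3 => G 1 0 (v.1 ⬝ᵥ v.1)) (dom S ×ˢ Set.univ) :=
  (contDiffOn_G_dot_fst S 1 0).continuousOn

theorem IsDensity.aestronglyMeasurable_regCurl (hφ : IsDensity p M φ) (k : ℂ) (h : ℝ) :
    AEStronglyMeasurable (fun y => regCurl p M x₀ φ k (h, y)) (sμ p M) := by
  have h1 : AEStronglyMeasurable (fun y => Kd k (nZ p M x₀ (h, y), dens p φ y)) (sμ p M) :=
    aestronglyMeasurable_nZ (continuousOn_Kd p.S k) hφ.aestronglyMeasurable_dens h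
  have h2 : AEStronglyMeasurable (fun y => G 1 0 (nZ p M x₀ (h, y) ⬝ᵥ nZ p M x₀ (h, y)))
      (sμ p M) :=
    aestronglyMeasurable_nZ (K := fun v : C3 × C3 => G 1 0 (v.1 ⬝ᵥ v.1)) (continuousOn_G_one p.S)
      hφ.aestronglyMeasurable_dens h
  simp only [regCurl]
  exact ((traceCL _ _).continuous.comp_aestronglyMeasurable h1).sub
    ((h2.const_mul _).smul_const _)

theorem continuous_traceCL (n : E3) : Continuous fun v : C3 × C3 => traceCL n v.1 v.2 :=
  (LinearMap.toContinuousLinearMap (crossProduct (toC n))).continuous.comp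
    (continuous_fst.mul continuous_snd)

theorem continuous_β_normalPt : Continuous fun h : ℝ => p.β (normalPt M x₀ h) :=
  (continuous_β p).comp (continuous_normalPt M x₀)

theorem continuousAt_regCurl (k : ℂ) {y : E3} (hy : y ≠ x₀) :
    ContinuousAt (fun h => regCurl p M x₀ φ k (h, y)) 0 := by
  have c1 : ContinuousAt (fun h : ℝ => Kd k (nZ p M x₀ (h, y), dens p φ y)) 0 :=
    continuousAt_kernel (continuousOn_Kd p.S k) hy (dens p φ y)
  have c2 : ContinuousAt (fun h : ℝ => G 1 0 (nZ p M x₀ (h, y) ⬝ᵥ nZ p M x₀ (h, y))) 0 :=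
    continuousAt_kernel (K := fun v : C3 × C3 => G 1 0 (v.1 ⬝ᵥ v.1)) (continuousOn_G_one p.S) hy
      (dens p φ y)
  have c3 : ContinuousAt (fun h : ℝ => traceCL (M.ν x₀) (p.β (normalPt M x₀ h))
      (Kd k (nZ p M x₀ (h, y), dens p φ y))) 0 :=
    ContinuousAt.comp (g := fun v : C3 × C3 => traceCL (M.ν x₀) v.1 v.2)
      (f := fun h : ℝ => (p.β (normalPt M x₀ h), Kd k (nZ p M x₀ (h, y), dens p φ y)))
      (continuous_traceCL _).continuousAt (continuous_β_normalPt.continuousAt.prodMk c1)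
  have c4 : ContinuousAt (fun h : ℝ => (h : ℂ)) 0 := Complex.continuous_ofReal.continuousAt
  exact c3.sub (((c4.mul continuousAt_const).mul c2).smul continuousAt_const)

theorem regCurl_zero (k : ℂ) {y : E3} (hy : y ≠ x₀) :
    regCurl p M x₀ φ k (0, y) = Kker p M k φ x₀ y := by
  rw [Kker_eq k φ hy]
  simp [regCurl, nZ, normalPt_zero]

theorem IsDensity.integrable_nZ {F : Type*} [NormedAddCommGroup F] (hφ : IsDensity p M φ)
    {K : C3 × C3 → F}
    (hK : ContinuousOn K (dom p.S ×ˢ Set.univ)) {h : ℝ} (hn : normalPt M x₀ h ∉ Γc p M) :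
    Integrable (fun y => K (nZ p M x₀ (h, y), dens p φ y)) (sμ p M) := by
  obtain ⟨R, hR⟩ := hφ.exists_ae_bound
  exact integrable_kernel p (f := K) (x := normalPt M x₀ h) (m := dens p φ) hK
    hφ.aestronglyMeasurable_dens (isCompact_Γc p M) hR hn

theorem IsDensity.integral_regCurl (hφ : IsDensity p M φ) (k : ℂ) {h : ℝ}
    (hn : normalPt M x₀ h ∉ Γc p M) : ∫ y, regCurl p M x₀ φ k (h, y) ∂(sμ p M) =
      rcross (M.ν x₀) (Dpot p M k φ (normalPt M x₀ h)) -
      ((h : ℂ) * p.J x₀ *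
        ∫ y, G 1 0 (nZ p M x₀ (h, y) ⬝ᵥ nZ p M x₀ (h, y)) ∂(sμ p M)) • φ x₀ := by
  have i1 := hφ.integrable_nZ (K := Kd k) (continuousOn_Kd p.S k) hn
  have i2 := hφ.integrable_nZ (K := fun v : C3 × C3 => G 1 0 (v.1 ⬝ᵥ v.1))
    (continuousOn_G_one p.S) hn
  have e1 : Dpot p M k φ (normalPt M x₀ h) = p.β (normalPt M x₀ h) *
      ∫ y, Kd k (nZ p M x₀ (h, y), dens p φ y) ∂(sμ p M) := by
    rw [hφ.Dpot_eq k hn, p.B_mulVec]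
    rfl
  have e2 : rcross (M.ν x₀) (Dpot p M k φ (normalPt M x₀ h)) =
      ∫ y, traceCL (M.ν x₀) (p.β (normalPt M x₀ h))
        (Kd k (nZ p M x₀ (h, y), dens p φ y)) ∂(sμ p M) := by
    rw [ContinuousLinearMap.integral_comp_comm _ i1, e1]
    rfl
  rw [e2, ← integral_const_mul, ← integral_smul_const, ← integral_sub]
  · rfl
  · exact (traceCL (M.ν x₀) (p.β (normalPt M x₀ h))).integrable_comp i1
  · exact (i2.const_mul ((h : ℂ) * p.J x₀)).smul_const (φ x₀)

/-- The tangential trace of `D̃` near the interface, up to a multiple of the density by a scalar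
model integral, tends to `K̃`. -/
theorem IsDensity.tendsto_Dpot_sub (hφ : IsDensity p M φ) (hx : x₀ ∈ Γb p M) (k : ℂ) :
    IntegrableOn (Kker p M k φ x₀) (Γb p M) (μHE[2] : Measure E3) ∧
    Filter.Tendsto (fun h : ℝ => rcross (M.ν x₀) (Dpot p M k φ (normalPt M x₀ h)) -
      ((h : ℂ) * p.J x₀ *
        ∫ y, G 1 0 (nZ p M x₀ (h, y) ⬝ᵥ nZ p M x₀ (h, y)) ∂(sμ p M)) • φ x₀) (𝓝[≠] 0)
      (𝓝 (Kop p M k φ x₀)) := by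
  obtain ⟨h₀, D, hh₀, hnot, hD, hcmp⟩ := exists_comparable hx
  obtain ⟨C, hC⟩ := isBigO_principal.1 (hφ.isBigO_regCurl hx k hD hcmp)
  have key := tendsto_integral_sμ (g := fun h y => regCurl p M x₀ φ k (h, y)) (C := |C|) hx hh₀
    (fun h _ => hφ.aestronglyMeasurable_regCurl k h)
    (fun h hh y hy hne => by
      refine (hC (h, y) (mem_nset.2 ⟨hh, hy, hne⟩)).trans ?_
      have h1 : 0 < ‖x₀ - y‖ := norm_pos_iff.2 (sub_ne_zero.2 hne.symm)
      have h2 : ‖x₀ - y‖ ≤ nd x₀ (h, y) := by unfold nd; linarith [abs_nonneg h]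
      rw [norm_inv, Real.norm_of_nonneg (h1.le.trans h2)]
      exact mul_le_mul (le_abs_self C) (inv_anti₀ h1 h2) (inv_nonneg.2 (h1.le.trans h2))
        (abs_nonneg C))
    (fun y _ hne => (continuousAt_regCurl k hne).tendsto)
  have hg0 : (fun y => regCurl p M x₀ φ k (0, y)) =ᵐ[sμ p M] Kker p M k φ x₀ := by
    filter_upwards [ae_sμ_ne (p := p) (M := M) x₀] with y hy using regCurl_zero k hy
  refine ⟨key.1.congr hg0, ?_⟩
  have h1 := key.2.1
  rw [integral_congr_ae hg0] at h1
  refine (h1.mono_left nhdsWithin_le_nhds).congr' ?_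
  have hh : ∀ᶠ h in 𝓝 (0 : ℝ), |h| < h₀ :=
    continuous_abs.continuousAt.eventually_lt continuousAt_const (by simpa using hh₀)
  filter_upwards [nhdsWithin_le_nhds hh, self_mem_nhdsWithin] with h hlt hne
  exact hφ.integral_regCurl k (hnot h hlt.le hne)

end SingleCurl

end PMLJump

namespace PMLJump
open MeasureTheory Asymptotics

/-! ### Gaussian integrals of complex quadratic forms -/

section Gauss

theorem csqrt_mul {a b : ℂ} (ha : 0 < a.re) (hb : 0 < b.re) :
    csqrt (a * b) = csqrt a * csqrt b := by
  have key : ∀ {c : ℂ}, 0 < c.re → 0 < (csqrt c).re ∧ |(csqrt c).im| < (csqrt c).re := by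
    intro c hc
    have h1 := re_csqrt_pos (Complex.mem_slitPlane_iff.2 (Or.inl hc))
    refine ⟨h1, abs_lt_of_sq_lt_sq ?_ h1.le⟩
    have h2 := congrArg Complex.re (csqrt_sq c)
    rw [pow_two, Complex.mul_re] at h2
    nlinarith
  obtain ⟨h1, h2⟩ := key ha
  obtain ⟨h3, h4⟩ := key hb
  refine csqrt_unique ?_ (by rw [mul_pow, csqrt_sq, csqrt_sq])
  rw [Complex.mul_re, sub_pos]
  calc _ ≤ |(csqrt a).im * (csqrt b).im| := le_abs_self _
    _ = |(csqrt a).im| * |(csqrt b).im| := abs_mul _ _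
    _ < _ := mul_lt_mul'' h2 h4 (abs_nonneg _) (abs_nonneg _)

theorem csqrt_pi_div {c : ℂ} (hc : 0 < c.re) :
    ((Real.pi : ℂ) / c) ^ (1 / 2 : ℂ) = (√Real.pi : ℝ) / csqrt c := by
  have h1 := re_csqrt_pos (Complex.mem_slitPlane_iff.2 (Or.inl hc))
  refine csqrt_unique ?_ ?_
  · rw [div_eq_mul_inv, Complex.re_ofReal_mul, Complex.inv_re]
    have h2 : 0 < Complex.normSq (csqrt c) := Complex.normSq_pos.2 (by
      intro h; rw [h] at h1; simp at h1)
    have := Real.pi_pos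
    positivity
  · rw [div_pow, csqrt_sq, ← Complex.ofReal_pow, Real.sq_sqrt Real.pi_pos.le]

/-- The second moment of a complex Gaussian, by integrating the derivative of
`r * exp (-Q r ^ 2)`. -/
theorem integral_sq_mul_cexp {Q : ℂ} (hQ : 0 < Q.re) :
    ∫ r : ℝ, (r : ℂ) ^ 2 * Complex.exp (-Q * (r : ℂ) ^ 2) =
      (√Real.pi : ℝ) / 2 * (csqrt Q ^ 3)⁻¹ := by
  have hQ0 : Q ≠ 0 := by rintro rfl; simp at hQ
  have i1 := integrable_cexp_neg_mul_sq hQ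
  have i2 : Integrable fun r : ℝ => (r : ℂ) ^ 2 * Complex.exp (-Q * (r : ℂ) ^ 2) := by
    have h := integrable_rpow_mul_exp_neg_mul_sq hQ (s := 2) (by norm_num)
    refine h.mono (by fun_prop) (Filter.Eventually.of_forall fun r => le_of_eq ?_)
    simp [Complex.norm_exp, ← Complex.ofReal_pow]
  have h1 : ∀ r : ℝ, HasDerivAt (fun r : ℝ => (r : ℂ) * Complex.exp (-Q * (r : ℂ) ^ 2))
      (Complex.exp (-Q * (r : ℂ) ^ 2) -
        2 * Q * ((r : ℂ) ^ 2 * Complex.exp (-Q * (r : ℂ) ^ 2))) r := fun r => by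
    have d1 : HasDerivAt (fun r : ℝ => (r : ℂ)) 1 r := Complex.ofRealCLM.hasDerivAt
    refine (d1.mul (((d1.pow 2).const_mul (-Q)).cexp)).congr_deriv ?_
    simp; ring
  have h2 := integral_eq_zero_of_hasDerivAt_of_integrable h1 (i1.sub (i2.const_mul _))
    (integrable_mul_cexp_neg_mul_sq hQ)
  rw [integral_sub i1 (i2.const_mul _), integral_gaussian_complex hQ, integral_const_mul,
    csqrt_pi_div hQ, sub_eq_zero] at h2
  have hs := csqrt_ne_zero hQ0
  have h3 : 2 * csqrt Q ^ 2 * ∫ r : ℝ, (r : ℂ) ^ 2 * Complex.exp (-Q * (r : ℂ) ^ 2) =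
      (√Real.pi : ℝ) / csqrt Q := by rw [csqrt_sq, h2]
  generalize ∫ r : ℝ, (r : ℂ) ^ 2 * Complex.exp (-Q * (r : ℂ) ^ 2) = I at h3 ⊢
  field_simp at h3 ⊢
  linear_combination h3

variable (b : OrthonormalBasis (Fin 3) ℝ E3)

/-- The coordinates of a frame: a height along the last vector, and a point of the plane that the
first two vectors span. -/
noncomputable def frameEquiv : ℝ × E2 ≃ᵐ E3 :=
  ((((MeasurableEquiv.refl ℝ).prodCongr (MeasurableEquiv.toLp 2 (Fin 2 → ℝ)).symm).trans
    (MeasurableEquiv.piFinSuccAbove (fun _ : Fin 3 => ℝ) 2).symm).trans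
    (MeasurableEquiv.toLp 2 (Fin 3 → ℝ))).trans b.repr.symm.toHomeomorph.toMeasurableEquiv

theorem frameEquiv_apply (v : ℝ × E2) : frameEquiv b v = emb b v.2 + v.1 • b 2 := by
  have h : frameEquiv b v =
      b.repr.symm (WithLp.toLp 2 (Fin.insertNth (α := fun _ => ℝ) 2 v.1 v.2.ofLp)) := rfl
  rw [h, ← b.sum_repr_symm, Fin.sum_univ_three, emb_apply]
  rfl

theorem measurePreserving_frameEquiv : MeasurePreserving (frameEquiv b) := by
  have h1 : MeasurePreserving ((MeasurableEquiv.refl ℝ).prodCongr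
      (MeasurableEquiv.toLp 2 (Fin 2 → ℝ)).symm) :=
    (MeasurePreserving.id (volume : Measure ℝ)).prod
      (EuclideanSpace.volume_preserving_symm_measurableEquiv_toLp (Fin 2))
  have h2 := (volume_preserving_piFinSuccAbove (fun _ : Fin 3 => ℝ) 2).symm
  exact b.measurePreserving_repr_symm.comp
    ((PiLp.volume_preserving_toLp (Fin 3)).comp (h2.comp h1))

/-- The diagonal quadratic form with complex coefficients `γ`. -/
noncomputable def qform (γ : Fin 3 → ℂ) (v : E3) : ℂ := ∑ l, γ l * (v l : ℂ) ^ 2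

theorem qform_smul (γ : Fin 3 → ℂ) (r : ℝ) (v : E3) :
    qform γ (r • v) = qform γ v * (r : ℂ) ^ 2 := by
  simp only [qform, Finset.sum_mul]
  refine Finset.sum_congr rfl fun l _ => ?_
  simp; ring

theorem integrable_cexp_qform {γ : Fin 3 → ℂ} (hγ : ∀ l, 0 < (γ l).re) :
    Integrable fun v : E3 => Complex.exp (-qform γ v) := by
  have h := GaussianFourier.integrable_cexp_neg_sum_mul_add hγ 0
  rw [← (PiLp.volume_preserving_toLp (Fin 3)).integrable_comp_emb
    (MeasurableEquiv.toLp 2 _).measurableEmbedding]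
  simpa [qform, Function.comp_def] using h

theorem integral_cexp_qform {γ : Fin 3 → ℂ} (hγ : ∀ l, 0 < (γ l).re) :
    ∫ v : E3, Complex.exp (-qform γ v) = (√Real.pi : ℝ) ^ 3 / ∏ l, csqrt (γ l) := by
  have h := GaussianFourier.integral_cexp_neg_sum_mul_add hγ 0
  rw [← (PiLp.volume_preserving_toLp (Fin 3)).integral_comp
    (MeasurableEquiv.toLp 2 _).measurableEmbedding]
  simp only [csqrt_pi_div (hγ _), Pi.zero_apply, zero_mul, Finset.sum_const_zero, add_zero,
    zero_pow two_ne_zero, zero_div, Complex.exp_zero, mul_one, Finset.prod_div_distrib,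
    Finset.prod_const, Finset.card_univ, Fintype.card_fin] at h
  exact h

theorem qform_re_pos {γ : Fin 3 → ℂ} (hγ : ∀ l, 0 < (γ l).re) {v : E3} (hv : v ≠ 0) :
    0 < (qform γ v).re := by
  have hre : (qform γ v).re = ∑ l, (γ l).re * (v l) ^ 2 := by
    simp only [qform, Complex.re_sum, ← Complex.ofReal_pow, Complex.re_mul_ofReal]
  obtain ⟨l, hl⟩ : ∃ l, v l ≠ 0 := by
    by_contra! h
    exact hv (by ext l; simpa using h l)
  rw [hre]
  refine Finset.sum_pos' (fun l _ => mul_nonneg (hγ l).le (sq_nonneg _)) ⟨l, Finset.mem_univ l, ?_⟩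
  exact mul_pos (hγ l) (by positivity)

theorem emb_add_ne_zero (s : E2) : emb b s + b 2 ≠ 0 := fun h => by
  have := inner_two_emb_add b s 1
  rw [one_smul, h, inner_zero_right] at this
  exact zero_ne_one this

/-- The integral of `q ^ (-3/2)` over the affine plane at height one. The three-dimensional Gaussian
integral of the form is computed in two ways: coordinate by coordinate, and by slicing along the
rays through the plane. -/
theorem integral_inv_csqrt_qform {γ : Fin 3 → ℂ} (hγ : ∀ l, 0 < (γ l).re) :
    ∫ s : E2, (csqrt (qform γ (emb b s + b 2)) ^ 3)⁻¹ =
      2 * (Real.pi : ℂ) / ∏ l, csqrt (γ l) := by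
  set F : ℝ → E2 → ℂ := fun r t => Complex.exp (-qform γ (emb b t + r • b 2)) with hF
  have iF : Integrable (Function.uncurry F) ((volume : Measure ℝ).prod (volume : Measure E2)) := by
    have := ((measurePreserving_frameEquiv b).integrable_comp_emb
      (frameEquiv b).measurableEmbedding).2 (integrable_cexp_qform hγ)
    refine this.congr (Filter.Eventually.of_forall fun v => ?_)
    simp only [Function.comp_apply, frameEquiv_apply]
    rfl
  have vF : ∫ r, ∫ t, F r t = (√Real.pi : ℝ) ^ 3 / ∏ l, csqrt (γ l) := by
    rw [integral_integral iF, ← integral_cexp_qform hγ,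
      ← (measurePreserving_frameEquiv b).integral_comp (frameEquiv b).measurableEmbedding]
    simp only [frameEquiv_apply]
    rfl
  -- the slices, rescaled to the plane at height one
  set H : ℝ → E2 → ℂ := fun r s =>
    (r : ℂ) ^ 2 * Complex.exp (-qform γ (emb b s + b 2) * (r : ℂ) ^ 2) with hH
  have hFH : ∀ r s, H r s = (r : ℂ) ^ 2 * F r (r • s) := fun r s => by
    simp only [hF, hH, map_smul, ← smul_add, qform_smul, neg_mul]
  have hr : ∀ᵐ r : ℝ, r ≠ 0 := compl_mem_ae_iff.2 (measure_singleton 0)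
  have hscale : ∀ {r : ℝ}, r ≠ 0 → |(r ^ Module.finrank ℝ E2)⁻¹| = (r ^ 2)⁻¹ := fun {r} _ => by
    rw [finrank_euclideanSpace_fin, abs_of_nonneg (by positivity)]
  have hint : ∀ {r : ℝ}, r ≠ 0 → ∫ s, H r s = ∫ t, F r t := fun {r} h0 => by
    have h1 : (r : ℂ) ≠ 0 := by exact_mod_cast h0
    simp only [hFH]
    rw [integral_const_mul, Measure.integral_comp_smul volume (F r) r, hscale h0,
      Complex.real_smul]
    push_cast
    field_simp
  have hnorm : ∀ {r : ℝ}, r ≠ 0 → ∫ s, ‖H r s‖ = ∫ t, ‖F r t‖ := fun {r} h0 => by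
    simp only [hFH, norm_mul]
    rw [integral_const_mul, Measure.integral_comp_smul volume (fun t => ‖F r t‖) r, hscale h0,
      norm_pow, Complex.norm_real, Real.norm_eq_abs, sq_abs, smul_eq_mul]
    field_simp
  have hcont : Continuous (Function.uncurry H) := by
    simp only [hH, Function.uncurry_def, qform]
    fun_prop
  have iH : Integrable (Function.uncurry H) ((volume : Measure ℝ).prod (volume : Measure E2)) := by
    rw [integrable_prod_iff hcont.aestronglyMeasurable]
    constructor
    · filter_upwards [hr, iF.prod_right_ae] with r h0 h1
      simp only [Function.uncurry_apply_pair, hFH] at h1 ⊢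
      exact (h1.comp_smul h0).const_mul _
    · refine iF.integral_norm_prod_left.congr ?_
      filter_upwards [hr] with r h0 using (hnorm h0).symm
  have h1 : ∫ r, ∫ s, H r s = (√Real.pi : ℝ) ^ 3 / ∏ l, csqrt (γ l) := by
    rw [← vF]
    refine integral_congr_ae ?_
    filter_upwards [hr] with r h0 using hint h0
  rw [integral_integral_swap iH] at h1
  simp only [hH, integral_sq_mul_cexp (qform_re_pos hγ (emb_add_ne_zero b _)),
    integral_const_mul] at h1
  have hpi : ((√Real.pi : ℝ) : ℂ) ≠ 0 := by
    exact_mod_cast (Real.sqrt_pos.2 Real.pi_pos).ne'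
  have h2 : ((√Real.pi : ℝ) : ℂ) ^ 2 = Real.pi := by
    rw [← Complex.ofReal_pow, Real.sq_sqrt Real.pi_pos.le]
  rw [← h2]
  have hprod : ∏ l, csqrt (γ l) ≠ 0 := Finset.prod_ne_zero_iff.2 fun l _ => csqrt_ne_zero (by
    intro h; have := hγ l; simp [h] at this)
  field_simp at h1 ⊢
  linear_combination h1

end Gauss

end PMLJump

namespace PMLJump
open MeasureTheory Asymptotics

/-! ### The jump of the single curl -/

section SingleJump

variable {p : PML} {M : LayeredMedium p.a} {x₀ : E3} {φ : E3 → C3}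

theorem PML.re_rot_mul_β_sq (p : PML) (x : E3) (l : Fin 3) :
    0 < (rot p.S * p.β x l ^ 2).re :=
  zero_lt_one.trans_le (p.re_rot_mul_sq _ (p.σ_mem l _).1 (p.σ_mem l _).2)

theorem β_mul_dot_self (x v : E3) : (p.β x * toC v) ⬝ᵥ (p.β x * toC v) =
    (rot p.S)⁻¹ * qform (fun l => rot p.S * p.β x l ^ 2) v := by
  have h := rot_ne_zero p.S
  simp only [dotProduct, qform, Finset.mul_sum, Pi.mul_apply, toC_apply]
  refine Finset.sum_congr rfl fun l _ => ?_
  field_simp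

theorem re_inv_rot_pos (S : ℝ) : 0 < ((rot S)⁻¹).re := by
  rw [Complex.inv_re]
  exact div_pos (by simp [rot]) (Complex.normSq_pos.2 (rot_ne_zero S))

theorem β_mul_toC_mem_dom (x : E3) {v : E3} (hv : v ≠ 0) : p.β x * toC v ∈ dom p.S := by
  have := qform_re_pos (p.re_rot_mul_β_sq x) hv
  change 0 < (rot p.S * _).re
  rwa [β_mul_dot_self, mul_inv_cancel_left₀ (rot_ne_zero p.S)]

/-- The integral of the static kernel over the tangent plane at unit distance. -/
theorem integral_G_one_plane (b : OrthonormalBasis (Fin 3) ℝ E3) (x : E3) :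
    ∫ s : E2, G 1 0 ((p.β x * toC (emb b s + b 2)) ⬝ᵥ (p.β x * toC (emb b s + b 2))) =
      -(2 * p.J x)⁻¹ := by
  set γ : Fin 3 → ℂ := fun l => rot p.S * p.β x l ^ 2 with hγ
  have hpos := p.re_rot_mul_β_sq x
  set u := csqrt (rot p.S)⁻¹ with hu
  have hu0 : u ≠ 0 := csqrt_ne_zero (inv_ne_zero (rot_ne_zero p.S))
  have h1 : ∀ s : E2, G 1 0 ((p.β x * toC (emb b s + b 2)) ⬝ᵥ (p.β x * toC (emb b s + b 2))) =
      -(4 * (Real.pi : ℂ) * u ^ 3)⁻¹ * (csqrt (qform γ (emb b s + b 2)) ^ 3)⁻¹ := fun s => by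
    rw [β_mul_dot_self, G_one_zero, csqrt_mul (re_inv_rot_pos p.S)
      (qform_re_pos hpos (emb_add_ne_zero b s)), ← hu, ← hγ, mul_pow, ← mul_assoc, mul_inv, neg_mul]
  have h2 : ∀ l, u * csqrt (γ l) = p.β x l := fun l => by
    have e : (rot p.S)⁻¹ * γ l = p.β x l ^ 2 := inv_mul_cancel_left₀ (rot_ne_zero p.S) _
    rw [hu, ← csqrt_mul (re_inv_rot_pos p.S) (hpos l), e]
    refine csqrt_unique ?_ rfl
    simp [PML.β, PML.α]
  have h3 : u ^ 3 * ∏ l, csqrt (γ l) = p.J x := by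
    rw [p.J_eq, ← h2 0, ← h2 1, ← h2 2, Fin.prod_univ_three]; ring
  simp only [h1]
  rw [integral_const_mul, integral_inv_csqrt_qform b hpos, ← h3]
  have hpi : (Real.pi : ℂ) ≠ 0 := by exact_mod_cast Real.pi_ne_zero
  have h4 : ∏ l, csqrt (γ l) ≠ 0 := fun h => p.J_ne_zero x (by rw [← h3, h, mul_zero])
  change _ * (2 * (Real.pi : ℂ) / ∏ l, csqrt (γ l)) = _
  field_simp
  norm_num

theorem continuousAt_G_dot {z : C3} (hz : z ∈ dom p.S) (n : ℕ) (k : ℂ) :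
    ContinuousAt (fun z : C3 => G n k (z ⬝ᵥ z)) z :=
  (contDiffOn_G_dot p.S n k).continuousOn.continuousAt ((isOpen_dom p.S).mem_nhds hz)

/-- The argument of the kernel, rescaled by the height, in a graph chart. -/
theorem GraphChart.tendsto_inv_smul_nZ (c : GraphChart M x₀) (s : E2) :
    Filter.Tendsto (fun h : ℝ => h⁻¹ • nZ p M x₀ (h, c.Y (h • s))) (𝓝[≠] 0)
      (𝓝 (-(p.β x₀ * toC (emb c.b s + c.b 2)))) := by
  have h1 : HasDerivAt (fun h : ℝ => p.X (normalPt M x₀ h)) (fderiv ℝ p.X x₀ (-M.ν x₀)) 0 := by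
    have := p.hasFDerivAt_X (normalPt M x₀ 0)
    rw [normalPt_zero] at this
    exact HasFDerivAt.comp_hasDerivAt_of_eq (0 : ℝ) this (hasDerivAt_normalPt M x₀ 0)
      (normalPt_zero M x₀).symm
  have h2 : HasDerivAt (fun h : ℝ => h • s) s 0 := by
    simpa using (hasDerivAt_id (0 : ℝ)).smul_const s
  have h3 : HasDerivAt (fun h : ℝ => p.X (c.Y (h • s)))
      (fderiv ℝ p.X x₀ (emb c.b s)) 0 := by
    have hY := c.hasFDerivAt_Y c.zero_mem_ball
    have e : (0 : E2) = (0 : ℝ) • s := (zero_smul ℝ s).symm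
    have hY' := hY.comp_hasDerivAt_of_eq (0 : ℝ) h2 e
    have hX := p.hasFDerivAt_X x₀
    have := hX.comp_hasDerivAt_of_eq (0 : ℝ) hY' (by simp [c.Y_zero])
    refine this.congr_deriv ?_
    rw [GraphChart.fderiv_Y_apply, c.fderiv_zero]
    simp
  have h4 := hasDerivAt_iff_tendsto_slope_zero.1 (h1.sub h3)
  have e : fderiv ℝ p.X x₀ (-M.ν x₀) - fderiv ℝ p.X x₀ (emb c.b s) =
      -(p.β x₀ * toC (emb c.b s + c.b 2)) := by
    rw [← map_sub, p.fderiv_X_eq, ← mul_neg, ← map_neg, c.frame_two]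
    congr 2; abel
  rw [e] at h4
  refine h4.congr fun h => ?_
  simp [nZ, c.Y_zero, normalPt_zero]

theorem integrable_nZ_const {K : C3 × C3 → ℂ} (hK : ContinuousOn K (dom p.S ×ˢ Set.univ)) {h : ℝ}
    (hn : normalPt M x₀ h ∉ Γc p M) :
    Integrable (fun y => K (nZ p M x₀ (h, y), 0)) (sμ p M) :=
  integrable_kernel p (f := K) (x := normalPt M x₀ h) (m := fun _ => 0) (R := 0) hK
    aestronglyMeasurable_const (isCompact_Γc p M)
    (ae_sμ.mono fun _ hy => ⟨Γb_subset_Γc p M hy, by simp⟩) hn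

theorem GraphChart.tendsto_w (c : GraphChart M x₀) (s : E2) :
    Filter.Tendsto (fun h : ℝ => c.w (h • s)) (𝓝 0) (𝓝 1) := by
  have h1 : Filter.Tendsto (fun h : ℝ => 1 + c.C ^ 2 * ‖h • s‖ ^ 2) (𝓝 0) (𝓝 1) := by
    have : Continuous fun h : ℝ => 1 + c.C ^ 2 * ‖h • s‖ ^ 2 := by fun_prop
    simpa using this.tendsto 0
  exact tendsto_of_tendsto_of_tendsto_of_le_of_le tendsto_const_nhds h1
    (fun h => c.one_le_w _) fun h => c.w_le _

/-- The scalar model integral, weighted by the distance to the interface, tends to its value for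
the tangent plane. -/
theorem tendsto_abs_mul_integral_G (hx : x₀ ∈ Γb p M) : Filter.Tendsto (fun h : ℝ => |h| •
    ∫ y, G 1 0 (nZ p M x₀ (h, y) ⬝ᵥ nZ p M x₀ (h, y)) ∂(sμ p M)) (𝓝[≠] 0)
    (𝓝 (-(2 * p.J x₀)⁻¹)) := by
  obtain ⟨c, hV⟩ := exists_chart_box hx
  obtain ⟨h₀, D, hh₀, hnot, hD, hcmp⟩ := exists_comparable hx
  obtain ⟨ρ, hρ, hfar⟩ := c.exists_dist_le
  obtain ⟨C', hC'⟩ := isBigO_principal.1 (hcmp.isBigO_G hD 1 0)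
  set g : ℝ → E3 → ℂ := fun h y => G 1 0 (nZ p M x₀ (h, y) ⬝ᵥ nZ p M x₀ (h, y)) with hg
  have hC : ∀ h, |h| ≤ h₀ → ∀ y ∈ Γb p M, y ≠ x₀ →
      ‖g h y‖ ≤ |C'| * (|h| + ‖x₀ - y‖)⁻¹ ^ 3 := fun h hh y hy hne => by
    have h1 := hC' (h, y) (mem_nset.2 ⟨hh, hy, hne⟩)
    have h2 : 0 < nd x₀ (h, y) := nd_pos hne
    rw [norm_pow, norm_inv, Real.norm_of_nonneg h2.le] at h1
    exact h1.trans (mul_le_mul_of_nonneg_right (le_abs_self _) (by positivity))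
  have hmeas : ∀ h, AEStronglyMeasurable (g h) (sμ p M) := fun h =>
    aestronglyMeasurable_nZ (K := fun v : C3 × C3 => G 1 0 (v.1 ⬝ᵥ v.1)) (m := fun _ => 0)
      (continuousOn_G_one p.S) aestronglyMeasurable_const h
  have hint : ∀ h, |h| ≤ h₀ → h ≠ 0 → Integrable (g h) (sμ p M) := fun h hh h0 =>
    integrable_nZ_const (K := fun v : C3 × C3 => G 1 0 (v.1 ⬝ᵥ v.1)) (continuousOn_G_one p.S)
      (hnot h hh h0)
  have hsmall : ∀ᶠ h in 𝓝[≠] (0 : ℝ), |h| ≤ h₀ ∧ h ≠ 0 := by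
    have : ∀ᶠ h in 𝓝 (0 : ℝ), |h| < h₀ :=
      continuous_abs.continuousAt.eventually_lt continuousAt_const (by simpa using hh₀)
    filter_upwards [nhdsWithin_le_nhds this, self_mem_nhdsWithin] with h h1 h2 using ⟨h1.le, h2⟩
  have hVm : MeasurableSet c.V := c.isOpen_V.measurableSet
  -- away from the base point the kernel is bounded
  have lfar : Filter.Tendsto (fun h : ℝ => |h| • ∫ y in c.Vᶜ, g h y ∂(sμ p M)) (𝓝[≠] 0) (𝓝 0) := by
    have habs : Filter.Tendsto (fun h : ℝ => |h| * (|C'| * ρ⁻¹ ^ 3 * (sμ p M).real c.Vᶜ)) (𝓝[≠] 0)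
        (𝓝 0) := by
      have : Continuous fun h : ℝ => |h| * (|C'| * ρ⁻¹ ^ 3 * (sμ p M).real c.Vᶜ) := by fun_prop
      simpa using (this.tendsto 0).mono_left nhdsWithin_le_nhds
    refine squeeze_zero_norm' ?_ habs
    filter_upwards [hsmall] with h hh
    rw [norm_smul, Real.norm_eq_abs, abs_abs]
    refine mul_le_mul_of_nonneg_left ?_ (abs_nonneg h)
    refine norm_setIntegral_le_of_norm_le_const_ae (measure_lt_top _ _) ?_
    filter_upwards [ae_restrict_of_ae (ae_sμ (p := p) (M := M)),
      ae_restrict_of_ae (ae_sμ_ne (p := p) (M := M) x₀), ae_restrict_mem hVm.compl] with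
      y hy hne hyV
    refine (hC h hh.1 y hy hne).trans ?_
    have := hfar y hyV
    gcongr
    linarith [abs_nonneg h]
  -- near the base point the height is scaled out
  set fh : ℝ → E2 → ℂ := fun h => (Metric.ball (0 : E2) c.R).indicator
    fun t => c.w t • g h (c.Y t) with hfh
  have fh_of_mem : ∀ h, ∀ t ∈ Metric.ball (0 : E2) c.R, fh h t = c.w t • g h (c.Y t) :=
    fun h t ht => Set.indicator_of_mem ht _
  have hnear : ∀ h, h ≠ 0 → |h| • ∫ y in c.V, g h y ∂(sμ p M) =
      ∫ s, |h| ^ 3 • fh h (h • s) := fun h h0 => by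
    have hm : AEStronglyMeasurable (g h) ((μHE[2] : Measure E3).restrict (M.Γ ∩ c.V)) := by
      rw [← c.Γb_inter_V hV]
      exact (hmeas h).mono_measure (Measure.restrict_mono Set.inter_subset_left le_rfl)
    have h1 : ∫ y in c.V, g h y ∂(sμ p M) = ∫ t, fh h t := by
      rw [sμ, Measure.restrict_restrict hVm, Set.inter_comm, c.Γb_inter_V hV, c.integral_eq hm,
        hfh, integral_indicator Metric.isOpen_ball.measurableSet]
    rw [h1, integral_smul, Measure.integral_comp_smul, finrank_euclideanSpace_fin, abs_inv, abs_pow,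
      smul_smul]
    congr 1
    have := abs_pos.2 h0
    field_simp
  have lnear : Filter.Tendsto (fun h : ℝ => ∫ s, |h| ^ 3 • fh h (h • s)) (𝓝[≠] 0)
      (𝓝 (∫ s : E2, G 1 0 ((p.β x₀ * toC (emb c.b s + c.b 2)) ⬝ᵥ
        (p.β x₀ * toC (emb c.b s + c.b 2))))) := by
    refine tendsto_integral_filter_of_dominated_convergence
      (fun s => 2 * |C'| * (1 + ‖s‖) ^ (-3 : ℝ)) ?_ ?_ ?_ ?_
    · filter_upwards [hsmall] with h hh
      have hm : AEStronglyMeasurable (g h) ((μHE[2] : Measure E3).restrict (M.Γ ∩ c.V)) := by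
        rw [← c.Γb_inter_V hV]
        exact (hmeas h).mono_measure (Measure.restrict_mono Set.inter_subset_left le_rfl)
      have h1 : AEStronglyMeasurable (fh h) :=
        (aestronglyMeasurable_indicator_iff Metric.isOpen_ball.measurableSet).2
          (c.measurable_w.aestronglyMeasurable.smul (c.aestronglyMeasurable_comp_Y hm))
      have h2 := h1.comp_quasiMeasurePreserving
        (Measure.quasiMeasurePreserving_smul volume hh.2)
      exact h2.const_smul (|h| ^ 3)
    · filter_upwards [hsmall] with h hh
      have hs0 : ∀ᵐ s : E2, s ≠ 0 := compl_mem_ae_iff.2 (measure_singleton 0)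
      filter_upwards [hs0] with s hs
      have hp := abs_pos.2 hh.2
      have hb : (1 + ‖s‖) ^ (-3 : ℝ) = (1 + ‖s‖)⁻¹ ^ 3 := by
        rw [Real.rpow_neg (by positivity), show (3 : ℝ) = ((3 : ℕ) : ℝ) by norm_num,
          Real.rpow_natCast, inv_pow]
      rw [hb, norm_smul, norm_pow, Real.norm_eq_abs, abs_abs]
      by_cases ht : h • s ∈ Metric.ball (0 : E2) c.R
      · have hne : c.Y (h • s) ≠ x₀ := fun h' => by
          have := c.norm_le_norm_Y_sub (h • s)
          rw [h', sub_self, norm_zero] at this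
          exact smul_ne_zero hh.2 hs (norm_le_zero_iff.1 this)
        have h1 := hC h hh.1 (c.Y (h • s)) (c.inter_V_subset hV (c.Y_mem ht)) hne
        have h2 := c.norm_le_norm_Y_sub (h • s)
        rw [norm_sub_rev, norm_smul, Real.norm_eq_abs] at h2
        have h3 : (|h| + ‖x₀ - c.Y (h • s)‖)⁻¹ ≤ |h|⁻¹ * (1 + ‖s‖)⁻¹ := by
          rw [← mul_inv]
          exact inv_anti₀ (by positivity) (by linarith)
        have h4 : ‖fh h (h • s)‖ ≤ 2 * (|C'| * (|h|⁻¹ * (1 + ‖s‖)⁻¹) ^ 3) := by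
          rw [fh_of_mem h _ ht, norm_smul, Real.norm_of_nonneg (c.w_nonneg _)]
          refine mul_le_mul (c.w_le_two ht) (h1.trans ?_) (norm_nonneg _) (by norm_num)
          gcongr
        calc _ ≤ |h| ^ 3 * (2 * (|C'| * (|h|⁻¹ * (1 + ‖s‖)⁻¹) ^ 3)) := by gcongr
          _ = _ := by field_simp
      · have h1 : fh h (h • s) = 0 := Set.indicator_of_notMem ht _
        rw [h1, norm_zero, mul_zero]
        positivity
    · exact (integrable_one_add_norm (by simp; norm_num)).const_mul _
    · refine Filter.Eventually.of_forall fun s => ?_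
      have hz := c.tendsto_inv_smul_nZ (p := p) s
      have hdom : -(p.β x₀ * toC (emb c.b s + c.b 2)) ∈ dom p.S := by
        rw [← mul_neg, ← map_neg]
        exact β_mul_toC_mem_dom x₀ (neg_ne_zero.2 (emb_add_ne_zero c.b s))
      have hG := (continuousAt_G_dot hdom 1 0).tendsto.comp hz
      rw [neg_dotProduct_neg] at hG
      have hw := (c.tendsto_w s).mono_left (nhdsWithin_le_nhds (s := {0}ᶜ))
      have hl := hw.smul hG
      rw [one_smul] at hl
      have hb : ∀ᶠ h in 𝓝[≠] (0 : ℝ), h • s ∈ Metric.ball (0 : E2) c.R := by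
        have : Continuous fun h : ℝ => h • s := by fun_prop
        have h1 := this.tendsto 0
        rw [zero_smul] at h1
        exact nhdsWithin_le_nhds (h1 (Metric.isOpen_ball.mem_nhds c.zero_mem_ball))
      refine hl.congr' ?_
      filter_upwards [hsmall, hb] with h hh hhb
      have hp := abs_pos.2 hh.2
      have hmem : nZ p M x₀ (h, c.Y (h • s)) ∈ dom p.S := by
        refine p.X_sub_mem_dom fun h' => hnot h hh.1 hh.2 ?_
        change normalPt M x₀ h = c.Y (h • s) at h'
        rw [h']
        exact Γb_subset_Γc p M (c.inter_V_subset hV (c.Y_mem hhb))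
      rw [fh_of_mem h _ hhb, Function.comp_apply, smul_comm]
      congr 1
      have hsq : ((h⁻¹ : ℝ) : ℂ) ^ 2 = ((|h|⁻¹ : ℝ) : ℂ) ^ 2 := by
        rw [← Complex.ofReal_pow, ← Complex.ofReal_pow, inv_pow, inv_pow, sq_abs]
      rw [smul_dot_smul, hsq, G_homogeneous 1 (inv_pos.2 hp) (dot_mem_slitPlane hmem),
        Complex.real_smul]
      push_cast
      simp [hg]
  rw [integral_G_one_plane] at lnear
  have hsum := lnear.add lfar
  rw [add_zero] at hsum
  refine hsum.congr' ?_
  filter_upwards [hsmall] with h hh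
  rw [← hnear h hh.2, ← smul_add, integral_add_compl hVm (hint h hh.1 hh.2)]

/-- The one-sided limits of the tangential trace of `D̃`. -/
theorem IsDensity.tendsto_Dpot (hφ : IsDensity p M φ) (hx : x₀ ∈ Γb p M) (k : ℂ) :
    Filter.Tendsto (fun h : ℝ => rcross (M.ν x₀) (Dpot p M k φ (x₀ - h • M.ν x₀))) (𝓝[>] 0)
      (𝓝 (Kop p M k φ x₀ - (1 / 2 : ℂ) • φ x₀)) ∧
    Filter.Tendsto (fun h : ℝ => rcross (M.ν x₀) (Dpot p M k φ (x₀ + h • M.ν x₀))) (𝓝[>] 0)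
      (𝓝 (Kop p M k φ x₀ + (1 / 2 : ℂ) • φ x₀)) := by
  have hJ := p.J_ne_zero x₀
  have h1 := (hφ.tendsto_Dpot_sub hx k).2
  have h2 := tendsto_abs_mul_integral_G hx
  set I : ℝ → ℂ := fun h => ∫ y, G 1 0 (nZ p M x₀ (h, y) ⬝ᵥ nZ p M x₀ (h, y)) ∂(sμ p M) with hI
  have hpos : 𝓝[>] (0 : ℝ) ≤ 𝓝[≠] 0 := nhdsWithin_mono 0 fun h (hh : 0 < h) => hh.ne'
  have hneg : Filter.Tendsto (fun h : ℝ => -h) (𝓝[>] 0) (𝓝[≠] 0) := by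
    refine tendsto_nhdsWithin_iff.2 ⟨?_, ?_⟩
    · have : Continuous fun h : ℝ => -h := by fun_prop
      simpa using (this.tendsto 0).mono_left nhdsWithin_le_nhds
    · filter_upwards [self_mem_nhdsWithin] with h hh
      exact neg_ne_zero.2 (ne_of_gt hh)
  have s1 : Filter.Tendsto (fun h : ℝ => ((h : ℂ) * p.J x₀ * I h) • φ x₀) (𝓝[>] 0)
      (𝓝 (-(1 / 2 : ℂ) • φ x₀)) := by
    have := ((h2.mono_left hpos).const_mul (p.J x₀)).smul_const (φ x₀)
    have e : p.J x₀ * -(2 * p.J x₀)⁻¹ = -(1 / 2 : ℂ) := by field_simp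
    rw [e] at this
    refine this.congr' ?_
    filter_upwards [self_mem_nhdsWithin] with h hh
    have hh' : 0 < h := hh
    rw [abs_of_pos hh', Complex.real_smul]
    congr 1; ring
  have s2 : Filter.Tendsto (fun h : ℝ => (((-h : ℝ) : ℂ) * p.J x₀ * I (-h)) • φ x₀) (𝓝[>] 0)
      (𝓝 ((1 / 2 : ℂ) • φ x₀)) := by
    have := ((h2.comp hneg).const_mul (-p.J x₀)).smul_const (φ x₀)
    have e : -p.J x₀ * -(2 * p.J x₀)⁻¹ = (1 / 2 : ℂ) := by field_simp
    rw [e] at this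
    refine this.congr' ?_
    filter_upwards [self_mem_nhdsWithin] with h hh
    have hh' : 0 < h := hh
    rw [Function.comp_apply, abs_neg, abs_of_pos hh', Complex.real_smul]
    congr 1; push_cast; ring
  constructor
  · have := (h1.mono_left hpos).add s1
    rw [neg_smul, ← sub_eq_add_neg] at this
    refine this.congr fun h => ?_
    simp only [hI, sub_add_cancel]
    rfl
  · have := (h1.comp hneg).add s2
    refine this.congr fun h => ?_
    simp only [hI, Function.comp_apply, sub_add_cancel]
    rw [normalPt, neg_smul, sub_neg_eq_add]

end SingleJump

end PMLJump

namespace PMLJump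
open MeasureTheory Asymptotics

/-! ### Limits and finite parts -/

section FinitePart

variable {E : Type*} [NormedAddCommGroup E] [NormedSpace ℝ E] {H : Prop} {F F' T T' : ℝ → E}

/-- The values `F h` off the surface follow the truncated integrals `T |h|`, freed of their
divergence `c / |h|`; under the hypothesis `H` both converge. -/
def FollowsTruncation (H : Prop) (F T : ℝ → E) : Prop :=
  ∃ c : E, Filter.Tendsto (fun h : ℝ => F h - (T |h| - |h|⁻¹ • c)) (𝓝[≠] 0) (𝓝 0) ∧
    Filter.Tendsto (fun ε : ℝ => ε • T ε) (𝓝[>] 0) (𝓝 c) ∧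
    (H → ∃ v : E, Filter.Tendsto (fun ε : ℝ => T ε - ε⁻¹ • c) (𝓝[>] 0) (𝓝 v))

theorem tendsto_abs_nhdsNE : Filter.Tendsto (fun h : ℝ => |h|) (𝓝[≠] 0) (𝓝[>] 0) := by
  refine tendsto_nhdsWithin_iff.2 ⟨?_, ?_⟩
  · simpa using ((continuous_abs (G := ℝ)).tendsto 0).mono_left nhdsWithin_le_nhds
  · filter_upwards [self_mem_nhdsWithin] with h hh using abs_pos.2 hh

theorem tendsto_id_nhdsGT : Filter.Tendsto (fun ε : ℝ => ε) (𝓝[>] 0) (𝓝 0) := nhdsWithin_le_nhds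

namespace FollowsTruncation

theorem congr (h : FollowsTruncation H F T) (hF : F =ᶠ[𝓝[≠] 0] F') (hT : T =ᶠ[𝓝[>] 0] T') :
    FollowsTruncation H F' T' := by
  obtain ⟨c, h1, h2, h3⟩ := h
  refine ⟨c, h1.congr' ?_, h2.congr' ?_, fun hH => ?_⟩
  · filter_upwards [hF, tendsto_abs_nhdsNE.eventually hT] with h e1 e2
    rw [e1, e2]
  · filter_upwards [hT] with ε e
    rw [e]
  · obtain ⟨v, hv⟩ := h3 hH
    refine ⟨v, hv.congr' ?_⟩
    filter_upwards [hT] with ε e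
    rw [e]

theorem add (h : FollowsTruncation H F T) (h' : FollowsTruncation H F' T') :
    FollowsTruncation H (fun h => F h + F' h) fun ε => T ε + T' ε := by
  obtain ⟨c, h1, h2, h3⟩ := h
  obtain ⟨c', h1', h2', h3'⟩ := h'
  refine ⟨c + c', ?_, (h2.add h2').congr fun ε => (smul_add _ _ _).symm, fun hH => ?_⟩
  · have := h1.add h1'
    rw [add_zero] at this
    exact this.congr fun h => by module
  · obtain ⟨v, hv⟩ := h3 hH
    obtain ⟨v', hv'⟩ := h3' hH
    exact ⟨v + v', (hv.add hv').congr fun ε => by module⟩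

theorem of_tendsto {L : E} (hF : Filter.Tendsto F (𝓝[≠] 0) (𝓝 L))
    (hT : Filter.Tendsto T (𝓝[>] 0) (𝓝 L)) : FollowsTruncation H F T := by
  refine ⟨0, ?_, ?_, fun _ => ⟨L, by simpa using hT⟩⟩
  · simpa using hF.sub (hT.comp tendsto_abs_nhdsNE)
  · simpa using tendsto_id_nhdsGT.smul hT

theorem pi {n : ℕ} {F T : ℝ → Fin n → ℂ}
    (h : ∀ i, FollowsTruncation H (fun h => F h i) fun ε => T ε i) : FollowsTruncation H F T := by
  choose c h1 h2 h3 using h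
  refine ⟨c, tendsto_pi_nhds.2 h1, tendsto_pi_nhds.2 h2, fun hH => ?_⟩
  choose v hv using fun i => h3 i hH
  exact ⟨v, tendsto_pi_nhds.2 hv⟩

/-- A truncation with `ε T ε → c` can have a finite part only with the divergence `c / ε`. -/
theorem tendsto_of_finitePart {c c' v : E}
    (h2 : Filter.Tendsto (fun ε : ℝ => ε • T ε) (𝓝[>] 0) (𝓝 c))
    (h : Filter.Tendsto (fun ε : ℝ => T ε - ε⁻¹ • c') (𝓝[>] 0) (𝓝 v)) : c' = c := by
  have h3 := tendsto_id_nhdsGT.smul h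
  have h4 := h2.sub h3
  rw [zero_smul, sub_zero] at h4
  refine tendsto_nhds_unique (tendsto_const_nhds.congr' ?_) h4
  filter_upwards [self_mem_nhdsWithin] with ε hε
  have hε' : ε ≠ 0 := ne_of_gt hε
  rw [smul_sub, smul_inv_smul₀ hε', sub_sub_cancel]

/-- A one-sided limit exists exactly if the finite part does, and has the same value. -/
theorem tendsto_iff (h : FollowsTruncation H F T) {s : ℝ → ℝ}
    (hs : Filter.Tendsto s (𝓝[>] 0) (𝓝[≠] 0)) (hs' : ∀ ε, 0 < ε → |s ε| = ε) (v : E) :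
    Filter.Tendsto (fun ε => F (s ε)) (𝓝[>] 0) (𝓝 v) ↔
      ∃ c : E, Filter.Tendsto (fun ε : ℝ => T ε - ε⁻¹ • c) (𝓝[>] 0) (𝓝 v) := by
  obtain ⟨c, h1, h2, -⟩ := h
  have h4 : Filter.Tendsto (fun ε : ℝ => F (s ε) - (T ε - ε⁻¹ • c)) (𝓝[>] 0) (𝓝 0) := by
    refine (h1.comp hs).congr' ?_
    filter_upwards [self_mem_nhdsWithin] with ε hε
    rw [Function.comp_apply, hs' ε hε]
  constructor
  · intro hF
    refine ⟨c, ?_⟩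
    have := hF.sub h4
    rw [sub_zero] at this
    exact this.congr fun ε => sub_sub_cancel _ _
  · rintro ⟨c', hc'⟩
    obtain rfl := tendsto_of_finitePart h2 hc'
    have := h4.add hc'
    rw [zero_add] at this
    exact this.congr fun ε => sub_add_cancel _ _

theorem exists_finitePart (h : FollowsTruncation H F T) (hH : H) :
    ∃ v c : E, Filter.Tendsto (fun ε : ℝ => T ε - ε⁻¹ • c) (𝓝[>] 0) (𝓝 v) := by
  obtain ⟨c, -, -, h3⟩ := h
  obtain ⟨v, hv⟩ := h3 hH
  exact ⟨v, c, hv⟩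

end FollowsTruncation

end FinitePart

/-! ### The density in a graph chart -/

section ChartDensity

variable {p : PML} {M : LayeredMedium p.a} {x₀ : E3} {φ : E3 → C3}

theorem sum_frame_dot (b : OrthonormalBasis (Fin 3) ℝ E3) (w : C3) :
    ∑ l, (toC (b l) ⬝ᵥ w) • toC (b l) = w := by
  have key : ∀ m n : Fin 3, ∑ l, (b l m : ℂ) * (b l n : ℂ) = if n = m then 1 else 0 := by
    intro m n
    have h := congrArg (fun v : E3 => v n) (b.sum_repr' (EuclideanSpace.single m (1 : ℝ)))
    simp only [EuclideanSpace.inner_single_right, WithLp.ofLp_sum, Finset.sum_apply,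
      PiLp.smul_apply, smul_eq_mul, PiLp.single_apply, one_mul, conj_trivial] at h
    have h' := congrArg (fun r : ℝ => (r : ℂ)) h
    simpa [apply_ite] using h'
  ext n
  have e : ∀ l, ((toC (b l) ⬝ᵥ w) • toC (b l)) n = ∑ m, w m * ((b l m : ℂ) * (b l n : ℂ)) := by
    intro l
    rw [Pi.smul_apply, smul_eq_mul, dotProduct, Finset.sum_mul]
    refine Finset.sum_congr rfl fun m _ => ?_
    rw [toC_apply, toC_apply]; ring
  rw [Finset.sum_apply, Finset.sum_congr rfl fun l _ => e l, Finset.sum_comm]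
  simp only [← Finset.mul_sum, key]
  simp

/-- The continuous linear functional `w ↦ b · w`. -/
noncomputable def dotL (b : C3) : C3 →L[ℂ] ℂ :=
  LinearMap.toContinuousLinearMap
    { toFun := fun w => b ⬝ᵥ w
      map_add' := fun v w => dotProduct_add _ v w
      map_smul' := fun r w => by simp [dotProduct_smul] }

theorem dotL_apply (b w : C3) : dotL b w = b ⬝ᵥ w := rfl

theorem toC_smul (r : ℝ) (v : E3) : toC (r • v) = (r : ℂ) • toC v := by
  ext l; simp [toC_apply]

namespace GraphChart

variable (c : GraphChart M x₀)

/-- The component of the density along a frame vector, in the chart. -/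
noncomputable def comp (φ : E3 → C3) (j : Fin 3) (t : E2) : ℂ := toC (c.b j) ⬝ᵥ φ (c.Y t)

theorem emb_single_zero : emb c.b (EuclideanSpace.single 0 1) = c.b 0 := by simp [emb_apply]

theorem emb_single_one : emb c.b (EuclideanSpace.single 1 1) = c.b 1 := by simp [emb_apply]

/-- Tangential vectors are combinations of the two coordinate tangent vectors of the chart. -/
theorem φ_Y_eq (hφ : IsDensity p M φ) (hV : c.V ⊆ p.box) {t : E2}
    (ht : t ∈ Metric.ball (0 : E2) c.R) : φ (c.Y t) =
      c.comp φ 0 t • toC (emb c.b (EuclideanSpace.single 0 1) +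
        fderiv ℝ c.f t (EuclideanSpace.single 0 1) • c.b 2) +
      c.comp φ 1 t • toC (emb c.b (EuclideanSpace.single 1 1) +
        fderiv ℝ c.f t (EuclideanSpace.single 1 1) • c.b 2) := by
  set e₀ : E2 := EuclideanSpace.single 0 1 with he₀
  set e₁ : E2 := EuclideanSpace.single 1 1 with he₁
  set n := M.ν (c.Y t) with hn
  have hsum := sum_frame_dot c.b (φ (c.Y t))
  rw [Fin.sum_univ_three] at hsum
  obtain ⟨hn0, hnt⟩ := c.normal t ht
  change n ≠ 0 at hn0
  have h0 := hnt e₀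
  have h1 := hnt e₁
  rw [inner_add_right, inner_smul_right, he₀, c.emb_single_zero] at h0
  rw [inner_add_right, inner_smul_right, he₁, c.emb_single_one] at h1
  change inner ℝ n _ + _ * inner ℝ n _ = 0 at h0 h1
  have hn2 : inner ℝ n (c.b 2) ≠ (0 : ℝ) := fun h2 => hn0 (by
    rw [h2, mul_zero, add_zero] at h0 h1
    have := c.b.sum_repr' n
    rw [Fin.sum_univ_three, real_inner_comm, h0, real_inner_comm, h1, real_inner_comm, h2] at this
    simpa using this.symm)
  have htan : toC n ⬝ᵥ φ (c.Y t) = 0 := hφ.tangential _ (c.inter_V_subset hV (c.Y_mem ht))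
  rw [← hsum] at htan
  simp only [dotProduct_add, dotProduct_smul, toC_dot_toC, smul_eq_mul] at htan
  have h0' : ((inner ℝ n (c.b 0) : ℝ) : ℂ) =
      -((fderiv ℝ c.f t e₀ : ℝ) : ℂ) * (inner ℝ n (c.b 2) : ℝ) := by
    rw [← Complex.ofReal_neg, ← Complex.ofReal_mul]
    congr 1; linarith
  have h1' : ((inner ℝ n (c.b 1) : ℝ) : ℂ) =
      -((fderiv ℝ c.f t e₁ : ℝ) : ℂ) * (inner ℝ n (c.b 2) : ℝ) := by
    rw [← Complex.ofReal_neg, ← Complex.ofReal_mul]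
    congr 1; linarith
  rw [h0', h1'] at htan
  have hn2' : ((inner ℝ n (c.b 2) : ℝ) : ℂ) ≠ 0 := by exact_mod_cast hn2
  have h2 : toC (c.b 2) ⬝ᵥ φ (c.Y t) = c.comp φ 0 t * (fderiv ℝ c.f t e₀ : ℝ) +
      c.comp φ 1 t * (fderiv ℝ c.f t e₁ : ℝ) := by
    refine mul_right_cancel₀ hn2' ?_
    unfold comp
    linear_combination htan
  rw [map_add, map_add, toC_smul, toC_smul, he₀, he₁, c.emb_single_zero, c.emb_single_one]
  conv_lhs => rw [← hsum, h2]
  rw [he₀, he₁]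
  unfold comp
  module

theorem norm_comp_le {R : ℝ} {t : E2} (j : Fin 3) (h : ‖φ (c.Y t)‖ ≤ R) :
    ‖c.comp φ j t‖ ≤ 3 * R := by
  refine (norm_dotProduct_le _ _).trans ?_
  have h1 : ‖toC (c.b j)‖ ≤ 1 := (norm_toC_le _).trans (c.b.orthonormal.1 j).le
  have := mul_le_mul h1 h (norm_nonneg _) zero_le_one
  rw [one_mul] at this
  linarith

theorem hasFDerivAt_Y_zero : HasFDerivAt c.Y (emb c.b) 0 := by
  have := c.hasFDerivAt_Y c.zero_mem_ball
  rw [c.fderiv_zero] at this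
  refine this.congr_fderiv ?_
  ext1 e; simp

theorem isBigO_w_sub_one : (fun t => c.w t - 1) =O[𝓝 0] fun t : E2 => ‖t‖ ^ 2 :=
  IsBigO.of_bound (c.C ^ 2) (Filter.Eventually.of_forall fun t => by
    rw [Real.norm_of_nonneg (by linarith [c.one_le_w t]), norm_pow, norm_norm]
    linarith [c.w_le t])

theorem hasFDerivAt_φ_Y (hφ : IsDensity p M φ) (hV : c.V ⊆ p.box) :
    ∃ A : E2 →L[ℝ] C3, HasFDerivAt (fun t => φ (c.Y t)) A 0 := by
  have hx : c.Y 0 ∈ Γb p M := c.inter_V_subset hV (c.Y_mem c.zero_mem_ball)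
  have h1 := ((hφ.contDiffOn _ hx).differentiableWithinAt (by simp)).hasFDerivWithinAt
  have h2 := h1.comp (0 : E2) (c.hasFDerivAt_Y_zero.hasFDerivWithinAt (s := Metric.ball 0 c.R))
    fun t ht => c.inter_V_subset hV (c.Y_mem ht)
  exact ⟨_, h2.hasFDerivAt (Metric.isOpen_ball.mem_nhds c.zero_mem_ball)⟩

/-- The `j`-th coefficient of the density with respect to the coordinate tangent vectors, weighted
by the density of the surface measure. -/
noncomputable def coef (φ : E3 → C3) (j : Fin 3) (t : E2) : ℂ := (c.w t : ℂ) * c.comp φ j t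

theorem hasFDerivAt_w : HasFDerivAt c.w (0 : E2 →L[ℝ] ℝ) 0 := by
  have h0 : c.w 0 = 1 := le_antisymm (by simpa using c.w_le 0) (c.one_le_w 0)
  refine HasFDerivAt.of_isLittleO ?_
  simp only [h0, zero_apply, sub_zero]
  refine c.isBigO_w_sub_one.trans_isLittleO ?_
  have : (fun t : E2 => ‖t‖ ^ 2) =o[𝓝 0] fun t => ‖t‖ ^ 1 := isLittleO_norm_pow_norm_pow one_lt_two
  exact isLittleO_norm_right.1 (by simpa using this)

/-- The functional `w ↦ b_j · w`. -/
noncomputable def dotCL (j : Fin 3) : C3 →L[ℝ] ℂ := (dotL (toC (c.b j))).restrictScalars ℝ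

theorem coef_eq (φ : E3 → C3) (j : Fin 3) :
    c.coef φ j = fun t => c.w t • c.dotCL j (φ (c.Y t)) := by
  ext t; rw [Complex.real_smul]; rfl

theorem exists_hasFDerivAt_coef (hφ : IsDensity p M φ) (hV : c.V ⊆ p.box) (j : Fin 3) :
    ∃ A : E2 →L[ℝ] ℂ, HasFDerivAt (c.coef φ j) A 0 := by
  obtain ⟨A, hA⟩ := c.hasFDerivAt_φ_Y hφ hV
  have h1 := (c.dotCL j).hasFDerivAt.comp (0 : E2) hA
  rw [coef_eq]
  exact ⟨_, c.hasFDerivAt_w.smul h1⟩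

theorem hasFDerivAt_taylor {E F : Type*} [NormedAddCommGroup E] [NormedSpace ℝ E]
    [NormedAddCommGroup F] [NormedSpace ℝ F] {ψ : E → F} {U : Set E} {x₀ : E} {β C : ℝ}
    (hU : IsOpen U) (hx : x₀ ∈ U) (hβ : 0 < β) (hψ : ContDiffOn ℝ 1 ψ U)
    (hC : ∀ y ∈ U, ‖fderiv ℝ ψ y - fderiv ℝ ψ x₀‖ ≤ C * ‖y - x₀‖ ^ β) :
    (fun y => ψ y - ψ x₀ - fderiv ℝ ψ x₀ (y - x₀)) =O[𝓝 x₀] fun y => ‖y - x₀‖ ^ (1 + β) := by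
  obtain ⟨r, hr, hball⟩ := Metric.isOpen_iff.1 hU x₀ hx
  refine IsBigO.of_bound |C| ?_
  filter_upwards [Metric.ball_mem_nhds x₀ hr] with y hy
  have hsub : Metric.closedBall x₀ ‖y - x₀‖ ⊆ U := fun z hz => hball (by
    rw [mem_ball_iff_norm] at hy ⊢
    exact (mem_closedBall_iff_norm.1 hz).trans_lt hy)
  have h := (convex_closedBall x₀ ‖y - x₀‖).norm_image_sub_le_of_norm_hasFDerivWithin_le'
    (f := ψ) (f' := fderiv ℝ ψ) (φ := fderiv ℝ ψ x₀) (C := |C| * ‖y - x₀‖ ^ β) (fun z hz =>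
      (((hψ.contDiffAt (hU.mem_nhds (hsub hz))).differentiableAt
        (by simp)).hasFDerivAt).hasFDerivWithinAt) (fun z hz => ?_)
    (Metric.mem_closedBall_self (norm_nonneg _)) (mem_closedBall_iff_norm.2 le_rfl)
  · refine h.trans (le_of_eq ?_)
    rw [Real.norm_of_nonneg (by positivity), Real.rpow_add_of_nonneg (norm_nonneg _) zero_le_one
      hβ.le, Real.rpow_one]
    ring
  · refine (hC z (hsub hz)).trans (mul_le_mul (le_abs_self C) ?_ (by positivity) (abs_nonneg C))
    exact Real.rpow_le_rpow (norm_nonneg _) (mem_closedBall_iff_norm.1 hz) hβ.le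

theorem isBigO_norm_rpow {s r : ℝ} (hs : 0 ≤ s) (h : s ≤ r) :
    (fun t : E2 => ‖t‖ ^ r) =O[𝓝 0] fun t => ‖t‖ ^ s := by
  refine IsBigO.of_bound 1 ?_
  filter_upwards [Metric.ball_mem_nhds (0 : E2) one_pos] with t ht
  rw [Real.norm_of_nonneg (by positivity), Real.norm_of_nonneg (by positivity), one_mul]
  exact Real.rpow_le_rpow_of_exponent_ge' (norm_nonneg t) (mem_ball_zero_iff.1 ht).le hs h

/-- The coefficients inherit the Hölder regularity of the density. -/
theorem exists_holder_coef (hV : c.V ⊆ p.box) (h : IsC1HolderNear p M φ x₀) (j : Fin 3)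
    {A : E2 →L[ℝ] ℂ} (hA : HasFDerivAt (c.coef φ j) A 0) : ∃ β > (0 : ℝ), ∃ H : ℝ,
      ∀ᶠ t in 𝓝 (0 : E2), ‖c.coef φ j t - c.coef φ j 0 - A t‖ ≤ H * ‖t‖ ^ ((1 : ℝ) + β) := by
  obtain ⟨β, C, U, ψ, hβ, hU, hxU, hψ, hψφ, hC⟩ := h
  set β' := min β 1 with hβ'
  have hβ'0 : 0 < β' := lt_min hβ one_pos
  have hY0 : Filter.Tendsto c.Y (𝓝 0) (𝓝 x₀) := by
    have := c.hasFDerivAt_Y_zero.continuousAt.tendsto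
    rwa [c.Y_zero] at this
  have hball : ∀ᶠ t in 𝓝 (0 : E2), t ∈ Metric.ball (0 : E2) c.R :=
    Metric.isOpen_ball.mem_nhds c.zero_mem_ball
  have hd : HasFDerivAt ψ (fderiv ℝ ψ x₀) x₀ :=
    ((hψ.contDiffAt (hU.mem_nhds hxU)).differentiableAt (by simp)).hasFDerivAt
  set g : E2 → ℂ := fun t => c.dotCL j (ψ (c.Y t)) with hg
  set A' : E2 →L[ℝ] ℂ := (c.dotCL j).comp ((fderiv ℝ ψ x₀).comp (emb c.b)) with hA'
  have hcoef : ∀ᶠ t in 𝓝 (0 : E2), c.coef φ j t = c.w t • g t := by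
    filter_upwards [hball, hY0 (hU.mem_nhds hxU)] with t h1 h2
    rw [coef_eq, hg]
    simp only [hψφ (c.Y t) ⟨h2, c.inter_V_subset hV (c.Y_mem h1)⟩]
  -- the Taylor formula for the extension, along the chart
  have o1 : (fun t => ψ (c.Y t) - ψ x₀ - fderiv ℝ ψ x₀ (c.Y t - x₀)) =O[𝓝 0]
      fun t : E2 => ‖t‖ ^ (1 + β') := by
    have h1 := (hasFDerivAt_taylor hU hxU hβ hψ fun y hy => hC y hy x₀ hxU).comp_tendsto hY0
    refine (h1.trans ?_).trans
      (isBigO_norm_rpow (by linarith) (add_le_add_right (min_le_left β 1) 1))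
    refine IsBigO.of_bound ((3 / 2) ^ (1 + β)) ?_
    filter_upwards [hball] with t ht
    rw [Function.comp_apply, Real.norm_of_nonneg (by positivity),
      Real.norm_of_nonneg (by positivity), ← Real.mul_rpow (by norm_num) (norm_nonneg t)]
    exact Real.rpow_le_rpow (norm_nonneg _) (c.norm_Y_sub_le ht) (by linarith)
  have hsq : (fun t : E2 => ‖t‖ ^ 2) =O[𝓝 0] fun t : E2 => ‖t‖ ^ (1 + β') := by
    have := isBigO_norm_rpow (s := 1 + β') (r := 2) (by linarith)
      (by linarith [min_le_right β 1])
    exact this.congr_left fun t => by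
      rw [show (2 : ℝ) = ((2 : ℕ) : ℝ) by norm_num, Real.rpow_natCast]
  have o2 : (fun t => g t - g 0 - A' t) =O[𝓝 0] fun t : E2 => ‖t‖ ^ (1 + β') := by
    have h2 : (fun t => fderiv ℝ ψ x₀ (c.f t • c.b 2)) =O[𝓝 0] fun t : E2 => ‖t‖ ^ (1 + β') := by
      refine IsBigO.trans ?_ hsq
      refine IsBigO.of_bound (‖fderiv ℝ ψ x₀‖ * c.C) ?_
      filter_upwards [hball] with t ht
      refine ((fderiv ℝ ψ x₀).le_opNorm _).trans ?_
      rw [norm_smul, c.norm_b_two, mul_one, norm_pow, norm_norm, mul_assoc]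
      exact mul_le_mul_of_nonneg_left (c.norm_f_le t ht) (norm_nonneg _)
    have h3 := ((c.dotCL j).isBigO_comp (fun t => ψ (c.Y t) - ψ x₀ - fderiv ℝ ψ x₀ (c.Y t - x₀) +
      fderiv ℝ ψ x₀ (c.f t • c.b 2)) (𝓝 0)).trans (o1.add h2)
    refine h3.congr_left fun t => ?_
    rw [c.Y_sub, map_add (fderiv ℝ ψ x₀), ← sub_sub, sub_add_cancel, map_sub, map_sub]
    change _ = c.dotCL j (ψ (c.Y t)) - c.dotCL j (ψ (c.Y 0)) - _
    rw [c.Y_zero]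
    rfl
  have og : g =O[𝓝 0] fun _ => (1 : ℝ) := by
    have : ContinuousAt g 0 := (c.dotCL j).continuous.continuousAt.comp
      (ContinuousAt.comp (g := ψ) (by rw [c.Y_zero]; exact hd.continuousAt)
        c.hasFDerivAt_Y_zero.continuousAt)
    exact this.tendsto.isBigO_one ℝ
  have o3 : (fun t => (c.w t - 1) • g t) =O[𝓝 0] fun t : E2 => ‖t‖ ^ (1 + β') := by
    have := (c.isBigO_w_sub_one.smul og).congr_right (g₂ := fun t : E2 => ‖t‖ ^ 2) fun t => by simp
    exact this.trans hsq
  have h0 : c.w 0 = 1 := le_antisymm (by simpa using c.w_le 0) (c.one_le_w 0)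
  have hc0 : c.coef φ j 0 = g 0 := by rw [hcoef.self_of_nhds, h0, one_smul]
  have o4 : (fun t => c.coef φ j t - c.coef φ j 0 - A' t) =O[𝓝 0]
      fun t : E2 => ‖t‖ ^ (1 + β') := by
    refine (o2.add o3).congr' ?_ .rfl
    filter_upwards [hcoef] with t ht
    rw [ht, hc0, sub_smul, one_smul]; abel
  have hder : HasFDerivAt (c.coef φ j) A' 0 := by
    refine HasFDerivAt.of_isLittleO ?_
    simp only [sub_zero]
    refine o4.trans_isLittleO (isLittleO_iff.2 fun ε hε => ?_)
    have hlim : Filter.Tendsto (fun t : E2 => ‖t‖ ^ β') (𝓝 0) (𝓝 0) := by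
      have h1 : Continuous fun t : E2 => ‖t‖ ^ β' :=
        continuous_norm.rpow_const fun _ => Or.inr hβ'0.le
      simpa [Real.zero_rpow hβ'0.ne'] using h1.tendsto 0
    filter_upwards [hlim.eventually_lt_const hε] with t ht
    rw [Real.norm_of_nonneg (by positivity), Real.rpow_add_of_nonneg (norm_nonneg _) zero_le_one
      hβ'0.le, Real.rpow_one, mul_comm]
    exact mul_le_mul_of_nonneg_right ht.le (norm_nonneg t)
  obtain ⟨H, hH⟩ := o4.bound
  refine ⟨β', hβ'0, H, ?_⟩
  filter_upwards [hH] with t ht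
  rw [hA.unique hder]
  rwa [Real.norm_of_nonneg (by positivity)] at ht

end GraphChart

end ChartDensity

end PMLJump

namespace PMLJump
open MeasureTheory Asymptotics

/-! ### The double curl near the base point -/

namespace Patch.Direction

variable {P : Patch} (Q : P.Direction) {α : E2 → ℂ} {B : ℝ}

theorem integrableOn_mul_k2 (hm : AEStronglyMeasurable α (volume.restrict (Metric.ball 0 P.R)))
    (hb : ∀ t ∈ Metric.ball (0 : E2) P.R, ‖α t‖ ≤ B) (e : E2) {h : ℝ} (hh : |h| ≤ P.h₀)
    (h0 : h ≠ 0) :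
    IntegrableOn (fun t => α t * k2 (Q.b h) (P.z h t) (P.D e t)) (Metric.ball 0 P.R) := by
  obtain ⟨c, hc, hk⟩ := Q.exists_bound_k2 e
  have hp := abs_pos.2 h0
  refine IntegrableOn.of_bound measure_ball_lt_top
    (hm.mul ((Q.continuousOn_slice_k2 e hh h0).aestronglyMeasurable
      Metric.isOpen_ball.measurableSet)) (B * (c * |h|⁻¹ ^ 3)) ?_
  filter_upwards [ae_restrict_mem Metric.isOpen_ball.measurableSet] with t ht
  have h2 : |h| ≤ Patch.d (h, t) := by unfold Patch.d; linarith [norm_nonneg t]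
  rw [norm_mul]
  refine mul_le_mul (hb t ht) ((hk (h, t) (P.mem_rset.2 ⟨hh, ht, Or.inl h0⟩)).trans ?_)
    (norm_nonneg _) ((norm_nonneg _).trans (hb t ht))
  exact mul_le_mul_of_nonneg_left
    (pow_le_pow_left₀ (inv_nonneg.2 (hp.le.trans h2)) (inv_anti₀ hp h2) 3) hc

theorem exists_bound_mul_zero (hb : ∀ t ∈ Metric.ball (0 : E2) P.R, ‖α t‖ ≤ B) (e : E2) :
    ∃ c, 0 ≤ c ∧ ∀ t ∈ Metric.ball (0 : E2) P.R, t ≠ 0 →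
      ‖α t * k2 (Q.b 0) (P.ψ t) (P.D e t)‖ ≤ c * ‖t‖⁻¹ ^ 3 := by
  obtain ⟨c, hc, hk⟩ := Q.exists_bound_zero e
  have hB : 0 ≤ B := (norm_nonneg _).trans (hb 0 P.zero_mem)
  refine ⟨B * c, mul_nonneg hB hc, fun t ht h0 => ?_⟩
  rw [norm_mul, mul_assoc]
  exact mul_le_mul (hb t ht) (hk t ht h0) (norm_nonneg _) hB

theorem aestronglyMeasurable_mul_zero
    (hm : AEStronglyMeasurable α (volume.restrict (Metric.ball 0 P.R))) (e : E2) :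
    AEStronglyMeasurable (fun t => α t * k2 (Q.b 0) (P.ψ t) (P.D e t))
      (volume.restrict (Metric.ball 0 P.R)) :=
  hm.mul (aestronglyMeasurable_of_continuousOn (P.continuousOn_k2_ψ (Q.b 0) e))

end Patch.Direction

/-- A function with a cubic singularity is integrable away from it. -/
theorem integrableOn_sdiff_of_cubic {R c ε : ℝ} {m : E2 → ℂ}
    (hm : AEStronglyMeasurable m (volume.restrict (Metric.ball 0 R))) (hc : 0 ≤ c)
    (hb : ∀ t ∈ Metric.ball (0 : E2) R, t ≠ 0 → ‖m t‖ ≤ c * ‖t‖⁻¹ ^ 3) (hε : 0 < ε) :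
    IntegrableOn m (Metric.ball 0 R \ Metric.ball 0 ε) := by
  refine IntegrableOn.of_bound ((measure_mono Set.sdiff_subset).trans_lt measure_ball_lt_top)
    (hm.mono_set Set.sdiff_subset) (c * ε⁻¹ ^ 3) ?_
  filter_upwards [ae_restrict_mem (Metric.isOpen_ball.measurableSet.diff
    Metric.isOpen_ball.measurableSet)] with t ht
  have h1 : ε ≤ ‖t‖ := by simpa using ht.2
  refine (hb t ht.1 (norm_pos_iff.1 (hε.trans_le h1))).trans ?_
  gcongr

section Truncation

variable {p : PML} {M : LayeredMedium p.a} {x₀ : E3} (c : GraphChart M x₀)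

theorem area_annulus {r ε : ℝ} (hr : 0 ≤ r) (h : r ≤ ε) :
    volume.real (Metric.ball (0 : E2) ε \ Metric.ball 0 r) =
      (ε ^ 2 - r ^ 2) * volume.real (Metric.ball (0 : E2) 1) := by
  rw [measureReal_sdiff (Metric.ball_subset_ball h) Metric.isOpen_ball.measurableSet,
    measureReal_def, measureReal_def, measureReal_def, Measure.addHaar_ball _ _ (hr.trans h),
    Measure.addHaar_ball _ _ hr, finrank_euclideanSpace_fin, ENNReal.toReal_mul,
    ENNReal.toReal_mul, ENNReal.toReal_ofReal (by positivity),
    ENNReal.toReal_ofReal (by positivity)]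
  ring

/-- Balls of the parameter plane and of the ambient space truncate alike: the regions differ by an
annulus of area `O(ε ^ 4)`, on which a cubic singularity is of size `ε ^ (-3)`. -/
theorem GraphChart.tendsto_truncation_sub {m : E2 → ℂ} {K : E3 → ℂ} {B : ℝ} (hB : 0 ≤ B)
    (hm : AEStronglyMeasurable m (volume.restrict (Metric.ball 0 c.R)))
    (hb : ∀ t ∈ Metric.ball (0 : E2) c.R, t ≠ 0 → ‖m t‖ ≤ B * ‖t‖⁻¹ ^ 3)
    (hK : AEStronglyMeasurable K ((μHE[2] : Measure E3).restrict (M.Γ ∩ c.V)))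
    (hmK : ∀ t ∈ Metric.ball (0 : E2) c.R, c.w t • K (c.Y t) = m t) :
    Filter.Tendsto (fun ε : ℝ => (∫ y in M.Γ ∩ c.V ∩ (Metric.ball x₀ ε)ᶜ, K y
      ∂(μHE[2] : Measure E3)) - ∫ t in Metric.ball 0 c.R \ Metric.ball 0 ε, m t) (𝓝[>] 0)
      (𝓝 0) := by
  have hC := c.C_nonneg
  set v := volume.real (Metric.ball (0 : E2) 1) with hv
  have hlim : Filter.Tendsto (fun ε : ℝ => ε * (16 * B * c.C ^ 2 * v)) (𝓝[>] 0) (𝓝 0) := by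
    simpa using tendsto_id_nhdsGT.mul_const (16 * B * c.C ^ 2 * v)
  have hsmall : ∀ᶠ ε in 𝓝[>] (0 : ℝ), c.C ^ 2 * ε ^ 2 < 1 / 2 := by
    have h1 : Continuous fun ε : ℝ => c.C ^ 2 * ε ^ 2 := by fun_prop
    refine nhdsWithin_le_nhds (h1.continuousAt.eventually_lt continuousAt_const ?_)
    norm_num
  refine squeeze_zero_norm' ?_ hlim
  filter_upwards [hsmall, self_mem_nhdsWithin] with ε hsm hε'
  have hε : 0 < ε := hε'
  have hmb : MeasurableSet (Metric.ball x₀ ε)ᶜ := Metric.isOpen_ball.measurableSet.compl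
  have hmb' : MeasurableSet (Metric.ball (0 : E2) ε)ᶜ := Metric.isOpen_ball.measurableSet.compl
  have hK' : AEStronglyMeasurable ((Metric.ball x₀ ε)ᶜ.indicator K)
      ((μHE[2] : Measure E3).restrict (M.Γ ∩ c.V)) := hK.indicator hmb
  have e1 : ∫ y in M.Γ ∩ c.V ∩ (Metric.ball x₀ ε)ᶜ, K y ∂(μHE[2] : Measure E3) =
      ∫ t in Metric.ball 0 c.R, c.w t • (Metric.ball x₀ ε)ᶜ.indicator K (c.Y t) := by
    rw [← setIntegral_indicator hmb, c.integral_eq hK']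
  have e2 : ∫ t in Metric.ball 0 c.R \ Metric.ball 0 ε, m t =
      ∫ t in Metric.ball 0 c.R, (Metric.ball (0 : E2) ε)ᶜ.indicator m t := by
    rw [setIntegral_indicator hmb', Set.sdiff_eq]
  set r := ε - c.C ^ 2 * ε ^ 3 with hr
  have hr2 : ε / 2 ≤ r := by
    rw [hr]
    nlinarith
  have hrε : r ≤ ε := by
    rw [hr]
    have : 0 ≤ c.C ^ 2 * ε ^ 3 := by positivity
    linarith
  have hval : ∀ t ∈ Metric.ball (0 : E2) c.R,
      c.w t • (Metric.ball x₀ ε)ᶜ.indicator K (c.Y t) =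
        if ε ≤ ‖c.Y t - x₀‖ then m t else 0 := fun t ht => by
    by_cases h : ε ≤ ‖c.Y t - x₀‖
    · rw [if_pos h, Set.indicator_of_mem (by simpa [dist_eq_norm] using h), hmK t ht]
    · rw [if_neg h, Set.indicator_of_notMem (by simpa [dist_eq_norm] using h), smul_zero]
  have hY : ∀ t ∈ Metric.ball (0 : E2) c.R, ε ≤ ‖c.Y t - x₀‖ → r ≤ ‖t‖ := fun t ht h => by
    by_contra! hlt
    have h1 : ‖c.Y t - x₀‖ ^ 2 ≤ ‖t‖ ^ 2 * (1 + c.C ^ 2 * ‖t‖ ^ 2) := by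
      rw [c.Y_sub, norm_emb_add_sq]
      have h2 := pow_le_pow_left₀ (abs_nonneg _) (c.norm_f_le t ht) 2
      rw [sq_abs] at h2
      linarith
    have h3 : ‖t‖ < ε := hlt.trans_le hrε
    have h4 : ‖t‖ ^ 2 < r ^ 2 := pow_lt_pow_left₀ hlt (norm_nonneg _) two_ne_zero
    have h5 : ‖t‖ ^ 2 ≤ ε ^ 2 := pow_le_pow_left₀ (norm_nonneg _) h3.le 2
    have h6 : ε ^ 2 ≤ ‖c.Y t - x₀‖ ^ 2 := pow_le_pow_left₀ hε.le h 2
    have h7 : ‖t‖ ^ 2 * (1 + c.C ^ 2 * ‖t‖ ^ 2) < r ^ 2 * (1 + c.C ^ 2 * ε ^ 2) := by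
      have h8 : 1 + c.C ^ 2 * ‖t‖ ^ 2 ≤ 1 + c.C ^ 2 * ε ^ 2 := by gcongr
      exact mul_lt_mul h4 h8 (by positivity) (by positivity)
    -- `r = ε (1 - q)` with `q = C² ε²`, and `(1 - q)² (1 + q) ≤ 1`
    have h9 : r ^ 2 * (1 + c.C ^ 2 * ε ^ 2) ≤ ε ^ 2 := by
      set q := c.C ^ 2 * ε ^ 2 with hq
      have hq0 : 0 ≤ q := by positivity
      have : r = ε * (1 - q) := by rw [hr, hq]; ring
      rw [this, mul_pow, mul_assoc]
      have : (1 - q) ^ 2 * (1 + q) ≤ 1 := by nlinarith [mul_nonneg hq0 hq0]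
      exact mul_le_of_le_one_right (by positivity) this
    linarith
  have hbd : ∀ t ∈ Metric.ball (0 : E2) c.R, ε / 2 ≤ ‖t‖ → ‖m t‖ ≤ 8 * B * ε⁻¹ ^ 3 :=
    fun t ht h => by
      refine (hb t ht (norm_pos_iff.1 (lt_of_lt_of_le (by positivity) h))).trans ?_
      calc B * ‖t‖⁻¹ ^ 3 ≤ B * (ε / 2)⁻¹ ^ 3 := by gcongr
        _ = _ := by field_simp; norm_num
  have i1 : IntegrableOn (fun t => c.w t • (Metric.ball x₀ ε)ᶜ.indicator K (c.Y t))
      (Metric.ball 0 c.R) := by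
    refine IntegrableOn.of_bound measure_ball_lt_top
      (c.measurable_w.aestronglyMeasurable.smul (c.aestronglyMeasurable_comp_Y hK'))
      (8 * B * ε⁻¹ ^ 3) ?_
    filter_upwards [ae_restrict_mem Metric.isOpen_ball.measurableSet] with t ht
    rw [hval t ht]
    split_ifs with h
    · exact hbd t ht (hr2.trans (hY t ht h))
    · rw [norm_zero]; positivity
  have i2 : IntegrableOn ((Metric.ball (0 : E2) ε)ᶜ.indicator m) (Metric.ball 0 c.R) := by
    rw [IntegrableOn, integrable_indicator_iff hmb', IntegrableOn,
      Measure.restrict_restrict hmb', Set.inter_comm, ← Set.sdiff_eq]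
    exact integrableOn_sdiff_of_cubic hm hB hb hε
  rw [e1, e2, ← integral_sub i1 i2]
  set A := Metric.ball (0 : E2) ε \ Metric.ball 0 r with hA
  have hAm : MeasurableSet A := Metric.isOpen_ball.measurableSet.diff
    Metric.isOpen_ball.measurableSet
  have iA : Integrable (A.indicator fun _ => 8 * B * ε⁻¹ ^ 3) :=
    (integrable_indicator_iff hAm).2 (integrableOn_const
      ((measure_mono Set.sdiff_subset).trans_lt measure_ball_lt_top).ne)
  refine (norm_integral_le_of_norm_le (iA.integrableOn (s := Metric.ball 0 c.R)) ?_).trans ?_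
  · filter_upwards [ae_restrict_mem Metric.isOpen_ball.measurableSet] with t ht
    rw [hval t ht]
    have hind : 0 ≤ A.indicator (fun _ => 8 * B * ε⁻¹ ^ 3) t :=
      Set.indicator_nonneg (fun _ _ => by positivity) t
    by_cases h1 : ε ≤ ‖t‖
    · have h2 : ε ≤ ‖c.Y t - x₀‖ := h1.trans (c.norm_le_norm_Y_sub t)
      rw [if_pos h2, Set.indicator_of_mem (by simpa using h1), sub_self, norm_zero]
      exact hind
    · rw [Set.indicator_of_notMem (s := (Metric.ball (0 : E2) ε)ᶜ) (by simpa using h1), sub_zero]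
      split_ifs with h2
      · have h3 := hY t ht h2
        have h4 : t ∈ A := ⟨by simpa using h1, by simpa using h3⟩
        rw [Set.indicator_of_mem h4]
        exact hbd t ht (hr2.trans h3)
      · rw [norm_zero]; exact hind
  · refine (setIntegral_le_integral iA (Filter.Eventually.of_forall
      (Set.indicator_nonneg fun _ _ => by positivity))).trans ?_
    rw [integral_indicator hAm, setIntegral_const, area_annulus (by linarith) hrε, smul_eq_mul,
      ← hv]
    have hv0 : 0 ≤ v := measureReal_nonneg
    have h1 : ε ^ 2 - r ^ 2 ≤ 2 * c.C ^ 2 * ε ^ 4 := by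
      rw [hr]; nlinarith [sq_nonneg (c.C ^ 2 * ε ^ 3)]
    calc (ε ^ 2 - r ^ 2) * v * (8 * B * ε⁻¹ ^ 3)
        ≤ 2 * c.C ^ 2 * ε ^ 4 * v * (8 * B * ε⁻¹ ^ 3) := by gcongr
      _ = _ := by field_simp; ring

end Truncation

end PMLJump

namespace PMLJump
open MeasureTheory Asymptotics

/-! ### The tangential trace of the double curl -/

section DoubleCurl

variable {p : PML} {M : LayeredMedium p.a} {x₀ : E3} {φ : E3 → C3}

namespace GraphChart

variable (c : GraphChart M x₀)

theorem nZ_Y (hV : c.V ⊆ p.box) (h : ℝ) (t : E2) :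
    nZ p M x₀ (h, c.Y t) = -(c.patch hV).z h t := by
  change _ = -((p.X (c.Y t) - p.X x₀) - (p.X (normalPt M x₀ h) - p.X x₀))
  rw [nZ]; abel

theorem aestronglyMeasurable_φ (hφ : IsDensity p M φ) (hV : c.V ⊆ p.box) :
    AEStronglyMeasurable φ ((μHE[2] : Measure E3).restrict (M.Γ ∩ c.V)) :=
  AEStronglyMeasurable.mono_set (c.inter_V_subset hV) hφ.aestronglyMeasurable

theorem aestronglyMeasurable_coef (hφ : IsDensity p M φ) (hV : c.V ⊆ p.box) (j : Fin 3) :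
    AEStronglyMeasurable (c.coef φ j) (volume.restrict (Metric.ball 0 c.R)) := by
  rw [coef_eq]
  exact c.measurable_w.aestronglyMeasurable.smul ((c.dotCL j).continuous.comp_aestronglyMeasurable
    (c.aestronglyMeasurable_comp_Y (c.aestronglyMeasurable_φ hφ hV)))

theorem exists_bound_coef (hφ : IsDensity p M φ) (hV : c.V ⊆ p.box) :
    ∃ B, 0 ≤ B ∧ ∀ j, ∀ t ∈ Metric.ball (0 : E2) c.R, ‖c.coef φ j t‖ ≤ B := by
  obtain ⟨R, hR0, hR⟩ := hφ.exists_bound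
  refine ⟨2 * (3 * R), by positivity, fun j t ht => ?_⟩
  rw [coef, norm_mul, Complex.norm_real, Real.norm_of_nonneg (c.w_nonneg t)]
  exact mul_le_mul (c.w_le_two ht)
    (c.norm_comp_le j (hR _ (c.inter_V_subset hV (c.Y_mem ht)))) (norm_nonneg _) (by norm_num)

/-- In the chart, the double curl kernel acts on the coordinate tangent vectors. -/
theorem w_smul_k2 (hφ : IsDensity p M φ) (hV : c.V ⊆ p.box) {t : E2}
    (ht : t ∈ Metric.ball (0 : E2) c.R) (b : C3) (h : ℝ) :
    c.w t • k2 b (nZ p M x₀ (h, c.Y t)) (dens p φ (c.Y t)) =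
      c.coef φ 0 t * k2 b ((c.patch hV).z h t) ((c.patch hV).D (EuclideanSpace.single 0 1) t) +
      c.coef φ 1 t * k2 b ((c.patch hV).z h t) ((c.patch hV).D (EuclideanSpace.single 1 1) t) := by
  have hD : ∀ e, (c.patch hV).D e t =
      p.β (c.Y t) * toC (emb c.b e + fderiv ℝ c.f t e • c.b 2) := fun e => c.fderiv_X_Y ht e
  have hdens : dens p φ (c.Y t) =
      c.comp φ 0 t • (c.patch hV).D (EuclideanSpace.single 0 1) t +
      c.comp φ 1 t • (c.patch hV).D (EuclideanSpace.single 1 1) t := by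
    rw [dens, c.φ_Y_eq hφ hV ht, hD, hD, mul_add, mul_smul_comm, mul_smul_comm]
  rw [c.nZ_Y hV, k2_neg, hdens, Complex.real_smul, coef, coef]
  simp only [k2_eq, dotProduct_add, dotProduct_smul, smul_eq_mul]
  ring

/-- The part of a tangential component of the double curl that comes from a neighbourhood of the
base point, for wave number zero. -/
theorem followsTruncation_near (hφ : IsDensity p M φ) (hV : c.V ⊆ p.box) (e' : E2) :
    FollowsTruncation (IsC1HolderNear p M φ x₀)
      (fun h => ∫ y in M.Γ ∩ c.V, k2 ((c.direction hV e').b h) (nZ p M x₀ (h, y)) (dens p φ y)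
        ∂(μHE[2] : Measure E3))
      (fun ε => ∫ y in M.Γ ∩ c.V ∩ (Metric.ball x₀ ε)ᶜ,
        k2 ((c.direction hV e').b 0) (nZ p M x₀ (0, y)) (dens p φ y) ∂(μHE[2] : Measure E3)) := by
  set Q := c.direction hV e' with hQ
  obtain ⟨B, hB0, hB⟩ := c.exists_bound_coef hφ hV
  have hm := c.aestronglyMeasurable_coef hφ hV
  have hK : ∀ h, AEStronglyMeasurable (fun y => k2 (Q.b h) (nZ p M x₀ (h, y)) (dens p φ y))
      ((μHE[2] : Measure E3).restrict (M.Γ ∩ c.V)) := fun h =>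
    AEStronglyMeasurable.mono_set (c.inter_V_subset hV)
      (aestronglyMeasurable_nZ (K := fun v : C3 × C3 => k2 (Q.b h) v.1 v.2)
        (contDiffOn_k2_right p.S (Q.b h)).continuousOn hφ.aestronglyMeasurable_dens h)
  have jump : ∀ j e, FollowsTruncation (IsC1HolderNear p M φ x₀)
      (fun h => ∫ t in Metric.ball 0 c.R,
        c.coef φ j t * k2 (Q.b h) ((c.patch hV).z h t) ((c.patch hV).D e t))
      (fun ε => ∫ t in Metric.ball 0 c.R \ Metric.ball 0 ε,
        c.coef φ j t * k2 (Q.b 0) ((c.patch hV).ψ t) ((c.patch hV).D e t)) := fun j e => by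
    obtain ⟨A, hA⟩ := c.exists_hasFDerivAt_coef hφ hV j
    obtain ⟨v, h1, h2, h3⟩ := Q.exists_jump e (hm j) (hB j) hA
    exact ⟨v, h1, h2, fun hH => h3 (c.exists_holder_coef hV hH j hA)⟩
  set e₀ : E2 := EuclideanSpace.single 0 1 with he₀
  set e₁ : E2 := EuclideanSpace.single 1 1 with he₁
  obtain ⟨B₀, hB₀, hb₀⟩ := Q.exists_bound_mul_zero (hB 0) e₀
  obtain ⟨B₁, hB₁, hb₁⟩ := Q.exists_bound_mul_zero (hB 1) e₁
  have hm₀ := Q.aestronglyMeasurable_mul_zero (hm 0) e₀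
  have hm₁ := Q.aestronglyMeasurable_mul_zero (hm 1) e₁
  have htr := c.tendsto_truncation_sub (add_nonneg hB₀ hB₁) (hm₀.add hm₁)
    (fun t ht h0 => by
      rw [add_mul]
      exact (norm_add_le _ _).trans (add_le_add (hb₀ t ht h0) (hb₁ t ht h0)))
    (hK 0) fun t ht => by
      rw [c.w_smul_k2 hφ hV ht, (c.patch hV).z_zero]; rfl
  refine (((jump 0 e₀).add (jump 1 e₁)).add
    (FollowsTruncation.of_tendsto tendsto_const_nhds htr)).congr ?_ ?_
  · filter_upwards [(c.patch hV).eventually_small] with h hh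
    rw [add_zero, c.integral_eq (hK h)]
    refine (integral_add (Q.integrableOn_mul_k2 (hm 0) (hB 0) e₀ hh.1 hh.2)
      (Q.integrableOn_mul_k2 (hm 1) (hB 1) e₁ hh.1 hh.2)).symm.trans ?_
    exact setIntegral_congr_fun Metric.isOpen_ball.measurableSet
      fun t ht => (c.w_smul_k2 hφ hV ht _ h).symm
  · filter_upwards [self_mem_nhdsWithin] with ε hε
    have hε' : 0 < ε := hε
    have h1 := integral_add (integrableOn_sdiff_of_cubic hm₀ hB₀ hb₀ hε')
      (integrableOn_sdiff_of_cubic hm₁ hB₁ hb₁ hε')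
    refine (congrArg (· + _) h1.symm).trans ?_
    exact add_sub_cancel _ _

end GraphChart

/-- The vector `e_i × n`. -/
noncomputable def tangentVec (n : E3) (i : Fin 3) : E3 :=
  WithLp.toLp 2 ((Pi.single i 1 : Fin 3 → ℝ) ⨯₃ n.ofLp)

theorem inner_tangentVec (n : E3) (i : Fin 3) : inner ℝ n (tangentVec n i) = 0 := by
  fin_cases i <;>
    simp [tangentVec, PiLp.inner_apply, Fin.sum_univ_three, cross_apply] <;> ring

/-- The components of a tangential trace are the products with tangent vectors. -/
theorem traceCL_component (n : E3) (b w : C3) (i : Fin 3) :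
    traceCL n b w i = (b * toC (tangentVec n i)) ⬝ᵥ w := by
  fin_cases i <;>
    simp [traceCL_apply, tangentVec, toC_apply, dotProduct, Fin.sum_univ_three, cross_apply] <;>
    ring

theorem GraphChart.emb_prj_tangentVec (c : GraphChart M x₀) (i : Fin 3) :
    emb c.b (prj c.b (tangentVec (M.ν x₀) i)) = tangentVec (M.ν x₀) i := by
  have := emb_prj_add c.b (tangentVec (M.ν x₀) i)
  rwa [c.frame_two, inner_tangentVec, zero_smul, add_zero] at this

/-- The tangential trace of the double curl follows the truncated hypersingular integral. -/
theorem IsDensity.followsTruncation_Spot (hφ : IsDensity p M φ) (hx : x₀ ∈ Γb p M) (k : ℂ) :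
    FollowsTruncation (IsC1HolderNear p M φ x₀)
      (fun h => rcross (M.ν x₀) (Spot p M k φ (normalPt M x₀ h)))
      (fun ε => ∫ y in Γb p M \ Metric.ball x₀ ε, Nker p M k φ x₀ y
        ∂(μHE[2] : Measure E3)) := by
  obtain ⟨c, hV⟩ := exists_chart_box hx
  obtain ⟨ρ, hρ, hfar⟩ := c.exists_dist_le
  obtain ⟨h₀, D, hh₀, hnot, hD, hcmp⟩ := exists_comparable hx
  obtain ⟨Rd, hRd0, hRd⟩ := hφ.exists_bound_dens
  have hVm : MeasurableSet c.V := c.isOpen_V.measurableSet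
  have hbm : ∀ ε : ℝ, MeasurableSet (Metric.ball x₀ ε)ᶜ :=
    fun ε => Metric.isOpen_ball.measurableSet.compl
  have hdens : (fun v : ℝ × E3 => dens p φ v.2) =O[Filter.principal (nset p M x₀ h₀)]
      fun _ => (1 : ℝ) :=
    isBigO_principal.2 ⟨Rd, fun v hv => by simpa using hRd v.2 (mem_nset.1 hv).2.1⟩
  obtain ⟨C₁, hC₁⟩ := isBigO_principal.1 (hcmp.isBigO_Ks_sub hD k hdens)
  obtain ⟨C₂, hC₂⟩ := isBigO_principal.1 (hcmp.isBigO_Ks hdens hD)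
  set κ : ℂ → ℝ → E3 → C3 := fun k h y => Ks k (nZ p M x₀ (h, y), dens p φ y) with hκ
  have bκ : ∀ h, |h| ≤ h₀ → ∀ y ∈ Γb p M, y ≠ x₀ →
      ‖κ k h y - κ 0 h y‖ ≤ |C₁| * ‖x₀ - y‖⁻¹ ∧ ‖κ 0 h y‖ ≤ |C₂| * ‖x₀ - y‖⁻¹ ^ 3 := by
    intro h hh y hy hne
    have h1 : 0 < ‖x₀ - y‖ := norm_pos_iff.2 (sub_ne_zero.2 hne.symm)
    have h2 : ‖x₀ - y‖ ≤ nd x₀ (h, y) := by unfold nd; linarith [abs_nonneg h]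
    have h3 : (nd x₀ (h, y))⁻¹ ≤ ‖x₀ - y‖⁻¹ := inv_anti₀ h1 h2
    have h4 : 0 ≤ (nd x₀ (h, y))⁻¹ := inv_nonneg.2 (h1.le.trans h2)
    have a1 := hC₁ (h, y) (mem_nset.2 ⟨hh, hy, hne⟩)
    have a2 := hC₂ (h, y) (mem_nset.2 ⟨hh, hy, hne⟩)
    rw [Real.norm_of_nonneg h4] at a1
    rw [Real.norm_of_nonneg (pow_nonneg h4 3)] at a2
    exact ⟨a1.trans (mul_le_mul (le_abs_self _) h3 h4 (abs_nonneg _)), a2.trans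
      (mul_le_mul (le_abs_self _) (pow_le_pow_left₀ h4 h3 3) (pow_nonneg h4 3) (abs_nonneg _))⟩
  have mκ : ∀ k h, AEStronglyMeasurable (κ k h) (sμ p M) := fun k h =>
    aestronglyMeasurable_nZ (contDiffOn_Ks p.S k).continuousOn hφ.aestronglyMeasurable_dens h
  have iκ : ∀ k h, |h| ≤ h₀ → h ≠ 0 → Integrable (κ k h) (sμ p M) := fun k h hh h0 =>
    hφ.integrable_nZ (contDiffOn_Ks p.S k).continuousOn (hnot h hh h0)
  have hae : ∀ᵐ y ∂(sμ p M), y ∈ Γb p M ∧ y ≠ x₀ := ae_sμ.and (ae_sμ_ne x₀)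
  have iκ₀ : ∀ ε, 0 < ε → IntegrableOn (κ 0 0) (Metric.ball x₀ ε)ᶜ (sμ p M) := fun ε hε => by
    refine IntegrableOn.of_bound (measure_lt_top _ _) (mκ 0 0).restrict (|C₂| * ε⁻¹ ^ 3) ?_
    filter_upwards [ae_restrict_mem (hbm ε), ae_restrict_of_ae hae] with y h1 h2
    refine (bκ 0 (by simpa using hh₀.le) y h2.1 h2.2).2.trans ?_
    have h3 : ε ≤ ‖x₀ - y‖ := by simpa [dist_eq_norm, norm_sub_rev] using h1
    gcongr
  -- the kernel without its static part near the base point is weakly singular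
  set g : ℝ → E3 → C3 := fun h y => κ k h y - c.V.indicator (κ 0 h) y with hg
  obtain ⟨ig, lF, lT⟩ := tendsto_integral_sμ (g := g) (C := |C₁| + |C₂| * ρ⁻¹ ^ 2) hx hh₀
    (fun h _ => (mκ k h).sub ((mκ 0 h).indicator hVm))
    (fun h hh y hy hne => by
      obtain ⟨h1, h2⟩ := bκ h hh y hy hne
      have h0 : 0 < ‖x₀ - y‖ := norm_pos_iff.2 (sub_ne_zero.2 hne.symm)
      by_cases hyV : y ∈ c.V
      · simp only [hg, Set.indicator_of_mem hyV]
        refine h1.trans (mul_le_mul_of_nonneg_right ?_ (inv_nonneg.2 h0.le))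
        have : 0 ≤ |C₂| * ρ⁻¹ ^ 2 := by positivity
        linarith
      · simp only [hg, Set.indicator_of_notMem hyV, sub_zero]
        have h3 : ‖x₀ - y‖⁻¹ ≤ ρ⁻¹ := inv_anti₀ hρ (hfar y hyV)
        calc _ = ‖(κ k h y - κ 0 h y) + κ 0 h y‖ := by rw [sub_add_cancel]
          _ ≤ |C₁| * ‖x₀ - y‖⁻¹ + |C₂| * ‖x₀ - y‖⁻¹ ^ 3 :=
            (norm_add_le _ _).trans (add_le_add h1 h2)
          _ = (|C₁| + |C₂| * ‖x₀ - y‖⁻¹ ^ 2) * ‖x₀ - y‖⁻¹ := by ring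
          _ ≤ _ := by gcongr)
    (fun y _ hne => by
      have ck : ∀ k, Filter.Tendsto (fun h => κ k h y) (𝓝 0) (𝓝 (κ k 0 y)) := fun k =>
        (continuousAt_kernel (contDiffOn_Ks p.S k).continuousOn hne (dens p φ y)).tendsto
      by_cases hyV : y ∈ c.V
      · simp only [hg, Set.indicator_of_mem hyV]
        exact (ck k).sub (ck 0)
      · simp only [hg, Set.indicator_of_notMem hyV]
        exact (ck k).sub tendsto_const_nhds)
  have hβ : Filter.Tendsto (fun h => p.β (normalPt M x₀ h)) (𝓝 0) (𝓝 (p.β x₀)) := by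
    have := (continuous_β_normalPt (p := p) (M := M) (x₀ := x₀)).tendsto 0
    rwa [normalPt_zero] at this
  have lF' : Filter.Tendsto (fun h => traceCL (M.ν x₀) (p.β (normalPt M x₀ h))
      (∫ y, g h y ∂(sμ p M))) (𝓝[≠] 0) (𝓝 (traceCL (M.ν x₀) (p.β x₀) (∫ y, g 0 y ∂(sμ p M)))) :=
    (((continuous_traceCL (M.ν x₀)).tendsto (p.β x₀, _)).comp (hβ.prodMk_nhds lF)).mono_left
      nhdsWithin_le_nhds
  have lT' : Filter.Tendsto (fun ε => traceCL (M.ν x₀) (p.β x₀)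
      (∫ y in (Metric.ball x₀ ε)ᶜ, g 0 y ∂(sμ p M))) (𝓝[>] 0)
      (𝓝 (traceCL (M.ν x₀) (p.β x₀) (∫ y, g 0 y ∂(sμ p M)))) :=
    ((traceCL (M.ν x₀) (p.β x₀)).continuous.tendsto _).comp lT
  have hrV : (sμ p M).restrict c.V = (μHE[2] : Measure E3).restrict (M.Γ ∩ c.V) := by
    rw [sμ, Measure.restrict_restrict hVm, Set.inter_comm, c.Γb_inter_V hV]
  have hrε : ∀ ε : ℝ, (sμ p M).restrict ((Metric.ball x₀ ε)ᶜ ∩ c.V) =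
      (μHE[2] : Measure E3).restrict (M.Γ ∩ c.V ∩ (Metric.ball x₀ ε)ᶜ) := fun ε => by
    rw [← Measure.restrict_restrict (hbm ε), hrV, Measure.restrict_restrict (hbm ε),
      Set.inter_comm]
  have hb : ∀ i h, p.β (normalPt M x₀ h) * toC (tangentVec (M.ν x₀) i) =
      (c.direction hV (prj c.b (tangentVec (M.ν x₀) i))).b h := fun i h => by
    conv_lhs => rw [← c.emb_prj_tangentVec i]
    rfl
  have near : FollowsTruncation (IsC1HolderNear p M φ x₀)
      (fun h => traceCL (M.ν x₀) (p.β (normalPt M x₀ h)) (∫ y in c.V, κ 0 h y ∂(sμ p M)))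
      (fun ε => traceCL (M.ν x₀) (p.β x₀)
        (∫ y in (Metric.ball x₀ ε)ᶜ ∩ c.V, κ 0 0 y ∂(sμ p M))) := by
    refine FollowsTruncation.pi fun i => ?_
    refine (c.followsTruncation_near hφ hV (prj c.b (tangentVec (M.ν x₀) i))).congr ?_ ?_
    · have hh : ∀ᶠ h in 𝓝 (0 : ℝ), |h| < h₀ :=
        continuous_abs.continuousAt.eventually_lt continuousAt_const (by simpa using hh₀)
      filter_upwards [nhdsWithin_le_nhds hh, self_mem_nhdsWithin] with h hlt hne
      rw [traceCL_component, hb, ← dotL_apply,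
        ← ContinuousLinearMap.integral_comp_comm _ (iκ 0 h hlt.le hne).integrableOn, hrV]
      rfl
    · filter_upwards [self_mem_nhdsWithin] with ε hε
      have e := hb i 0
      rw [normalPt_zero] at e
      rw [traceCL_component, e, ← dotL_apply, ← ContinuousLinearMap.integral_comp_comm _
        ((iκ₀ ε hε).mono_set Set.inter_subset_left), hrε]
      rfl
  refine ((FollowsTruncation.of_tendsto lF' lT').add near).congr ?_ ?_
  · have hh : ∀ᶠ h in 𝓝 (0 : ℝ), |h| < h₀ :=
      continuous_abs.continuousAt.eventually_lt continuousAt_const (by simpa using hh₀)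
    filter_upwards [nhdsWithin_le_nhds hh, self_mem_nhdsWithin] with h hlt hne
    have i0 := iκ 0 h hlt.le hne
    rw [← map_add, hφ.Spot_eq k (hnot h hlt.le hne), p.B_mulVec]
    have e : ∫ y, g h y ∂(sμ p M) = ∫ y, κ k h y ∂(sμ p M) - ∫ y in c.V, κ 0 h y ∂(sμ p M) := by
      rw [← integral_indicator hVm]
      exact integral_sub (iκ k h hlt.le hne) (i0.indicator hVm)
    rw [e, sub_add_cancel]
    rfl
  · filter_upwards [self_mem_nhdsWithin] with ε hε
    have i1 : IntegrableOn (c.V.indicator (κ 0 0)) (Metric.ball x₀ ε)ᶜ (sμ p M) :=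
      (iκ₀ ε hε).indicator hVm
    have i2 : IntegrableOn (κ k 0) (Metric.ball x₀ ε)ᶜ (sμ p M) := by
      refine (ig.integrableOn.add i1).congr (Filter.Eventually.of_forall fun y => ?_)
      exact sub_add_cancel _ _
    have e : ∫ y in (Metric.ball x₀ ε)ᶜ, g 0 y ∂(sμ p M) =
        ∫ y in (Metric.ball x₀ ε)ᶜ, κ k 0 y ∂(sμ p M) -
          ∫ y in (Metric.ball x₀ ε)ᶜ ∩ c.V, κ 0 0 y ∂(sμ p M) := by
      rw [← setIntegral_indicator hVm]
      exact integral_sub i2 i1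
    have hr : (μHE[2] : Measure E3).restrict (Γb p M \ Metric.ball x₀ ε) =
        (sμ p M).restrict (Metric.ball x₀ ε)ᶜ := by
      rw [sμ, Measure.restrict_restrict (hbm ε), Set.inter_comm, Set.sdiff_eq]
    rw [← map_add, e, sub_add_cancel, ← ContinuousLinearMap.integral_comp_comm _ i2, hr]
    refine integral_congr_ae (ae_restrict_of_ae ?_)
    filter_upwards [ae_sμ_ne (p := p) (M := M) x₀] with y hy
    rw [Nker_eq k φ hy, hκ]
    simp only [nZ, normalPt_zero]

theorem IsDensity.tendsto_Spot_iff (hφ : IsDensity p M φ) (hx : x₀ ∈ Γb p M) (k : ℂ) (v : C3) :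
    (Filter.Tendsto (fun h : ℝ => rcross (M.ν x₀) (Spot p M k φ (x₀ - h • M.ν x₀))) (𝓝[>] 0)
      (𝓝 v) ↔ HasNop p M k φ x₀ v) ∧
    (Filter.Tendsto (fun h : ℝ => rcross (M.ν x₀) (Spot p M k φ (x₀ + h • M.ν x₀))) (𝓝[>] 0)
      (𝓝 v) ↔ HasNop p M k φ x₀ v) := by
  have h := hφ.followsTruncation_Spot hx k
  have hpos : Filter.Tendsto (fun h : ℝ => h) (𝓝[>] 0) (𝓝[≠] 0) :=
    nhdsWithin_mono 0 fun h (hh : 0 < h) => hh.ne'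
  have hneg : Filter.Tendsto (fun h : ℝ => -h) (𝓝[>] 0) (𝓝[≠] 0) := by
    refine tendsto_nhdsWithin_iff.2 ⟨?_, ?_⟩
    · simpa using tendsto_id_nhdsGT.neg
    · filter_upwards [self_mem_nhdsWithin] with h hh
      exact neg_ne_zero.2 (ne_of_gt hh)
  refine ⟨h.tendsto_iff hpos (fun ε hε => abs_of_pos hε) v, ?_⟩
  have h2 := h.tendsto_iff hneg (fun ε hε => by rw [abs_neg, abs_of_pos hε]) v
  simp only [normalPt, neg_smul, sub_neg_eq_add] at h2
  exact h2

theorem IsDensity.exists_hasNop (hφ : IsDensity p M φ) (hx : x₀ ∈ Γb p M) (k : ℂ)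
    (h : IsC1HolderNear p M φ x₀) : ∃ v, HasNop p M k φ x₀ v :=
  (hφ.followsTruncation_Spot hx k).exists_finitePart h

end DoubleCurl

end PMLJump

theorem mainTheorem1 (p : PMLJump.PML) (M : PMLJump.LayeredMedium p.a) (k₁ k₂ : ℂ)
    (φ : PMLJump.E3 → PMLJump.C3) (hφ : PMLJump.IsDensity p M φ) :
    -- the potentials are classically differentiable in the two truncated layers
    (ContDiffOn ℝ 1 (PMLJump.vpot p M k₁ φ) (PMLJump.Ω₁b p M) ∧
      ContDiffOn ℝ 1 (PMLJump.Spot p M k₁ φ) (PMLJump.Ω₁b p M) ∧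
      ContDiffOn ℝ 1 (PMLJump.Dpot p M k₁ φ) (PMLJump.Ω₁b p M)) ∧
    (ContDiffOn ℝ 1 (PMLJump.vpot p M k₂ φ) (PMLJump.Ω₂b p M) ∧
      ContDiffOn ℝ 1 (PMLJump.Spot p M k₂ φ) (PMLJump.Ω₂b p M) ∧
      ContDiffOn ℝ 1 (PMLJump.Dpot p M k₂ φ) (PMLJump.Ω₂b p M)) ∧
    -- the curl identities in the two truncated layers
    (∀ x ∈ PMLJump.Ω₁b p M,
      PMLJump.curl (PMLJump.Spot p M k₁ φ) x = k₁ ^ 2 • ((p.A x)⁻¹ *ᵥ PMLJump.Dpot p M k₁ φ x) ∧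
      PMLJump.curl (PMLJump.Dpot p M k₁ φ) x = (p.A x)⁻¹ *ᵥ PMLJump.Spot p M k₁ φ x) ∧
    (∀ x ∈ PMLJump.Ω₂b p M,
      PMLJump.curl (PMLJump.Spot p M k₂ φ) x = k₂ ^ 2 • ((p.A x)⁻¹ *ᵥ PMLJump.Dpot p M k₂ φ x) ∧
      PMLJump.curl (PMLJump.Dpot p M k₂ φ) x = (p.A x)⁻¹ *ᵥ PMLJump.Spot p M k₂ φ x) ∧
    ∀ x ∈ PMLJump.Γb p M,
      -- the limits of `ν × S̃` from the two sides are the hypersingular integrals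
      (∀ v : PMLJump.C3,
        Filter.Tendsto
          (fun h : ℝ => PMLJump.rcross (M.ν x) (PMLJump.Spot p M k₁ φ (x - h • M.ν x)))
          (𝓝[>] (0 : ℝ)) (𝓝 v) ↔ PMLJump.HasNop p M k₁ φ x v) ∧
      (∀ v : PMLJump.C3,
        Filter.Tendsto
          (fun h : ℝ => PMLJump.rcross (M.ν x) (PMLJump.Spot p M k₂ φ (x + h • M.ν x)))
          (𝓝[>] (0 : ℝ)) (𝓝 v) ↔ PMLJump.HasNop p M k₂ φ x v) ∧
      -- which exist where the density has a Hölder continuous derivative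
      (PMLJump.IsC1HolderNear p M φ x →
        (∃ v, PMLJump.HasNop p M k₁ φ x v) ∧ (∃ v, PMLJump.HasNop p M k₂ φ x v)) ∧
      -- the integrals defining `K̃` converge absolutely, and `ν × D̃` jumps
      MeasureTheory.IntegrableOn (PMLJump.Kker p M k₁ φ x) (PMLJump.Γb p M)
        (μHE[2] : MeasureTheory.Measure PMLJump.E3) ∧
      MeasureTheory.IntegrableOn (PMLJump.Kker p M k₂ φ x) (PMLJump.Γb p M)
        (μHE[2] : MeasureTheory.Measure PMLJump.E3) ∧
      Filter.Tendsto
        (fun h : ℝ => PMLJump.rcross (M.ν x) (PMLJump.Dpot p M k₁ φ (x - h • M.ν x)))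
        (𝓝[>] (0 : ℝ)) (𝓝 (PMLJump.Kop p M k₁ φ x - (1 / 2 : ℂ) • φ x)) ∧
      Filter.Tendsto
        (fun h : ℝ => PMLJump.rcross (M.ν x) (PMLJump.Dpot p M k₂ φ (x + h • M.ν x)))
        (𝓝[>] (0 : ℝ)) (𝓝 (PMLJump.Kop p M k₂ φ x + (1 / 2 : ℂ) • φ x)) := by
  have b₁ : PMLJump.Ω₁b p M ⊆ p.box := Set.inter_subset_right
  have b₂ : PMLJump.Ω₂b p M ⊆ p.box := Set.inter_subset_right
  have c₁ := PMLJump.Ω₁b_subset p M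
  have c₂ := PMLJump.Ω₂b_subset p M
  refine ⟨⟨(hφ.contDiffOn_vpot k₁).mono c₁, hφ.contDiffOn_Spot k₁ b₁ c₁,
    hφ.contDiffOn_Dpot k₁ b₁ c₁⟩, ⟨(hφ.contDiffOn_vpot k₂).mono c₂, hφ.contDiffOn_Spot k₂ b₂ c₂,
    hφ.contDiffOn_Dpot k₂ b₂ c₂⟩, fun x hx => ⟨hφ.curl_Spot k₁ (c₁ hx), hφ.curl_Dpot k₁ (c₁ hx)⟩,
    fun x hx => ⟨hφ.curl_Spot k₂ (c₂ hx), hφ.curl_Dpot k₂ (c₂ hx)⟩, fun x hx => ?_⟩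
  exact ⟨fun v => (hφ.tendsto_Spot_iff hx k₁ v).1, fun v => (hφ.tendsto_Spot_iff hx k₂ v).2,
    fun h => ⟨hφ.exists_hasNop hx k₁ h, hφ.exists_hasNop hx k₂ h⟩,
    (hφ.tendsto_Dpot_sub hx k₁).1, (hφ.tendsto_Dpot_sub hx k₂).1, (hφ.tendsto_Dpot hx k₁).1,
    (hφ.tendsto_Dpot hx k₂).2⟩
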